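/- **Notation.** For $\beta>0$ let $[\beta]$ be the largest integer strictly less than $\beta$, and write $C^{k+\beta}=C^{k+[\beta],\,\beta-[\beta]}$, where $\beta-[\beta]\in(0,1]$ is the Hölder exponent of the derivatives of order $k+[\beta]$. For a continuous function $w:\overline\Omega\to\mathbb R$ on the closure of a bounded convex domain $\Omega\subset\mathbb R^2$, its convex envelope is $$u(x)=\sup\{\ell(x) : \ell \text{ is affine and } \ell\le w \text{ in } \overline\Omega\},\qquad x\in\overline\Omega .$$ **Theorem.** Let $k\ge 4$ be an even integer, $\beta\in(0,k]$, and let $\Omega\subset\mathbb R^2$ be a bounded convex domain with $0\in\partial\Omega$ and $\partial\Omega\in C^{k+\beta}$. Suppose that * $\partial\Omega$ is $(k,\beta)$-order degenerate at $0$: near $0$, $\Omega=\{x_2>\rho(x_1)\}$ with $\rho$ of class $C^{k+\beta}$ and $\rho(0)=\rho'(0)=0$, where $\rho^{(i)}(0)=0$ for $2\le i\le k-1$, $\rho^{(k)}(0)\neq 0$, and $\rho(x_1)-\frac1{k!}\rho^{(k)}(0)\,x_1^k\le O(|x_1|^{k+\beta})$ as $x_1\to0$; * $0$ is the only degenerate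 boundary point, i.e. the curvature of $\partial\Omega$ is positive at every point of $\partial\Omega\setminus\{0\}$. Let $w\in C^{k+\beta}(\overline\Omega)$ satisfy $$(\mathcal P3)\qquad D^{(i)}w(0)=0\quad\text{for } i=2,\dots,k+[\beta].$$ Then the convex envelope $u$ of $w$ belongs to $C^{1,\beta/k}(\overline\Omega)$, and $$\|u\|_{C^{1,\beta/k}(\overline\Omega)}\le C,$$ where $C$ is a constant depending only on $k$, $\beta$, $\Omega$ and an upper bound for $\|w\|_{C^{k+\beta}(\overline\Omega)}$. In particular, if $\beta=k$, then $u\in C^{1,1}(\overline\Omega)$. -/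

import Mathlib

open Set Filter Topology
open scoped NNReal ENNReal

/-- The Euclidean plane; the coordinates `x₁, x₂` of a point `x` are `x 0` and `x 1`. -/
abbrev Plane : Type := EuclideanSpace ℝ (Fin 2)

/-- The largest integer strictly less than `β`, for `β > 0` (so it is `β - 1` if `β` is an
integer). -/
noncomputable def strictFloor (β : ℝ) : ℕ := ⌈β⌉₊ - 1

/-- The `C^{m,α}` norm of `f` over the open set `U`, with values in `[0, ∞]`: the sum of the sup
norms of the derivatives of order at most `m`, plus the `α`-Hölder seminorm of the derivative of
order `m`. -/
noncomputable def cHolderNorm {V : Type*} [NormedAddCommGroup V] [NormedSpace ℝ V]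
    (m : ℕ) (α : ℝ) (U : Set V) (f : V → ℝ) : ℝ≥0∞ :=
  (∑ i ∈ Finset.range (m + 1), ⨆ x ∈ U, ‖iteratedFDeriv ℝ i f x‖ₑ) +
    eHolderNorm α.toNNReal (U.domRestrict (iteratedFDeriv ℝ m f))

/-- `f ∈ C^{m,α}(Ū)` for an open set `U`: `f` is `C^m` in `U`, `f` is continuous up to the boundary,
each derivative of order at most `m` extends continuously to `Ū`, and the `C^{m,α}` norm is finite.
The values of `f` outside `Ū` play no role. -/
structure MemCHolder {V : Type*} [NormedAddCommGroup V] [NormedSpace ℝ V]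
    (m : ℕ) (α : ℝ) (U : Set V) (f : V → ℝ) : Prop where
  contDiffOn : ContDiffOn ℝ m f U
  continuousOn : ContinuousOn f (closure U)
  extends_closure : ∀ i ≤ m, ∃ g : V → V [×i]→L[ℝ] ℝ,
    ContinuousOn g (closure U) ∧ EqOn g (iteratedFDeriv ℝ i f) U
  norm_lt_top : cHolderNorm m α U f < ⊤

/-- In the Cartesian coordinates given by the rigid motion `Φ`, which moves `z` to the origin, `Ω`
is the region above the graph of `ρ` inside the box `(-r, r) × (-r, r)`, and the graph passes
through the origin. -/
structure IsGraphAt (Ω : Set Plane) (z : Plane) (Φ : Plane ≃ᵃⁱ[ℝ] Plane) (ρ : ℝ → ℝ) (r : ℝ) :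
    Prop where
  pos : 0 < r
  map_base : Φ z = 0
  graph_zero : ρ 0 = 0
  mem_iff : ∀ x : Plane, |x 0| < r → |x 1| < r → (Φ.symm x ∈ Ω ↔ ρ (x 0) < x 1)

/-- `∂Ω ∈ C^{m,α}`: near each of its points, `∂Ω` is, in suitable Cartesian coordinates, the graph
of a `C^{m,α}` function, with `Ω` lying on one side. -/
def HasCHolderBoundary (m : ℕ) (α : ℝ) (Ω : Set Plane) : Prop :=
  ∀ z ∈ frontier Ω, ∃ (Φ : Plane ≃ᵃⁱ[ℝ] Plane) (ρ : ℝ → ℝ) (r : ℝ),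
    IsGraphAt Ω z Φ ρ r ∧ MemCHolder m α (Ioo (-r) r) ρ

/-- `∂Ω` is `C²` near `z` and has curvature `κ` there, with the sign for which the boundary of a
convex set has nonnegative curvature. -/
def HasBoundaryCurvatureAt (Ω : Set Plane) (z : Plane) (κ : ℝ) : Prop :=
  ∃ (Φ : Plane ≃ᵃⁱ[ℝ] Plane) (ρ : ℝ → ℝ) (r : ℝ),
    IsGraphAt Ω z Φ ρ r ∧ ContDiffOn ℝ 2 ρ (Ioo (-r) r) ∧
      κ = iteratedDeriv 2 ρ 0 / (1 + deriv ρ 0 ^ 2) ^ (3 / 2 : ℝ)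

/-- `∂Ω` is `(k, β)`-order degenerate at `0`: near `0`, `Ω` is given by `x₂ > ρ(x₁)`, where `ρ` is
of class `C^{k+β}`, `ρ(0) = ρ'(0) = 0`, `ρ^{(i)}(0) = 0` for `2 ≤ i ≤ k - 1`, `ρ^{(k)}(0) ≠ 0`, and
`ρ(t) - ρ^{(k)}(0) t^k / k! ≤ O(|t|^{k+β})` as `t → 0`. -/
def IsDegenerateAtOrigin (k : ℕ) (β : ℝ) (Ω : Set Plane) : Prop :=
  ∃ (ρ : ℝ → ℝ) (r : ℝ),
    IsGraphAt Ω 0 (AffineIsometryEquiv.refl ℝ Plane) ρ r ∧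
    MemCHolder (k + strictFloor β) (β - strictFloor β) (Ioo (-r) r) ρ ∧
    deriv ρ 0 = 0 ∧
    (∀ i : ℕ, 2 ≤ i → i ≤ k - 1 → iteratedDeriv i ρ 0 = 0) ∧
    iteratedDeriv k ρ 0 ≠ 0 ∧
    ∃ C : ℝ, ∀ᶠ t in 𝓝 (0 : ℝ),
      ρ t - iteratedDeriv k ρ 0 / (k.factorial : ℝ) * t ^ k ≤ C * |t| ^ ((k : ℝ) + β)

/-- `D^i w(0) = 0` for `2 ≤ i ≤ N`, where the derivatives at the boundary point `0` are the limits
of the derivatives inside `Ω`. -/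
def DerivsVanishAtOrigin (N : ℕ) (Ω : Set Plane) (w : Plane → ℝ) : Prop :=
  ∀ i : ℕ, 2 ≤ i → i ≤ N → Tendsto (iteratedFDeriv ℝ i w) (𝓝[Ω] (0 : Plane)) (𝓝 0)

/-- The convex envelope over `Ω̄`: the supremum of the affine functions that are at most `w`
on `Ω̄`. -/
noncomputable def convexEnvelope (Ω : Set Plane) (w : Plane → ℝ) (x : Plane) : ℝ :=
  sSup {t : ℝ | ∃ l : Plane →ᵃ[ℝ] ℝ, (∀ y ∈ closure Ω, l y ≤ w y) ∧ t = l x}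

/-! ### One-variable calculus -/

/-! Write γ = β/k and let u be the convex envelope. At y ∈ Ω there is a supporting affine function,
with slope L, and the whole matter is an upper bound u(z) ≤ u(y) + L(z − y) + C‖z − y‖^(1+γ) for z ∈
Ω, with C uniform in y and in w. Together with the support from below this identifies L with the
gradient of u and makes the gradient γ-Hölder (`hasFDerivAt_of_taylor`, `norm_grad_sub_le`), hence
extendable to the closure.

Reduction to pairs. By Hahn–Banach y lies in the convex hull of the contact set {L + b = w}
(`mem_convexHull_contact`). Walking from y towards z, one either reaches z inside this planar hull,
where u is at most the support, or meets a segment joining two contact points, at a point no farther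
from z (`Plane.mem_convexHull_or_exists_segment`). So the base point may be assumed to lie on a
segment [y₁, y₂] between contact points. There it suffices to exhibit through z a chord of the
closed domain along which the interpolation of V = w − L − b ≥ 0 is at most C‖z − y‖^(1+γ): this is
`ChordBound`, and `ChordBound.convexEnvelope_le` converts it into a bound for u.

Nondegenerate pairs. If the pair sits well in the domain (`AdmissiblePair`) and w is controlled in
C⁴, which is available because k ≥ 4, the chord bound is even quadratic
(`exists_chordBound_of_admissiblePair`). If one contact point is interior, V ≥ 0 with two zeros
forces the second and third derivatives of V along the chord to be small in terms of the radius κ of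
a ball around the midpoint; the chord is then displaced by z − y and its ends are adjusted along its
own direction. If both contact points are on the boundary and far apart, crude bounds do. If they
are close, V restricted to the boundary graph has two zeros s = p, q, so Hermite interpolation
bounds it by C(s − p)²(s − q)²; the ends of a parallel chord at height t satisfy |(s − p)(s − q)| ≤
C|t| by uniform convexity, so V ≤ Ct² there.

Degenerate pairs. Near 0 the domain looks like {x₂ > a|x₁|^k} with a > 0, which is invariant under
(x₁, x₂) ↦ (Tx₁, T^k x₂). By (P3), w minus an affine function is O(‖x‖^(k+β)), and its derivatives
decay accordingly, so after the dilation and division by T^(k+β) it is bounded in C⁴ uniformly in T.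
With T^k equal to the larger height of the two contact points, the rescaled pair has a point at
height one and is admissible with fixed constants (`OriginChart.exists_rescaled_admissible`).
Scaling back, T^(k+β) h^(1+γ) = (T^k h)^(1+γ) ≤ ‖z − y‖^(1+γ), since the inverse dilation stretches
lengths by at most T^(−k). This is where the exponent 1 + β/k comes from. The two regimes are joined
in `exists_chordBound_rpow`. -/

theorem hasDerivAt_sub_const_pow (r t : ℝ) (n : ℕ) :
    HasDerivAt (fun t : ℝ => (t - r) ^ n) (n * (t - r) ^ (n - 1)) t :=
  (((hasDerivAt_id t).sub_const r).pow n).congr_deriv (by simp)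

/-- A crude third-order Taylor formula on `[0, 1]`, for a function and its first two derivatives. -/
theorem taylor_unitInterval {f₀ f₁ f₂ f₃ f₄ : ℝ → ℝ} {C : ℝ}
    (h₀ : ∀ t ∈ Icc (0 : ℝ) 1, HasDerivAt f₀ (f₁ t) t)
    (h₁ : ∀ t ∈ Icc (0 : ℝ) 1, HasDerivAt f₁ (f₂ t) t)
    (h₂ : ∀ t ∈ Icc (0 : ℝ) 1, HasDerivAt f₂ (f₃ t) t)
    (h₃ : ∀ t ∈ Icc (0 : ℝ) 1, HasDerivAt f₃ (f₄ t) t)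
    (h₄ : ∀ t ∈ Icc (0 : ℝ) 1, |f₄ t| ≤ C) :
    |f₀ 1 - f₀ 0 - f₁ 0 - f₂ 0 / 2 - f₃ 0 / 6| ≤ C ∧
      |f₁ 1 - f₁ 0 - f₂ 0 - f₃ 0 / 2| ≤ C := by
  have hC : 0 ≤ C := (abs_nonneg _).trans (h₄ 0 ⟨le_rfl, zero_le_one⟩)
  -- Integrating over [0, t] with t ≤ 1 keeps the bound C, so the four successive remainders share
  -- it and no factorials appear.
  have key : ∀ {g g' : ℝ → ℝ}, g 0 = 0 → (∀ t ∈ Icc (0 : ℝ) 1, HasDerivAt g (g' t) t) →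
      (∀ t ∈ Icc (0 : ℝ) 1, |g' t| ≤ C) → ∀ t ∈ Icc (0 : ℝ) 1, |g t| ≤ C := by
    intro g g' hg hd hb t ht
    have := norm_image_sub_le_of_norm_deriv_le_segment' (f := g) (f' := g') (a := 0) (b := 1)
      (C := C) (fun x hx => (hd x hx).hasDerivWithinAt) (fun x hx => hb x ⟨hx.1, hx.2.le⟩) t ht
    rw [hg, sub_zero, sub_zero, Real.norm_eq_abs] at this
    nlinarith [ht.1, ht.2]
  have e₃ : ∀ t ∈ Icc (0 : ℝ) 1, |f₃ t - f₃ 0| ≤ C :=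
    key (by simp) (fun t ht => (h₃ t ht).sub_const _) h₄
  have e₂ : ∀ t ∈ Icc (0 : ℝ) 1, |f₂ t - f₂ 0 - f₃ 0 * t| ≤ C := by
    refine key (by simp) (fun t ht => ?_) e₃
    exact (((h₂ t ht).sub_const (f₂ 0)).sub ((hasDerivAt_id t).const_mul (f₃ 0))).congr_deriv
      (by simp)
  have e₁ : ∀ t ∈ Icc (0 : ℝ) 1, |f₁ t - f₁ 0 - f₂ 0 * t - f₃ 0 * t ^ 2 / 2| ≤ C := by
    refine key (by simp) (fun t ht => ?_) e₂
    exact ((((h₁ t ht).sub_const (f₁ 0)).sub ((hasDerivAt_id t).const_mul (f₂ 0))).sub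
      ((((hasDerivAt_id t).pow 2).const_mul (f₃ 0)).div_const 2)).congr_deriv (by simp; ring)
  have e₀ : ∀ t ∈ Icc (0 : ℝ) 1,
      |f₀ t - f₀ 0 - f₁ 0 * t - f₂ 0 * t ^ 2 / 2 - f₃ 0 * t ^ 3 / 6| ≤ C := by
    refine key (by simp) (fun t ht => ?_) e₁
    exact (((((h₀ t ht).sub_const (f₀ 0)).sub ((hasDerivAt_id t).const_mul (f₁ 0))).sub
      ((((hasDerivAt_id t).pow 2).const_mul (f₂ 0)).div_const 2)).sub
      ((((hasDerivAt_id t).pow 3).const_mul (f₃ 0)).div_const 6)).congr_deriv (by simp; ring)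
  have i₀ := e₀ 1 ⟨zero_le_one, le_rfl⟩
  have i₁ := e₁ 1 ⟨zero_le_one, le_rfl⟩
  norm_num at i₀ i₁
  exact ⟨i₀, i₁⟩

/-- Rolle's theorem in three layers: four zeros give three, then two, then one. In the Hermite
estimate `g₀` is itself a first derivative, so the point found is a zero of a fourth derivative. -/
theorem exists_zero_third_deriv {a b : ℝ} {g₀ g₁ g₂ g₃ : ℝ → ℝ}
    (h₀ : ∀ t ∈ Ioo a b, HasDerivAt g₀ (g₁ t) t)
    (h₁ : ∀ t ∈ Ioo a b, HasDerivAt g₁ (g₂ t) t)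
    (h₂ : ∀ t ∈ Ioo a b, HasDerivAt g₂ (g₃ t) t)
    {p q r s : ℝ} (hap : a < p) (hpq : p < q) (hqr : q < r) (hrs : r < s) (hsb : s < b)
    (hp : g₀ p = 0) (hq : g₀ q = 0) (hr : g₀ r = 0) (hs : g₀ s = 0) :
    ∃ ξ ∈ Ioo a b, g₃ ξ = 0 := by
  have rolle : ∀ {g g' : ℝ → ℝ}, (∀ t ∈ Ioo a b, HasDerivAt g (g' t) t) → ∀ {x y : ℝ}, a < x →
      x < y → y < b → g x = 0 → g y = 0 → ∃ c, x < c ∧ c < y ∧ g' c = 0 := by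
    intro g g' hg x y hx hxy hy hgx hgy
    obtain ⟨c, hc, h⟩ := exists_hasDerivAt_eq_zero hxy
      (fun t ht => (hg t ⟨by linarith [ht.1], by linarith [ht.2]⟩).continuousAt.continuousWithinAt)
      (hgx.trans hgy.symm) (fun t ht => hg t ⟨by linarith [ht.1], by linarith [ht.2]⟩)
    exact ⟨c, hc.1, hc.2, h⟩
  obtain ⟨c₁, _, _, k₁⟩ := rolle h₀ hap hpq (by linarith) hp hq
  obtain ⟨c₂, _, _, k₂⟩ := rolle h₀ (by linarith) hqr (by linarith) hq hr
  obtain ⟨c₃, _, _, k₃⟩ := rolle h₀ (by linarith) hrs hsb hr hs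
  obtain ⟨d₁, _, _, m₁⟩ := rolle h₁ (by linarith : a < c₁) (by linarith : c₁ < c₂)
    (by linarith) k₁ k₂
  obtain ⟨d₂, _, _, m₂⟩ := rolle h₁ (by linarith : a < c₂) (by linarith : c₂ < c₃)
    (by linarith) k₂ k₃
  obtain ⟨e, _, _, n⟩ := rolle h₂ (by linarith : a < d₁) (by linarith : d₁ < d₂)
    (by linarith) m₁ m₂
  exact ⟨e, ⟨by linarith, by linarith⟩, n⟩

/-- The error of cubic Hermite interpolation, for vanishing Hermite data. -/
theorem hermite_zero_bound {a b K : ℝ} {f₀ f₁ f₂ f₃ f₄ : ℝ → ℝ}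
    (h₀ : ∀ t ∈ Ioo a b, HasDerivAt f₀ (f₁ t) t)
    (h₁ : ∀ t ∈ Ioo a b, HasDerivAt f₁ (f₂ t) t)
    (h₂ : ∀ t ∈ Ioo a b, HasDerivAt f₂ (f₃ t) t)
    (h₃ : ∀ t ∈ Ioo a b, HasDerivAt f₃ (f₄ t) t)
    (h₄ : ∀ t ∈ Ioo a b, |f₄ t| ≤ K)
    {p q s : ℝ} (hp : p ∈ Ioo a b) (hq : q ∈ Ioo a b) (hs : s ∈ Ioo a b) (hpq : p < q)
    (hfp : f₀ p = 0) (hfp' : f₁ p = 0) (hfq : f₀ q = 0) (hfq' : f₁ q = 0) :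
    |f₀ s| ≤ K * ((s - p) ^ 2 * (s - q) ^ 2) := by
  have hK : 0 ≤ K := (abs_nonneg _).trans (h₄ p hp)
  rcases eq_or_ne s p with rfl | hsp
  · simp [hfp]
  rcases eq_or_ne s q with rfl | hsq
  · simp [hfq]
  set P := (s - p) ^ 2 * (s - q) ^ 2 with hP
  have hPpos : 0 < P := by
    have := sub_ne_zero.2 hsp
    have := sub_ne_zero.2 hsq
    positivity
  -- The classical device: c is fixed so that f₀ − c(t − p)²(t − q)² vanishes at s as well. Its
  -- fourth derivative is f₄ − 24c, so a zero of that derivative bounds c.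
  obtain ⟨c, hc⟩ : ∃ c, c * P = f₀ s := ⟨f₀ s / P, by field_simp⟩
  have g₀ : ∀ t ∈ Ioo a b, HasDerivAt (fun t => f₀ t - c * ((t - p) ^ 2 * (t - q) ^ 2))
      (f₁ t - c * (2 * (t - p) * (t - q) ^ 2 + (t - p) ^ 2 * (2 * (t - q)))) t := by
    intro t ht
    have hpow : ∀ r : ℝ, HasDerivAt (fun t : ℝ => (t - r) ^ 2) (2 * (t - r)) t := by
      intro r
      exact (hasDerivAt_sub_const_pow r t 2).congr_deriv (by simp)
    exact (h₀ t ht).sub (((hpow p).mul (hpow q)).const_mul c)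
  have g₁ : ∀ t ∈ Ioo a b, HasDerivAt
      (fun t => f₁ t - c * (2 * (t - p) * (t - q) ^ 2 + (t - p) ^ 2 * (2 * (t - q))))
      (f₂ t - c * (2 * (t - q) ^ 2 + 8 * ((t - p) * (t - q)) + 2 * (t - p) ^ 2)) t := by
    intro t ht
    have hl : ∀ r : ℝ, HasDerivAt (fun t : ℝ => t - r) 1 t := fun r => (hasDerivAt_id t).sub_const r
    have hpow : ∀ r : ℝ, HasDerivAt (fun t : ℝ => (t - r) ^ 2) (2 * (t - r)) t := by
      intro r
      exact (hasDerivAt_sub_const_pow r t 2).congr_deriv (by simp)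
    exact ((h₁ t ht).sub (((((hl p).const_mul 2).mul (hpow q)).add
      ((hpow p).mul ((hl q).const_mul 2))).const_mul c)).congr_deriv (by ring)
  have g₂ : ∀ t ∈ Ioo a b, HasDerivAt
      (fun t => f₂ t - c * (2 * (t - q) ^ 2 + 8 * ((t - p) * (t - q)) + 2 * (t - p) ^ 2))
      (f₃ t - c * (12 * (t - q) + 12 * (t - p))) t := by
    intro t ht
    have hl : ∀ r : ℝ, HasDerivAt (fun t : ℝ => t - r) 1 t := fun r => (hasDerivAt_id t).sub_const r
    have hpow : ∀ r : ℝ, HasDerivAt (fun t : ℝ => (t - r) ^ 2) (2 * (t - r)) t := by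
      intro r
      exact (hasDerivAt_sub_const_pow r t 2).congr_deriv (by simp)
    exact ((h₂ t ht).sub (((((hpow q).const_mul 2).add
      (((hl p).mul (hl q)).const_mul 8)).add ((hpow p).const_mul 2)).const_mul c)).congr_deriv (by ring)
  have g₃ : ∀ t ∈ Ioo a b, HasDerivAt
      (fun t => f₃ t - c * (12 * (t - q) + 12 * (t - p))) (f₄ t - c * 24) t := by
    intro t ht
    have hl : ∀ r : ℝ, HasDerivAt (fun t : ℝ => t - r) 1 t := fun r => (hasDerivAt_id t).sub_const r
    exact ((h₃ t ht).sub ((((hl q).const_mul 12).add ((hl p).const_mul 12)).const_mul c)).congr_deriv (by ring)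
  have rolle : ∀ {x y : ℝ}, a < x → x < y → y < b →
      f₀ x - c * ((x - p) ^ 2 * (x - q) ^ 2) = 0 → f₀ y - c * ((y - p) ^ 2 * (y - q) ^ 2) = 0 →
      ∃ z, x < z ∧ z < y ∧
        f₁ z - c * (2 * (z - p) * (z - q) ^ 2 + (z - p) ^ 2 * (2 * (z - q))) = 0 := by
    intro x y hx hxy hy hgx hgy
    obtain ⟨z, hz, h⟩ := exists_hasDerivAt_eq_zero hxy
      (fun t ht => (g₀ t ⟨by linarith [ht.1], by linarith [ht.2]⟩).continuousAt.continuousWithinAt)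
      (hgx.trans hgy.symm) (fun t ht => g₀ t ⟨by linarith [ht.1], by linarith [ht.2]⟩)
    exact ⟨z, hz.1, hz.2, h⟩
  have zp : f₀ p - c * ((p - p) ^ 2 * (p - q) ^ 2) = 0 := by simp [hfp]
  have zq : f₀ q - c * ((q - p) ^ 2 * (q - q) ^ 2) = 0 := by simp [hfq]
  have zs : f₀ s - c * ((s - p) ^ 2 * (s - q) ^ 2) = 0 := by rw [← hP, hc, sub_self]
  have dp : f₁ p - c * (2 * (p - p) * (p - q) ^ 2 + (p - p) ^ 2 * (2 * (p - q))) = 0 := by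
    simp [hfp']
  have dq : f₁ q - c * (2 * (q - p) * (q - q) ^ 2 + (q - p) ^ 2 * (2 * (q - q))) = 0 := by
    simp [hfq']
  -- The corrected function vanishes at p, q, s, and its derivative vanishes at p and q and at two
  -- further points between consecutive zeros. The three cases only order these four points.
  have hξ : ∃ ξ ∈ Ioo a b, f₄ ξ - c * 24 = 0 := by
    rcases lt_or_gt_of_ne hsp with h | h
    · obtain ⟨x, _, _, hx⟩ := rolle hs.1 h hp.2 zs zp
      obtain ⟨y, _, _, hy⟩ := rolle hp.1 hpq hq.2 zp zq
      exact exists_zero_third_deriv g₁ g₂ g₃ (by linarith [hs.1]) ‹x < p› ‹p < y› ‹y < q› hq.2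
        hx dp hy dq
    · rcases lt_or_gt_of_ne hsq with h' | h'
      · obtain ⟨x, _, _, hx⟩ := rolle hp.1 h hs.2 zp zs
        obtain ⟨y, _, _, hy⟩ := rolle hs.1 h' hq.2 zs zq
        exact exists_zero_third_deriv g₁ g₂ g₃ hp.1 ‹p < x› (by linarith) ‹y < q› hq.2
          dp hx hy dq
      · obtain ⟨x, _, _, hx⟩ := rolle hp.1 hpq hq.2 zp zq
        obtain ⟨y, _, _, hy⟩ := rolle hq.1 h' hs.2 zq zs
        exact exists_zero_third_deriv g₁ g₂ g₃ hp.1 ‹p < x› ‹x < q› ‹q < y› (by linarith [hs.2])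
          dp hx dq hy
  obtain ⟨ξ, hξ, hξ'⟩ := hξ
  have hcK : |c| ≤ K := by
    have := h₄ ξ hξ
    have h24 : f₄ ξ = c * 24 := by linarith
    rw [h24, abs_mul] at this
    norm_num at this
    nlinarith [abs_nonneg c]
  rw [← hc, abs_mul, abs_of_pos hPpos]
  exact mul_le_mul_of_nonneg_right hcK hPpos.le

/-- The error of cubic Hermite interpolation. -/
theorem hermite_bound {a b K : ℝ} {f₀ f₁ f₂ f₃ f₄ : ℝ → ℝ}
    (h₀ : ∀ t ∈ Ioo a b, HasDerivAt f₀ (f₁ t) t)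
    (h₁ : ∀ t ∈ Ioo a b, HasDerivAt f₁ (f₂ t) t)
    (h₂ : ∀ t ∈ Ioo a b, HasDerivAt f₂ (f₃ t) t)
    (h₃ : ∀ t ∈ Ioo a b, HasDerivAt f₃ (f₄ t) t)
    (h₄ : ∀ t ∈ Ioo a b, |f₄ t| ≤ K)
    {p q s : ℝ} (hp : p ∈ Ioo a b) (hq : q ∈ Ioo a b) (hs : s ∈ Ioo a b) (hpq : p < q) :
    |f₀ s - (f₀ p + f₁ p * (s - p) +
        (3 * (f₀ q - f₀ p) / (q - p) - 2 * f₁ p - f₁ q) / (q - p) * (s - p) ^ 2 +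
        (f₁ p + f₁ q - 2 * (f₀ q - f₀ p) / (q - p)) / (q - p) ^ 2 * (s - p) ^ 3)| ≤
      K * ((s - p) ^ 2 * (s - q) ^ 2) := by
  have hL : q - p ≠ 0 := (sub_pos.2 hpq).ne'
  -- A and B are the coefficients for which the cubic, already matched at p, also matches the value
  -- and slope at q.
  set A := (3 * (f₀ q - f₀ p) / (q - p) - 2 * f₁ p - f₁ q) / (q - p) with hA
  set B := (f₁ p + f₁ q - 2 * (f₀ q - f₀ p) / (q - p)) / (q - p) ^ 2 with hB
  have hl : ∀ t : ℝ, HasDerivAt (fun t : ℝ => t - p) 1 t := fun t => (hasDerivAt_id t).sub_const p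
  have hpow2 : ∀ t : ℝ, HasDerivAt (fun t : ℝ => (t - p) ^ 2) (2 * (t - p)) t := by
    intro t
    exact (hasDerivAt_sub_const_pow p t 2).congr_deriv (by simp)
  have hpow3 : ∀ t : ℝ, HasDerivAt (fun t : ℝ => (t - p) ^ 3) (3 * (t - p) ^ 2) t := by
    intro t
    exact (hasDerivAt_sub_const_pow p t 3).congr_deriv (by simp)
  refine hermite_zero_bound
    (f₀ := fun t => f₀ t - (f₀ p + f₁ p * (t - p) + A * (t - p) ^ 2 + B * (t - p) ^ 3))
    (f₁ := fun t => f₁ t - (f₁ p + 2 * A * (t - p) + 3 * B * (t - p) ^ 2))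
    (f₂ := fun t => f₂ t - (2 * A + 6 * B * (t - p)))
    (f₃ := fun t => f₃ t - 6 * B) (f₄ := f₄) ?_ ?_ ?_ ?_ h₄ hp hq hs hpq ?_ ?_ ?_ ?_
  · intro t ht
    exact ((h₀ t ht).sub (((((hl t).const_mul (f₁ p)).const_add (f₀ p)).add
      ((hpow2 t).const_mul A)).add ((hpow3 t).const_mul B))).congr_deriv (by ring)
  · intro t ht
    exact ((h₁ t ht).sub ((((hl t).const_mul (2 * A)).const_add (f₁ p)).add
      ((hpow2 t).const_mul (3 * B)))).congr_deriv (by ring)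
  · intro t ht
    exact ((h₂ t ht).sub (((hl t).const_mul (6 * B)).const_add (2 * A))).congr_deriv (by ring)
  · intro t ht
    exact (h₃ t ht).sub_const _
  · simp
  · simp
  · simp only [hA, hB]
    field_simp
    ring
  · simp only [hA, hB]
    field_simp
    ring

/-- A limit of nonnegative functions with bounded derivatives of orders two and four which vanishes
at two points is controlled by the product of the squared distances to these points. -/
theorem limit_le_of_two_zeros {a b K : ℝ} {F : ℕ → ℕ → ℝ → ℝ}
    (hd : ∀ n, ∀ i < 4, ∀ t ∈ Ioo a b, HasDerivAt (F n i) (F n (i + 1) t) t)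
    (h₂ : ∀ n, ∀ t ∈ Ioo a b, |F n 2 t| ≤ K) (h₄ : ∀ n, ∀ t ∈ Ioo a b, |F n 4 t| ≤ K)
    (hnn : ∀ n, ∀ t ∈ Ioo a b, 0 ≤ F n 0 t)
    {p q s v : ℝ} (hp : p ∈ Ioo a b) (hq : q ∈ Ioo a b) (hs : s ∈ Ioo a b) (hpq : p < q)
    (hFp : Tendsto (fun n => F n 0 p) atTop (𝓝 0)) (hFq : Tendsto (fun n => F n 0 q) atTop (𝓝 0))
    (hFs : Tendsto (fun n => F n 0 s) atTop (𝓝 v)) :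
    v ≤ K * ((s - p) ^ 2 * (s - q) ^ 2) := by
  have hK : 0 ≤ K := (abs_nonneg _).trans (h₄ 0 p hp)
  -- A nonnegative function with bounded second derivative and small value at an interior point has
  -- small slope there. So the slopes at p and q also tend to zero, and the limiting Hermite cubic
  -- is zero.
  have hder : ∀ r ∈ Ioo a b, Tendsto (fun n => F n 0 r) atTop (𝓝 0) →
      Tendsto (fun n => F n 1 r) atTop (𝓝 0) := by
    intro r hr hFr
    obtain ⟨δ, hδ, hδr⟩ : ∃ δ > 0, ∀ t, |t| ≤ δ → r + t ∈ Ioo a b := by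
      refine ⟨min (r - a) (b - r) / 2, by
        have := hr.1; have := hr.2
        exact half_pos (lt_min (by linarith) (by linarith)), fun t ht => ?_⟩
      have h1 := min_le_left (r - a) (b - r)
      have h2 := min_le_right (r - a) (b - r)
      have := abs_le.1 ht
      have := hr.1; have := hr.2
      have : 0 < min (r - a) (b - r) := lt_min (by linarith) (by linarith)
      constructor <;> linarith
    have hT : ∀ n, ∀ t, |t| ≤ δ → F n 0 (r + t) ≤ F n 0 r + F n 1 r * t + K * t ^ 2 := by
      intro n t ht
      have hmem : ∀ x ∈ Icc (0 : ℝ) 1, r + x * t ∈ Ioo a b := by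
        intro x hx
        refine hδr _ ?_
        rw [abs_mul, abs_of_nonneg hx.1]
        nlinarith [hx.2, abs_nonneg t]
      have hlin : ∀ x, HasDerivAt (fun x : ℝ => r + x * t) t x := by
        intro x
        simpa using ((hasDerivAt_id x).mul_const t).const_add r
      have b1 : ∀ x ∈ Icc (0 : ℝ) 1, |F n 1 (r + x * t) * t - F n 1 r * t| ≤ K * t ^ 2 := by
        intro x hx
        have := norm_image_sub_le_of_norm_deriv_le_segment' (f := fun x => F n 1 (r + x * t) * t)
          (f' := fun x => F n 2 (r + x * t) * t * t) (a := 0) (b := 1) (C := K * t ^ 2)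
          (fun x hx => ?_) (fun x hx => ?_) x hx
        · simp only [zero_mul, add_zero, sub_zero, Real.norm_eq_abs] at this
          have h3 : 0 ≤ K * t ^ 2 := by positivity
          nlinarith [hx.1, hx.2]
        · exact ((((hd n 1 (by norm_num) _ (hmem x hx)).comp x (hlin x))).mul_const
            t).hasDerivWithinAt
        · rw [Real.norm_eq_abs, abs_mul, abs_mul, mul_assoc, ← pow_two, sq_abs]
          exact mul_le_mul_of_nonneg_right (h₂ n _ (hmem x ⟨hx.1, hx.2.le⟩)) (sq_nonneg t)
      have := norm_image_sub_le_of_norm_deriv_le_segment'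
          (f := fun x => F n 0 (r + x * t) - F n 1 r * t * x)
          (f' := fun x => F n 1 (r + x * t) * t - F n 1 r * t) (a := 0) (b := 1) (C := K * t ^ 2)
          (fun x hx => ?_) (fun x hx => b1 x ⟨hx.1, hx.2.le⟩) 1 ⟨zero_le_one, le_rfl⟩
      · simp only [zero_mul, add_zero, sub_zero, Real.norm_eq_abs, one_mul, mul_one, mul_zero]
          at this
        have := (abs_le.1 this).2
        linarith
      · have h5 := ((hd n 0 (by norm_num) _ (hmem x hx)).comp x (hlin x)).sub
          ((hasDerivAt_id x).const_mul (F n 1 r * t))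
        have h6 : HasDerivAt (fun x => F n 0 (r + x * t) - F n 1 r * t * x)
          (F n 1 (r + x * t) * t - F n 1 r * t) x := h5.congr_deriv (by simp)
        exact h6.hasDerivWithinAt
    rw [Metric.tendsto_atTop]
    intro ε hε
    -- Using 0 ≤ F(r ± t) ≤ F(r) ± tF′(r) + Kt², with Kt ≤ ε/4 and then F(r) < tε/4, gives |F′(r)| <
    -- ε.
    obtain ⟨t, ht, htδ, htK⟩ : ∃ t > 0, t ≤ δ ∧ K * t ≤ ε / 4 := by
      refine ⟨min δ (ε / (4 * (K + 1))), lt_min hδ (by positivity), min_le_left _ _, ?_⟩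
      calc K * min δ (ε / (4 * (K + 1))) ≤ (K + 1) * (ε / (4 * (K + 1))) := by
            gcongr
            · linarith
            · exact min_le_right _ _
        _ = ε / 4 := by field_simp
    obtain ⟨N, hN⟩ := (Metric.tendsto_atTop.1 hFr) (ε / 4 * t) (by positivity)
    refine ⟨N, fun n hn => ?_⟩
    have hn' := hN n hn
    rw [Real.dist_eq, sub_zero] at hn' ⊢
    have hn2 := (abs_lt.1 hn').2
    have p1 := (hnn n _ (hδr t (by rwa [abs_of_pos ht]))).trans
      (hT n t (by rwa [abs_of_pos ht]))
    have p2 := (hnn n _ (hδr (-t) (by rwa [abs_neg, abs_of_pos ht]))).trans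
      (hT n (-t) (by rwa [abs_neg, abs_of_pos ht]))
    rw [abs_lt]
    constructor
    · by_contra hcon
      nlinarith
    · by_contra hcon
      nlinarith
  have hdp := hder p hp hFp
  have hdq := hder q hq hFq
  have hlim : Tendsto (fun n => |F n 0 s - (F n 0 p + F n 1 p * (s - p) +
        (3 * (F n 0 q - F n 0 p) / (q - p) - 2 * F n 1 p - F n 1 q) / (q - p) * (s - p) ^ 2 +
        (F n 1 p + F n 1 q - 2 * (F n 0 q - F n 0 p) / (q - p)) / (q - p) ^ 2 * (s - p) ^ 3)|)
      atTop (𝓝 |v - (0 + 0 * (s - p) +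
        (3 * (0 - 0) / (q - p) - 2 * 0 - 0) / (q - p) * (s - p) ^ 2 +
        (0 + 0 - 2 * (0 - 0) / (q - p)) / (q - p) ^ 2 * (s - p) ^ 3)|) := by
    refine (hFs.sub (((hFp.add (hdp.mul_const _)).add ?_).add ?_)).abs
    · exact ((((((hFq.sub hFp).const_mul 3).div_const _).sub (hdp.const_mul 2)).sub
        hdq).div_const _).mul_const _
    · exact (((hdp.add hdq).sub (((hFq.sub hFp).const_mul 2).div_const _)).div_const _).mul_const _
  have := le_of_tendsto' hlim (fun n => hermite_bound (hd n 0 (by norm_num)) (hd n 1 (by norm_num))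
    (hd n 2 (by norm_num)) (hd n 3 (by norm_num)) (h₄ n) hp hq hs hpq)
  simp only [sub_self, mul_zero, zero_mul, zero_div, add_zero, sub_zero] at this
  exact (le_abs_self v).trans this

/-! ### Functions with bounded derivatives on a convex domain -/

section Regular

set_option maxSynthPendingDepth 3

variable {E : Type*} [NormedAddCommGroup E] [InnerProductSpace ℝ E]

/-- `V` is `C⁴` on the bounded convex open set `D`, its derivatives of order at most four are
bounded by `K`, and `V` and its gradient extend continuously to the closure, the gradient by `g`. -/
structure RegularOn (K : ℝ) (D : Set E) (V : E → ℝ) (g : E → E →L[ℝ] ℝ) :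
    Prop where
  isOpen : IsOpen D
  convex : Convex ℝ D
  subset_ball : D ⊆ Metric.ball 0 K
  contDiffOn : ContDiffOn ℝ 4 V D
  continuousOn : ContinuousOn V (closure D)
  continuousOn_grad : ContinuousOn g (closure D)
  grad_eq : ∀ x ∈ D, g x = fderiv ℝ V x
  bound : ∀ i ≤ 4, ∀ x ∈ D, ‖iteratedFDeriv ℝ i V x‖ ≤ K

/-- The second derivative as a bilinear form. -/
noncomputable abbrev hess (V : E → ℝ) : E → E →L[ℝ] E →L[ℝ] ℝ :=
  fderiv ℝ (fderiv ℝ V)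

/-- The third derivative as a trilinear form. -/
noncomputable abbrev thirdDeriv (V : E → ℝ) : E → E →L[ℝ] E →L[ℝ] E →L[ℝ] ℝ :=
  fderiv ℝ (hess V)

theorem hasDerivAt_affine_path {E F : Type*} [NormedAddCommGroup E] [NormedSpace ℝ E]
    [NormedAddCommGroup F] [NormedSpace ℝ F] {f : E → F} {f' : E →L[ℝ] F} {p x : E} {t : ℝ}
    (h : HasFDerivAt f f' (p + t • x)) : HasDerivAt (fun s : ℝ => f (p + s • x)) (f' x) t := by
  have h1 : HasDerivAt (fun s : ℝ => p + s • x) x t := by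
    have := ((hasDerivAt_id t).smul_const x).const_add p
    exact this.congr_deriv (by simp)
  exact h.comp_hasDerivAt t h1

theorem closure_ineq {X : Type*} [TopologicalSpace X] {D : Set X} {f g : X → ℝ} {q : X}
    (hq : q ∈ closure D) (hf : ContinuousOn f (closure D)) (hg : ContinuousOn g (closure D))
    (h : ∀ y ∈ D, f y ≤ g y) : f q ≤ g q :=
  ContinuousWithinAt.closure_le hq ((hf q hq).mono subset_closure) ((hg q hq).mono subset_closure) h

namespace RegularOn

variable {K : ℝ} {D : Set E} {V : E → ℝ} {g : E → E →L[ℝ] ℝ}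

theorem contDiffAt (h : RegularOn K D V g) {x : E} (hx : x ∈ D) : ContDiffAt ℝ 4 V x :=
  h.contDiffOn.contDiffAt (h.isOpen.mem_nhds hx)

theorem hasFDerivAt (h : RegularOn K D V g) {x : E} (hx : x ∈ D) :
    HasFDerivAt V (fderiv ℝ V x) x :=
  ((h.contDiffAt hx).differentiableAt (by norm_num)).hasFDerivAt

theorem hasFDerivAt_grad (h : RegularOn K D V g) {x : E} (hx : x ∈ D) :
    HasFDerivAt (fderiv ℝ V) (hess V x) x :=
  (((h.contDiffAt hx).fderiv_right (m := 3) (by norm_num)).differentiableAt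
    (by norm_num)).hasFDerivAt

theorem hasFDerivAt_hess (h : RegularOn K D V g) {x : E} (hx : x ∈ D) :
    HasFDerivAt (hess V) (thirdDeriv V x) x :=
  ((((h.contDiffAt hx).fderiv_right (m := 3) (by norm_num)).fderiv_right (m := 2)
    (by norm_num)).differentiableAt (by norm_num)).hasFDerivAt

theorem hasFDerivAt_third (h : RegularOn K D V g) {x : E} (hx : x ∈ D) :
    HasFDerivAt (thirdDeriv V) (fderiv ℝ (thirdDeriv V) x) x :=
  (((((h.contDiffAt hx).fderiv_right (m := 3) (by norm_num)).fderiv_right (m := 2)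
    (by norm_num)).fderiv_right (m := 1) (by norm_num)).differentiableAt
    (by norm_num)).hasFDerivAt

theorem norm_grad_le' (h : RegularOn K D V g) {x : E} (hx : x ∈ D) : ‖fderiv ℝ V x‖ ≤ K := by
  have := h.bound 1 (by norm_num) x hx
  rwa [← norm_iteratedFDeriv_fderiv, norm_iteratedFDeriv_zero] at this

theorem norm_hess_le (h : RegularOn K D V g) {x : E} (hx : x ∈ D) : ‖hess V x‖ ≤ K := by
  have := h.bound 2 (by norm_num) x hx
  rwa [← norm_iteratedFDeriv_fderiv, ← norm_iteratedFDeriv_fderiv, norm_iteratedFDeriv_zero] at this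

theorem norm_third_le (h : RegularOn K D V g) {x : E} (hx : x ∈ D) : ‖thirdDeriv V x‖ ≤ K := by
  have := h.bound 3 (by norm_num) x hx
  rwa [← norm_iteratedFDeriv_fderiv, ← norm_iteratedFDeriv_fderiv, ← norm_iteratedFDeriv_fderiv,
    norm_iteratedFDeriv_zero] at this

theorem norm_fourth_le (h : RegularOn K D V g) {x : E} (hx : x ∈ D) :
    ‖fderiv ℝ (thirdDeriv V) x‖ ≤ K := by
  have := h.bound 4 (by norm_num) x hx
  rwa [← norm_iteratedFDeriv_fderiv, ← norm_iteratedFDeriv_fderiv, ← norm_iteratedFDeriv_fderiv,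
    ← norm_iteratedFDeriv_fderiv, norm_iteratedFDeriv_zero] at this

theorem abs_le (h : RegularOn K D V g) {x : E} (hx : x ∈ closure D) : |V x| ≤ K := by
  refine closure_ineq hx h.continuousOn.abs continuousOn_const fun y hy => ?_
  have := h.bound 0 (by norm_num) y hy
  rwa [norm_iteratedFDeriv_zero, Real.norm_eq_abs] at this

theorem norm_grad_le (h : RegularOn K D V g) {x : E} (hx : x ∈ closure D) : ‖g x‖ ≤ K := by
  refine closure_ineq hx h.continuousOn_grad.norm continuousOn_const fun y hy => ?_
  rw [h.grad_eq y hy]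
  exact h.norm_grad_le' hy

theorem norm_sub_le (h : RegularOn K D V g) {x y : E} (hx : x ∈ closure D)
    (hy : y ∈ closure D) : ‖x - y‖ ≤ 2 * K := by
  have hb : ∀ z ∈ closure D, ‖z‖ ≤ K := by
    intro z hz
    have := closure_mono h.subset_ball hz
    simpa using Metric.closure_ball_subset_closedBall this
  linarith [_root_.norm_sub_le x y, hb x hx, hb y hy]

theorem segment_mem (h : RegularOn K D V g) {p q : E} (hp : p ∈ D) (hq : q ∈ D) :
    ∀ t ∈ Icc (0 : ℝ) 1, p + t • (q - p) ∈ D := fun _ ht =>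
  h.convex.add_smul_sub_mem hp hq ht

theorem taylor_third_of_mem (h : RegularOn K D V g) {p q : E} (hp : p ∈ D) (hq : q ∈ D) :
    |V q - V p - fderiv ℝ V p (q - p) - hess V p (q - p) (q - p) / 2
        - thirdDeriv V p (q - p) (q - p) (q - p) / 6| ≤ K * ‖q - p‖ ^ 4 ∧
      |fderiv ℝ V q (q - p) - fderiv ℝ V p (q - p) - hess V p (q - p) (q - p)
        - thirdDeriv V p (q - p) (q - p) (q - p) / 2| ≤ K * ‖q - p‖ ^ 4 := by
  have hseg := h.segment_mem hp hq
  have := taylor_unitInterval (C := K * ‖q - p‖ ^ 4)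
    (f₀ := fun t => V (p + t • (q - p)))
    (f₁ := fun t => fderiv ℝ V (p + t • (q - p)) (q - p))
    (f₂ := fun t => hess V (p + t • (q - p)) (q - p) (q - p))
    (f₃ := fun t => thirdDeriv V (p + t • (q - p)) (q - p) (q - p) (q - p))
    (f₄ := fun t => fderiv ℝ (thirdDeriv V) (p + t • (q - p)) (q - p) (q - p) (q - p) (q - p))
    (fun t ht => hasDerivAt_affine_path (h.hasFDerivAt (hseg t ht)))
    (fun t ht => ?_) (fun t ht => ?_) (fun t ht => ?_) (fun t ht => ?_)
  · simpa using this
  · have := hasDerivAt_affine_path (h.hasFDerivAt_grad (hseg t ht))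
    exact (this.clm_apply (hasDerivAt_const t (q - p))).congr_deriv (by simp)
  · have := hasDerivAt_affine_path (h.hasFDerivAt_hess (hseg t ht))
    exact ((this.clm_apply (hasDerivAt_const t (q - p))).clm_apply
      (hasDerivAt_const t (q - p))).congr_deriv (by simp)
  · have := hasDerivAt_affine_path (h.hasFDerivAt_third (hseg t ht))
    exact (((this.clm_apply (hasDerivAt_const t (q - p))).clm_apply
      (hasDerivAt_const t (q - p))).clm_apply (hasDerivAt_const t (q - p))).congr_deriv (by simp)
  · set x := q - p
    calc |fderiv ℝ (thirdDeriv V) (p + t • x) x x x x|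
        ≤ ‖fderiv ℝ (thirdDeriv V) (p + t • x) x x x‖ * ‖x‖ := by
          rw [← Real.norm_eq_abs]; exact ContinuousLinearMap.le_opNorm _ _
      _ ≤ (‖fderiv ℝ (thirdDeriv V) (p + t • x) x x‖ * ‖x‖) * ‖x‖ := by
          gcongr; exact ContinuousLinearMap.le_opNorm _ _
      _ ≤ ((‖fderiv ℝ (thirdDeriv V) (p + t • x) x‖ * ‖x‖) * ‖x‖) * ‖x‖ := by
          gcongr; exact ContinuousLinearMap.le_opNorm _ _
      _ ≤ (((K * ‖x‖) * ‖x‖) * ‖x‖) * ‖x‖ := by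
          gcongr
          exact ContinuousLinearMap.le_of_opNorm_le _ (h.norm_fourth_le (hseg t ht)) _
      _ = K * ‖x‖ ^ 4 := by ring

/-- Only `V` and `g`, which extend continuously, are evaluated at `q`; the higher derivatives are
taken at the interior point `p`. The estimate is therefore a closed condition in `q`. -/
theorem taylor_third (h : RegularOn K D V g) {p q : E} (hp : p ∈ D) (hq : q ∈ closure D) :
    |V q - V p - fderiv ℝ V p (q - p) - hess V p (q - p) (q - p) / 2
        - thirdDeriv V p (q - p) (q - p) (q - p) / 6| ≤ K * ‖q - p‖ ^ 4 ∧
      |g q (q - p) - fderiv ℝ V p (q - p) - hess V p (q - p) (q - p)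
        - thirdDeriv V p (q - p) (q - p) (q - p) / 2| ≤ K * ‖q - p‖ ^ 4 := by
  have hc : ContinuousOn (fun q : E => q - p) (closure D) := by fun_prop
  have hV := h.continuousOn
  have hg := h.continuousOn_grad
  constructor
  · refine closure_ineq (f := fun q => |V q - V p - fderiv ℝ V p (q - p)
      - hess V p (q - p) (q - p) / 2 - thirdDeriv V p (q - p) (q - p) (q - p) / 6|)
      (g := fun q => K * ‖q - p‖ ^ 4) hq ?_ (by fun_prop)
      fun y hy => (h.taylor_third_of_mem hp hy).1
    refine ContinuousOn.abs (ContinuousOn.sub (ContinuousOn.sub (ContinuousOn.sub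
      (hV.sub continuousOn_const) (by fun_prop)) (by fun_prop)) (by fun_prop))
  · refine closure_ineq (f := fun q => |g q (q - p) - fderiv ℝ V p (q - p)
      - hess V p (q - p) (q - p) - thirdDeriv V p (q - p) (q - p) (q - p) / 2|)
      (g := fun q => K * ‖q - p‖ ^ 4) hq ?_ (by fun_prop)
      fun y hy => by
        have := (h.taylor_third_of_mem hp hy).2
        rwa [← h.grad_eq y hy] at this
    refine ContinuousOn.abs (ContinuousOn.sub (ContinuousOn.sub (ContinuousOn.sub
      (hg.clm_apply hc) (by fun_prop)) (by fun_prop)) (by fun_prop))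

theorem norm_hess_sub_le (h : RegularOn K D V g) {p q : E} (hp : p ∈ D) (hq : q ∈ D) :
    ‖hess V q - hess V p‖ ≤ K * ‖q - p‖ :=
  h.convex.norm_image_sub_le_of_norm_hasFDerivWithin_le
    (fun _ hx => (h.hasFDerivAt_hess hx).hasFDerivWithinAt) (fun _ hx => h.norm_third_le hx) hp hq

theorem norm_third_sub_le (h : RegularOn K D V g) {p q : E} (hp : p ∈ D) (hq : q ∈ D) :
    ‖thirdDeriv V q - thirdDeriv V p‖ ≤ K * ‖q - p‖ :=
  h.convex.norm_image_sub_le_of_norm_hasFDerivWithin_le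
    (fun _ hx => (h.hasFDerivAt_third hx).hasFDerivWithinAt) (fun _ hx => h.norm_fourth_le hx) hp hq

theorem norm_grad_sub_le (h : RegularOn K D V g) {p q : E} (hp : p ∈ closure D)
    (hq : q ∈ closure D) : ‖g q - g p‖ ≤ K * ‖q - p‖ := by
  have hg := h.continuousOn_grad
  have key : ∀ p ∈ D, ∀ q ∈ closure D, ‖g q - g p‖ ≤ K * ‖q - p‖ := by
    intro p hp q hq
    refine closure_ineq (f := fun q => ‖g q - g p‖) (g := fun q => K * ‖q - p‖) hq
      (by fun_prop) (by fun_prop) fun y hy => ?_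
    rw [h.grad_eq y hy, h.grad_eq p hp]
    exact h.convex.norm_image_sub_le_of_norm_hasFDerivWithin_le
      (fun x hx => (h.hasFDerivAt_grad hx).hasFDerivWithinAt) (fun _ hx => h.norm_hess_le hx) hp hy
  exact closure_ineq (f := fun p => ‖g q - g p‖) (g := fun p => K * ‖q - p‖) hp
      (by fun_prop) (by fun_prop) fun y hy => key y hy q hq

/-- A function on a segment whose derivative deviates at most linearly. -/
theorem norm_sub_sub_le_sq {E F : Type*} [NormedAddCommGroup E] [NormedSpace ℝ E]
    [NormedAddCommGroup F] [NormedSpace ℝ F] {D : Set E} (hD : Convex ℝ D) {f : E → F}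
    {f' : E → E →L[ℝ] F} {C : ℝ} (hf : ∀ x ∈ D, HasFDerivAt f (f' x) x)
    {p q : E} (hp : p ∈ D) (hq : q ∈ D) (hC : ∀ x ∈ D, ‖f' x - f' p‖ ≤ C * ‖x - p‖)
    (hC0 : 0 ≤ C) :
    ‖f q - f p - f' p (q - p)‖ ≤ C * ‖q - p‖ ^ 2 := by
  have hseg : ∀ t ∈ Icc (0 : ℝ) 1, p + t • (q - p) ∈ D := fun t ht =>
    hD.add_smul_sub_mem hp hq ht
  have := norm_image_sub_le_of_norm_deriv_le_segment' (a := 0) (b := 1) (C := C * ‖q - p‖ ^ 2)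
    (f := fun t : ℝ => f (p + t • (q - p)) - t • f' p (q - p))
    (f' := fun t => f' (p + t • (q - p)) (q - p) - f' p (q - p))
    (fun t ht => ?_) (fun t ht => ?_) 1 ⟨zero_le_one, le_rfl⟩
  · simp only [one_smul, add_sub_cancel, zero_smul, add_zero, sub_zero, mul_one] at this
    rwa [sub_right_comm] at this
  · have h1 := (hasDerivAt_affine_path (hf _ (hseg t ht))).sub
      ((hasDerivAt_id t).smul_const (f' p (q - p)))
    have h2 : HasDerivAt (fun t : ℝ => f (p + t • (q - p)) - t • f' p (q - p))
      (f' (p + t • (q - p)) (q - p) - f' p (q - p)) t := h1.congr_deriv (by simp)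
    exact h2.hasDerivWithinAt
  · have h1 := hC _ (hseg t ⟨ht.1, ht.2.le⟩)
    rw [add_sub_cancel_left, norm_smul, Real.norm_eq_abs, abs_of_nonneg ht.1] at h1
    rw [← sub_apply]
    calc _ ≤ ‖f' (p + t • (q - p)) - f' p‖ * ‖q - p‖ := ContinuousLinearMap.le_opNorm _ _
      _ ≤ (C * (t * ‖q - p‖)) * ‖q - p‖ := by gcongr
      _ ≤ (C * (1 * ‖q - p‖)) * ‖q - p‖ := by gcongr; exact ht.2.le
      _ = C * ‖q - p‖ ^ 2 := by ring

theorem nonneg (h : RegularOn K D V g) {p : E} (hp : p ∈ D) : 0 ≤ K :=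
  (norm_nonneg _).trans (h.norm_grad_le' hp)

theorem grad_taylor (h : RegularOn K D V g) {p q : E} (hp : p ∈ D) (hq : q ∈ closure D) :
    ‖g q - fderiv ℝ V p - hess V p (q - p)‖ ≤ K * ‖q - p‖ ^ 2 := by
  have hg := h.continuousOn_grad
  refine closure_ineq (f := fun q => ‖g q - fderiv ℝ V p - hess V p (q - p)‖)
    (g := fun q => K * ‖q - p‖ ^ 2) hq (by fun_prop) (by fun_prop) fun y hy => ?_
  rw [h.grad_eq y hy]
  exact norm_sub_sub_le_sq h.convex (fun x hx => h.hasFDerivAt_grad hx) hp hy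
    (fun x hx => h.norm_hess_sub_le hp hx) (h.nonneg hp)

theorem hess_taylor (h : RegularOn K D V g) {p q : E} (hp : p ∈ D) (hq : q ∈ D) :
    ‖hess V q - hess V p - thirdDeriv V p (q - p)‖ ≤ K * ‖q - p‖ ^ 2 :=
  norm_sub_sub_le_sq h.convex (fun _ hx => h.hasFDerivAt_hess hx) hp hq
    (fun _ hx => h.norm_third_sub_le hp hx) (h.nonneg hp)

/-- A second-order Taylor bound from above, for a directional bound of the second derivative near
the segment. -/
theorem le_of_hess_le (h : RegularOn K D V g) {p q : E} (hp : p ∈ closure D)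
    (hq : q ∈ closure D) {S δ : ℝ} (hδ : 0 < δ) (hS0 : 0 ≤ S) (hne : D.Nonempty)
    (hS : ∀ t ∈ Icc (0 : ℝ) 1, ∀ r ∈ D, ‖r - (p + t • (q - p))‖ ≤ δ →
      hess V r (q - p) (q - p) ≤ S) :
    V q ≤ V p + g p (q - p) + S := by
  obtain ⟨c, hc⟩ := hne
  -- Both ends are pulled towards an interior point c. The new segment lies in D, stays δ-close to
  -- the old one and is parallel to it with factor 1 − ε, so the directional bound survives. The
  -- limit ε → 0 uses only the continuity of V and g on the closure.
  set P : ℝ → E := fun ε => p + ε • (c - p) with hP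
  set Q : ℝ → E := fun ε => q + ε • (c - q) with hQ
  have hmem : ∀ {a : E}, a ∈ closure D → ∀ ε ∈ Ioo (0 : ℝ) 1, a + ε • (c - a) ∈ D := by
    intro a ha ε hε
    have := h.convex.combo_interior_closure_mem_interior (x := c) (y := a) (a := ε) (b := 1 - ε)
      (by rwa [h.isOpen.interior_eq]) ha hε.1 (by linarith [hε.2]) (by ring)
    rw [h.isOpen.interior_eq] at this
    convert this using 1
    module
  have hev : ∀ᶠ ε in 𝓝[>] (0 : ℝ), V (Q ε) ≤ V (P ε) + g (P ε) (Q ε - P ε) + S := by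
    have h1 : ∀ᶠ ε in 𝓝[>] (0 : ℝ), ε ∈ Ioo (0 : ℝ) 1 := Ioo_mem_nhdsGT one_pos
    have h2 : ∀ᶠ ε in 𝓝[>] (0 : ℝ), ε * (‖c - p‖ + ‖q - p‖) < δ := by
      have : Tendsto (fun ε : ℝ => ε * (‖c - p‖ + ‖q - p‖)) (𝓝[>] 0) (𝓝 0) := by
        have : Tendsto (fun ε : ℝ => ε * (‖c - p‖ + ‖q - p‖)) (𝓝 0) (𝓝 (0 * (‖c - p‖ + ‖q - p‖))) :=
          (continuous_id.mul continuous_const).tendsto 0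
        rw [zero_mul] at this
        exact this.mono_left nhdsWithin_le_nhds
      exact this.eventually_lt_const hδ
    filter_upwards [h1, h2] with ε hε hε2
    have hPD : P ε ∈ D := hmem hp ε hε
    have hQD : Q ε ∈ D := hmem hq ε hε
    have hdiff : Q ε - P ε = (1 - ε) • (q - p) := by simp only [hP, hQ]; module
    have hseg := h.segment_mem hPD hQD
    have hb : ∀ t ∈ Icc (0 : ℝ) 1,
        hess V (P ε + t • (Q ε - P ε)) (Q ε - P ε) (Q ε - P ε) ≤ S := by
      intro t ht
      have h3 := hS t ht _ (hseg t ht) ?_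
      · set r := P ε + t • (Q ε - P ε)
        rw [hdiff]
        simp only [map_smul, smul_apply, smul_eq_mul]
        have h4 : 0 ≤ 1 - ε := by linarith [hε.2]
        have h5 : 1 - ε ≤ 1 := by linarith [hε.1]
        rcases le_total (hess V r (q - p) (q - p)) 0 with h6 | h6
        · have : (1 - ε) * ((1 - ε) * hess V r (q - p) (q - p)) ≤ 0 :=
            mul_nonpos_of_nonneg_of_nonpos h4 (mul_nonpos_of_nonneg_of_nonpos h4 h6)
          linarith
        · calc _ ≤ 1 * (1 * hess V r (q - p) (q - p)) := by gcongr
            _ ≤ S := by linarith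
      · have : P ε + t • (Q ε - P ε) - (p + t • (q - p)) = ε • ((c - p) - t • (q - p)) := by
          rw [hdiff]; simp only [hP]; module
        rw [this, norm_smul, Real.norm_eq_abs, abs_of_pos hε.1]
        refine le_trans ?_ hε2.le
        have h7 : ‖(c - p) - t • (q - p)‖ ≤ ‖c - p‖ + ‖q - p‖ := by
          refine (_root_.norm_sub_le _ _).trans ?_
          rw [norm_smul, Real.norm_eq_abs, abs_of_nonneg ht.1]
          have := mul_le_mul_of_nonneg_right ht.2 (norm_nonneg (q - p))
          linarith
        exact mul_le_mul_of_nonneg_left h7 hε.1.le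
    -- integrate twice along the segment
    set x := Q ε - P ε
    have d1 : ∀ t ∈ Icc (0 : ℝ) 1, HasDerivAt (fun t : ℝ => fderiv ℝ V (P ε + t • x) x)
        (hess V (P ε + t • x) x x) t := by
      intro t ht
      have := hasDerivAt_affine_path (h.hasFDerivAt_grad (hseg t ht))
      exact (this.clm_apply (hasDerivAt_const t x)).congr_deriv (by simp)
    have d0 : ∀ t ∈ Icc (0 : ℝ) 1, HasDerivAt (fun t : ℝ => V (P ε + t • x))
        (fderiv ℝ V (P ε + t • x) x) t := fun t ht =>
      hasDerivAt_affine_path (h.hasFDerivAt (hseg t ht))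
    have m1 : ∀ t ∈ Icc (0 : ℝ) 1, fderiv ℝ V (P ε + t • x) x ≤ fderiv ℝ V (P ε) x + S := by
      intro t ht
      have := image_le_of_deriv_right_le_deriv_boundary
        (f := fun t : ℝ => fderiv ℝ V (P ε + t • x) x) (f' := fun t => hess V (P ε + t • x) x x)
        (a := 0) (b := 1) (B := fun t => fderiv ℝ V (P ε) x + S * t) (B' := fun _ => S)
        (fun t ht => (d1 t ht).continuousAt.continuousWithinAt)
        (fun t ht => (d1 t ⟨ht.1, ht.2.le⟩).hasDerivWithinAt) (by simp) (by fun_prop)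
        (fun t _ => by
          exact ((((hasDerivAt_id t).const_mul S).const_add _).congr_deriv
            (by simp)).hasDerivWithinAt)
        (fun t ht => hb t ⟨ht.1, ht.2.le⟩) ht
      nlinarith [ht.1, ht.2]
    have := image_le_of_deriv_right_le_deriv_boundary
        (f := fun t : ℝ => V (P ε + t • x)) (f' := fun t => fderiv ℝ V (P ε + t • x) x)
        (a := 0) (b := 1) (B := fun t => V (P ε) + (fderiv ℝ V (P ε) x + S) * t)
        (B' := fun _ => fderiv ℝ V (P ε) x + S)
        (fun t ht => (d0 t ht).continuousAt.continuousWithinAt)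
        (fun t ht => (d0 t ⟨ht.1, ht.2.le⟩).hasDerivWithinAt) (by simp) (by fun_prop)
        (fun t _ => by
          exact ((((hasDerivAt_id t).const_mul _).const_add _).congr_deriv
            (by simp)).hasDerivWithinAt)
        (fun t ht => m1 t ⟨ht.1, ht.2.le⟩) (x := 1) ⟨zero_le_one, le_rfl⟩
    simp only [one_smul, mul_one] at this
    have hxe : P ε + x = Q ε := by simp [x]
    rw [hxe, ← h.grad_eq _ hPD] at this
    linarith
  have tP : Tendsto P (𝓝[>] 0) (𝓝[closure D] p) := by
    refine tendsto_nhdsWithin_iff.2 ⟨?_, ?_⟩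
    · have : Tendsto P (𝓝 0) (𝓝 (P 0)) := Continuous.tendsto (by fun_prop) 0
      simp only [hP, zero_smul, add_zero] at this
      exact this.mono_left nhdsWithin_le_nhds
    · filter_upwards [Ioo_mem_nhdsGT (one_pos : (0 : ℝ) < 1)] with ε hε
      exact subset_closure (hmem hp ε hε)
  have tQ : Tendsto Q (𝓝[>] 0) (𝓝[closure D] q) := by
    refine tendsto_nhdsWithin_iff.2 ⟨?_, ?_⟩
    · have : Tendsto Q (𝓝 0) (𝓝 (Q 0)) := Continuous.tendsto (by fun_prop) 0
      simp only [hQ, zero_smul, add_zero] at this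
      exact this.mono_left nhdsWithin_le_nhds
    · filter_upwards [Ioo_mem_nhdsGT (one_pos : (0 : ℝ) < 1)] with ε hε
      exact subset_closure (hmem hq ε hε)
  have tP' := tP.mono_right nhdsWithin_le_nhds
  have tQ' := tQ.mono_right nhdsWithin_le_nhds
  have tg : Tendsto (fun ε => g (P ε)) (𝓝[>] 0) (𝓝 (g p)) :=
    (h.continuousOn_grad p hp).tendsto.comp tP
  exact le_of_tendsto_of_tendsto ((h.continuousOn q hq).tendsto.comp tQ)
    ((((h.continuousOn p hp).tendsto.comp tP).add
      ((isBoundedBilinearMap_apply.continuous.tendsto (g p, q - p)).comp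
        (tg.prodMk_nhds (tQ'.sub tP')))).add_const S) hev

theorem hess_apply_le (h : RegularOn K D V g) {p : E} (hp : p ∈ D) (x y : E) :
    |hess V p x y| ≤ K * ‖x‖ * ‖y‖ :=
  (ContinuousLinearMap.le_opNorm₂ (hess V p) x y).trans (by
    have := h.norm_hess_le hp
    gcongr)

theorem le_taylor (h : RegularOn K D V g) {p q : E} (hp : p ∈ closure D)
    (hq : q ∈ closure D) (hne : D.Nonempty) :
    V q ≤ V p + g p (q - p) + K * ‖q - p‖ ^ 2 := by
  obtain ⟨c, hc⟩ := hne
  have hK := h.nonneg hc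
  refine h.le_of_hess_le hp hq one_pos (by positivity) ⟨c, hc⟩ fun t _ r hr _ => ?_
  refine (le_abs_self _).trans ((h.hess_apply_le hr _ _).trans (le_of_eq (by ring)))

theorem eventually_mem_add_smul (h : RegularOn K D V g) {p : E} (hp : p ∈ D) (x : E) :
    ∀ᶠ t in 𝓝 (0 : ℝ), p + t • x ∈ D := by
  have : Tendsto (fun t : ℝ => p + t • x) (𝓝 0) (𝓝 (p + (0 : ℝ) • x)) :=
    Continuous.tendsto (by fun_prop) 0
  rw [zero_smul, add_zero] at this
  exact this (h.isOpen.mem_nhds hp)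

theorem grad_eq_zero (h : RegularOn K D V g) (hV : ∀ x ∈ closure D, 0 ≤ V x) {p : E}
    (hp : p ∈ D) (hVp : V p = 0) : fderiv ℝ V p = 0 := by
  have : IsLocalMin V p := by
    filter_upwards [h.isOpen.mem_nhds hp] with x hx
    rw [hVp]
    exact hV x (subset_closure hx)
  exact this.fderiv_eq_zero

/-- The gradient vanishes at the zero, so dividing the Taylor expansion along the ray by t² and
letting t → 0⁺ leaves half the second derivative. -/
theorem hess_nonneg (h : RegularOn K D V g) (hV : ∀ x ∈ closure D, 0 ≤ V x) {p : E}
    (hp : p ∈ D) (hVp : V p = 0) (x : E) : 0 ≤ hess V p x x := by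
  have hg := h.grad_eq_zero hV hp hVp
  have hev : ∀ᶠ t in 𝓝[>] (0 : ℝ), 0 ≤ hess V p x x / 2 + t * (thirdDeriv V p x x x / 6) +
      t ^ 2 * (K * ‖x‖ ^ 4) := by
    filter_upwards [nhdsWithin_le_nhds (h.eventually_mem_add_smul hp x), self_mem_nhdsWithin]
      with t ht ht0
    have ht0' : (0 : ℝ) < t := ht0
    have h1 := (h.taylor_third_of_mem hp ht).1
    have h2 := hV _ (subset_closure ht)
    simp only [add_sub_cancel_left, hVp, hg, map_smul, smul_apply,
      smul_eq_mul, zero_apply, norm_smul, Real.norm_eq_abs, abs_of_pos ht0']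
      at h1
    have h3 := (_root_.abs_le.1 h1).2
    have h4 : 0 ≤ t ^ 2 * (hess V p x x / 2 + t * (thirdDeriv V p x x x / 6) +
      t ^ 2 * (K * ‖x‖ ^ 4)) := by nlinarith
    exact nonneg_of_mul_nonneg_right h4 (by positivity)
  have hlim : Tendsto (fun t : ℝ => hess V p x x / 2 + t * (thirdDeriv V p x x x / 6) +
      t ^ 2 * (K * ‖x‖ ^ 4)) (𝓝[>] 0) (𝓝 (hess V p x x / 2 + 0 * (thirdDeriv V p x x x / 6) +
      0 ^ 2 * (K * ‖x‖ ^ 4))) :=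
    (Continuous.tendsto (by fun_prop) 0).mono_left nhdsWithin_le_nhds
  have := ge_of_tendsto hlim hev
  norm_num at this
  linarith

/-- At an interior zero the Hessian is a positive semidefinite form. This lets the single number
`hess V p x x` control the whole covector `hess V p x`. -/
theorem hess_cauchySchwarz (h : RegularOn K D V g) (hV : ∀ x ∈ closure D, 0 ≤ V x) {p : E}
    (hp : p ∈ D) (hVp : V p = 0) (x y : E) :
    (hess V p x y) ^ 2 ≤ hess V p x x * hess V p y y := by
  have hsymm : hess V p x y = hess V p y x :=
    (h.contDiffAt hp).isSymmSndFDerivAt (by simp; norm_num) x y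
  have := LinearMap.BilinForm.apply_mul_apply_le_of_forall_zero_le
    ((ContinuousLinearMap.coeLM ℝ).comp (hess V p).toLinearMap)
    (fun x => h.hess_nonneg hV hp hVp x) x y
  change hess V p x y * hess V p y x ≤ hess V p x x * hess V p y y at this
  rw [← hsymm] at this
  nlinarith

/-- For t > 0, the point p + t • x lies in the ball exactly when t‖x‖² < 2R⟨n, x⟩. -/
theorem exists_mem_of_inner_pos {D : Set E} {p n x : E} {R : ℝ} (hR : 0 < R)
    (hn : ‖n‖ = 1) (hball : Metric.ball (p + R • n) R ⊆ D) (hx : 0 < inner ℝ n x) :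
    ∀ᶠ t in 𝓝[>] (0 : ℝ), p + t • x ∈ D := by
  have h1 : ∀ᶠ t in 𝓝[>] (0 : ℝ), t * ‖x‖ ^ 2 < 2 * R * inner ℝ n x := by
    have : Tendsto (fun t : ℝ => t * ‖x‖ ^ 2) (𝓝[>] 0) (𝓝 (0 * ‖x‖ ^ 2)) :=
      (Continuous.tendsto (by fun_prop) 0).mono_left nhdsWithin_le_nhds
    rw [zero_mul] at this
    exact this.eventually_lt_const (by positivity)
  filter_upwards [h1, self_mem_nhdsWithin] with t ht ht0
  have ht0' : (0 : ℝ) < t := ht0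
  apply hball
  rw [mem_ball_iff_norm]
  refine lt_of_pow_lt_pow_left₀ 2 hR.le ?_
  have : p + t • x - (p + R • n) = t • x - R • n := by module
  rw [this, norm_sub_sq_real, norm_smul, norm_smul, inner_smul_left, inner_smul_right,
    real_inner_comm, hn]
  simp only [Real.norm_eq_abs, abs_of_pos hR, abs_of_pos ht0', conj_trivial]
  nlinarith

/-- At a boundary point with an interior ball, the gradient of a nonnegative function vanishing
there is a nonnegative multiple of the inner normal. -/
theorem grad_boundary (h : RegularOn K D V g) (hV : ∀ x ∈ closure D, 0 ≤ V x) {p n : E}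
    {R : ℝ} (hp : p ∈ closure D) (hVp : V p = 0) (hR : 0 < R) (hn : ‖n‖ = 1)
    (hball : Metric.ball (p + R • n) R ⊆ D) :
    ∃ a, 0 ≤ a ∧ a ≤ ‖g p‖ ∧ ∀ x, g p x = a * inner ℝ n x := by
  have hne : D.Nonempty := ⟨p + R • n, hball (Metric.mem_ball_self hR)⟩
  have hpos : ∀ x, 0 < inner ℝ n x → 0 ≤ g p x := by
    intro x hx
    have hev : ∀ᶠ t in 𝓝[>] (0 : ℝ), 0 ≤ g p x + t * (K * ‖x‖ ^ 2) := by
      filter_upwards [exists_mem_of_inner_pos hR hn hball hx, self_mem_nhdsWithin] with t ht ht0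
      have ht0' : (0 : ℝ) < t := ht0
      have h1 := h.le_taylor hp (subset_closure ht) hne
      have h2 := hV _ (subset_closure ht)
      simp only [add_sub_cancel_left, hVp, map_smul, smul_eq_mul, norm_smul, Real.norm_eq_abs,
        abs_of_pos ht0'] at h1
      have h4 : 0 ≤ t * (g p x + t * (K * ‖x‖ ^ 2)) := by nlinarith
      exact nonneg_of_mul_nonneg_right h4 ht0'
    have hlim : Tendsto (fun t : ℝ => g p x + t * (K * ‖x‖ ^ 2)) (𝓝[>] 0)
        (𝓝 (g p x + 0 * (K * ‖x‖ ^ 2))) :=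
      (Continuous.tendsto (by fun_prop) 0).mono_left nhdsWithin_le_nhds
    have := ge_of_tendsto hlim hev
    simpa using this
  have hnn : inner ℝ n n = (1 : ℝ) := by rw [real_inner_self_eq_norm_sq, hn]; norm_num
  -- A linear form that is nonnegative on an open half-space vanishes on its bounding hyperplane:
  -- otherwise a suitable multiple s of x makes the form equal to −1 at n + s • x.
  have htan : ∀ x, inner ℝ n x = 0 → g p x = 0 := by
    intro x hx
    have key : ∀ s : ℝ, 0 ≤ g p n + s * g p x := by
      intro s
      have := hpos (n + s • x) (by rw [inner_add_right, inner_smul_right, hx, hnn]; norm_num)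
      simpa using this
    by_contra hne0
    have := key (-(g p n + 1) / g p x)
    rw [div_mul_cancel₀ _ hne0] at this
    linarith
  refine ⟨g p n, hpos n (by rw [hnn]; norm_num), ?_, fun x => ?_⟩
  · have := (g p).le_opNorm n
    rw [hn, mul_one] at this
    exact (le_abs_self _).trans this
  · have := htan (x - (inner ℝ n x : ℝ) • n)
      (by rw [inner_sub_right, inner_smul_right, hnn]; ring)
    rw [map_sub, map_smul, smul_eq_mul, sub_eq_zero] at this
    rw [this, mul_comm]

end RegularOn

end Regular

/-! ### Chords, and chords parallel to a given one -/

section Chords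

set_option maxSynthPendingDepth 3

variable {E : Type*} [NormedAddCommGroup E] [InnerProductSpace ℝ E]

/-- The point `z` lies on a chord of `closure D` along which the linear interpolation of `V` at `z`
is at most `t`. -/
def ChordBound (D : Set E) (V : E → ℝ) (z : E) (t : ℝ) : Prop :=
  ∃ z₁ ∈ closure D, ∃ z₂ ∈ closure D, ∃ a b : ℝ, 0 ≤ a ∧ 0 ≤ b ∧ a + b = 1 ∧
    a • z₁ + b • z₂ = z ∧ a * V z₁ + b * V z₂ ≤ t

theorem ChordBound.mono {D : Set E} {V : E → ℝ} {z : E} {t t' : ℝ} (h : ChordBound D V z t)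
    (ht : t ≤ t') : ChordBound D V z t' := by
  obtain ⟨z₁, h₁, z₂, h₂, a, b, ha, hb, hab, hz, hV⟩ := h
  exact ⟨z₁, h₁, z₂, h₂, a, b, ha, hb, hab, hz, hV.trans ht⟩

theorem chordBound_of_le {D : Set E} {V : E → ℝ} {z : E} {t : ℝ} (hz : z ∈ closure D)
    (h : V z ≤ t) : ChordBound D V z t :=
  ⟨z, hz, z, hz, 1, 0, zero_le_one, le_rfl, by norm_num, by simp, by simpa using h⟩

theorem chordBound_of_le_of_le {D : Set E} {V : E → ℝ} {z z₁ z₂ : E} {a b t : ℝ}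
    (hz₁ : z₁ ∈ closure D) (hz₂ : z₂ ∈ closure D) (ha : 0 ≤ a) (hb : 0 ≤ b) (hab : a + b = 1)
    (hz : a • z₁ + b • z₂ = z) (h₁ : V z₁ ≤ t) (h₂ : V z₂ ≤ t) : ChordBound D V z t := by
  refine ⟨z₁, hz₁, z₂, hz₂, a, b, ha, hb, hab, hz, ?_⟩
  calc a * V z₁ + b * V z₂ ≤ a * t + b * t := by gcongr
    _ = t := by rw [← add_mul, hab, one_mul]

theorem combo_mem_of_closure {D : Set E} (hD : IsOpen D) (hconv : Convex ℝ D) {x y : E}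
    (hx : x ∈ D) (hy : y ∈ closure D) {a b : ℝ} (ha : 0 < a) (hb : 0 ≤ b) (hab : a + b = 1) :
    a • x + b • y ∈ D := by
  have := hconv.combo_interior_closure_mem_interior (by rwa [hD.interior_eq]) hy ha hb hab
  rwa [hD.interior_eq] at this

/-- One end of a chord through `z`, parallel to a given chord whose point `y + d` is the centre of a
ball in `D`. -/
theorem exists_parallel_chord_end {D : Set E} (hD : IsOpen D) (hconv : Convex ℝ D)
    (hbdd : Bornology.IsBounded D) {y d h : E} {κ s : ℝ} (hy : y ∈ closure D) (hd : d ≠ 0)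
    (hball : Metric.ball (y + d) κ ⊆ D) (hh : ‖h‖ < κ) (hs : 0 ≤ s) (hz : y + s • d + h ∈ D) :
    ∃ σ ≤ s, |σ| ≤ ‖h‖ / κ ∧ y + h + σ • d ∈ closure D ∧ (y ∈ D ∨ y + h + σ • d ∉ D) := by
  have hκ : 0 < κ := (norm_nonneg h).trans_lt hh
  set τ := ‖h‖ / κ with hτ
  have hτ0 : 0 ≤ τ := by positivity
  have hτ1 : τ < 1 := by rwa [hτ, div_lt_one hκ]
  have hτκ : τ * κ = ‖h‖ := by rw [hτ]; field_simp
  have hz' : y + h + s • d ∈ D := by convert hz using 1; abel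
  -- The point y + h + ςd is the combination, with weights 1 − ς and ς, of y and y + d + ς⁻¹h; the
  -- latter lies in the ball once ς > ‖h‖/κ.
  have hin : ∀ ς, τ < ς → ς ≤ 1 → y + h + ς • d ∈ D := by
    intro ς h1 h2
    have hς : 0 < ς := hτ0.trans_lt h1
    have hm : (y + d) + ς⁻¹ • h ∈ D := by
      apply hball
      rw [mem_ball_iff_norm, add_sub_cancel_left, norm_smul, norm_inv, Real.norm_eq_abs,
        abs_of_pos hς, inv_mul_lt_iff₀ hς, ← hτκ]
      exact mul_lt_mul_of_pos_right h1 hκ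
    have := combo_mem_of_closure hD hconv hm hy hς (sub_nonneg.2 h2) (by ring)
    convert this using 1
    rw [smul_add, smul_smul, mul_inv_cancel₀ hς.ne']
    module
  by_cases hyD : y ∈ D
  · rcases le_total s τ with hsτ | hsτ
    · exact ⟨s, le_rfl, by rwa [abs_of_nonneg hs], subset_closure hz', Or.inl hyD⟩
    · refine ⟨τ, hsτ, by rw [abs_of_nonneg hτ0], ?_, Or.inl hyD⟩
      have hcont : Tendsto (fun ς : ℝ => y + h + ς • d) (𝓝[>] τ) (𝓝 (y + h + τ • d)) :=
        (Continuous.tendsto (by fun_prop) τ).mono_left nhdsWithin_le_nhds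
      refine mem_closure_of_tendsto hcont ?_
      filter_upwards [Ioo_mem_nhdsGT hτ1] with ς hς
      exact hin ς hς.1 hς.2.le
  -- If y is a boundary point, the end is the last point outside D before the parameter s. It is a
  -- limit of points of D, yet outside D, which the first-order estimate at the boundary will need.
  · set S : Set ℝ := {σ | σ ≤ s ∧ y + h + σ • d ∉ D} with hS
    have hSclosed : IsClosed S := by
      have h1 : IsClosed {σ : ℝ | y + h + σ • d ∉ D} :=
        (hD.isClosed_compl).preimage (f := fun σ : ℝ => y + h + σ • d) (by fun_prop)
      exact isClosed_Iic.inter h1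
    have hSne : S.Nonempty := by
      obtain ⟨R, hR⟩ := hbdd.subset_ball (y + h)
      have hdpos : 0 < ‖d‖ := norm_pos_iff.2 hd
      refine ⟨min s (-(|R| / ‖d‖)), min_le_left _ _, fun hmem => ?_⟩
      have := hR hmem
      rw [mem_ball_iff_norm, add_sub_cancel_left, norm_smul, Real.norm_eq_abs] at this
      have h2 : min s (-(|R| / ‖d‖)) ≤ -(|R| / ‖d‖) := min_le_right _ _
      have h3 : |R| / ‖d‖ ≤ |min s (-(|R| / ‖d‖))| := by
        have := neg_le_abs (min s (-(|R| / ‖d‖)))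
        linarith
      have h4 : |R| ≤ |min s (-(|R| / ‖d‖))| * ‖d‖ := by rwa [div_le_iff₀ hdpos] at h3
      linarith [le_abs_self R]
    have hSbdd : BddAbove S := ⟨s, fun σ hσ => hσ.1⟩
    obtain ⟨hσs, hσD⟩ := hSclosed.csSup_mem hSne hSbdd
    set σ := sSup S with hσ
    have hσlt : σ < s := lt_of_le_of_ne hσs fun he => hσD (he ▸ hz')
    have habove : ∀ ς, σ < ς → ς ≤ s → y + h + ς • d ∈ D := by
      intro ς h1 h2
      by_contra hcon
      exact absurd (le_csSup hSbdd ⟨h2, hcon⟩) (not_le.2 h1)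
    have hcl : y + h + σ • d ∈ closure D := by
      have hcont : Tendsto (fun ς : ℝ => y + h + ς • d) (𝓝[>] σ) (𝓝 (y + h + σ • d)) :=
        (Continuous.tendsto (by fun_prop) σ).mono_left nhdsWithin_le_nhds
      refine mem_closure_of_tendsto hcont ?_
      filter_upwards [Ioo_mem_nhdsGT hσlt] with ς hς
      exact habove ς hς.1 hς.2.le
    refine ⟨σ, hσs, abs_le.2 ⟨?_, ?_⟩, hcl, Or.inr hσD⟩
    · by_contra hcon
      push Not at hcon
      -- If σ were below −τ, then y would lie strictly between a point of the ball around y + d and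
      -- the end y + h + σd in the closure, hence in D.
      obtain ⟨ς, hς⟩ : ∃ ς, ς = -σ := ⟨_, rfl⟩
      have h1 : τ < ς := by linarith
      have hς0 : 0 < ς := hτ0.trans_lt h1
      have hm : (y + d) - ς⁻¹ • h ∈ D := by
        apply hball
        rw [mem_ball_iff_norm, sub_sub_cancel_left, norm_neg, norm_smul, norm_inv,
          Real.norm_eq_abs, abs_of_pos hς0, inv_mul_lt_iff₀ hς0, ← hτκ]
        exact mul_lt_mul_of_pos_right h1 hκ
      have h1ς : (1 + ς) ≠ 0 := by positivity
      have := combo_mem_of_closure hD hconv hm hcl (a := ς / (1 + ς)) (b := 1 / (1 + ς))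
        (by positivity) (by positivity) (by field_simp; ring)
      apply hyD
      convert this using 1
      have hσ' : σ = -ς := by linarith
      rw [hσ']
      match_scalars <;> field_simp <;> ring
    · by_contra hcon
      push Not at hcon
      rcases le_total σ 1 with h1 | h1
      · exact hσD (hin σ hcon h1)
      · have h2 := hin 1 hτ1 le_rfl
        rw [one_smul] at h2
        have hs1 : 1 < s := h1.trans_lt hσlt
        have hs1' : s - 1 ≠ 0 := by linarith
        have := hconv h2 hz' (a := (s - σ) / (s - 1)) (b := (σ - 1) / (s - 1))
          (div_nonneg (by linarith) (by linarith)) (div_nonneg (by linarith) (by linarith))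
          (by field_simp; ring)
        apply hσD
        convert this using 1
        match_scalars <;> field_simp <;> ring

/-- A chord through `z = y + h`, parallel to the chord from `y₁` to `y₂` through `y`. -/
theorem exists_parallel_chord {D : Set E} (hD : IsOpen D) (hconv : Convex ℝ D)
    (hbdd : Bornology.IsBounded D) {y₁ d h : E} {κ s : ℝ} (hy₁ : y₁ ∈ closure D)
    (hy₂ : y₁ + (2 : ℝ) • d ∈ closure D) (hd : d ≠ 0)
    (hball : Metric.ball (y₁ + d) κ ⊆ D) (hh : ‖h‖ < κ) (hs : s ∈ Icc (0 : ℝ) 2)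
    (hz : y₁ + s • d + h ∈ D) :
    ∃ σ₁ σ₂ : ℝ, |σ₁| ≤ ‖h‖ / κ ∧ |σ₂| ≤ ‖h‖ / κ ∧
      y₁ + (h + σ₁ • d) ∈ closure D ∧ (y₁ + (2 : ℝ) • d) + (h + σ₂ • d) ∈ closure D ∧
      (y₁ ∈ D ∨ y₁ + (h + σ₁ • d) ∉ D) ∧
      ((y₁ + (2 : ℝ) • d) ∈ D ∨ (y₁ + (2 : ℝ) • d) + (h + σ₂ • d) ∉ D) ∧
      ∃ a b : ℝ, 0 ≤ a ∧ 0 ≤ b ∧ a + b = 1 ∧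
        a • (y₁ + (h + σ₁ • d)) + b • ((y₁ + (2 : ℝ) • d) + (h + σ₂ • d)) = y₁ + s • d + h := by
  obtain ⟨σ₁, h1s, h1τ, h1c, h1D⟩ :=
    exists_parallel_chord_end hD hconv hbdd hy₁ hd hball hh hs.1 hz
  have e1 : (y₁ + (2 : ℝ) • d) + -d = y₁ + d := by module
  have e2 : (y₁ + (2 : ℝ) • d) + (2 - s) • (-d) + h = y₁ + s • d + h := by module
  -- The other end is the same construction from y₁ + 2d in the direction −d; the midpoint, and so
  -- the ball, is the same.
  obtain ⟨σ₂, h2s, h2τ, h2c, h2D⟩ :=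
    exists_parallel_chord_end hD hconv hbdd hy₂ (neg_ne_zero.2 hd) (by rwa [e1]) hh
      (by linarith [hs.2] : 0 ≤ 2 - s) (by rwa [e2])
  have e3 : y₁ + h + σ₁ • d = y₁ + (h + σ₁ • d) := by module
  have e4 : (y₁ + (2 : ℝ) • d) + h + σ₂ • (-d) = (y₁ + (2 : ℝ) • d) + (h + (-σ₂) • d) := by module
  rw [e3] at h1c h1D
  rw [e4] at h2c h2D
  refine ⟨σ₁, -σ₂, h1τ, by rwa [abs_neg], h1c, h2c, h1D, h2D, ?_⟩
  rcases eq_or_ne ((s - σ₁) + (2 - s - σ₂)) 0 with h0 | h0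
  · have : s = σ₁ := by linarith
    exact ⟨1, 0, zero_le_one, le_rfl, by norm_num, by rw [this]; module⟩
  · have hpos : 0 < (s - σ₁) + (2 - s - σ₂) := lt_of_le_of_ne (by linarith) (Ne.symm h0)
    refine ⟨(2 - s - σ₂) / ((s - σ₁) + (2 - s - σ₂)), (s - σ₁) / ((s - σ₁) + (2 - s - σ₂)),
      div_nonneg (by linarith) hpos.le, div_nonneg (by linarith) hpos.le,
      by field_simp; ring, ?_⟩
    match_scalars <;> field_simp <;> ring

/-- A point outside `D` lies outside any ball in `D` touching at `p`. -/
theorem inner_le_of_not_mem {D : Set E} {p n x : E} {R : ℝ} (hR : 0 < R) (hn : ‖n‖ = 1)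
    (hball : Metric.ball (p + R • n) R ⊆ D) (hx : p + x ∉ D) :
    inner ℝ n x ≤ ‖x‖ ^ 2 / (2 * R) := by
  have h1 : R ≤ ‖x - R • n‖ := by
    by_contra hcon
    push Not at hcon
    refine hx (hball ?_)
    rwa [mem_ball_iff_norm, add_sub_add_left_eq_sub]
  have h2 : R ^ 2 ≤ ‖x - R • n‖ ^ 2 := by gcongr
  rw [norm_sub_sq_real, norm_smul, inner_smul_right, real_inner_comm, hn, Real.norm_eq_abs,
    abs_of_pos hR] at h2
  rw [le_div_iff₀ (by positivity)]
  nlinarith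

end Chords

/-! ### Values at the ends of a displaced chord -/

section ContactPairs

set_option maxSynthPendingDepth 3

variable {E : Type*} [NormedAddCommGroup E] [InnerProductSpace ℝ E]

theorem RegularOn.isBounded {K : ℝ} {D : Set E} {V : E → ℝ} {g : E → E →L[ℝ] ℝ}
    (h : RegularOn K D V g) : Bornology.IsBounded D :=
  Metric.isBounded_ball.subset h.subset_ball

/-- The value at the end of a parallel chord, under bounds for the second derivatives adapted to the
direction `d` of the chord. -/
theorem RegularOn.le_at_chord_end {K K₁ κ R σ : ℝ} {D : Set E} {V : E → ℝ} {g : E → E →L[ℝ] ℝ}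
    (h : RegularOn K D V g) (hV : ∀ x ∈ closure D, 0 ≤ V x) (hK₁ : 0 ≤ K₁) {y d v : E} (hκ : 0 < κ)
    (hR : 0 < R) (hy : y ∈ closure D) (hVy : V y = 0) (hne : D.Nonempty)
    (hd : ‖d‖ ^ 2 ≤ K₁ * κ) (hκK : κ ≤ K₁) (hgy : ‖g y‖ ≤ K₁ * κ)
    (hnormal : y ∈ D ∨ ∃ n : E, ‖n‖ = 1 ∧ Metric.ball (y + R • n) R ⊆ D)
    (hv : ‖v‖ < κ) (hσ : |σ| ≤ ‖v‖ / κ)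
    (hhess : ∀ α ∈ Icc (-1 : ℝ) 1, ∀ b : E, ‖b‖ ≤ 2 * κ → y + α • d + b ∈ D →
      |hess V (y + α • d + b) d d| ≤ K₁ * κ ^ 2 ∧ ‖hess V (y + α • d + b) d‖ ≤ K₁ * κ)
    (hend : y + (v + σ • d) ∈ closure D) (hout : y ∈ D ∨ y + (v + σ • d) ∉ D) :
    V (y + (v + σ • d)) ≤ (K₁ * (2 * K₁ + 2 * K₁) / (2 * R) + (K + 3 * K₁)) * ‖v‖ ^ 2 := by
  obtain ⟨c, hc⟩ := hne
  have hK := h.nonneg hc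
  set x := v + σ • d with hx
  have hσ1 : |σ| ≤ 1 := hσ.trans ((div_le_one hκ).2 hv.le)
  have hσκ : |σ| * κ ≤ ‖v‖ := by rwa [le_div_iff₀ hκ] at hσ
  -- second order terms
  have hS : V (y + x) ≤ V y + g y (y + x - y) + (K + 3 * K₁) * ‖v‖ ^ 2 := by
    refine h.le_of_hess_le hy hend hκ (by positivity) ⟨c, hc⟩ fun t ht r hr hrt => ?_
    rw [add_sub_cancel_left] at hrt ⊢
    have hrep : r = y + (t * σ) • d + (t • v + (r - (y + t • x))) := by rw [hx]; module
    have hα : t * σ ∈ Icc (-1 : ℝ) 1 := by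
      rw [mem_Icc, ← _root_.abs_le, abs_mul, abs_of_nonneg ht.1]
      calc t * |σ| ≤ 1 * 1 := by gcongr; exact ht.2
        _ = 1 := one_mul 1
    have hb : ‖t • v + (r - (y + t • x))‖ ≤ 2 * κ := by
      refine (norm_add_le _ _).trans ?_
      rw [norm_smul, Real.norm_eq_abs, abs_of_nonneg ht.1]
      have : t * ‖v‖ ≤ 1 * ‖v‖ := by gcongr; exact ht.2
      linarith
    have h12 := hhess _ hα _ hb (by rwa [← hrep])
    rw [← hrep] at h12
    obtain ⟨h1, h2⟩ := h12
    have hsymm : hess V r v d = hess V r d v :=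
      (h.contDiffAt hr).isSymmSndFDerivAt (by simp; norm_num) v d
    have e : hess V r x x = hess V r v v + 2 * σ * hess V r d v + σ ^ 2 * hess V r d d := by
      simp only [hx, map_add, map_smul, add_apply, smul_apply, smul_eq_mul, hsymm]
      ring
    have t1 : hess V r v v ≤ K * ‖v‖ ^ 2 :=
      (le_abs_self _).trans ((h.hess_apply_le hr v v).trans (le_of_eq (by ring)))
    have t2 : 2 * σ * hess V r d v ≤ 2 * K₁ * ‖v‖ ^ 2 := by
      have h3 : |hess V r d v| ≤ K₁ * κ * ‖v‖ := by
        rw [← Real.norm_eq_abs]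
        exact ContinuousLinearMap.le_of_opNorm_le _ h2 v
      calc 2 * σ * hess V r d v ≤ |2 * σ * hess V r d v| := le_abs_self _
        _ = 2 * |σ| * |hess V r d v| := by rw [abs_mul, abs_mul, abs_two]
        _ ≤ 2 * |σ| * (K₁ * κ * ‖v‖) := by gcongr
        _ = 2 * K₁ * ‖v‖ * (|σ| * κ) := by ring
        _ ≤ 2 * K₁ * ‖v‖ * ‖v‖ := by gcongr
        _ = 2 * K₁ * ‖v‖ ^ 2 := by ring
    have t3 : σ ^ 2 * hess V r d d ≤ K₁ * ‖v‖ ^ 2 := by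
      calc σ ^ 2 * hess V r d d ≤ σ ^ 2 * (K₁ * κ ^ 2) := by
            gcongr; exact (le_abs_self _).trans h1
        _ = K₁ * (|σ| * κ) ^ 2 := by rw [mul_pow, sq_abs]; ring
        _ ≤ K₁ * ‖v‖ ^ 2 := by gcongr
    rw [e]; linarith
  rw [hVy, add_sub_cancel_left, zero_add] at hS
  -- first order term
  have hg : g y x ≤ K₁ * (2 * K₁ + 2 * K₁) / (2 * R) * ‖v‖ ^ 2 := by
    by_cases hyD : y ∈ D
    · rw [h.grad_eq y hyD, h.grad_eq_zero hV hyD hVy]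
      simp only [zero_apply]
      positivity
    · obtain ⟨n, hn, hball⟩ := hnormal.resolve_left hyD
      obtain ⟨a, ha0, ha, hgx⟩ := h.grad_boundary hV hy hVy hR hn hball
      have h1 := inner_le_of_not_mem hR hn hball (hout.resolve_left hyD)
      rw [hgx]
      have hxx : κ * ‖x‖ ^ 2 ≤ (2 * K₁ + 2 * K₁) * ‖v‖ ^ 2 := by
        have h2 : ‖x‖ ≤ ‖v‖ + |σ| * ‖d‖ := by
          refine (norm_add_le _ _).trans ?_
          rw [norm_smul, Real.norm_eq_abs]
        have h3 : ‖x‖ ^ 2 ≤ 2 * ‖v‖ ^ 2 + 2 * (|σ| ^ 2 * ‖d‖ ^ 2) := by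
          calc ‖x‖ ^ 2 ≤ (‖v‖ + |σ| * ‖d‖) ^ 2 := by gcongr
            _ ≤ _ := by nlinarith [sq_nonneg (‖v‖ - |σ| * ‖d‖)]
        calc κ * ‖x‖ ^ 2 ≤ κ * (2 * ‖v‖ ^ 2 + 2 * (|σ| ^ 2 * ‖d‖ ^ 2)) := by gcongr
          _ ≤ κ * (2 * ‖v‖ ^ 2 + 2 * (|σ| ^ 2 * (K₁ * κ))) := by gcongr
          _ = κ * (2 * ‖v‖ ^ 2) + 2 * K₁ * (|σ| * κ) ^ 2 := by ring
          _ ≤ K₁ * (2 * ‖v‖ ^ 2) + 2 * K₁ * ‖v‖ ^ 2 := by gcongr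
          _ = _ := by ring
      calc a * inner ℝ n x ≤ a * (‖x‖ ^ 2 / (2 * R)) := by gcongr
        _ ≤ (K₁ * κ) * (‖x‖ ^ 2 / (2 * R)) := by gcongr; exact ha.trans hgy
        _ = K₁ * (κ * ‖x‖ ^ 2) / (2 * R) := by ring
        _ ≤ K₁ * ((2 * K₁ + 2 * K₁) * ‖v‖ ^ 2) / (2 * R) := by gcongr
        _ = _ := by ring
  linarith

/-- The chord bound near the given chord, under bounds for the second derivatives adapted to its
direction. -/
theorem RegularOn.chordBound_of_hess {K K₁ κ R : ℝ} {D : Set E} {V : E → ℝ} {g : E → E →L[ℝ] ℝ}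
    (h : RegularOn K D V g) (hV : ∀ x ∈ closure D, 0 ≤ V x) (hK₁ : 0 ≤ K₁) {y₁ d : E}
    (hR : 0 < R) (hy₁ : y₁ ∈ closure D) (hy₂ : y₁ + (2 : ℝ) • d ∈ closure D) (hd0 : d ≠ 0)
    (hV₁ : V y₁ = 0) (hV₂ : V (y₁ + (2 : ℝ) • d) = 0)
    (hball : Metric.ball (y₁ + d) κ ⊆ D)
    (hd : ‖d‖ ^ 2 ≤ K₁ * κ) (hκK : κ ≤ K₁)
    (hg₁ : ‖g y₁‖ ≤ K₁ * κ) (hg₂ : ‖g (y₁ + (2 : ℝ) • d)‖ ≤ K₁ * κ)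
    (hn₁ : y₁ ∈ D ∨ ∃ n : E, ‖n‖ = 1 ∧ Metric.ball (y₁ + R • n) R ⊆ D)
    (hn₂ : (y₁ + (2 : ℝ) • d) ∈ D ∨
      ∃ n : E, ‖n‖ = 1 ∧ Metric.ball ((y₁ + (2 : ℝ) • d) + R • n) R ⊆ D)
    (hhess : ∀ α ∈ Icc (-1 : ℝ) 3, ∀ b : E, ‖b‖ ≤ 2 * κ → y₁ + α • d + b ∈ D →
      |hess V (y₁ + α • d + b) d d| ≤ K₁ * κ ^ 2 ∧ ‖hess V (y₁ + α • d + b) d‖ ≤ K₁ * κ)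
    {s : ℝ} (hs : s ∈ Icc (0 : ℝ) 2) {v : E} (hv : ‖v‖ < κ) (hz : y₁ + s • d + v ∈ D) :
    ChordBound D V (y₁ + s • d + v)
      ((K₁ * (2 * K₁ + 2 * K₁) / (2 * R) + (K + 3 * K₁)) * ‖v‖ ^ 2) := by
  have hκ : 0 < κ := (norm_nonneg v).trans_lt hv
  have hne : D.Nonempty := ⟨_, hz⟩
  obtain ⟨σ₁, σ₂, hσ₁, hσ₂, hc₁, hc₂, ho₁, ho₂, a, b, ha, hb, hab, hzz⟩ :=
    exists_parallel_chord h.isOpen h.convex h.isBounded hy₁ hy₂ hd0 hball hv hs hz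
  refine chordBound_of_le_of_le hc₁ hc₂ ha hb hab hzz ?_ ?_
  · exact h.le_at_chord_end hV hK₁ hκ hR hy₁ hV₁ hne hd hκK hg₁ hn₁ hv hσ₁
      (fun α hα b hb hm => hhess α ⟨hα.1, by linarith [hα.2]⟩ b hb hm) hc₁ ho₁
  · refine h.le_at_chord_end hV hK₁ hκ hR hy₂ hV₂ hne hd hκK hg₂ hn₂ hv hσ₂
      (fun α hα b hb hm => ?_) hc₂ ho₂
    have e : y₁ + (2 : ℝ) • d + α • d + b = y₁ + (2 + α) • d + b := by module
    rw [e] at hm ⊢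
    exact hhess (2 + α) ⟨by linarith [hα.1], by linarith [hα.2]⟩ b hb hm

theorem le_add_sqrt_of_sq_le {X b c : ℝ} (hb : 0 ≤ b) (hc : 0 ≤ c)
    (h : X ^ 2 ≤ b * X + c ^ 2) : X ≤ b + c := by
  by_contra hcon
  push Not at hcon
  nlinarith

end ContactPairs

/-! ### A contact point in the interior -/

section InteriorContact

set_option maxSynthPendingDepth 3

variable {E : Type*} [NormedAddCommGroup E] [InnerProductSpace ℝ E]
  {K κ : ℝ} {D : Set E} {V : E → ℝ} {g : E → E →L[ℝ] ℝ}

theorem RegularOn.third_apply_le (h : RegularOn K D V g) {p : E} (hp : p ∈ D) (x y z : E) :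
    |thirdDeriv V p x y z| ≤ K * ‖x‖ * ‖y‖ * ‖z‖ := by
  calc |thirdDeriv V p x y z| ≤ ‖thirdDeriv V p x‖ * ‖y‖ * ‖z‖ := by
        rw [← Real.norm_eq_abs]; exact ContinuousLinearMap.le_opNorm₂ _ _ _
    _ ≤ K * ‖x‖ * ‖y‖ * ‖z‖ := by
        gcongr
        exact ContinuousLinearMap.le_of_opNorm_le _ (h.norm_third_le hp) _

/-- Second and third derivatives of a nonnegative function at an interior zero `p`, in the direction
of another zero `q`, which may lie on the boundary. -/
theorem RegularOn.interior_contact_derivs (h : RegularOn K D V g)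
    (hV : ∀ x ∈ closure D, 0 ≤ V x) (hK : 1 ≤ K) (hκ : 0 < κ) {p x : E}
    (hp : p ∈ D) (hq : p + x ∈ closure D) (hVp : V p = 0) (hVq : V (p + x) = 0)
    (hx : ‖x‖ ^ 2 ≤ K * κ) (hgq : -(K * κ * ‖g (p + x)‖) ≤ g (p + x) x) :
    hess V p x x ≤ 36 * K ^ 3 * κ ^ 2 ∧ ‖hess V p x‖ ≤ 6 * K ^ 2 * κ ∧
      ‖g (p + x)‖ ≤ 7 * K ^ 2 * κ ∧ |thirdDeriv V p x x x| ≤ 114 * K ^ 3 * κ ^ 2 := by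
  have hK0 : 0 < K := by linarith
  have hgp := h.grad_eq_zero hV hp hVp
  obtain ⟨e1, e2⟩ := h.taylor_third hp hq
  have e3 := h.grad_taylor hp hq
  simp only [add_sub_cancel_left, hVp, hVq, hgp, zero_apply, sub_zero] at e1 e2 e3
  set A := hess V p x x with hA
  set B := thirdDeriv V p x x x with hB
  have hA0 : 0 ≤ A := h.hess_nonneg hV hp hVp x
  have hx4 : K * ‖x‖ ^ 4 ≤ K ^ 3 * κ ^ 2 := by
    calc K * ‖x‖ ^ 4 = K * (‖x‖ ^ 2) ^ 2 := by ring
      _ ≤ K * (K * κ) ^ 2 := by gcongr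
      _ = _ := by ring
  obtain ⟨e1l, e1r⟩ := _root_.abs_le.1 e1
  obtain ⟨e2l, e2r⟩ := _root_.abs_le.1 e2
  set X := Real.sqrt (A * K) with hX
  have hX0 : 0 ≤ X := Real.sqrt_nonneg _
  have hXsq : X ^ 2 = A * K := Real.sq_sqrt (by positivity)
  -- Cauchy–Schwarz for the Hessian at p: the covector has norm at most √(AK).
  have hHx : ‖hess V p x‖ ≤ X := by
    refine ContinuousLinearMap.opNorm_le_bound _ hX0 fun y => ?_
    rw [Real.norm_eq_abs]
    refine abs_le_of_sq_le_sq ?_ (by positivity)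
    calc (hess V p x y) ^ 2 ≤ A * hess V p y y := h.hess_cauchySchwarz hV hp hVp x y
      _ ≤ A * (K * ‖y‖ * ‖y‖) := by
        gcongr
        exact (le_abs_self _).trans (h.hess_apply_le hp y y)
      _ = (X * ‖y‖) ^ 2 := by rw [mul_pow, hXsq]; ring
  have hgq' : ‖g (p + x)‖ ≤ X + K ^ 2 * κ := by
    calc ‖g (p + x)‖ = ‖hess V p x + (g (p + x) - hess V p x)‖ := by congr 1; abel
      _ ≤ ‖hess V p x‖ + ‖g (p + x) - hess V p x‖ := norm_add_le _ _
      _ ≤ X + K * ‖x‖ ^ 2 := add_le_add hHx e3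
      _ ≤ X + K * (K * κ) := by gcongr
      _ = _ := by ring
  -- Eliminating the third derivative B between 0 = A/2 + B/6 + O(κ²) and g(q)(x) = A + B/2 + O(κ²)
  -- leaves A/2 = −g(q)(x) + O(κ²). The lower bound for g(q)(x) and the bound of ‖g(q)‖ by X + K²κ
  -- then give a quadratic inequality for X = √(AK), whence X = O(κ).
  have hA2 : A / 2 ≤ 4 * (K ^ 3 * κ ^ 2) + K * κ * (X + K ^ 2 * κ) := by
    have : K * κ * ‖g (p + x)‖ ≤ K * κ * (X + K ^ 2 * κ) := by gcongr
    linarith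
  have hXle : X ≤ 6 * K ^ 2 * κ := by
    have := le_add_sqrt_of_sq_le (X := X) (b := 2 * K ^ 2 * κ) (c := 4 * K ^ 2 * κ) (by positivity)
      (by positivity) (by
        rw [hXsq]
        have h1 : A / 2 * (2 * K) ≤
            (4 * (K ^ 3 * κ ^ 2) + K * κ * (X + K ^ 2 * κ)) * (2 * K) := by gcongr
        have h2 : 0 ≤ K ^ 4 * κ ^ 2 := by positivity
        nlinarith)
    linarith
  have hAle : A ≤ 36 * K ^ 3 * κ ^ 2 := by
    have h1 : A * K ≤ (36 * K ^ 3 * κ ^ 2) * K := by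
      rw [← hXsq]
      calc X ^ 2 ≤ (6 * K ^ 2 * κ) ^ 2 := by gcongr
        _ = _ := by ring
    exact le_of_mul_le_mul_right h1 hK0
  refine ⟨hAle, hHx.trans hXle, hgq'.trans (by linarith), ?_⟩
  rw [_root_.abs_le]
  constructor <;> nlinarith

/-- The Hessian is expanded about the interior zero p. The displacement along the chord meets the
small third derivative D³V(x, x, x) = O(κ²); the transverse part is O(κ) and meets ‖x‖² = O(κ); the
remainder is O(‖x‖⁴ + κ²‖x‖²). The range −1 ≤ α ≤ 3 covers the chord, which is 0 ≤ α ≤ 2, enlarged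
by one unit at each end, the most by which an end can slide. -/
theorem RegularOn.interior_contact_hess (h : RegularOn K D V g)
    (hV : ∀ x ∈ closure D, 0 ≤ V x) (hK : 1 ≤ K) (hκ : 0 < κ) {p d : E}
    (hp : p ∈ D) (hq : p + (2 : ℝ) • d ∈ closure D) (hVp : V p = 0) (hVq : V (p + (2 : ℝ) • d) = 0)
    (hx : ‖(2 : ℝ) • d‖ ^ 2 ≤ K * κ)
    (hgq : -(K * κ * ‖g (p + (2 : ℝ) • d)‖) ≤ g (p + (2 : ℝ) • d) ((2 : ℝ) • d))
    {α : ℝ} (hα : α ∈ Icc (-1 : ℝ) 3) {b : E} (hb : ‖b‖ ≤ 2 * κ) (hr : p + α • d + b ∈ D) :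
    |hess V (p + α • d + b) d d| ≤ 62 * K ^ 3 * κ ^ 2 ∧
      ‖hess V (p + α • d + b) d‖ ≤ 62 * K ^ 3 * κ := by
  have hK0 : 0 < K := by linarith
  obtain ⟨h1, h2, -, h3⟩ := h.interior_contact_derivs hV hK hκ hp hq hVp hVq hx hgq
  have hA0 : 0 ≤ hess V p ((2 : ℝ) • d) ((2 : ℝ) • d) := h.hess_nonneg hV hp hVp _
  have hx2 : ‖(2 : ℝ) • d‖ ≤ 2 * K := by
    have := h.norm_sub_le hq (subset_closure hp)
    rwa [add_sub_cancel_left] at this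
  set r := p + α • d + b with hr'
  set x := (2 : ℝ) • d with hxd
  have hrp : r - p = (α / 2) • x + b := by rw [hr', hxd]; module
  have hα2 : |α / 2| ≤ 3 / 2 := _root_.abs_le.2 ⟨by linarith [hα.1], by linarith [hα.2]⟩
  have hrn : ‖r - p‖ ≤ 3 / 2 * ‖x‖ + 2 * κ := by
    rw [hrp]
    refine (norm_add_le _ _).trans ?_
    rw [norm_smul, Real.norm_eq_abs]
    gcongr
  have hK23 : K ^ 2 ≤ K ^ 3 := pow_le_pow_right₀ hK (by norm_num)
  have hxx : |hess V r x x| ≤ 248 * K ^ 3 * κ ^ 2 := by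
    have e : hess V r x x = hess V p x x + thirdDeriv V p (r - p) x x +
        (hess V r - hess V p - thirdDeriv V p (r - p)) x x := by
      simp only [sub_apply]; ring
    have b1 : |thirdDeriv V p (r - p) x x| ≤ 173 * K ^ 3 * κ ^ 2 := by
      have : thirdDeriv V p (r - p) x x = α / 2 * thirdDeriv V p x x x + thirdDeriv V p b x x := by
        rw [hrp]; simp
      rw [this]
      calc |α / 2 * thirdDeriv V p x x x + thirdDeriv V p b x x|
          ≤ |α / 2 * thirdDeriv V p x x x| + |thirdDeriv V p b x x| := abs_add_le _ _
        _ ≤ 3 / 2 * (114 * K ^ 3 * κ ^ 2) + K * ‖b‖ * ‖x‖ * ‖x‖ := by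
            rw [abs_mul]
            gcongr
            exact h.third_apply_le hp _ _ _
        _ = 3 / 2 * (114 * K ^ 3 * κ ^ 2) + K * ‖b‖ * ‖x‖ ^ 2 := by ring
        _ ≤ 3 / 2 * (114 * K ^ 3 * κ ^ 2) + K * (2 * κ) * (K * κ) := by gcongr
        _ ≤ _ := by nlinarith [sq_nonneg κ]
    have b2 : |(hess V r - hess V p - thirdDeriv V p (r - p)) x x| ≤ 37 * K ^ 3 * κ ^ 2 := by
      calc _ ≤ ‖hess V r - hess V p - thirdDeriv V p (r - p)‖ * ‖x‖ * ‖x‖ :=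
            ContinuousLinearMap.le_opNorm₂ _ _ _
        _ ≤ (K * ‖r - p‖ ^ 2) * ‖x‖ * ‖x‖ := by gcongr; exact h.hess_taylor hp hr
        _ ≤ (K * (3 / 2 * ‖x‖ + 2 * κ) ^ 2) * ‖x‖ * ‖x‖ := by gcongr
        _ ≤ (K * (9 / 2 * ‖x‖ ^ 2 + 8 * κ ^ 2)) * ‖x‖ * ‖x‖ := by
            gcongr; nlinarith [sq_nonneg (3 / 2 * ‖x‖ - 2 * κ)]
        _ = K * (9 / 2 * (‖x‖ ^ 2) ^ 2 + 8 * κ ^ 2 * ‖x‖ ^ 2) := by ring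
        _ ≤ K * (9 / 2 * (K * κ) ^ 2 + 8 * κ ^ 2 * (2 * K) ^ 2) := by gcongr
        _ = (9 / 2 + 32) * K ^ 3 * κ ^ 2 := by ring
        _ ≤ 37 * K ^ 3 * κ ^ 2 := by gcongr; norm_num
    rw [e]
    calc _ ≤ |hess V p x x| + |thirdDeriv V p (r - p) x x| +
          |(hess V r - hess V p - thirdDeriv V p (r - p)) x x| := abs_add_three _ _ _
      _ ≤ 36 * K ^ 3 * κ ^ 2 + 173 * K ^ 3 * κ ^ 2 + 37 * K ^ 3 * κ ^ 2 := by
          rw [abs_of_nonneg hA0]; gcongr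
      _ ≤ 248 * K ^ 3 * κ ^ 2 := by
          have : 0 ≤ K ^ 3 * κ ^ 2 := by positivity
          linarith
  have hxn : ‖hess V r x‖ ≤ 12 * K ^ 3 * κ := by
    calc ‖hess V r x‖ = ‖hess V p x + (hess V r - hess V p) x‖ := by
          congr 1; simp only [sub_apply]; abel
      _ ≤ ‖hess V p x‖ + ‖(hess V r - hess V p) x‖ := norm_add_le _ _
      _ ≤ 6 * K ^ 2 * κ + (K * ‖r - p‖) * ‖x‖ := by
          gcongr
          exact ContinuousLinearMap.le_of_opNorm_le _ (h.norm_hess_sub_le hp hr) _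
      _ ≤ 6 * K ^ 2 * κ + (K * (3 / 2 * ‖x‖ + 2 * κ)) * ‖x‖ := by gcongr
      _ = 6 * K ^ 2 * κ + K * (3 / 2 * ‖x‖ ^ 2) + K * (2 * κ) * ‖x‖ := by ring
      _ ≤ 6 * K ^ 2 * κ + K * (3 / 2 * (K * κ)) + K * (2 * κ) * (2 * K) := by gcongr
      _ ≤ 12 * K ^ 3 * κ := by nlinarith
  have hdx : d = (1 / 2 : ℝ) • x := by rw [hxd, smul_smul]; norm_num
  have hκ3 : 0 ≤ K ^ 3 * κ := by positivity
  constructor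
  · have : hess V r d d = 1 / 4 * hess V r x x := by
      rw [hdx]; simp only [map_smul, smul_apply, smul_eq_mul]; ring
    rw [this, abs_mul, abs_of_pos (by norm_num : (0 : ℝ) < 1 / 4)]
    linarith
  · rw [hdx, map_smul, norm_smul, Real.norm_eq_abs, abs_of_pos (by norm_num : (0 : ℝ) < 1 / 2)]
    linarith

/-- The chord bound when one of the two contact points is interior. -/
theorem RegularOn.chordBound_of_interior_contact (h : RegularOn K D V g)
    (hV : ∀ x ∈ closure D, 0 ≤ V x) (hK : 1 ≤ K) (hκ : 0 < κ) (hκK : κ ≤ K) {p d : E} (hd0 : d ≠ 0)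
    (hp : p ∈ D) (hq : p + (2 : ℝ) • d ∈ closure D) (hVp : V p = 0) (hVq : V (p + (2 : ℝ) • d) = 0)
    (hball : Metric.ball (p + d) κ ⊆ D)
    (hx : ‖(2 : ℝ) • d‖ ^ 2 ≤ K * κ)
    (hn : (p + (2 : ℝ) • d) ∈ D ∨
      ∃ n : E, ‖n‖ = 1 ∧ Metric.ball ((p + (2 : ℝ) • d) + K⁻¹ • n) K⁻¹ ⊆ D ∧
        inner ℝ n (-((2 : ℝ) • d)) ≤ K * κ)
    {s : ℝ} (hs : s ∈ Icc (0 : ℝ) 2) {v : E} (hz : p + s • d + v ∈ D) :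
    ChordBound D V (p + s • d + v) (10 ^ 5 * K ^ 7 * ‖v‖ ^ 2) := by
  have hK0 : 0 < K := by linarith
  have hKpow : ∀ n ≤ 7, K ^ n ≤ K ^ 7 := fun n hn => pow_le_pow_right₀ hK hn
  -- At a boundary contact the gradient is a multiple of the inner normal, so the condition that the
  -- chord makes only an O(κ) normal advance bounds the directional derivative.
  have hgq : -(K * κ * ‖g (p + (2 : ℝ) • d)‖) ≤ g (p + (2 : ℝ) • d) ((2 : ℝ) • d) := by
    rcases hn with hn | ⟨n, hn1, hnb, hni⟩
    · rw [h.grad_eq _ hn, h.grad_eq_zero hV hn hVq]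
      simp
    · obtain ⟨a, ha0, ha, hgx⟩ := h.grad_boundary hV hq hVq (inv_pos.2 hK0) hn1 hnb
      rw [hgx]
      rw [inner_neg_right] at hni
      have : a * (-inner ℝ n ((2 : ℝ) • d)) ≤ a * (K * κ) := by gcongr
      have : a * (K * κ) ≤ ‖g (p + (2 : ℝ) • d)‖ * (K * κ) := by gcongr
      linarith
  obtain ⟨h1, h2, h2', h3⟩ := h.interior_contact_derivs hV hK hκ hp hq hVp hVq hx hgq
  have hgp := h.grad_eq_zero hV hp hVp
  have hK37 := hKpow 3 (by norm_num)
  have hK17 : K ≤ K ^ 7 := by simpa using hKpow 1 (by norm_num)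
  have hK23 : K ^ 2 ≤ K ^ 3 := pow_le_pow_right₀ hK (by norm_num)
  have hK13 : K ≤ K ^ 3 := by simpa using pow_le_pow_right₀ hK (by norm_num : 1 ≤ 3)
  have hK1 : 1 ≤ K ^ 3 := one_le_pow₀ hK
  rcases lt_or_ge ‖v‖ κ with hv | hv
  · have hnd : ‖(2 : ℝ) • d‖ ^ 2 = 4 * ‖d‖ ^ 2 := by
      rw [norm_smul, mul_pow]; norm_num
    have := h.chordBound_of_hess hV (K₁ := 62 * K ^ 3) (R := K⁻¹) (κ := κ) (by positivity)
      (by positivity) (subset_closure hp) hq hd0 hVp hVq hball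
      (by
        have : K * κ ≤ 62 * K ^ 3 * κ := by gcongr; linarith
        nlinarith [sq_nonneg ‖d‖])
      (by linarith) (by rw [h.grad_eq p hp, hgp, norm_zero]; positivity)
      (h2'.trans (by gcongr; linarith)) (Or.inl hp)
      (hn.imp id fun ⟨n, hn1, hnb, _⟩ => ⟨n, hn1, hnb⟩)
      (fun α hα b hb hr => h.interior_contact_hess hV hK hκ hp hq hVp hVq hx hgq hα hb hr)
      hs hv hz
    refine this.mono ?_
    gcongr
    have : 62 * K ^ 3 * (2 * (62 * K ^ 3) + 2 * (62 * K ^ 3)) / (2 * K⁻¹) = 7688 * K ^ 7 := by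
      field_simp; ring
    rw [this]
    linarith
  -- For ‖v‖ ≥ κ no chord is needed: V(z) itself is O(‖v‖²), by the Taylor expansion at p, since κ ≤
  -- ‖v‖.
  · refine chordBound_of_le (subset_closure hz) ?_
    have hzp : p + s • d + v - p = (s / 2) • ((2 : ℝ) • d) + v := by module
    have hT := (h.taylor_third_of_mem hp hz).1
    have hT2 := h.le_taylor (subset_closure hp) (subset_closure hz) ⟨p, hp⟩
    rw [hzp] at hT hT2
    rw [h.grad_eq p hp] at hT2
    simp only [hVp, hgp, zero_apply, sub_zero, add_zero, zero_add] at hT hT2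
    set x := (2 : ℝ) • d with hxd
    set α := s / 2 with hα
    have hα0 : 0 ≤ α := by have := hs.1; positivity
    have hα1 : α ≤ 1 := by have := hs.2; rw [hα]; linarith
    have hXn : ‖α • x + v‖ ≤ ‖x‖ + ‖v‖ := by
      refine (norm_add_le _ _).trans ?_
      rw [norm_smul, Real.norm_eq_abs, abs_of_nonneg hα0]
      have := mul_le_mul_of_nonneg_right hα1 (norm_nonneg x)
      linarith
    rcases le_total ‖x‖ ‖v‖ with hxv | hxv
    · calc V (p + s • d + v) ≤ K * ‖α • x + v‖ ^ 2 := hT2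
        _ ≤ K * (‖v‖ + ‖v‖) ^ 2 := by gcongr; linarith
        _ = 4 * K * ‖v‖ ^ 2 := by ring
        _ ≤ 10 ^ 5 * K ^ 7 * ‖v‖ ^ 2 := by gcongr; norm_num
    · have hκv : κ ^ 2 ≤ ‖v‖ ^ 2 := by gcongr
      -- The mixed cubic terms become quadratic in ‖v‖ because ‖x‖² ≤ Kκ ≤ K‖v‖; here ‖v‖ ≤ ‖x‖.
      have hxv1 : ‖x‖ ^ 2 * ‖v‖ ≤ K * ‖v‖ ^ 2 := by
        calc ‖x‖ ^ 2 * ‖v‖ ≤ K * κ * ‖v‖ := by gcongr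
          _ ≤ K * ‖v‖ * ‖v‖ := by gcongr
          _ = _ := by ring
      have hxv2 : ‖x‖ * ‖v‖ ^ 2 ≤ K * ‖v‖ ^ 2 := by
        refine le_trans ?_ hxv1
        rw [pow_two, pow_two]
        nlinarith [norm_nonneg x, norm_nonneg v, mul_nonneg (norm_nonneg x) (norm_nonneg v)]
      have hxv3 : ‖v‖ ^ 3 ≤ K * ‖v‖ ^ 2 := by
        refine le_trans ?_ hxv2
        calc ‖v‖ ^ 3 = ‖v‖ * ‖v‖ ^ 2 := by ring
          _ ≤ ‖x‖ * ‖v‖ ^ 2 := by gcongr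
      have hHXX : hess V p (α • x + v) (α • x + v) ≤ 49 * K ^ 3 * ‖v‖ ^ 2 := by
        have hsymm : hess V p v x = hess V p x v :=
          (h.contDiffAt hp).isSymmSndFDerivAt (by simp; norm_num) v x
        have e : hess V p (α • x + v) (α • x + v) =
            α ^ 2 * hess V p x x + 2 * α * hess V p x v + hess V p v v := by
          simp only [map_add, map_smul, add_apply, smul_apply, smul_eq_mul, hsymm]
          ring
        have t1 : α ^ 2 * hess V p x x ≤ 36 * K ^ 3 * ‖v‖ ^ 2 := by
          calc α ^ 2 * hess V p x x ≤ 1 ^ 2 * (36 * K ^ 3 * κ ^ 2) := by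
                have := h.hess_nonneg hV hp hVp x
                gcongr
            _ ≤ 36 * K ^ 3 * ‖v‖ ^ 2 := by rw [one_pow, one_mul]; gcongr
        have t2 : 2 * α * hess V p x v ≤ 12 * K ^ 3 * ‖v‖ ^ 2 := by
          have h4 : |hess V p x v| ≤ 6 * K ^ 2 * κ * ‖v‖ := by
            rw [← Real.norm_eq_abs]
            exact ContinuousLinearMap.le_of_opNorm_le _ h2 v
          calc 2 * α * hess V p x v ≤ 2 * α * |hess V p x v| := by gcongr; exact le_abs_self _
            _ ≤ 2 * 1 * (6 * K ^ 2 * κ * ‖v‖) := by gcongr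
            _ ≤ 2 * 1 * (6 * K ^ 3 * ‖v‖ * ‖v‖) := by gcongr
            _ = _ := by ring
        have t3 : hess V p v v ≤ K ^ 3 * ‖v‖ ^ 2 := by
          calc hess V p v v ≤ K * ‖v‖ * ‖v‖ := (le_abs_self _).trans (h.hess_apply_le hp v v)
            _ = K * ‖v‖ ^ 2 := by ring
            _ ≤ _ := by gcongr
        rw [e]; linarith
      have hTXX : thirdDeriv V p (α • x + v) (α • x + v) (α • x + v) ≤ 121 * K ^ 3 * ‖v‖ ^ 2 := by
        set u := α • x with hu
        have hun : ‖u‖ ≤ ‖x‖ := by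
          rw [hu, norm_smul, Real.norm_eq_abs, abs_of_nonneg hα0]
          exact mul_le_of_le_one_left (norm_nonneg x) hα1
        set T := thirdDeriv V p with hTdef
        have e : T (u + v) (u + v) (u + v) = T u u u + (T u u v + T u v u + T v u u) +
            (T u v v + T v u v + T v v u) + T v v v := by
          simp only [map_add, add_apply]
          ring
        have b : ∀ x y z, T x y z ≤ K * ‖x‖ * ‖y‖ * ‖z‖ := fun x y z =>
          (le_abs_self _).trans (h.third_apply_le hp x y z)
        have t0 : T u u u ≤ 114 * K ^ 3 * ‖v‖ ^ 2 := by
          have : T u u u = α ^ 3 * T x x x := by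
            rw [hu]; simp only [map_smul, smul_apply, smul_eq_mul]; ring
          rw [this]
          calc α ^ 3 * T x x x ≤ α ^ 3 * |T x x x| := by gcongr; exact le_abs_self _
            _ ≤ 1 ^ 3 * (114 * K ^ 3 * κ ^ 2) := by gcongr
            _ ≤ _ := by rw [one_pow, one_mul]; gcongr
        have m1 : K * (‖u‖ ^ 2 * ‖v‖) ≤ K ^ 3 * ‖v‖ ^ 2 := by
          calc K * (‖u‖ ^ 2 * ‖v‖) ≤ K * (‖x‖ ^ 2 * ‖v‖) := by gcongr
            _ ≤ K * (K * ‖v‖ ^ 2) := by gcongr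
            _ = K ^ 2 * ‖v‖ ^ 2 := by ring
            _ ≤ _ := by gcongr
        have m2 : K * (‖u‖ * ‖v‖ ^ 2) ≤ K ^ 3 * ‖v‖ ^ 2 := by
          calc K * (‖u‖ * ‖v‖ ^ 2) ≤ K * (‖x‖ * ‖v‖ ^ 2) := by gcongr
            _ ≤ K * (K * ‖v‖ ^ 2) := by gcongr
            _ = K ^ 2 * ‖v‖ ^ 2 := by ring
            _ ≤ _ := by gcongr
        have m3 : K * ‖v‖ ^ 3 ≤ K ^ 3 * ‖v‖ ^ 2 := by
          calc K * ‖v‖ ^ 3 ≤ K * (K * ‖v‖ ^ 2) := by gcongr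
            _ = K ^ 2 * ‖v‖ ^ 2 := by ring
            _ ≤ _ := by gcongr
        have a1 := b u u v
        have a2 := b u v u
        have a3 := b v u u
        have a4 := b u v v
        have a5 := b v u v
        have a6 := b v v u
        have a7 := b v v v
        rw [e]
        have r1 : K * ‖u‖ * ‖u‖ * ‖v‖ = K * (‖u‖ ^ 2 * ‖v‖) := by ring
        have r2 : K * ‖u‖ * ‖v‖ * ‖u‖ = K * (‖u‖ ^ 2 * ‖v‖) := by ring
        have r3 : K * ‖v‖ * ‖u‖ * ‖u‖ = K * (‖u‖ ^ 2 * ‖v‖) := by ring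
        have r4 : K * ‖u‖ * ‖v‖ * ‖v‖ = K * (‖u‖ * ‖v‖ ^ 2) := by ring
        have r5 : K * ‖v‖ * ‖u‖ * ‖v‖ = K * (‖u‖ * ‖v‖ ^ 2) := by ring
        have r6 : K * ‖v‖ * ‖v‖ * ‖u‖ = K * (‖u‖ * ‖v‖ ^ 2) := by ring
        have r7 : K * ‖v‖ * ‖v‖ * ‖v‖ = K * ‖v‖ ^ 3 := by ring
        linarith
      have hX4 : K * ‖α • x + v‖ ^ 4 ≤ 16 * K ^ 3 * ‖v‖ ^ 2 := by
        calc K * ‖α • x + v‖ ^ 4 ≤ K * (‖x‖ + ‖x‖) ^ 4 := by gcongr; linarith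
          _ = 16 * K * (‖x‖ ^ 2) ^ 2 := by ring
          _ ≤ 16 * K * (K * κ) ^ 2 := by gcongr
          _ = 16 * K ^ 3 * κ ^ 2 := by ring
          _ ≤ _ := by gcongr
      have hfin := (_root_.abs_le.1 hT).2
      have hvv : K ^ 3 * ‖v‖ ^ 2 ≤ K ^ 7 * ‖v‖ ^ 2 := by gcongr
      have : 0 ≤ K ^ 7 * ‖v‖ ^ 2 := by positivity
      linarith

end InteriorContact

/-! ### Long chords and touching balls -/

section BoundaryContacts

set_option maxSynthPendingDepth 3

theorem RegularOn.mono {E : Type*} [NormedAddCommGroup E] [InnerProductSpace ℝ E]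
    {K K' : ℝ} {D : Set E} {V : E → ℝ} {g : E → E →L[ℝ] ℝ}
    (h : RegularOn K D V g) (hK : K ≤ K') : RegularOn K' D V g where
  isOpen := h.isOpen
  convex := h.convex
  subset_ball := h.subset_ball.trans (Metric.ball_subset_ball hK)
  contDiffOn := h.contDiffOn
  continuousOn := h.continuousOn
  continuousOn_grad := h.continuousOn_grad
  grad_eq := h.grad_eq
  bound i hi x hx := (h.bound i hi x hx).trans hK

theorem touching_ball_subset {E : Type*} [NormedAddCommGroup E] [NormedSpace ℝ E]
    {p n : E} {r R : ℝ} (hr : r ≤ R) (hn : ‖n‖ = 1) :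
    Metric.ball (p + r • n) r ⊆ Metric.ball (p + R • n) R := by
  refine Metric.ball_subset_ball' ?_
  rw [dist_add_left, dist_eq_norm, ← sub_smul, norm_smul, hn, Real.norm_eq_abs,
    abs_of_nonpos (by linarith)]
  linarith

/-- The chord bound for two contact points whose midpoint is the centre of a ball in the domain. -/
theorem RegularOn.chordBound_of_long {E : Type*} [NormedAddCommGroup E] [InnerProductSpace ℝ E]
    {K κ : ℝ} {D : Set E} {V : E → ℝ} {g : E → E →L[ℝ] ℝ} (h : RegularOn K D V g)
    (hV : ∀ x ∈ closure D, 0 ≤ V x) (hK : 1 ≤ K) (hκ : 0 < κ) (hκK : κ ≤ K) {p d : E}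
    (hd0 : d ≠ 0) (hp : p ∈ closure D) (hq : p + (2 : ℝ) • d ∈ closure D) (hVp : V p = 0)
    (hVq : V (p + (2 : ℝ) • d) = 0) (hball : Metric.ball (p + d) κ ⊆ D)
    (hnp : p ∈ D ∨ ∃ n : E, ‖n‖ = 1 ∧ Metric.ball (p + K⁻¹ • n) K⁻¹ ⊆ D)
    (hnq : (p + (2 : ℝ) • d) ∈ D ∨
      ∃ n : E, ‖n‖ = 1 ∧ Metric.ball ((p + (2 : ℝ) • d) + K⁻¹ • n) K⁻¹ ⊆ D)
    {s : ℝ} (hs : s ∈ Icc (0 : ℝ) 2) {v : E} (hz : p + s • d + v ∈ D) :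
    ChordBound D V (p + s • d + v) (((K ^ 5 / κ ^ 2) * (2 * (K ^ 5 / κ ^ 2) + 2 * (K ^ 5 / κ ^ 2))
      / (2 * K⁻¹) + (K + 3 * (K ^ 5 / κ ^ 2)) + K / κ ^ 2) * ‖v‖ ^ 2) := by
  have hK0 : 0 < K := by linarith
  rcases lt_or_ge ‖v‖ κ with hv | hv
  · have hdK : ‖d‖ ≤ K := by
      have := h.norm_sub_le hq hp
      rw [add_sub_cancel_left, norm_smul, Real.norm_eq_abs, abs_two] at this
      linarith
    have hKκ : 1 ≤ K / κ := by rwa [one_le_div hκ]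
    -- The resulting constant may depend on κ here. The value K⁵/κ² is large enough for the crude
    -- bounds K³ and K² on the second derivatives to have the form K₁κ² and K₁κ.
    have hK₁ : K ^ 5 / κ ^ 2 = K ^ 3 * (K / κ) ^ 2 := by field_simp
    have hKm : ∀ m : ℕ, 1 ≤ K ^ m := fun m => one_le_pow₀ hK
    have e2 : K ^ 5 / κ ^ 2 * κ ^ 2 = K ^ 5 := by field_simp
    have e1 : K ^ 5 / κ ^ 2 * κ = K ^ 4 * (K / κ) := by field_simp
    have c1 : K ^ 2 ≤ K ^ 5 / κ ^ 2 * κ := by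
      rw [e1]
      calc K ^ 2 ≤ K ^ 4 * 1 := by rw [mul_one]; exact pow_le_pow_right₀ hK (by norm_num)
        _ ≤ _ := by gcongr
    have c0 : K ≤ K ^ 2 := by nlinarith
    have hg : ∀ y ∈ closure D, ‖g y‖ ≤ K ^ 5 / κ ^ 2 * κ := fun y hy =>
      (h.norm_grad_le hy).trans (c0.trans c1)
    have := h.chordBound_of_hess hV (K₁ := K ^ 5 / κ ^ 2) (R := K⁻¹) (κ := κ) (by positivity)
      (by positivity) hp hq hd0 hVp hVq hball
      (le_trans (by gcongr) c1)
      (by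
        rw [hK₁]
        calc κ ≤ K := hκK
          _ ≤ K ^ 3 * 1 ^ 2 := by
            rw [one_pow, mul_one]
            simpa using pow_le_pow_right₀ hK (by norm_num : 1 ≤ 3)
          _ ≤ _ := by gcongr)
      (hg _ hp) (hg _ hq) hnp hnq
      (fun α _ b _ hr => ⟨?_, ?_⟩) hs hv hz
    · refine this.mono (mul_le_mul_of_nonneg_right ?_ (sq_nonneg _))
      have : 0 ≤ K / κ ^ 2 := by positivity
      linarith
    · rw [e2]
      calc _ ≤ K * ‖d‖ * ‖d‖ := h.hess_apply_le hr d d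
        _ ≤ K * K * K := by gcongr
        _ = K ^ 3 := by ring
        _ ≤ K ^ 5 := pow_le_pow_right₀ hK (by norm_num)
    · calc _ ≤ K * ‖d‖ := ContinuousLinearMap.le_of_opNorm_le _ (h.norm_hess_le hr) d
        _ ≤ K * K := by gcongr
        _ = K ^ 2 := by ring
        _ ≤ _ := c1
  · refine chordBound_of_le (subset_closure hz) ?_
    calc V _ ≤ K := (le_abs_self _).trans (h.abs_le (subset_closure hz))
      _ = K / κ ^ 2 * κ ^ 2 := by field_simp
      _ ≤ K / κ ^ 2 * ‖v‖ ^ 2 := by gcongr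
      _ ≤ _ := by
        gcongr
        have : 0 ≤ K ^ 5 / κ ^ 2 * (2 * (K ^ 5 / κ ^ 2) + 2 * (K ^ 5 / κ ^ 2)) / (2 * K⁻¹) +
          (K + 3 * (K ^ 5 / κ ^ 2)) := by positivity
        linarith

/-- A touching ball at `q` which is seen from `p` at an angle gives a ball around the midpoint. -/
theorem ball_midpoint_of_touching {E : Type*} [NormedAddCommGroup E] [InnerProductSpace ℝ E]
    {K : ℝ} {D : Set E} (hD : IsOpen D) (hconv : Convex ℝ D) (hK : 2 ≤ K) {q x n : E}
    (hp : q + x ∈ closure D) (hn : ‖n‖ = 1) (hball : Metric.ball (q + K⁻¹ • n) K⁻¹ ⊆ D)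
    (hx : ‖x‖ ^ 2 ≤ K * inner ℝ n x) :
    Metric.ball (q + (1 / 2 : ℝ) • x) (inner ℝ n x / (4 * K ^ 2)) ⊆ D := by
  have hK0 : 0 < K := by linarith
  set a : ℝ := inner ℝ n x with ha
  have ha0 : 0 ≤ a := by
    have : 0 ≤ K * a := (sq_nonneg _).trans hx
    exact nonneg_of_mul_nonneg_right this hK0
  -- At parameter τ = K⁻² the point q + τx is at depth at least τa/2 inside the touching ball, where
  -- a = ⟨n, x⟩. The midpoint is the combination of this point, with weight 1/(2(1 − τ)) ≥ 1/2, and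
  -- of q + x, so at least half of that depth survives.
  set τ : ℝ := (K ^ 2)⁻¹ with hτ
  have hτ0 : 0 < τ := by positivity
  have hτ1 : τ ≤ 1 / 4 := by
    rw [hτ]
    have : (4 : ℝ) ≤ K ^ 2 := by nlinarith
    calc (K ^ 2)⁻¹ ≤ 4⁻¹ := by gcongr
      _ = 1 / 4 := by norm_num
  have hτx : ‖τ • x - K⁻¹ • n‖ ≤ K⁻¹ - τ * a / 2 := by
    have hax : a ≤ ‖x‖ := by
      have := real_inner_le_norm n x
      rwa [hn, one_mul] at this
    have haK : a ≤ K := by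
      by_contra hcon
      push Not at hcon
      nlinarith
    have h0 : 0 ≤ K⁻¹ - τ * a / 2 := by
      have : τ * a ≤ (K ^ 2)⁻¹ * K := by rw [hτ]; gcongr
      have e : (K ^ 2)⁻¹ * K = K⁻¹ := by field_simp
      have : 0 < K⁻¹ := by positivity
      linarith
    refine le_of_sq_le_sq ?_ h0
    rw [norm_sub_sq_real, norm_smul, norm_smul, inner_smul_left, inner_smul_right,
      real_inner_comm, hn, ← ha]
    simp only [Real.norm_eq_abs, abs_of_pos hτ0, abs_of_pos (inv_pos.2 hK0), conj_trivial]
    have e1 : τ ^ 2 * ‖x‖ ^ 2 ≤ τ * K⁻¹ * a := by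
      calc τ ^ 2 * ‖x‖ ^ 2 ≤ τ ^ 2 * (K * a) := by gcongr
        _ = τ * K⁻¹ * a := by rw [hτ]; field_simp
    nlinarith [sq_nonneg (τ * a)]
  intro y hy
  rw [mem_ball_iff_norm] at hy
  set w := y - (q + (1 / 2 : ℝ) • x) with hw
  set lam : ℝ := 1 / (2 * (1 - τ)) with hlam
  have h1τ : 0 < 1 - τ := by linarith
  have hlam0 : 0 < lam := by positivity
  have hlam1 : lam ≤ 1 := by
    rw [hlam, div_le_one (by positivity)]; linarith
  have hlam2 : 1 / 2 ≤ lam := by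
    rw [hlam]
    exact one_div_le_one_div_of_le (by positivity) (by linarith)
  have hin : q + τ • x + lam⁻¹ • w ∈ D := by
    apply hball
    rw [mem_ball_iff_norm]
    have e : q + τ • x + lam⁻¹ • w - (q + K⁻¹ • n) = (τ • x - K⁻¹ • n) + lam⁻¹ • w := by abel
    rw [e]
    refine (norm_add_le _ _).trans_lt ?_
    have h2 : ‖lam⁻¹ • w‖ < τ * a / 2 := by
      rw [norm_smul, norm_inv, Real.norm_eq_abs, abs_of_pos hlam0, inv_mul_lt_iff₀ hlam0]
      calc ‖w‖ < a / (4 * K ^ 2) := hy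
        _ = 1 / 2 * (τ * a / 2) := by rw [hτ]; field_simp; norm_num
        _ ≤ lam * (τ * a / 2) := by gcongr
    linarith
  have := combo_mem_of_closure hD hconv hin hp hlam0 (sub_nonneg.2 hlam1) (by ring)
  have hτ' : 1 - τ ≠ 0 := h1τ.ne'
  have hy' : y = w + (q + (1 / 2 : ℝ) • x) := by rw [hw]; abel
  convert this using 1
  have hw' : lam • lam⁻¹ • w = w := by rw [smul_smul, mul_inv_cancel₀ hlam0.ne', one_smul]
  rw [hy', smul_add, smul_add, hw', hlam]
  match_scalars <;> field_simp <;> ring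

/-! ### Graphs -/

theorem plane_decomposition {e₁ e₂ : Plane} (h₁ : ‖e₁‖ = 1) (h₂ : ‖e₂‖ = 1)
    (h₁₂ : inner ℝ e₁ e₂ = (0 : ℝ)) (x : Plane) :
    x = (inner ℝ e₁ x : ℝ) • e₁ + (inner ℝ e₂ x : ℝ) • e₂ := by
  have ho : Orthonormal ℝ ![e₁, e₂] := by
    rw [orthonormal_iff_ite]
    intro i j
    fin_cases i <;> fin_cases j <;>
      simp [h₁₂, h₁, h₂, real_inner_comm e₁ e₂]
  have hspan : ⊤ ≤ Submodule.span ℝ (Set.range ![e₁, e₂]) := by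
    have := ho.linearIndependent.span_eq_top_of_card_eq_finrank (by simp)
    rw [this]
  have := (OrthonormalBasis.mk ho hspan).sum_repr' x
  rw [Fin.sum_univ_two] at this
  simpa using this.symm

theorem inner_coords {e₁ e₂ : Plane} (h₁ : ‖e₁‖ = 1) (h₂ : ‖e₂‖ = 1)
    (h₁₂ : inner ℝ e₁ e₂ = (0 : ℝ)) (s η s' η' : ℝ) :
    inner ℝ (s • e₁ + η • e₂) (s' • e₁ + η' • e₂) = s * s' + η * η' := by
  have h₂₁ : inner ℝ e₂ e₁ = (0 : ℝ) := by rw [real_inner_comm]; exact h₁₂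
  simp only [inner_add_left, inner_add_right, inner_smul_left, inner_smul_right, conj_trivial,
    real_inner_self_eq_norm_sq, h₁, h₂, h₁₂, h₂₁]
  ring

theorem norm_sq_coords {e₁ e₂ : Plane} (h₁ : ‖e₁‖ = 1) (h₂ : ‖e₂‖ = 1)
    (h₁₂ : inner ℝ e₁ e₂ = (0 : ℝ)) (s η : ℝ) : ‖s • e₁ + η • e₂‖ ^ 2 = s ^ 2 + η ^ 2 := by
  rw [← real_inner_self_eq_norm_sq, inner_coords h₁ h₂ h₁₂]; ring

theorem abs_le_norm_coords {e₁ e₂ : Plane} (h₁ : ‖e₁‖ = 1) (h₂ : ‖e₂‖ = 1)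
    (h₁₂ : inner ℝ e₁ e₂ = (0 : ℝ)) (s η : ℝ) :
    |s| ≤ ‖s • e₁ + η • e₂‖ ∧ |η| ≤ ‖s • e₁ + η • e₂‖ := by
  have := norm_sq_coords h₁ h₂ h₁₂ s η
  constructor <;> refine abs_le_of_sq_le_sq ?_ (norm_nonneg _) <;> rw [this]
  · nlinarith [sq_nonneg η]
  · nlinarith [sq_nonneg s]

/-- Near the point over `s₀`, the set `D` is the region above the graph of `ρ` in the orthonormal
frame `e₁, e₂` at `o`, and `ρ` has derivatives bounded by `K`. -/
structure GraphNear (K : ℝ) (D : Set Plane) (o e₁ e₂ : Plane) (ρ : ℝ → ℝ) (s₀ : ℝ) : Prop where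
  norm_fst : ‖e₁‖ = 1
  norm_snd : ‖e₂‖ = 1
  inner_eq : inner ℝ e₁ e₂ = (0 : ℝ)
  contDiffOn : ContDiffOn ℝ 4 ρ (Ioo (s₀ - K⁻¹) (s₀ + K⁻¹))
  deriv_le : ∀ i, 1 ≤ i → i ≤ 4 → ∀ s ∈ Ioo (s₀ - K⁻¹) (s₀ + K⁻¹), |iteratedDeriv i ρ s| ≤ K
  mem_iff : ∀ s ∈ Ioo (s₀ - K⁻¹) (s₀ + K⁻¹), ∀ η, |η - ρ s₀| < K⁻¹ →
    (o + s • e₁ + η • e₂ ∈ D ↔ ρ s < η)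

theorem hasDerivAt_iteratedDeriv {ρ : ℝ → ℝ} {a b : ℝ} {n : ℕ} (h : ContDiffOn ℝ n ρ (Ioo a b))
    {i : ℕ} (hi : i < n) {s : ℝ} (hs : s ∈ Ioo a b) :
    HasDerivAt (iteratedDeriv i ρ) (iteratedDeriv (i + 1) ρ s) s := by
  have h1 := h.differentiableOn_iteratedDerivWithin (m := i) (by exact_mod_cast hi)
    isOpen_Ioo.uniqueDiffOn
  have h2 : DifferentiableAt ℝ (iteratedDerivWithin i ρ (Ioo a b)) s :=
    (h1 s hs).differentiableAt (isOpen_Ioo.mem_nhds hs)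
  have h3 : iteratedDerivWithin i ρ (Ioo a b) =ᶠ[𝓝 s] iteratedDeriv i ρ := by
    filter_upwards [isOpen_Ioo.mem_nhds hs] with t ht
    exact iteratedDerivWithin_of_isOpen isOpen_Ioo ht
  rw [iteratedDeriv_succ]
  exact (h3.differentiableAt_iff.1 h2).hasDerivAt

theorem iteratedDeriv_eq_of_chain {F : Type*} [NormedAddCommGroup F] [NormedSpace ℝ F]
    {c : ℕ → ℝ → F} {U : Set ℝ} (hU : IsOpen U) {n : ℕ}
    (hc : ∀ i < n, ∀ s ∈ U, HasDerivAt (c i) (c (i + 1) s) s) :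
    ∀ i ≤ n, ∀ s ∈ U, iteratedDeriv i (c 0) s = c i s := by
  intro i
  induction i with
  | zero => intro _ s _; simp
  | succ i ih =>
    intro hi s hs
    rw [iteratedDeriv_succ]
    have : iteratedDeriv i (c 0) =ᶠ[𝓝 s] c i := by
      filter_upwards [hU.mem_nhds hs] with t ht
      exact ih (by omega) t ht
    rw [this.deriv_eq]
    exact (hc i (by omega) s hs).deriv

namespace GraphNear

variable {K : ℝ} {D : Set Plane} {o e₁ e₂ : Plane} {ρ : ℝ → ℝ} {s₀ : ℝ}

theorem hasDerivAt (h : GraphNear K D o e₁ e₂ ρ s₀) {i : ℕ} (hi : i < 4) {s : ℝ}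
    (hs : s ∈ Ioo (s₀ - K⁻¹) (s₀ + K⁻¹)) :
    HasDerivAt (iteratedDeriv i ρ) (iteratedDeriv (i + 1) ρ s) s :=
  hasDerivAt_iteratedDeriv (n := 4) h.contDiffOn hi hs

theorem hasDerivAt_zero (h : GraphNear K D o e₁ e₂ ρ s₀) {s : ℝ}
    (hs : s ∈ Ioo (s₀ - K⁻¹) (s₀ + K⁻¹)) : HasDerivAt ρ (iteratedDeriv 1 ρ s) s := by
  simpa using h.hasDerivAt (i := 0) (by norm_num) hs

theorem lipschitz (h : GraphNear K D o e₁ e₂ ρ s₀) {s t : ℝ}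
    (hs : s ∈ Ioo (s₀ - K⁻¹) (s₀ + K⁻¹)) (ht : t ∈ Ioo (s₀ - K⁻¹) (s₀ + K⁻¹)) :
    |ρ t - ρ s| ≤ K * |t - s| :=
  (convex_Ioo _ _).norm_image_sub_le_of_norm_hasDerivWithin_le
    (fun x hx => (h.hasDerivAt_zero hx).hasDerivWithinAt)
    (fun x hx => h.deriv_le 1 le_rfl (by norm_num) x hx) hs ht

theorem frame_norm_sq (h : GraphNear K D o e₁ e₂ ρ s₀) (s η : ℝ) :
    ‖s • e₁ + η • e₂‖ ^ 2 = s ^ 2 + η ^ 2 :=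
  norm_sq_coords h.norm_fst h.norm_snd h.inner_eq s η

theorem exists_coords (h : GraphNear K D o e₁ e₂ ρ s₀) (x : Plane) :
    ∃ s η : ℝ, x = o + s • e₁ + η • e₂ := by
  refine ⟨inner ℝ e₁ (x - o), inner ℝ e₂ (x - o), ?_⟩
  rw [add_assoc, ← plane_decomposition h.norm_fst h.norm_snd h.inner_eq (x - o)]
  abel

theorem abs_le_dist (h : GraphNear K D o e₁ e₂ ρ s₀) (s η s' η' : ℝ) :
    |s - s'| ≤ ‖(o + s • e₁ + η • e₂) - (o + s' • e₁ + η' • e₂)‖ ∧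
      |η - η'| ≤ ‖(o + s • e₁ + η • e₂) - (o + s' • e₁ + η' • e₂)‖ := by
  have e : (o + s • e₁ + η • e₂) - (o + s' • e₁ + η' • e₂) =
      (s - s') • e₁ + (η - η') • e₂ := by module
  rw [e]
  exact abs_le_norm_coords h.norm_fst h.norm_snd h.inner_eq _ _

/-- The graph lies in the closure of `D`. -/
theorem mem_closure (h : GraphNear K D o e₁ e₂ ρ s₀) {s : ℝ}
    (hs : s ∈ Ioo (s₀ - K⁻¹) (s₀ + K⁻¹)) (hρ : |ρ s - ρ s₀| < K⁻¹) :
    o + s • e₁ + ρ s • e₂ ∈ closure D := by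
  have hcont : Tendsto (fun t : ℝ => o + s • e₁ + (ρ s + t) • e₂) (𝓝[>] 0)
      (𝓝 (o + s • e₁ + (ρ s + 0) • e₂)) :=
    (Continuous.tendsto (by fun_prop) 0).mono_left nhdsWithin_le_nhds
  rw [add_zero] at hcont
  refine mem_closure_of_tendsto hcont ?_
  filter_upwards [Ioo_mem_nhdsGT (sub_pos.2 hρ)] with t ht
  refine (h.mem_iff s hs _ ?_).2 (by linarith [ht.1])
  calc |ρ s + t - ρ s₀| ≤ |ρ s - ρ s₀| + |t| := by
        have : ρ s + t - ρ s₀ = (ρ s - ρ s₀) + t := by ring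
        rw [this]; exact abs_add_le _ _
    _ < K⁻¹ := by rw [abs_of_pos ht.1]; linarith [ht.2]

theorem le_of_mem_closure (h : GraphNear K D o e₁ e₂ ρ s₀) {s η : ℝ}
    (hs : s ∈ Ioo (s₀ - K⁻¹) (s₀ + K⁻¹)) (hη : |η - ρ s₀| < K⁻¹)
    (hmem : o + s • e₁ + η • e₂ ∈ closure D) : ρ s ≤ η := by
  by_contra hcon
  push Not at hcon
  -- coordinates are continuous
  set S : Plane → ℝ := fun x => inner ℝ e₁ (x - o) with hS
  set H : Plane → ℝ := fun x => inner ℝ e₂ (x - o) with hH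
  have h₂₁ : inner ℝ e₂ e₁ = (0 : ℝ) := by rw [real_inner_comm]; exact h.inner_eq
  have hSx : ∀ s η : ℝ, S (o + s • e₁ + η • e₂) = s := by
    intro s η
    simp [hS, add_assoc, inner_add_right, inner_smul_right, h.inner_eq,
      h.norm_fst]
  have hHx : ∀ s η : ℝ, H (o + s • e₁ + η • e₂) = η := by
    intro s η
    simp [hH, add_assoc, inner_add_right, inner_smul_right, h₂₁, h.norm_snd]
  have hSc : Continuous S := by fun_prop
  have hHc : Continuous H := by fun_prop
  set x := o + s • e₁ + η • e₂ with hx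
  have ev1 : ∀ᶠ y in 𝓝 x, S y ∈ Ioo (s₀ - K⁻¹) (s₀ + K⁻¹) :=
    hSc.continuousAt.eventually (isOpen_Ioo.mem_nhds (by rwa [hx, hSx]))
  have ev2 : ∀ᶠ y in 𝓝 x, |H y - ρ s₀| < K⁻¹ :=
    (hHc.sub continuous_const).abs.continuousAt.eventually_lt continuousAt_const
      (by change |H x - ρ s₀| < K⁻¹; rwa [hx, hHx])
  have ev3 : ∀ᶠ y in 𝓝 x, H y < ρ (S y) := by
    refine hHc.continuousAt.eventually_lt ?_ (by rwa [hx, hHx, hSx])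
    have : ContinuousAt ρ (S x) := by
      rw [hx, hSx]; exact (h.hasDerivAt_zero hs).continuousAt
    exact ContinuousAt.comp (f := S) (x := x) this hSc.continuousAt
  obtain ⟨y, ⟨⟨h1, h2⟩, h3⟩, hy⟩ :=
    (mem_closure_iff_nhds.1 hmem _ (inter_mem (inter_mem ev1 ev2) ev3))
  have hyrep : y = o + S y • e₁ + H y • e₂ := by
    rw [add_assoc, ← plane_decomposition h.norm_fst h.norm_snd h.inner_eq (y - o)]
    abel
  rw [hyrep] at hy
  have := (h.mem_iff _ h1 _ h2).1 hy
  exact absurd h3 (not_lt.2 this.le)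

end GraphNear

end BoundaryContacts

/-! ### Regular functions along a boundary graph -/

section ShortChords

set_option maxSynthPendingDepth 3

/-- The error of linear interpolation. -/
theorem exists_linear_interpolation_error {a b : ℝ} {f₀ f₁ f₂ : ℝ → ℝ}
    (h₀ : ∀ t ∈ Ioo a b, HasDerivAt f₀ (f₁ t) t)
    (h₁ : ∀ t ∈ Ioo a b, HasDerivAt f₁ (f₂ t) t)
    {p q s : ℝ} (hp : p ∈ Ioo a b) (hq : q ∈ Ioo a b) (hs : s ∈ Ioo a b) (hpq : p < q) :
    ∃ ξ ∈ Ioo a b, f₀ s - (f₀ p + (f₀ q - f₀ p) / (q - p) * (s - p)) =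
      f₂ ξ / 2 * ((s - p) * (s - q)) := by
  have hpq' : q - p ≠ 0 := (sub_pos.2 hpq).ne'
  set μ := (f₀ q - f₀ p) / (q - p) with hμ
  have hμq : μ * (q - p) = f₀ q - f₀ p := by rw [hμ]; field_simp
  rcases eq_or_ne s p with rfl | hsp
  · exact ⟨s, hs, by simp⟩
  rcases eq_or_ne s q with rfl | hsq
  · exact ⟨s, hs, by rw [hμq]; ring⟩
  have hP : (s - p) * (s - q) ≠ 0 := mul_ne_zero (sub_ne_zero.2 hsp) (sub_ne_zero.2 hsq)
  -- As for Hermite interpolation, c makes the corrected error vanish at a third point; Rolle then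
  -- yields a zero of f₂ − 2c.
  obtain ⟨c, hc⟩ : ∃ c, c * ((s - p) * (s - q)) = f₀ s - (f₀ p + μ * (s - p)) :=
    ⟨(f₀ s - (f₀ p + μ * (s - p))) / ((s - p) * (s - q)), by field_simp⟩
  set G : ℝ → ℝ := fun t => f₀ t - (f₀ p + μ * (t - p)) - c * ((t - p) * (t - q)) with hG
  set G' : ℝ → ℝ := fun t => f₁ t - μ - c * (2 * t - p - q) with hG'
  have hl : ∀ r t : ℝ, HasDerivAt (fun t : ℝ => t - r) 1 t := fun r t =>
    (hasDerivAt_id t).sub_const r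
  have g₀ : ∀ t ∈ Ioo a b, HasDerivAt G (G' t) t := fun t ht =>
    (((h₀ t ht).sub (((hl p t).const_mul μ).const_add (f₀ p))).sub
      (((hl p t).mul (hl q t)).const_mul c)).congr_deriv (by simp only [hG']; ring)
  have g₁ : ∀ t ∈ Ioo a b, HasDerivAt G' (f₂ t - 2 * c) t := fun t ht =>
    (((h₁ t ht).sub_const μ).sub (((((hasDerivAt_id t).const_mul 2).sub_const p).sub_const
      q).const_mul c)).congr_deriv (by ring)
  have zp : G p = 0 := by simp [hG]
  have zq : G q = 0 := by simp only [hG]; rw [hμq]; ring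
  have zs : G s = 0 := by simp only [hG]; rw [hc]; ring
  have rolle : ∀ {g g' : ℝ → ℝ}, (∀ t ∈ Ioo a b, HasDerivAt g (g' t) t) → ∀ {x y : ℝ}, a < x →
      x < y → y < b → g x = 0 → g y = 0 → ∃ c, x < c ∧ c < y ∧ g' c = 0 := by
    intro g g' hg x y hx hxy hy hgx hgy
    obtain ⟨c, hc, h⟩ := exists_hasDerivAt_eq_zero hxy
      (fun t ht => (hg t ⟨by linarith [ht.1], by linarith [ht.2]⟩).continuousAt.continuousWithinAt)
      (hgx.trans hgy.symm) (fun t ht => hg t ⟨by linarith [ht.1], by linarith [ht.2]⟩)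
    exact ⟨c, hc.1, hc.2, h⟩
  have three : ∀ {x y z : ℝ}, a < x → x < y → y < z → z < b → G x = 0 → G y = 0 → G z = 0 →
      ∃ ξ ∈ Ioo a b, f₂ ξ - 2 * c = 0 := by
    intro x y z hx hxy hyz hz zx zy zz
    obtain ⟨c₁, _, _, k₁⟩ := rolle g₀ hx hxy (by linarith) zx zy
    obtain ⟨c₂, _, _, k₂⟩ := rolle g₀ (by linarith) hyz hz zy zz
    obtain ⟨ξ, _, _, k⟩ := rolle g₁ (by linarith : a < c₁) (by linarith : c₁ < c₂)
      (by linarith) k₁ k₂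
    exact ⟨ξ, ⟨by linarith, by linarith⟩, k⟩
  have hξ : ∃ ξ ∈ Ioo a b, f₂ ξ - 2 * c = 0 := by
    rcases lt_or_gt_of_ne hsp with h | h
    · exact three hs.1 h hpq hq.2 zs zp zq
    · rcases lt_or_gt_of_ne hsq with h' | h'
      · exact three hp.1 h h' hq.2 zp zs zq
      · exact three hp.1 hpq h' hs.2 zp zq zs
  obtain ⟨ξ, hξ, hk⟩ := hξ
  refine ⟨ξ, hξ, ?_⟩
  rw [← hc]
  have : f₂ ξ = 2 * c := by linarith
  rw [this]; ring

variable {K : ℝ} {D : Set Plane} {o e₁ e₂ : Plane} {ρ : ℝ → ℝ} {s₀ : ℝ}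
  {V : Plane → ℝ} {g : Plane → Plane →L[ℝ] ℝ}

/-- Derivatives of a regular function along a translate of the graph. -/
theorem GraphNear.iteratedDeriv_along (hG : GraphNear K D o e₁ e₂ ρ s₀) (h : RegularOn K D V g)
    (hK : 1 ≤ K) {a b ε : ℝ} (hab : Ioo a b ⊆ Ioo (s₀ - K⁻¹) (s₀ + K⁻¹))
    (hmem : ∀ s ∈ Ioo a b, o + s • e₁ + (ρ s + ε) • e₂ ∈ D) :
    (∀ i < 4, ∀ t ∈ Ioo a b,
      HasDerivAt (iteratedDeriv i fun s => V (o + s • e₁ + (ρ s + ε) • e₂))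
        (iteratedDeriv (i + 1) (fun s => V (o + s • e₁ + (ρ s + ε) • e₂)) t) t) ∧
    ∀ i ≤ 4, ∀ t ∈ Ioo a b, |iteratedDeriv i (fun s => V (o + s • e₁ + (ρ s + ε) • e₂)) t| ≤
      24 * K * (1 + K) ^ 4 := by
  have hK0 : 0 < K := by linarith
  set c : ℕ → ℝ → Plane := fun i s =>
    if i = 0 then o + s • e₁ + (ρ s + ε) • e₂
    else if i = 1 then e₁ + iteratedDeriv 1 ρ s • e₂ else iteratedDeriv i ρ s • e₂ with hc
  have hchain : ∀ i < 4, ∀ s ∈ Ioo a b, HasDerivAt (c i) (c (i + 1) s) s := by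
    intro i hi s hs
    have hd := hG.hasDerivAt hi (hab hs)
    match i, hi with
    | 0, _ =>
      have h0 := hG.hasDerivAt_zero (hab hs)
      have := (((hasDerivAt_id s).smul_const e₁).const_add o).add ((h0.add_const ε).smul_const e₂)
      have h1 : HasDerivAt (fun s => o + s • e₁ + (ρ s + ε) • e₂) (e₁ + iteratedDeriv 1 ρ s • e₂)
        s := this.congr_deriv (by simp)
      simpa [hc] using h1
    | 1, _ =>
      have h1 : HasDerivAt (fun s => e₁ + iteratedDeriv 1 ρ s • e₂) (iteratedDeriv 2 ρ s • e₂) s :=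
        (hd.smul_const e₂).const_add e₁
      simpa [hc] using h1
    | 2, _ => simpa [hc] using hd.smul_const e₂
    | 3, _ => simpa [hc] using hd.smul_const e₂
  have hc0 : c 0 = fun s => o + s • e₁ + (ρ s + ε) • e₂ := by simp [hc]
  have hcD : ContDiffOn ℝ 4 (c 0) (Ioo a b) := by
    rw [hc0]
    have := hG.contDiffOn.mono hab
    fun_prop
  have hmaps : MapsTo (c 0) (Ioo a b) D := by
    intro s hs
    rw [hc0]; exact hmem s hs
  have hcomp : ContDiffOn ℝ 4 (V ∘ c 0) (Ioo a b) := h.contDiffOn.comp hcD hmaps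
  have hfun : (fun s => V (o + s • e₁ + (ρ s + ε) • e₂)) = V ∘ c 0 := by rw [hc0]; rfl
  rw [hfun]
  refine ⟨fun i hi t ht => hasDerivAt_iteratedDeriv (n := 4) hcomp hi ht, fun i hi t ht => ?_⟩
  have hcb : ∀ j, 1 ≤ j → j ≤ i →
      ‖iteratedFDerivWithin ℝ j (c 0) (Ioo a b) t‖ ≤ (1 + K) ^ j := by
    intro j hj1 hji
    rw [norm_iteratedFDerivWithin_eq_norm_iteratedDerivWithin,
      iteratedDerivWithin_of_isOpen isOpen_Ioo ht,
      iteratedDeriv_eq_of_chain isOpen_Ioo hchain j (by omega) t ht]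
    have hb := hG.deriv_le j hj1 (by omega) t (hab ht)
    have h1K : 1 + K ≤ (1 + K) ^ j := by
      simpa using pow_le_pow_right₀ (by linarith : 1 ≤ 1 + K) hj1
    rcases eq_or_ne j 1 with rfl | hj
    · simp only [hc, one_ne_zero, if_false, if_true, pow_one]
      refine (norm_add_le _ _).trans ?_
      rw [norm_smul, hG.norm_fst, hG.norm_snd, mul_one, Real.norm_eq_abs]
      linarith
    · have hj0 : j ≠ 0 := by omega
      simp only [hc, hj, hj0, if_false]
      rw [norm_smul, hG.norm_snd, mul_one, Real.norm_eq_abs]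
      linarith
  -- The i-th derivative of a composite is at most i! · K · (1 + K)^i when the j-th derivative of
  -- the curve is at most (1 + K)^j for 1 ≤ j ≤ i; and i! ≤ 24 for i ≤ 4.
  have := norm_iteratedFDerivWithin_comp_le (n := i) (C := K) (D := 1 + K) h.contDiffOn hcD
    (by exact_mod_cast hi) h.isOpen.uniqueDiffOn isOpen_Ioo.uniqueDiffOn hmaps ht
    (fun j hj => by
      rw [iteratedFDerivWithin_of_isOpen j h.isOpen (hmaps ht)]
      exact h.bound j (by omega) _ (hmaps ht)) hcb
  rw [norm_iteratedFDerivWithin_eq_norm_iteratedDerivWithin,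
    iteratedDerivWithin_of_isOpen isOpen_Ioo ht, Real.norm_eq_abs] at this
  refine this.trans ?_
  have hf : (i.factorial : ℝ) ≤ 24 := by
    have := Nat.factorial_le hi
    exact_mod_cast this
  gcongr
  linarith

end ShortChords

/-! ### Chords between nearby boundary points -/

section ShortChordBound

set_option maxSynthPendingDepth 3

variable {K : ℝ} {D : Set Plane} {o e₁ e₂ : Plane} {ρ : ℝ → ℝ} {s₀ : ℝ}
  {V : Plane → ℝ} {g : Plane → Plane →L[ℝ] ℝ}

/-- Along the graph, a nonnegative regular function with two zeros is quadratic at both. -/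
theorem GraphNear.le_of_two_zeros (hG : GraphNear K D o e₁ e₂ ρ s₀) (h : RegularOn K D V g)
    (hK : 1 ≤ K) (hV : ∀ x ∈ closure D, 0 ≤ V x) {p q s : ℝ}
    (hp : p ∈ Ioo (s₀ - 1 / (4 * K ^ 2)) (s₀ + 1 / (4 * K ^ 2)))
    (hq : q ∈ Ioo (s₀ - 1 / (4 * K ^ 2)) (s₀ + 1 / (4 * K ^ 2)))
    (hs : s ∈ Ioo (s₀ - 1 / (4 * K ^ 2)) (s₀ + 1 / (4 * K ^ 2)))
    (hpq : p < q) (hVp : V (o + p • e₁ + ρ p • e₂) = 0) (hVq : V (o + q • e₁ + ρ q • e₂) = 0) :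
    V (o + s • e₁ + ρ s • e₂) ≤ 24 * K * (1 + K) ^ 4 * ((s - p) ^ 2 * (s - q) ^ 2) := by
  have hK0 : 0 < K := by linarith
  have hKi : 0 < K⁻¹ := inv_pos.2 hK0
  have hsub : Ioo (s₀ - 1 / (4 * K ^ 2)) (s₀ + 1 / (4 * K ^ 2)) ⊆ Ioo (s₀ - K⁻¹) (s₀ + K⁻¹) := by
    have : 1 / (4 * K ^ 2) ≤ K⁻¹ := by
      rw [inv_eq_one_div]
      exact one_div_le_one_div_of_le hK0 (by nlinarith)
    exact Ioo_subset_Ioo (by linarith) (by linarith)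
  have hs₀ : s₀ ∈ Ioo (s₀ - K⁻¹) (s₀ + K⁻¹) := ⟨by linarith, by linarith⟩
  have hρ : ∀ t ∈ Ioo (s₀ - 1 / (4 * K ^ 2)) (s₀ + 1 / (4 * K ^ 2)),
      |ρ t - ρ s₀| ≤ K⁻¹ / 4 := by
    intro t ht
    refine (hG.lipschitz hs₀ (hsub ht)).trans ?_
    have : |t - s₀| ≤ 1 / (4 * K ^ 2) := by
      rw [abs_le]; constructor <;> linarith [ht.1, ht.2]
    calc K * |t - s₀| ≤ K * (1 / (4 * K ^ 2)) := by gcongr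
      _ = K⁻¹ / 4 := by field_simp
  -- V is four times differentiable only inside D, so the graph is lifted by εₙ → 0 into D. The
  -- lifted restrictions have uniform derivative bounds, and their values converge to those on the
  -- graph.
  set ε : ℕ → ℝ := fun n => K⁻¹ / 4 * (1 / ((n : ℝ) + 1)) with hε
  have hε0 : ∀ n, 0 < ε n := fun n => by positivity
  have hε1 : ∀ n, ε n ≤ K⁻¹ / 4 := by
    intro n
    have : 1 / ((n : ℝ) + 1) ≤ 1 := by
      rw [div_le_one (by positivity)]
      have : (0 : ℝ) ≤ n := Nat.cast_nonneg n
      linarith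
    calc ε n ≤ K⁻¹ / 4 * 1 := by simp only [hε]; gcongr
      _ = _ := mul_one _
  have hεt : Tendsto ε atTop (𝓝 0) := by
    have := (tendsto_one_div_add_atTop_nhds_zero_nat (𝕜 := ℝ)).const_mul (K⁻¹ / 4)
    simpa [hε] using this
  have hmem : ∀ n, ∀ t ∈ Ioo (s₀ - 1 / (4 * K ^ 2)) (s₀ + 1 / (4 * K ^ 2)),
      o + t • e₁ + (ρ t + ε n) • e₂ ∈ D := by
    intro n t ht
    refine (hG.mem_iff t (hsub ht) _ ?_).2 (by linarith [hε0 n])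
    have e : ρ t + ε n - ρ s₀ = (ρ t - ρ s₀) + ε n := by ring
    rw [e]
    refine (abs_add_le _ _).trans_lt ?_
    rw [abs_of_pos (hε0 n)]
    linarith [hρ t ht, hε1 n]
  have hlim : ∀ t ∈ Ioo (s₀ - 1 / (4 * K ^ 2)) (s₀ + 1 / (4 * K ^ 2)),
      Tendsto (fun n => V (o + t • e₁ + (ρ t + ε n) • e₂)) atTop
        (𝓝 (V (o + t • e₁ + ρ t • e₂))) := by
    intro t ht
    have hcl : o + t • e₁ + ρ t • e₂ ∈ closure D :=
      hG.mem_closure (hsub ht) ((hρ t ht).trans_lt (by linarith))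
    have hc : Tendsto (fun n => o + t • e₁ + (ρ t + ε n) • e₂) atTop
        (𝓝 (o + t • e₁ + (ρ t + 0) • e₂)) :=
      ((hεt.const_add (ρ t)).smul_const e₂).const_add _
    rw [add_zero] at hc
    exact (h.continuousOn _ hcl).tendsto.comp (tendsto_nhdsWithin_iff.2
      ⟨hc, Eventually.of_forall fun n => subset_closure (hmem n t ht)⟩)
  refine limit_le_of_two_zeros (K := 24 * K * (1 + K) ^ 4)
    (F := fun n i t => iteratedDeriv i (fun s => V (o + s • e₁ + (ρ s + ε n) • e₂)) t)
    (fun n => (hG.iteratedDeriv_along h hK hsub (hmem n)).1)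
    (fun n => (hG.iteratedDeriv_along h hK hsub (hmem n)).2 2 (by norm_num))
    (fun n => (hG.iteratedDeriv_along h hK hsub (hmem n)).2 4 (by norm_num))
    (fun n t ht => by
      simp only [iteratedDeriv_zero]
      exact hV _ (subset_closure (hmem n t ht))) hp hq hs hpq ?_ ?_ ?_
  · simpa [hVp] using hlim p hp
  · simpa [hVq] using hlim q hq
  · simpa using hlim s hs

-- F is the height of the graph above the line through the two contact points, and t the height of z
-- above that line. The parallel line through z meets the graph at abscissae on both sides of ζ,
-- where F = t. Since F = ρ″(ξ)/2 · (s − p)(s − q) and ρ″ ≥ K⁻¹, these satisfy |(s − p)(s − q)| ≤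
-- 2K|t|, and the double-zero estimate along the graph gives V = O(t²) at both ends.
set_option maxHeartbeats 800000 in
theorem GraphNear.chordBound_of_ordered (hG : GraphNear K D o e₁ e₂ ρ s₀) (h : RegularOn K D V g)
    (hK : 1 ≤ K) (hV : ∀ x ∈ closure D, 0 ≤ V x)
    (hconv : ∀ s ∈ Ioo (s₀ - K⁻¹) (s₀ + K⁻¹), K⁻¹ ≤ iteratedDeriv 2 ρ s)
    {c : ℝ} (hc : c = 1 / (1000 * K ^ 6)) {p q r : ℝ} (hp : |p - s₀| ≤ c) (hq : |q - s₀| ≤ c)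
    (hpq : p < q) (hVp : V (o + p • e₁ + ρ p • e₂) = 0) (hVq : V (o + q • e₁ + ρ q • e₂) = 0)
    (hr : r ∈ Icc p q) {z y : Plane} (hz : z ∈ D)
    (hy : y = o + r • e₁ + (ρ p + (ρ q - ρ p) / (q - p) * (r - p)) • e₂) (hzy : ‖z - y‖ ≤ c) :
    ChordBound D V z (24 * K * (1 + K) ^ 4 * (2 * K * ((1 + K) * ‖z - y‖)) ^ 2) := by
  have hK0 : 0 < K := by linarith
  have hKi : 0 < K⁻¹ := inv_pos.2 hK0
  set δ : ℝ := 1 / (4 * K ^ 2) with hδ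
  have hδ0 : 0 < δ := by positivity
  have hcδ : c ≤ δ / 8 := by
    rw [hc, hδ, div_div]
    refine one_div_le_one_div_of_le (by positivity) ?_
    have : K ^ 2 ≤ K ^ 6 := pow_le_pow_right₀ hK (by norm_num)
    nlinarith [sq_nonneg K]
  have hδK : K * δ = K⁻¹ / 4 := by rw [hδ]; field_simp
  have hδ1 : δ ≤ K⁻¹ / 4 := by nlinarith
  have hsub : Ioo (s₀ - δ) (s₀ + δ) ⊆ Ioo (s₀ - K⁻¹) (s₀ + K⁻¹) :=
    Ioo_subset_Ioo (by linarith) (by linarith)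
  have hs₀ : s₀ ∈ Ioo (s₀ - K⁻¹) (s₀ + K⁻¹) := ⟨by linarith, by linarith⟩
  have hp' := abs_le.1 hp
  have hq' := abs_le.1 hq
  have hpJ : p ∈ Ioo (s₀ - δ) (s₀ + δ) := ⟨by linarith, by linarith⟩
  have hqJ : q ∈ Ioo (s₀ - δ) (s₀ + δ) := ⟨by linarith, by linarith⟩
  have hρ : ∀ t ∈ Ioo (s₀ - δ) (s₀ + δ), |ρ t - ρ s₀| ≤ K⁻¹ / 4 := by
    intro t ht
    refine (hG.lipschitz hs₀ (hsub ht)).trans ?_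
    have : |t - s₀| ≤ δ := by rw [abs_le]; constructor <;> linarith [ht.1, ht.2]
    calc K * |t - s₀| ≤ K * δ := by gcongr
      _ = K⁻¹ / 4 := hδK
  set μ : ℝ := (ρ q - ρ p) / (q - p) with hμ
  have hμK : |μ| ≤ K := by
    rw [hμ, abs_div, div_le_iff₀ (abs_pos.2 (sub_pos.2 hpq).ne')]
    exact hG.lipschitz (hsub hpJ) (hsub hqJ)
  obtain ⟨ζ, η, hzrep⟩ := hG.exists_coords z
  have hd := hG.abs_le_dist ζ η r (ρ p + μ * (r - p))
  rw [← hzrep, ← hy] at hd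
  set N := ‖z - y‖ with hN
  have hζ := abs_le.1 (hd.1.trans hzy)
  have hζJ : ζ ∈ Ioo (s₀ - δ) (s₀ + δ) := ⟨by linarith [hr.1], by linarith [hr.2]⟩
  set F : ℝ → ℝ := fun s => ρ s - (ρ p + μ * (s - p)) with hF
  have herr : ∀ s ∈ Ioo (s₀ - δ) (s₀ + δ), ∃ ξ ∈ Ioo (s₀ - δ) (s₀ + δ),
      F s = iteratedDeriv 2 ρ ξ / 2 * ((s - p) * (s - q)) := fun s hs =>
    exists_linear_interpolation_error (fun t ht => hG.hasDerivAt_zero (hsub ht))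
      (fun t ht => hG.hasDerivAt (i := 1) (by norm_num) (hsub ht)) hpJ hqJ hs hpq
  set t : ℝ := η - (ρ p + μ * (ζ - p)) with ht
  have htN : |t| ≤ (1 + K) * N := by
    have e : t = (η - (ρ p + μ * (r - p))) - μ * (ζ - r) := by rw [ht]; ring
    rw [e]
    refine (abs_sub _ _).trans ?_
    rw [abs_mul]
    have := mul_le_mul hμK hd.1 (abs_nonneg _) hK0.le
    linarith [hd.2]
  have hη : |η - ρ s₀| < K⁻¹ := by
    have hrJ : r ∈ Ioo (s₀ - δ) (s₀ + δ) := ⟨by linarith [hr.1], by linarith [hr.2]⟩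
    have e : η - ρ s₀ = (η - (ρ p + μ * (r - p))) + (ρ p - ρ s₀) + μ * (r - p) := by ring
    rw [e]
    have h1 : |μ * (r - p)| ≤ K * (δ / 4) := by
      rw [abs_mul]
      have : |r - p| ≤ δ / 4 := by rw [abs_le]; constructor <;> linarith [hr.1, hr.2]
      exact mul_le_mul hμK this (abs_nonneg _) hK0.le
    have h2 := hρ p hpJ
    have h3 := hd.2
    have h4 := abs_add_le ((η - (ρ p + μ * (r - p))) + (ρ p - ρ s₀)) (μ * (r - p))
    have h5 := abs_add_le (η - (ρ p + μ * (r - p))) (ρ p - ρ s₀)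
    linarith
  have hFζ : F ζ < t := by
    have := (hG.mem_iff ζ (hsub hζJ) η hη).1 (hzrep ▸ hz)
    simp only [hF, ht]; linarith
  -- At s₀ ± δ/2 both factors |s − p| and |s − q| are at least 3δ/8, as |p − s₀| and |q − s₀| are at
  -- most δ/8. The constant 1/(1000K⁶) is small enough that t stays below the resulting value of F,
  -- so the parallel line does cross the graph on either side.
  have hends : ∀ s ∈ Ioo (s₀ - δ) (s₀ + δ), 9 / 64 * δ ^ 2 ≤ (s - p) * (s - q) → t ≤ F s := by
    intro s hs hsp
    obtain ⟨ξ, hξ, e⟩ := herr s hs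
    have h1 := hconv ξ (hsub hξ)
    have h2 : K⁻¹ / 2 * (9 / 64 * δ ^ 2) ≤ F s := by
      rw [e]
      exact mul_le_mul (by linarith) hsp (by positivity) (by linarith)
    have h3 : (1 + K) * N ≤ 2 * K * c := by
      exact mul_le_mul (by linarith) hzy (norm_nonneg _) (by linarith)
    have h4 : 2 * K * c ≤ K⁻¹ / 2 * (9 / 64 * δ ^ 2) := by
      have e1 : 2 * K * c = 1 / 500 * (1 / K ^ 5) := by rw [hc]; field_simp; norm_num
      have e2 : K⁻¹ / 2 * (9 / 64 * δ ^ 2) = 9 / 2048 * (1 / K ^ 5) := by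
        rw [hδ]; field_simp; norm_num
      rw [e1, e2]
      exact mul_le_mul_of_nonneg_right (by norm_num) (by positivity)
    linarith [le_abs_self t]
  have hFc : ContinuousOn F (Ioo (s₀ - δ) (s₀ + δ)) := by
    intro s hs
    have := (hG.hasDerivAt_zero (hsub hs)).continuousAt
    exact ContinuousAt.continuousWithinAt (by simp only [hF]; fun_prop)
  obtain ⟨sr, ⟨hsr1, hsr2⟩, hsr⟩ : ∃ s ∈ Icc ζ (s₀ + δ / 2), F s = t := by
    have hmem : s₀ + δ / 2 ∈ Ioo (s₀ - δ) (s₀ + δ) := ⟨by linarith, by linarith⟩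
    refine intermediate_value_Icc (by linarith [hr.2])
      (hFc.mono fun x hx => ⟨by linarith [hx.1, hζJ.1], by linarith [hx.2]⟩) ⟨hFζ.le, hends _ hmem ?_⟩
    have h1 : 3 / 8 * δ ≤ s₀ + δ / 2 - p := by linarith
    have h2 : 3 / 8 * δ ≤ s₀ + δ / 2 - q := by linarith
    calc 9 / 64 * δ ^ 2 = 3 / 8 * δ * (3 / 8 * δ) := by ring
      _ ≤ _ := mul_le_mul h1 h2 (by positivity) (by linarith)
  obtain ⟨sl, ⟨hsl1, hsl2⟩, hsl⟩ : ∃ s ∈ Icc (s₀ - δ / 2) ζ, F s = t := by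
    have hmem : s₀ - δ / 2 ∈ Ioo (s₀ - δ) (s₀ + δ) := ⟨by linarith, by linarith⟩
    refine intermediate_value_Icc' (by linarith [hr.1])
      (hFc.mono fun x hx => ⟨by linarith [hx.1], by linarith [hx.2, hζJ.2]⟩) ⟨hFζ.le, hends _ hmem ?_⟩
    have h1 : 3 / 8 * δ ≤ p - (s₀ - δ / 2) := by linarith
    have h2 : 3 / 8 * δ ≤ q - (s₀ - δ / 2) := by linarith
    calc 9 / 64 * δ ^ 2 = 3 / 8 * δ * (3 / 8 * δ) := by ring
      _ ≤ (p - (s₀ - δ / 2)) * (q - (s₀ - δ / 2)) :=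
        mul_le_mul h1 h2 (by positivity) (by linarith)
      _ = _ := by ring
  have hsrJ : sr ∈ Ioo (s₀ - δ) (s₀ + δ) := ⟨by linarith [hζJ.1], by linarith⟩
  have hslJ : sl ∈ Ioo (s₀ - δ) (s₀ + δ) := ⟨by linarith, by linarith [hζJ.2]⟩
  have hval : ∀ s ∈ Ioo (s₀ - δ) (s₀ + δ), F s = t → o + s • e₁ + ρ s • e₂ ∈ closure D ∧
      V (o + s • e₁ + ρ s • e₂) ≤ 24 * K * (1 + K) ^ 4 * (2 * K * ((1 + K) * N)) ^ 2 := by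
    intro s hs hst
    refine ⟨hG.mem_closure (hsub hs) ((hρ s hs).trans_lt (by linarith)), ?_⟩
    refine (hG.le_of_two_zeros h hK hV hpJ hqJ hs hpq hVp hVq).trans ?_
    obtain ⟨ξ, hξ, e⟩ := herr s hs
    have h1 := hconv ξ (hsub hξ)
    have h2 : |(s - p) * (s - q)| ≤ 2 * K * ((1 + K) * N) := by
      rw [hst] at e
      have h3 : K⁻¹ / 2 * |(s - p) * (s - q)| ≤ |t| := by
        rw [e, abs_mul (iteratedDeriv 2 ρ ξ / 2), abs_of_pos (by linarith : 0 < iteratedDeriv 2 ρ ξ / 2)]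
        gcongr
      have h4 : |(s - p) * (s - q)| = 2 * K * (K⁻¹ / 2 * |(s - p) * (s - q)|) := by field_simp
      rw [h4]
      have := h3.trans htN
      gcongr
    have h3 := pow_le_pow_left₀ (abs_nonneg _) h2 2
    rw [sq_abs, mul_pow] at h3
    gcongr
  -- z lies strictly above the graph, so F(ζ) < t and the two crossings are distinct.
  have hne : sl < sr := by
    rcases lt_or_eq_of_le (hsl2.trans hsr1) with h1 | h1
    · exact h1
    · have : sl = ζ := le_antisymm hsl2 (h1 ▸ hsr1)
      rw [this] at hsl; linarith
  have hd0 : sr - sl ≠ 0 := (sub_pos.2 hne).ne'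
  obtain ⟨c1, v1⟩ := hval sl hslJ hsl
  obtain ⟨c2, v2⟩ := hval sr hsrJ hsr
  have eρl : ρ sl = ρ p + μ * (sl - p) + t := by
    have : ρ sl - (ρ p + μ * (sl - p)) = t := hsl
    linarith
  have eρr : ρ sr = ρ p + μ * (sr - p) + t := by
    have : ρ sr - (ρ p + μ * (sr - p)) = t := hsr
    linarith
  have eη : η = ρ p + μ * (ζ - p) + t := by rw [ht]; ring
  refine chordBound_of_le_of_le c1 c2 (a := (sr - ζ) / (sr - sl)) (b := (ζ - sl) / (sr - sl))
    (div_nonneg (by linarith) (by linarith)) (div_nonneg (by linarith) (by linarith))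
    (by field_simp; ring) ?_ v1 v2
  rw [hzrep, eρl, eρr, eη]
  match_scalars <;> field_simp <;> ring

/-- Chords between two nearby boundary points of a uniformly convex piece of the boundary. -/
theorem GraphNear.chordBound_of_short (hG : GraphNear K D o e₁ e₂ ρ s₀) (h : RegularOn K D V g)
    (hK : 1 ≤ K) (hV : ∀ x ∈ closure D, 0 ≤ V x)
    (hconv : ∀ s ∈ Ioo (s₀ - K⁻¹) (s₀ + K⁻¹), K⁻¹ ≤ iteratedDeriv 2 ρ s)
    {c : ℝ} (hc : c = 1 / (1000 * K ^ 6)) {y₁ y₂ : Plane} (hy₁ : y₁ = o + s₀ • e₁ + ρ s₀ • e₂)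
    (hy₂ : y₂ ∈ closure D) (hy₂D : y₂ ∉ D) (hne : y₁ ≠ y₂) (hV₁ : V y₁ = 0) (hV₂ : V y₂ = 0)
    (hl : ‖y₂ - y₁‖ ≤ c) {τ : ℝ} (hτ : τ ∈ Icc (0 : ℝ) 1) {z y : Plane}
    (hy : y = y₁ + τ • (y₂ - y₁)) (hz : z ∈ D) (hzy : ‖z - y‖ ≤ c) :
    ChordBound D V z (24 * K * (1 + K) ^ 4 * (2 * K * ((1 + K) * ‖z - y‖)) ^ 2) := by
  have hK0 : 0 < K := by linarith
  have hKi : 0 < K⁻¹ := inv_pos.2 hK0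
  have hc0 : 0 < c := by rw [hc]; positivity
  have hcK : c < K⁻¹ := by
    rw [hc, inv_eq_one_div]
    refine one_div_lt_one_div_of_lt hK0 ?_
    have : K ≤ K ^ 6 := le_self_pow₀ hK (by norm_num)
    nlinarith
  obtain ⟨s₂, η₂, h₂⟩ := hG.exists_coords y₂
  have hd := hG.abs_le_dist s₂ η₂ s₀ (ρ s₀)
  rw [← h₂, ← hy₁] at hd
  have hs₂ := abs_lt.1 ((hd.1.trans hl).trans_lt hcK)
  have hs₂I : s₂ ∈ Ioo (s₀ - K⁻¹) (s₀ + K⁻¹) := ⟨by linarith, by linarith⟩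
  have hη₂ : |η₂ - ρ s₀| < K⁻¹ := (hd.2.trans hl).trans_lt hcK
  -- A point of the closure outside D lies neither below nor above the graph.
  have e₂' : η₂ = ρ s₂ := by
    refine le_antisymm ?_ (hG.le_of_mem_closure hs₂I hη₂ (h₂ ▸ hy₂))
    by_contra hcon
    push Not at hcon
    exact hy₂D (h₂ ▸ (hG.mem_iff _ hs₂I _ hη₂).2 hcon)
  subst e₂'
  have hz0 : |s₀ - s₀| ≤ c := by simpa using hc0.le
  rcases lt_trichotomy s₀ s₂ with hlt | heq | hgt
  · refine hG.chordBound_of_ordered h hK hV hconv hc hz0 (hd.1.trans hl) hlt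
      (hy₁ ▸ hV₁) (h₂ ▸ hV₂) (r := s₀ + τ * (s₂ - s₀)) ⟨?_, ?_⟩ hz ?_ hzy
    · nlinarith [hτ.1]
    · nlinarith [hτ.2]
    · have : s₂ - s₀ ≠ 0 := (sub_pos.2 hlt).ne'
      rw [hy, h₂, hy₁]
      match_scalars <;> field_simp <;> ring
  · subst heq
    exact absurd (hy₁.trans h₂.symm) hne
  · refine hG.chordBound_of_ordered h hK hV hconv hc (hd.1.trans hl) hz0 hgt
      (h₂ ▸ hV₂) (hy₁ ▸ hV₁) (r := s₀ + τ * (s₂ - s₀)) ⟨?_, ?_⟩ hz ?_ hzy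
    · nlinarith [hτ.2]
    · nlinarith [hτ.1]
    · have : s₀ - s₂ ≠ 0 := (sub_pos.2 hgt).ne'
      rw [hy, h₂, hy₁]
      match_scalars <;> field_simp <;> ring

end ShortChordBound

/-! ### Admissible pairs of contact points -/

section ContactPairs

set_option maxSynthPendingDepth 3

/-- The position of a pair of points of `closure D` that makes it admissible for the quadratic
chord bound. -/
structure AdmissiblePair (K : ℝ) (D : Set Plane) (y₁ y₂ : Plane) : Prop where
  ne : y₁ ≠ y₂
  mem_fst : y₁ ∈ closure D
  mem_snd : y₂ ∈ closure D
  ball_subset : Metric.ball (y₁ + (1 / 2 : ℝ) • (y₂ - y₁)) (‖y₂ - y₁‖ ^ 2 / K) ⊆ D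
  touch_fst : y₁ ∈ D ∨ ∃ n : Plane, ‖n‖ = 1 ∧ Metric.ball (y₁ + K⁻¹ • n) K⁻¹ ⊆ D ∧
    ‖y₂ - y₁‖ ^ 2 ≤ K * inner ℝ n (y₂ - y₁)
  touch_snd : y₂ ∈ D ∨ ∃ n : Plane, ‖n‖ = 1 ∧ Metric.ball (y₂ + K⁻¹ • n) K⁻¹ ⊆ D ∧
    ‖y₁ - y₂‖ ^ 2 ≤ K * inner ℝ n (y₁ - y₂)
  graph : y₁ ∉ D → y₂ ∉ D → ‖y₂ - y₁‖ < K⁻¹ → ∃ (o e₁ e₂ : Plane) (ρ : ℝ → ℝ) (s₀ : ℝ),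
    GraphNear K D o e₁ e₂ ρ s₀ ∧ (∀ s ∈ Ioo (s₀ - K⁻¹) (s₀ + K⁻¹), K⁻¹ ≤ iteratedDeriv 2 ρ s) ∧
      y₁ = o + s₀ • e₁ + ρ s₀ • e₂

variable {K : ℝ} {D : Set Plane} {V : Plane → ℝ} {g : Plane → Plane →L[ℝ] ℝ}

/-- The interior-contact estimate is applied with a suitable radius κ. If y₂ is interior too, κ is
comparable to the squared distance. If y₂ is on the boundary, κ is a multiple of a = ⟨n, y₁ − y₂⟩,
the natural depth of the midpoint; it dominates the squared distance and bounds the normal advance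
of the chord, as both hypotheses on κ require. -/
theorem RegularOn.chordBound_of_fst_mem (h : RegularOn K D V g) (hK : 2 ≤ K)
    (hV : ∀ x ∈ closure D, 0 ≤ V x) {y₁ y₂ : Plane} (hne : y₁ ≠ y₂) (hy₁ : y₁ ∈ D)
    (hy₂ : y₂ ∈ closure D)
    (hball : Metric.ball (y₁ + (1 / 2 : ℝ) • (y₂ - y₁)) (‖y₂ - y₁‖ ^ 2 / K) ⊆ D)
    (htouch : y₂ ∈ D ∨ ∃ n : Plane, ‖n‖ = 1 ∧ Metric.ball (y₂ + K⁻¹ • n) K⁻¹ ⊆ D ∧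
      ‖y₁ - y₂‖ ^ 2 ≤ K * inner ℝ n (y₁ - y₂))
    (hV₁ : V y₁ = 0) (hV₂ : V y₂ = 0) {τ : ℝ} (hτ : τ ∈ Icc (0 : ℝ) 1) {z : Plane} (hz : z ∈ D) :
    ChordBound D V z (10 ^ 5 * (4 * K ^ 3) ^ 7 * ‖z - (y₁ + τ • (y₂ - y₁))‖ ^ 2) := by
  have hK0 : 0 < K := by linarith
  set K' := 4 * K ^ 3 with hK'
  have hK2 : 4 ≤ K ^ 2 := by nlinarith
  have hK3 : 8 ≤ K ^ 3 := by
    calc (8 : ℝ) = 2 ^ 3 := by norm_num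
      _ ≤ K ^ 3 := by gcongr
  have hKK : K ≤ K' := by nlinarith
  have hK1 : 1 ≤ K' := by linarith
  have hK'0 : 0 < K' := by linarith
  have h' := h.mono hKK
  set d : Plane := (1 / 2 : ℝ) • (y₂ - y₁) with hd
  have h2d : (2 : ℝ) • d = y₂ - y₁ := by rw [hd, smul_smul]; norm_num
  have e₂ : y₁ + (2 : ℝ) • d = y₂ := by rw [h2d]; abel
  have hd0 : d ≠ 0 := by
    intro h0
    rw [h0, smul_zero] at h2d
    exact hne (sub_eq_zero.1 h2d.symm).symm
  set l := ‖y₂ - y₁‖ with hl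
  have hl0 : 0 < l := norm_pos_iff.2 (sub_ne_zero.2 hne.symm)
  have hl2 : l ≤ 2 * K := h.norm_sub_le hy₂ (subset_closure hy₁)
  have hzr : y₁ + (2 * τ) • d + (z - (y₁ + τ • (y₂ - y₁))) = z := by
    rw [hd]; module
  have hs : 2 * τ ∈ Icc (0 : ℝ) 2 := ⟨by linarith [hτ.1], by linarith [hτ.2]⟩
  rcases htouch with hm | ⟨n, hn1, hnb, hni⟩
  · have := h'.chordBound_of_interior_contact hV hK1 (κ := l ^ 2 / K') (by positivity)
      (by
        rw [div_le_iff₀ hK'0]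
        nlinarith) hd0 hy₁ (e₂ ▸ hy₂) hV₁ (e₂ ▸ hV₂)
      ((Metric.ball_subset_ball (by gcongr)).trans hball)
      (by rw [h2d, ← hl]; field_simp; rfl) (Or.inl (e₂ ▸ hm)) hs (by rw [hzr]; exact hz)
    rwa [hzr] at this
  · set a : ℝ := inner ℝ n (y₁ - y₂) with ha
    have hl' : ‖y₁ - y₂‖ = l := norm_sub_rev _ _
    rw [hl'] at hni
    have ha0 : 0 < a := by
      by_contra hcon
      push Not at hcon
      nlinarith [pow_pos hl0 2]
    have hal : a ≤ l := by
      have := real_inner_le_norm n (y₁ - y₂)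
      rwa [hn1, one_mul, hl'] at this
    have hb := ball_midpoint_of_touching h.isOpen h.convex hK (q := y₂) (x := y₁ - y₂)
      (by rw [add_sub_cancel]; exact subset_closure hy₁) hn1 hnb (by rw [hl']; exact hni)
    rw [← ha] at hb
    have em : y₂ + (1 / 2 : ℝ) • (y₁ - y₂) = y₁ + d := by rw [hd]; module
    rw [em] at hb
    have := h'.chordBound_of_interior_contact hV hK1 (κ := a / (4 * K ^ 2)) (by positivity)
      (by
        rw [div_le_iff₀ (by positivity)]
        nlinarith) hd0 hy₁ (e₂ ▸ hy₂) hV₁ (e₂ ▸ hV₂) hb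
      (by
        rw [h2d, ← hl, hK']
        calc l ^ 2 ≤ K * a := hni
          _ = _ := by field_simp)
      (Or.inr ⟨n, hn1, by
        rw [e₂]
        exact (touching_ball_subset (by gcongr) hn1).trans hnb, by
        rw [h2d, neg_sub, ← ha, hK']
        have : 4 * K ^ 3 * (a / (4 * K ^ 2)) = K * a := by field_simp
        rw [this]; nlinarith⟩) hs (by rw [hzr]; exact hz)
    rwa [hzr] at this

/-- The quadratic chord bound at an admissible pair of contact points. -/
theorem exists_chordBound_of_admissiblePair {K : ℝ} (hK : 2 ≤ K) :
    ∃ C : ℝ, 0 ≤ C ∧ ∀ {D : Set Plane} {V : Plane → ℝ} {g : Plane → Plane →L[ℝ] ℝ},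
      RegularOn K D V g → (∀ x ∈ closure D, 0 ≤ V x) → ∀ {y₁ y₂ : Plane},
      AdmissiblePair K D y₁ y₂ → V y₁ = 0 → V y₂ = 0 → ∀ τ ∈ Icc (0 : ℝ) 1, ∀ z ∈ D,
      ChordBound D V z (C * ‖z - (y₁ + τ • (y₂ - y₁))‖ ^ 2) := by
  have hK0 : 0 < K := by linarith
  have hK1 : 1 ≤ K := by linarith
  set c : ℝ := 1 / (1000 * K ^ 6) with hc
  have hc0 : 0 < c := by positivity
  have hc1 : c ≤ 1 := by
    rw [hc, div_le_one (by positivity)]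
    have : 1 ≤ K ^ 6 := one_le_pow₀ hK1
    linarith
  have hcK : c < K⁻¹ := by
    rw [hc, inv_eq_one_div]
    refine one_div_lt_one_div_of_lt hK0 ?_
    have : K ≤ K ^ 6 := le_self_pow₀ hK1 (by norm_num)
    nlinarith
  -- c separates short from long boundary pairs; a pair at distance at least c has a ball of radius
  -- c²/K around its midpoint.
  set κ : ℝ := c ^ 2 / K with hκ
  have hκ0 : 0 < κ := by positivity
  have hκK : κ ≤ K := by
    rw [hκ, div_le_iff₀ hK0]
    nlinarith
  set C₁ : ℝ := 10 ^ 5 * (4 * K ^ 3) ^ 7 with hC₁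
  set C₂ : ℝ := ((K ^ 5 / κ ^ 2) * (2 * (K ^ 5 / κ ^ 2) + 2 * (K ^ 5 / κ ^ 2))
      / (2 * K⁻¹) + (K + 3 * (K ^ 5 / κ ^ 2)) + K / κ ^ 2) with hC₂
  set C₃ : ℝ := 24 * K * (1 + K) ^ 4 * (2 * K * (1 + K)) ^ 2 with hC₃
  set C₄ : ℝ := K / c ^ 2 with hC₄
  have p1 : 0 ≤ C₁ := by positivity
  have p2 : 0 ≤ C₂ := by positivity
  have p3 : 0 ≤ C₃ := by positivity
  have p4 : 0 ≤ C₄ := by positivity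
  refine ⟨C₁ + C₂ + C₃ + C₄, by positivity, ?_⟩
  intro D V g h hV y₁ y₂ hp hV₁ hV₂ τ hτ z hz
  set N := ‖z - (y₁ + τ • (y₂ - y₁))‖ with hN
  have hm₁ : ChordBound D V z (C₁ * N ^ 2) → ChordBound D V z ((C₁ + C₂ + C₃ + C₄) * N ^ 2) :=
    fun hh => hh.mono (mul_le_mul_of_nonneg_right (by linarith) (sq_nonneg _))
  by_cases hy₁ : y₁ ∈ D
  · exact hm₁ (h.chordBound_of_fst_mem hK hV hp.ne hy₁ hp.mem_snd hp.ball_subset hp.touch_snd hV₁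
      hV₂ hτ hz)
  by_cases hy₂ : y₂ ∈ D
  · refine hm₁ ?_
    have := h.chordBound_of_fst_mem hK hV hp.ne.symm hy₂ hp.mem_fst (by
      have e : y₂ + (1 / 2 : ℝ) • (y₁ - y₂) = y₁ + (1 / 2 : ℝ) • (y₂ - y₁) := by module
      rw [e, norm_sub_rev]
      exact hp.ball_subset) hp.touch_fst hV₂ hV₁ (τ := 1 - τ)
      ⟨by linarith [hτ.2], by linarith [hτ.1]⟩ hz
    have e : y₂ + (1 - τ) • (y₁ - y₂) = y₁ + τ • (y₂ - y₁) := by module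
    rwa [e] at this
  rcases le_or_gt c ‖y₂ - y₁‖ with hl | hl
  · set d : Plane := (1 / 2 : ℝ) • (y₂ - y₁) with hd
    have h2d : (2 : ℝ) • d = y₂ - y₁ := by rw [hd, smul_smul]; norm_num
    have e₂ : y₁ + (2 : ℝ) • d = y₂ := by rw [h2d]; abel
    have hd0 : d ≠ 0 := by
      intro h0
      rw [h0, smul_zero] at h2d
      exact hp.ne (sub_eq_zero.1 h2d.symm).symm
    have hzr : y₁ + (2 * τ) • d + (z - (y₁ + τ • (y₂ - y₁))) = z := by
      rw [hd]; module
    have := h.chordBound_of_long hV hK1 hκ0 hκK hd0 hp.mem_fst (e₂ ▸ hp.mem_snd) hV₁ (e₂ ▸ hV₂)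
      ((Metric.ball_subset_ball (by rw [hκ]; gcongr)).trans hp.ball_subset)
      (hp.touch_fst.imp_right fun ⟨n, a, b, _⟩ => ⟨n, a, b⟩)
      (by rw [e₂]; exact hp.touch_snd.imp_right fun ⟨n, a, b, _⟩ => ⟨n, a, b⟩)
      (s := 2 * τ) ⟨by linarith [hτ.1], by linarith [hτ.2]⟩ (by rw [hzr]; exact hz)
    rw [hzr] at this
    exact this.mono (mul_le_mul_of_nonneg_right (by linarith) (sq_nonneg _))
  · rcases le_or_gt N c with hNc | hNc
    · obtain ⟨o, e₁, e₂, ρ, s₀, hG, hconv, ho⟩ := hp.graph hy₁ hy₂ (hl.trans hcK)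
      refine (hG.chordBound_of_short h hK1 hV hconv hc ho hp.mem_snd hy₂ hp.ne hV₁ hV₂ hl.le hτ rfl
        hz hNc).mono ?_
      rw [← hN]
      calc _ = C₃ * N ^ 2 := by rw [hC₃]; ring
        _ ≤ _ := mul_le_mul_of_nonneg_right (by linarith) (sq_nonneg _)
    -- Away from a short chord the bound V ≤ K is already quadratic, since ‖z − y‖ > c.
    · refine chordBound_of_le (subset_closure hz) ?_
      calc V z ≤ K := (le_abs_self _).trans (h.abs_le (subset_closure hz))
        _ = C₄ * c ^ 2 := by rw [hC₄]; field_simp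
        _ ≤ C₄ * N ^ 2 := by gcongr
        _ ≤ _ := mul_le_mul_of_nonneg_right (by linarith) (sq_nonneg _)

theorem RegularOn.sub_affine (h : RegularOn K D V g) (hK : 0 ≤ K) (L : Plane →L[ℝ] ℝ) (b : ℝ) :
    RegularOn (K + ‖L‖ * (1 + K) + |b|) D (fun x => V x - (L x + b)) (fun x => g x - L) where
  isOpen := h.isOpen
  convex := h.convex
  subset_ball := h.subset_ball.trans (Metric.ball_subset_ball (by
    have := norm_nonneg L
    have := abs_nonneg b
    nlinarith [mul_nonneg (norm_nonneg L) hK]))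
  contDiffOn := h.contDiffOn.sub (L.contDiff.add contDiff_const).contDiffOn
  continuousOn := by
    have := h.continuousOn
    fun_prop
  continuousOn_grad := h.continuousOn_grad.sub continuousOn_const
  grad_eq x hx := by
    have h1 : DifferentiableAt ℝ V x :=
      (h.contDiffOn.differentiableOn (by norm_num) x hx).differentiableAt (h.isOpen.mem_nhds hx)
    rw [fderiv_fun_sub h1 (by fun_prop), fderiv_add_const, h.grad_eq x hx]
    simp
  bound i hi x hx := by
    have hn := norm_nonneg L
    have hb := abs_nonneg b
    have hLK : 0 ≤ ‖L‖ * K := mul_nonneg hn hK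
    have hder : ∀ y ∈ D, fderiv ℝ (fun x => V x - (L x + b)) y = fderiv ℝ V y - L := by
      intro y hy
      have h1 : DifferentiableAt ℝ V y :=
        (h.contDiffOn.differentiableOn (by norm_num) y hy).differentiableAt (h.isOpen.mem_nhds hy)
      rw [fderiv_fun_sub h1 (by fun_prop), fderiv_add_const]
      simp
    match i, hi with
    | 0, _ =>
      rw [norm_iteratedFDeriv_zero]
      have h1 := h.bound 0 (by norm_num) x hx
      rw [norm_iteratedFDeriv_zero] at h1
      have h2 : ‖L x + b‖ ≤ ‖L‖ * K + |b| := by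
        refine (norm_add_le _ _).trans (add_le_add ?_ le_rfl)
        refine (L.le_opNorm x).trans ?_
        have := h.subset_ball hx
        rw [mem_ball_zero_iff] at this
        gcongr
      refine (_root_.norm_sub_le _ _).trans ?_
      linarith
    | 1, _ =>
      have h1 := h.norm_grad_le' hx
      rw [← norm_iteratedFDeriv_fderiv, norm_iteratedFDeriv_zero, hder x hx]
      refine (_root_.norm_sub_le _ _).trans ?_
      linarith
    | (j + 2), hi =>
      have h1 := h.bound (j + 2) hi x hx
      rw [← norm_iteratedFDeriv_fderiv, ← norm_iteratedFDeriv_fderiv] at h1 ⊢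
      have h2 : fderiv ℝ (fderiv ℝ (fun x => V x - (L x + b))) =ᶠ[𝓝 x] fderiv ℝ (fderiv ℝ V) := by
        filter_upwards [h.isOpen.mem_nhds hx] with y hy
        have : fderiv ℝ (fun x => V x - (L x + b)) =ᶠ[𝓝 y] fun y => fderiv ℝ V y - L := by
          filter_upwards [h.isOpen.mem_nhds hy] with u hu
          exact hder u hu
        rw [this.fderiv_eq, fderiv_sub_const]
      rw [(h2.iteratedFDeriv ℝ j).eq_of_nhds]
      linarith [mul_nonneg hn (by linarith : (0:ℝ) ≤ 1 + K)]

/-- An affine minorant of `W` touching at an admissible pair has a controlled slope. -/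
theorem AdmissiblePair.norm_slope_le {y₁ y₂ : Plane} (hp : AdmissiblePair K D y₁ y₂)
    {W : Plane → ℝ} (h : RegularOn K D W g) (hK : 2 ≤ K) {L : Plane →L[ℝ] ℝ} {b : ℝ}
    (hle : ∀ x ∈ closure D, L x + b ≤ W x) (h₁ : L y₁ + b = W y₁) (h₂ : L y₂ + b = W y₂) :
    ‖L‖ ≤ K + K ^ 2 := by
  have hK0 : 0 < K := by linarith
  have hV := h.sub_affine hK0.le L b
  have hVnn : ∀ x ∈ closure D, 0 ≤ W x - (L x + b) := fun x hx => sub_nonneg.2 (hle x hx)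
  have hz₁ : W y₁ - (L y₁ + b) = 0 := by rw [h₁, sub_self]
  have hz₂ : W y₂ - (L y₂ + b) = 0 := by rw [h₂, sub_self]
  have interior : ∀ y ∈ D, W y - (L y + b) = 0 → ‖L‖ ≤ K + K ^ 2 := by
    intro y hy hz
    have h0 := hV.grad_eq_zero hVnn hy hz
    rw [← hV.grad_eq y hy, sub_eq_zero] at h0
    have := h.norm_grad_le (subset_closure hy)
    rw [← h0]
    nlinarith
  rcases hp.touch_fst with hm | ⟨n₁, hn₁, hb₁, hi₁⟩
  · exact interior _ hm hz₁
  rcases hp.touch_snd with hm | ⟨n₂, hn₂, hb₂, hi₂⟩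
  · exact interior _ hm hz₂
  obtain ⟨a₁, ha₁, -, hg₁⟩ := hV.grad_boundary hVnn hp.mem_fst hz₁ (inv_pos.2 hK0) hn₁ hb₁
  obtain ⟨a₂, ha₂, -, hg₂⟩ := hV.grad_boundary hVnn hp.mem_snd hz₂ (inv_pos.2 hK0) hn₂ hb₂
  set l := ‖y₂ - y₁‖ with hl
  have hl0 : 0 < l := norm_pos_iff.2 (sub_ne_zero.2 hp.ne.symm)
  have hl' : ‖y₁ - y₂‖ = l := norm_sub_rev _ _
  rw [hl'] at hi₂
  have e₁ := hg₁ (y₂ - y₁)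
  have e₂ := hg₂ (y₁ - y₂)
  -- Both contacts are on the boundary, so g(yᵢ) − L = aᵢnᵢ with aᵢ ≥ 0. Pairing these with y₂ − y₁
  -- and y₁ − y₂ gives two nonnegative terms whose sum no longer contains L and is at most K‖y₂ −
  -- y₁‖². The first term is at least a₁‖y₂ − y₁‖²/K, so a₁ ≤ K².
  have k1 : a₁ * l ^ 2 ≤ K * (g y₁ - L) (y₂ - y₁) := by
    rw [e₁]
    calc a₁ * l ^ 2 ≤ a₁ * (K * inner ℝ n₁ (y₂ - y₁)) := by gcongr
      _ = _ := by ring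
  have k2 : 0 ≤ (g y₂ - L) (y₁ - y₂) := by
    rw [e₂]
    have : 0 ≤ K * inner ℝ n₂ (y₁ - y₂) := (sq_nonneg l).trans hi₂
    exact mul_nonneg ha₂ (nonneg_of_mul_nonneg_right this hK0)
  have k3 : (g y₁ - L) (y₂ - y₁) + (g y₂ - L) (y₁ - y₂) ≤ K * l ^ 2 := by
    have e : (g y₁ - L) (y₂ - y₁) + (g y₂ - L) (y₁ - y₂) = (g y₂ - g y₁) (y₁ - y₂) := by
      have : y₂ - y₁ = -(y₁ - y₂) := by abel
      rw [this, map_neg]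
      simp only [_root_.sub_apply]
      ring
    rw [e]
    refine (le_abs_self _).trans ?_
    rw [← Real.norm_eq_abs]
    refine ((g y₂ - g y₁).le_opNorm _).trans ?_
    rw [hl']
    have := h.norm_grad_sub_le hp.mem_fst hp.mem_snd
    rw [← hl] at this
    nlinarith
  have ha : a₁ ≤ K ^ 2 := by
    have : a₁ * l ^ 2 ≤ K ^ 2 * l ^ 2 := by nlinarith
    exact le_of_mul_le_mul_right this (by positivity)
  have hgL : ‖g y₁ - L‖ ≤ a₁ := by
    refine ContinuousLinearMap.opNorm_le_bound _ ha₁ fun x => ?_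
    rw [hg₁, norm_mul, Real.norm_eq_abs, abs_of_nonneg ha₁]
    have := norm_inner_le_norm (𝕜 := ℝ) n₁ x
    rw [hn₁, one_mul] at this
    gcongr
  have e : L = g y₁ - (g y₁ - L) := by abel
  rw [e]
  exact (_root_.norm_sub_le _ _).trans (add_le_add (h.norm_grad_le hp.mem_fst) (hgL.trans ha))

theorem GraphNear.mono {K' : ℝ} {o e₁ e₂ : Plane} {ρ : ℝ → ℝ} {s₀ : ℝ}
    (hG : GraphNear K D o e₁ e₂ ρ s₀) (hK : 0 < K) (hKK : K ≤ K') :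
    GraphNear K' D o e₁ e₂ ρ s₀ := by
  have hi : K'⁻¹ ≤ K⁻¹ := by gcongr
  have hsub : Ioo (s₀ - K'⁻¹) (s₀ + K'⁻¹) ⊆ Ioo (s₀ - K⁻¹) (s₀ + K⁻¹) :=
    Ioo_subset_Ioo (by linarith) (by linarith)
  exact
    { norm_fst := hG.norm_fst
      norm_snd := hG.norm_snd
      inner_eq := hG.inner_eq
      contDiffOn := hG.contDiffOn.mono hsub
      deriv_le := fun i h1 h4 s hs => (hG.deriv_le i h1 h4 s (hsub hs)).trans hKK
      mem_iff := fun s hs η hη => hG.mem_iff s (hsub hs) η (hη.trans_le hi) }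

theorem AdmissiblePair.mono {K' : ℝ} {y₁ y₂ : Plane} (hp : AdmissiblePair K D y₁ y₂) (hK : 0 < K)
    (hKK : K ≤ K') : AdmissiblePair K' D y₁ y₂ := by
  have hi : K'⁻¹ ≤ K⁻¹ := by gcongr
  have touch : ∀ y x : Plane, (∃ n : Plane, ‖n‖ = 1 ∧ Metric.ball (y + K⁻¹ • n) K⁻¹ ⊆ D ∧
      ‖x‖ ^ 2 ≤ K * inner ℝ n x) → ∃ n : Plane, ‖n‖ = 1 ∧ Metric.ball (y + K'⁻¹ • n) K'⁻¹ ⊆ D ∧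
      ‖x‖ ^ 2 ≤ K' * inner ℝ n x := by
    rintro y x ⟨n, h1, h2, h3⟩
    refine ⟨n, h1, (touching_ball_subset hi h1).trans h2, h3.trans ?_⟩
    have : 0 ≤ inner ℝ n x := nonneg_of_mul_nonneg_right ((sq_nonneg _).trans h3) hK
    gcongr
  refine
    { ne := hp.ne
      mem_fst := hp.mem_fst
      mem_snd := hp.mem_snd
      ball_subset := (Metric.ball_subset_ball (by gcongr)).trans hp.ball_subset
      touch_fst := hp.touch_fst.imp_right (touch _ _)
      touch_snd := hp.touch_snd.imp_right (touch _ _)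
      graph := fun h1 h2 hl => ?_ }
  obtain ⟨o, e₁, e₂, ρ, s₀, hG, hc, ho⟩ := hp.graph h1 h2 (hl.trans_le hi)
  exact ⟨o, e₁, e₂, ρ, s₀, hG.mono hK hKK, fun s hs =>
    hi.trans (hc s (Ioo_subset_Ioo (by linarith) (by linarith) hs)), ho⟩

/-- The quadratic chord bound for the difference of a regular function and an affine minorant
touching it at an admissible pair. -/
theorem exists_chordBound_sub_affine {K : ℝ} (hK : 2 ≤ K) :
    ∃ C : ℝ, 0 ≤ C ∧ ∀ {D : Set Plane} {W : Plane → ℝ} {g : Plane → Plane →L[ℝ] ℝ},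
      RegularOn K D W g → ∀ {L : Plane →L[ℝ] ℝ} {b : ℝ},
      (∀ x ∈ closure D, L x + b ≤ W x) → ∀ {y₁ y₂ : Plane},
      AdmissiblePair K D y₁ y₂ → L y₁ + b = W y₁ → L y₂ + b = W y₂ →
      ‖L‖ ≤ C ∧ |b| ≤ C ∧ ∀ τ ∈ Icc (0 : ℝ) 1, ∀ z ∈ D,
      ChordBound D (fun x => W x - (L x + b)) z (C * ‖z - (y₁ + τ • (y₂ - y₁))‖ ^ 2) := by
  set A : ℝ := K + K ^ 2 with hA
  set B : ℝ := K + A * K with hB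
  have hK0 : 0 < K := by linarith
  have hA0 : 0 < A := by positivity
  have hB0 : 0 < B := by positivity
  have hAK : 0 ≤ A * (1 + K) := by positivity
  obtain ⟨C, hC, hmain⟩ := exists_chordBound_of_admissiblePair (K := K + A * (1 + K) + B)
    (by linarith)
  refine ⟨A + B + C, by linarith, ?_⟩
  intro D W g h L b hle y₁ y₂ hp h₁ h₂
  have hL := hp.norm_slope_le h hK hle h₁ h₂
  have hb : |b| ≤ B := by
    have e : b = W y₁ - L y₁ := by linarith
    have hy : ‖y₁‖ ≤ K := by
      have := closure_mono h.subset_ball hp.mem_fst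
      simpa using Metric.closure_ball_subset_closedBall this
    rw [e]
    refine (abs_sub _ _).trans (add_le_add (h.abs_le hp.mem_fst) ?_)
    rw [← Real.norm_eq_abs]
    exact (L.le_opNorm _).trans (mul_le_mul hL hy (norm_nonneg _) hA0.le)
  have hV := (h.sub_affine hK0.le L b).mono (K' := K + A * (1 + K) + B) (by gcongr)
  refine ⟨by linarith, by linarith, fun τ hτ z hz => ?_⟩
  refine (hmain hV (fun x hx => sub_nonneg.2 (hle x hx)) (hp.mono hK0 (by linarith))
    (by rw [h₁, sub_self]) (by rw [h₂, sub_self]) τ hτ z hz).mono ?_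
  exact mul_le_mul_of_nonneg_right (by linarith) (sq_nonneg _)

end ContactPairs

/-! ### Touching balls and enclosing paraboloids -/

section BoundaryGeometry

variable {K : ℝ} {D : Set Plane} {o e₁ e₂ : Plane} {ρ : ℝ → ℝ} {s₀ : ℝ}

/-- Cauchy's mean value theorem against (s − s₀)², followed by Lagrange's for the first derivative.
-/
theorem GraphNear.exists_taylor_second (hG : GraphNear K D o e₁ e₂ ρ s₀) (hK : 0 < K) {s : ℝ}
    (hs : s ∈ Ioo (s₀ - K⁻¹) (s₀ + K⁻¹)) :
    ∃ ξ ∈ Ioo (s₀ - K⁻¹) (s₀ + K⁻¹),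
      ρ s - ρ s₀ - iteratedDeriv 1 ρ s₀ * (s - s₀) = iteratedDeriv 2 ρ ξ / 2 * (s - s₀) ^ 2 := by
  have hKi : 0 < K⁻¹ := inv_pos.2 hK
  have hs₀ : s₀ ∈ Ioo (s₀ - K⁻¹) (s₀ + K⁻¹) := ⟨by linarith, by linarith⟩
  set F : ℝ → ℝ := fun t => ρ t - ρ s₀ - iteratedDeriv 1 ρ s₀ * (t - s₀) with hF
  set G : ℝ → ℝ := fun t => (t - s₀) ^ 2 with hGd
  have dF : ∀ t ∈ Ioo (s₀ - K⁻¹) (s₀ + K⁻¹),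
      HasDerivAt F (iteratedDeriv 1 ρ t - iteratedDeriv 1 ρ s₀) t := fun t ht =>
    (((hG.hasDerivAt_zero ht).sub_const _).sub
      (((hasDerivAt_id t).sub_const s₀).const_mul _)).congr_deriv (by ring)
  have dG : ∀ t, HasDerivAt G (2 * (t - s₀)) t := fun t =>
    (((hasDerivAt_id t).sub_const s₀).pow 2).congr_deriv (by simp)
  have d2 : ∀ t ∈ Ioo (s₀ - K⁻¹) (s₀ + K⁻¹), HasDerivAt (iteratedDeriv 1 ρ) (iteratedDeriv 2 ρ t) t :=
    fun t ht => hG.hasDerivAt (i := 1) (by norm_num) ht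
  have key : ∀ c ∈ Ioo (s₀ - K⁻¹) (s₀ + K⁻¹), ∃ ξ ∈ Ioo (s₀ - K⁻¹) (s₀ + K⁻¹),
      iteratedDeriv 1 ρ c - iteratedDeriv 1 ρ s₀ = iteratedDeriv 2 ρ ξ * (c - s₀) := by
    intro c hc
    rcases lt_trichotomy c s₀ with h | h | h
    · obtain ⟨ξ, hξ, e⟩ := exists_hasDerivAt_eq_slope (iteratedDeriv 1 ρ) (iteratedDeriv 2 ρ) h
        (fun t ht => (d2 t ⟨by linarith [ht.1, hc.1], by linarith [ht.2]⟩).continuousAt.continuousWithinAt)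
        (fun t ht => d2 t ⟨by linarith [ht.1, hc.1], by linarith [ht.2]⟩)
      refine ⟨ξ, ⟨by linarith [hξ.1, hc.1], by linarith [hξ.2]⟩, ?_⟩
      have : s₀ - c ≠ 0 := (sub_pos.2 h).ne'
      rw [e]; field_simp; ring
    · exact ⟨s₀, hs₀, by rw [h]; ring⟩
    · obtain ⟨ξ, hξ, e⟩ := exists_hasDerivAt_eq_slope (iteratedDeriv 1 ρ) (iteratedDeriv 2 ρ) h
        (fun t ht => (d2 t ⟨by linarith [ht.1], by linarith [ht.2, hc.2]⟩).continuousAt.continuousWithinAt)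
        (fun t ht => d2 t ⟨by linarith [ht.1], by linarith [ht.2, hc.2]⟩)
      refine ⟨ξ, ⟨by linarith [hξ.1], by linarith [hξ.2, hc.2]⟩, ?_⟩
      have : c - s₀ ≠ 0 := (sub_pos.2 h).ne'
      rw [e]; field_simp
  have F0 : F s₀ = 0 := by simp [hF]
  have G0 : G s₀ = 0 := by simp [hGd]
  have fin : ∀ c ∈ Ioo (s₀ - K⁻¹) (s₀ + K⁻¹), c ≠ s₀ →
      G s * (iteratedDeriv 1 ρ c - iteratedDeriv 1 ρ s₀) = F s * (2 * (c - s₀)) →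
      ∃ ξ ∈ Ioo (s₀ - K⁻¹) (s₀ + K⁻¹), F s = iteratedDeriv 2 ρ ξ / 2 * (s - s₀) ^ 2 := by
    intro c hc hne e
    obtain ⟨ξ, hξ, eξ⟩ := key c hc
    refine ⟨ξ, hξ, ?_⟩
    rw [eξ] at e
    have : c - s₀ ≠ 0 := sub_ne_zero.2 hne
    have h2 : G s * iteratedDeriv 2 ρ ξ * (c - s₀) = F s * 2 * (c - s₀) := by linarith
    have h3 := mul_right_cancel₀ this h2
    simp only [hGd] at h3
    linarith
  rcases lt_trichotomy s s₀ with h | h | h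
  · obtain ⟨c, hc, e⟩ := exists_ratio_hasDerivAt_eq_ratio_slope F
      (fun t => iteratedDeriv 1 ρ t - iteratedDeriv 1 ρ s₀) h
      (fun t ht => (dF t ⟨by linarith [ht.1, hs.1], by linarith [ht.2]⟩).continuousAt.continuousWithinAt)
      (fun t ht => dF t ⟨by linarith [ht.1, hs.1], by linarith [ht.2]⟩) G (fun t => 2 * (t - s₀))
      (fun t _ => (dG t).continuousAt.continuousWithinAt) (fun t _ => dG t)
    rw [F0, G0] at e
    exact fin c ⟨by linarith [hc.1, hs.1], by linarith [hc.2]⟩ hc.2.ne (by linarith)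
  · exact ⟨s₀, hs₀, by rw [h]; ring⟩
  · obtain ⟨c, hc, e⟩ := exists_ratio_hasDerivAt_eq_ratio_slope F
      (fun t => iteratedDeriv 1 ρ t - iteratedDeriv 1 ρ s₀) h
      (fun t ht => (dF t ⟨by linarith [ht.1], by linarith [ht.2, hs.2]⟩).continuousAt.continuousWithinAt)
      (fun t ht => dF t ⟨by linarith [ht.1], by linarith [ht.2, hs.2]⟩) G (fun t => 2 * (t - s₀))
      (fun t _ => (dG t).continuousAt.continuousWithinAt) (fun t _ => dG t)
    rw [F0, G0] at e
    exact fin c ⟨by linarith [hc.1], by linarith [hc.2, hs.2]⟩ hc.1.ne' (by linarith)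

theorem GraphNear.base_mem (hK : 0 < K) : s₀ ∈ Ioo (s₀ - K⁻¹) (s₀ + K⁻¹) := by
  have hKi : 0 < K⁻¹ := inv_pos.2 hK
  exact ⟨by linarith, by linarith⟩

/-- A ball touching the graph from inside. -/
theorem GraphNear.touching_ball (hG : GraphNear K D o e₁ e₂ ρ s₀) (hK : 1 ≤ K) {β : ℝ} (hβ : 0 < β)
    (hβ1 : β ≤ 1) (hn : ‖β • (e₂ - iteratedDeriv 1 ρ s₀ • e₁)‖ = 1) :
    Metric.ball (o + s₀ • e₁ + ρ s₀ • e₂ +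
      (2 * K)⁻¹ • (β • (e₂ - iteratedDeriv 1 ρ s₀ • e₁))) (2 * K)⁻¹ ⊆ D := by
  have hK0 : 0 < K := by linarith
  set m := iteratedDeriv 1 ρ s₀ with hm
  set n : Plane := β • (e₂ - m • e₁) with hnd
  set r : ℝ := (2 * K)⁻¹ with hr
  have hr0 : 0 < r := by positivity
  have hrK : 2 * r = K⁻¹ := by rw [hr]; field_simp
  intro x hx
  obtain ⟨s, η, hxr⟩ := hG.exists_coords x
  rw [mem_ball_iff_norm] at hx
  set u : Plane := (s - s₀) • e₁ + (η - ρ s₀) • e₂ with hu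
  have eu : x - (o + s₀ • e₁ + ρ s₀ • e₂ + r • n) = u - r • n := by rw [hxr, hu]; module
  rw [eu] at hx
  have hun : inner ℝ n u = β * ((η - ρ s₀) - m * (s - s₀)) := by
    have : n = (-(β * m)) • e₁ + β • e₂ := by rw [hnd]; module
    rw [this, hu, inner_coords hG.norm_fst hG.norm_snd hG.inner_eq]
    ring
  set t : ℝ := (η - ρ s₀) - m * (s - s₀) with ht
  -- Membership in the ball reads ‖u‖² < 2r⟨n, u⟩, where ⟨n, u⟩ = βt and t is the height above the
  -- tangent line. Hence (s − s₀)² < t/K, and the quadratic remainder of the graph is at most t/2.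
  have h1 : ‖u‖ ^ 2 < 2 * r * (β * t) := by
    have h2 : ‖u - r • n‖ ^ 2 < r ^ 2 := pow_lt_pow_left₀ hx (norm_nonneg _) (by norm_num)
    rw [norm_sub_sq_real, inner_smul_right, real_inner_comm, hun, norm_smul, hn,
      Real.norm_eq_abs, abs_of_pos hr0] at h2
    linarith
  have hu2 : ‖u‖ ^ 2 = (s - s₀) ^ 2 + (η - ρ s₀) ^ 2 := hG.frame_norm_sq _ _
  have ht0 : 0 < t := by
    have : 0 < 2 * r * (β * t) := (sq_nonneg _).trans_lt h1
    exact (pos_iff_pos_of_mul_pos ((pos_iff_pos_of_mul_pos this).1 (by positivity))).1 hβ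
  have hul : ‖u‖ < K⁻¹ := by
    have : ‖u‖ ≤ ‖u - r • n‖ + ‖r • n‖ := by
      have := norm_add_le (u - r • n) (r • n)
      rwa [sub_add_cancel] at this
    rw [norm_smul, hn, mul_one, Real.norm_eq_abs, abs_of_pos hr0] at this
    linarith
  have hco := abs_le_norm_coords hG.norm_fst hG.norm_snd hG.inner_eq (s - s₀) (η - ρ s₀)
  rw [← hu] at hco
  have hs' := abs_lt.1 (hco.1.trans_lt hul)
  have hs : s ∈ Ioo (s₀ - K⁻¹) (s₀ + K⁻¹) := ⟨by linarith, by linarith⟩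
  rw [hxr]
  refine (hG.mem_iff s hs η (hco.2.trans_lt hul)).2 ?_
  obtain ⟨ξ, hξ, e⟩ := hG.exists_taylor_second hK0 hs
  have h2 := (abs_le.1 (hG.deriv_le 2 (by norm_num) (by norm_num) ξ hξ)).2
  have h3 : (s - s₀) ^ 2 < K⁻¹ * t := by
    have : 2 * r * (β * t) ≤ K⁻¹ * t := by
      rw [hrK]
      have : β * t ≤ 1 * t := by gcongr
      rw [one_mul] at this
      gcongr
    nlinarith [sq_nonneg (η - ρ s₀)]
  have h4 : iteratedDeriv 2 ρ ξ / 2 * (s - s₀) ^ 2 ≤ K / 2 * (s - s₀) ^ 2 := by gcongr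
  have h5 : K / 2 * (s - s₀) ^ 2 ≤ K / 2 * (K⁻¹ * t) := by gcongr
  have h6 : K / 2 * (K⁻¹ * t) = t / 2 := by field_simp
  rw [← hm] at e
  linarith

theorem GraphNear.exists_touching_ball (hG : GraphNear K D o e₁ e₂ ρ s₀) (hK : 1 ≤ K) :
    ∃ n : Plane, ‖n‖ = 1 ∧
      Metric.ball (o + s₀ • e₁ + ρ s₀ • e₂ + (2 * K)⁻¹ • n) (2 * K)⁻¹ ⊆ D := by
  set m := iteratedDeriv 1 ρ s₀ with hm
  have h1 : 1 ≤ Real.sqrt (1 + m ^ 2) := Real.one_le_sqrt.2 (by nlinarith [sq_nonneg m])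
  set β : ℝ := (Real.sqrt (1 + m ^ 2))⁻¹ with hβ
  have hn : ‖β • (e₂ - m • e₁)‖ = 1 := by
    have e : e₂ - m • e₁ = (-m) • e₁ + (1 : ℝ) • e₂ := by module
    have h2 : ‖e₂ - m • e₁‖ = Real.sqrt (1 + m ^ 2) := by
      rw [← Real.sqrt_sq (norm_nonneg (e₂ - m • e₁)), e, hG.frame_norm_sq]
      congr 1; ring
    rw [norm_smul, h2, hβ, norm_inv, Real.norm_eq_abs, abs_of_pos (by linarith)]
    exact inv_mul_cancel₀ (by linarith)
  exact ⟨_, hn, hG.touching_ball hK (by positivity) (inv_le_one_of_one_le₀ h1) hn⟩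

/-- Uniform convexity of the boundary near a point bounds the domain by a paraboloid. -/
theorem GraphNear.norm_sq_le (hG : GraphNear K D o e₁ e₂ ρ s₀) (hK : 1 ≤ K)
    (hD : Convex ℝ D) (hDb : D ⊆ Metric.ball 0 K)
    (hconv : ∀ s ∈ Ioo (s₀ - K⁻¹) (s₀ + K⁻¹), K⁻¹ ≤ iteratedDeriv 2 ρ s)
    {p n x : Plane} (hp : p = o + s₀ • e₁ + ρ s₀ • e₂) (hn : ‖n‖ = 1)
    (hsupp : ∀ x ∈ closure D, 0 ≤ inner ℝ n (x - p)) (hx : x ∈ closure D) :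
    ‖x - p‖ ^ 2 ≤ 128 * K ^ 6 * inner ℝ n (x - p) := by
  have hK0 : 0 < K := by linarith
  have hKi : 0 < K⁻¹ := inv_pos.2 hK0
  have hKi1 : K⁻¹ ≤ 1 := inv_le_one_of_one_le₀ hK
  have hs₀ := GraphNear.base_mem (s₀ := s₀) hK0
  set m := iteratedDeriv 1 ρ s₀ with hm
  have hmK : |m| ≤ K := hG.deriv_le 1 le_rfl (by norm_num) s₀ hs₀
  set α : ℝ := inner ℝ e₁ n with hα
  set β : ℝ := inner ℝ e₂ n with hβ
  have hnr : n = α • e₁ + β • e₂ := plane_decomposition hG.norm_fst hG.norm_snd hG.inner_eq n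
  have hsup : ∀ s η : ℝ, o + s • e₁ + η • e₂ ∈ closure D →
      0 ≤ α * (s - s₀) + β * (η - ρ s₀) := by
    intro s η h
    have := hsupp _ h
    have e : o + s • e₁ + η • e₂ - p = (s - s₀) • e₁ + (η - ρ s₀) • e₂ := by rw [hp]; module
    rwa [e, hnr, inner_coords hG.norm_fst hG.norm_snd hG.inner_eq] at this
  have hpcl : p ∈ closure D := by
    rw [hp]; exact hG.mem_closure hs₀ (by simpa using hKi)
  have hβ0 : 0 ≤ β := by
    have h1 : o + s₀ • e₁ + (ρ s₀ + K⁻¹ / 2) • e₂ ∈ closure D := by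
      refine subset_closure ((hG.mem_iff s₀ hs₀ _ ?_).2 (by linarith))
      rw [add_sub_cancel_left, abs_of_pos (by positivity)]
      linarith
    have h2 := hsup _ _ h1
    rw [sub_self, mul_zero, zero_add, add_sub_cancel_left] at h2
    exact nonneg_of_mul_nonneg_left h2 (by positivity)
  -- The supporting functional ⟨n, · − p⟩ has a minimum at p along the graph, so n is normal to the
  -- graph.
  have hαβ : α = -(β * m) := by
    have hmin : IsLocalMin (fun s => α * (s - s₀) + β * (ρ s - ρ s₀)) s₀ := by
      have hc : ContinuousAt (fun s => |ρ s - ρ s₀|) s₀ :=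
        ((hG.hasDerivAt_zero hs₀).continuousAt.sub continuousAt_const).abs
      have h0 : |ρ s₀ - ρ s₀| < K⁻¹ := by simpa using hKi
      filter_upwards [isOpen_Ioo.mem_nhds hs₀, hc.eventually_lt continuousAt_const h0] with s h1 h2
      have := hsup _ _ (hG.mem_closure h1 h2)
      simpa using this
    have hd : HasDerivAt (fun s => α * (s - s₀) + β * (ρ s - ρ s₀)) (α * 1 + β * m) s₀ :=
      (((hasDerivAt_id s₀).sub_const s₀).const_mul α).add
        (((hG.hasDerivAt_zero hs₀).sub_const _).const_mul β)
    have := hmin.hasDerivAt_eq_zero hd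
    linarith
  have hab : α ^ 2 + β ^ 2 = 1 := by
    rw [← hG.frame_norm_sq α β, ← hnr, hn]; norm_num
  -- From β²(1 + m²) = 1 and |m| ≤ K.
  have hβK : 1 ≤ 2 * K * β := by
    have h1 : m ^ 2 ≤ K ^ 2 := sq_le_sq.2 (by rwa [abs_of_pos hK0])
    have h2 : 1 ≤ (2 * K * β) ^ 2 := by
      rw [hαβ] at hab
      nlinarith [sq_nonneg β, mul_le_mul_of_nonneg_left h1 (sq_nonneg β), sq_nonneg (K - 1)]
    by_contra hcon
    push Not at hcon
    have : 0 ≤ 2 * K * β := by positivity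
    nlinarith
  -- the estimate near `p`
  have hloc : ∀ u : Plane, p + u ∈ closure D → ‖u‖ < K⁻¹ → ‖u‖ ^ 2 ≤ 32 * K ^ 4 * inner ℝ n u := by
    intro u hu hul
    set σ : ℝ := inner ℝ e₁ u with hσ
    set θ : ℝ := inner ℝ e₂ u with hθ
    have hur : u = σ • e₁ + θ • e₂ := plane_decomposition hG.norm_fst hG.norm_snd hG.inner_eq u
    have hco := abs_le_norm_coords hG.norm_fst hG.norm_snd hG.inner_eq σ θ
    rw [← hur] at hco
    have hσ' := abs_lt.1 (hco.1.trans_lt hul)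
    have hs : s₀ + σ ∈ Ioo (s₀ - K⁻¹) (s₀ + K⁻¹) := ⟨by linarith, by linarith⟩
    have e : p + u = o + (s₀ + σ) • e₁ + (ρ s₀ + θ) • e₂ := by
      rw [hp]; nth_rewrite 1 [hur]; module
    have h1 : ρ (s₀ + σ) ≤ ρ s₀ + θ := hG.le_of_mem_closure hs
      (by rw [add_sub_cancel_left]; exact hco.2.trans_lt hul) (e ▸ hu)
    obtain ⟨ξ, hξ, e'⟩ := hG.exists_taylor_second hK0 hs
    rw [add_sub_cancel_left, ← hm] at e'
    have h2 := hconv ξ hξ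
    set t : ℝ := θ - m * σ with ht
    have hin : inner ℝ n u = β * t := by
      rw [hnr, hur, inner_coords hG.norm_fst hG.norm_snd hG.inner_eq, hαβ, ht]; ring
    have hn2 : ‖u‖ ^ 2 = σ ^ 2 + θ ^ 2 := by
      conv_lhs => rw [hur]
      exact hG.frame_norm_sq σ θ
    have h3 : K⁻¹ / 2 * σ ^ 2 ≤ t := by
      have : K⁻¹ / 2 * σ ^ 2 ≤ iteratedDeriv 2 ρ ξ / 2 * σ ^ 2 := by gcongr
      linarith
    have h3' : σ ^ 2 ≤ 2 * K * t := by
      have : σ ^ 2 = 2 * K * (K⁻¹ / 2 * σ ^ 2) := by field_simp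
      rw [this]; gcongr
    have ht0 : 0 ≤ t := le_trans (by positivity) h3
    have ht2 : t ≤ 2 := by
      have h4 : |m * σ| ≤ K * K⁻¹ := by
        rw [abs_mul]; exact mul_le_mul hmK (hco.1.trans hul.le) (abs_nonneg _) hK0.le
      rw [mul_inv_cancel₀ hK0.ne'] at h4
      have := (abs_le.1 h4).1
      have := (abs_le.1 (hco.2.trans hul.le)).2
      linarith
    have hm2 : m ^ 2 ≤ K ^ 2 := sq_le_sq.2 (by rwa [abs_of_pos hK0])
    have h5 : θ ^ 2 ≤ 2 * t ^ 2 + 2 * K ^ 2 * σ ^ 2 := by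
      have : θ = t + m * σ := by rw [ht]; ring
      rw [this]
      nlinarith [sq_nonneg (t - m * σ), mul_le_mul_of_nonneg_right hm2 (sq_nonneg σ)]
    have h6 : ‖u‖ ^ 2 ≤ (4 + 2 * K + 4 * K ^ 3) * t := by
      have b1 := mul_le_mul_of_nonneg_left h3' (by positivity : 0 ≤ 2 * K ^ 2)
      have b2 := mul_le_mul_of_nonneg_left ht2 ht0
      have b3 : (4 + 2 * K + 4 * K ^ 3) * t =
        2 * (t * 2) + 2 * K * t + 2 * K ^ 2 * (2 * K * t) := by ring
      have b4 : t ^ 2 = t * t := sq t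
      rw [hn2, b3]
      linarith
    have h7 : (4 + 2 * K + 4 * K ^ 3) ≤ 32 * K ^ 4 * β := by
      have a1 : 1 ≤ K ^ 3 := one_le_pow₀ hK
      have a2 : K ≤ K ^ 3 := le_self_pow₀ hK (by norm_num)
      calc 4 + 2 * K + 4 * K ^ 3 ≤ 16 * K ^ 3 * 1 := by linarith
        _ ≤ 16 * K ^ 3 * (2 * K * β) := by gcongr
        _ = _ := by ring
    rw [hin]
    calc ‖u‖ ^ 2 ≤ _ := h6
      _ ≤ 32 * K ^ 4 * β * t := by gcongr
      _ = _ := by ring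
  have hcb : ∀ y ∈ closure D, ‖y‖ ≤ K := by
    intro y hy
    have := closure_mono hDb hy
    simpa using Metric.closure_ball_subset_closedBall this
  have hxp : ‖x - p‖ ≤ 2 * K := by
    have := norm_sub_le x p
    linarith [hcb x hx, hcb p hpcl]
  -- Contraction towards p by 1/(4K²) brings every point of the closure within K⁻¹ of p. The
  -- inequality is quadratic on the left and linear on the right, so undoing the contraction costs a
  -- factor 4K².
  set lam : ℝ := 1 / (4 * K ^ 2) with hlam
  have hlam0 : 0 < lam := by positivity
  have hlam1 : lam ≤ 1 := by
    rw [hlam, div_le_one (by positivity)]; nlinarith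
  have hmem : p + lam • (x - p) ∈ closure D :=
    hD.closure.add_smul_sub_mem hpcl hx ⟨hlam0.le, hlam1⟩
  have := hloc _ hmem (by
    rw [norm_smul, Real.norm_eq_abs, abs_of_pos hlam0]
    calc lam * ‖x - p‖ ≤ lam * (2 * K) := by gcongr
      _ = K⁻¹ / 2 := by rw [hlam]; field_simp; norm_num
      _ < K⁻¹ := by linarith)
  rw [norm_smul, Real.norm_eq_abs, abs_of_pos hlam0, inner_smul_right, mul_pow] at this
  have h1 : lam * (lam * ‖x - p‖ ^ 2) ≤ lam * (32 * K ^ 4 * inner ℝ n (x - p)) := by linarith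
  have h2 := le_of_mul_le_mul_left h1 hlam0
  have h3 : ‖x - p‖ ^ 2 = 4 * K ^ 2 * (lam * ‖x - p‖ ^ 2) := by rw [hlam]; field_simp
  rw [h3]
  calc _ ≤ 4 * K ^ 2 * (32 * K ^ 4 * inner ℝ n (x - p)) := by gcongr
    _ = _ := by ring

end BoundaryGeometry

/-! ### A criterion for admissibility -/

section AdmissiblePairs

/-- The tangent line of a touching ball supports the convex set. If x were strictly behind it, a
short step from p in the direction p − x would enter D, and p would lie between that point and x,
hence in D. -/
theorem inner_nonneg_of_touching {E : Type*} [NormedAddCommGroup E] [InnerProductSpace ℝ E]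
    {D : Set E} (hD : IsOpen D) (hconv : Convex ℝ D) {p n x : E} {R : ℝ} (hR : 0 < R)
    (hn : ‖n‖ = 1) (hball : Metric.ball (p + R • n) R ⊆ D) (hp : p ∉ D) (hx : x ∈ closure D) :
    0 ≤ inner ℝ n (x - p) := by
  by_contra hcon
  push Not at hcon
  have h1 : 0 < inner ℝ n (p - x) := by
    rw [← neg_sub, inner_neg_right]; linarith
  obtain ⟨t, ht, ht0⟩ := ((RegularOn.exists_mem_of_inner_pos hR hn hball h1).and
    self_mem_nhdsWithin).exists
  have ht0' : 0 < t := ht0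
  have := combo_mem_of_closure hD hconv ht hx (a := 1 / (1 + t)) (b := t / (1 + t))
    (by positivity) (by positivity) (by field_simp)
  refine hp ?_
  convert this using 1
  match_scalars <;> field_simp
  ring

/-- A nearest complement point of an interior point m is a boundary point; if m is not interior, it
serves itself. This converts failure of a ball inclusion into a boundary point at which a normal is
available. -/
theorem exists_not_mem_closure_near {E : Type*} [NormedAddCommGroup E] [NormedSpace ℝ E]
    [FiniteDimensional ℝ E] {D : Set E} (hD : IsOpen D) {m u : E} (hm : m ∈ closure D) (hu : u ∉ D) :
    ∃ p ∈ closure D, p ∉ D ∧ ‖p - m‖ ≤ ‖u - m‖ := by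
  by_cases hmD : m ∈ D
  · obtain ⟨p, hp, hd⟩ := exists_mem_frontier_infDist_compl_eq_dist hmD
      (fun h => hu (h ▸ mem_univ u))
    rw [hD.frontier_eq] at hp
    refine ⟨p, hp.1, hp.2, ?_⟩
    rw [← dist_eq_norm, ← dist_eq_norm, dist_comm, ← hd, dist_comm]
    exact Metric.infDist_le_dist_of_mem hu
  · exact ⟨m, hm, hmD, by simp⟩

set_option maxHeartbeats 1000000 in
/-- Pairs of points that are not both near the degenerate boundary point `0` are admissible. -/
theorem exists_admissiblePair {K c₂ : ℝ} (hK : 2 ≤ K) (hc₂ : 0 < c₂) :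
    ∃ c₁ > 0, ∀ K₁ : ℝ, 1 ≤ K₁ → ∃ K' ≥ 2, ∀ {D : Set Plane} {e : Plane} {H : ℝ}, IsOpen D →
      Convex ℝ D → D ⊆ Metric.ball 0 K → D ⊆ Metric.ball 0 K₁ → ‖e‖ = 1 → 1 ≤ H →
      Metric.ball (K⁻¹ • e) K⁻¹ ⊆ D →
      (∀ p ∈ closure D, p ∉ D → inner ℝ e p ≤ 2 * H → ∃ n : Plane, ‖n‖ = 1 ∧
        Metric.ball (p + K⁻¹ • n) K⁻¹ ⊆ D) →
      (∀ p ∈ closure D, p ∉ D → inner ℝ e p ≤ 2 * H → c₁ ≤ ‖p‖ →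
        ∃ (o e₁ e₂ : Plane) (ρ : ℝ → ℝ) (s₀ : ℝ), GraphNear K₁ D o e₁ e₂ ρ s₀ ∧
          (∀ s ∈ Ioo (s₀ - K₁⁻¹) (s₀ + K₁⁻¹), K₁⁻¹ ≤ iteratedDeriv 2 ρ s) ∧
            p = o + s₀ • e₁ + ρ s₀ • e₂) →
      ∀ {y₁ y₂ : Plane}, y₁ ≠ y₂ → y₁ ∈ closure D → y₂ ∈ closure D → inner ℝ e y₁ ≤ H →
        inner ℝ e y₂ ≤ H → (c₂ ≤ inner ℝ e y₁ ∨ c₂ ≤ inner ℝ e y₂) → AdmissiblePair K' D y₁ y₂ := by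
  have hK0 : 0 < K := by linarith
  -- c₁ depends on K and c₂ only and is chosen before K₁, because the convexity constant of the
  -- boundary at distance at least c₁ from 0 is available only once c₁ is fixed. It makes normals at
  -- boundary points closer to 0 than c₁ deviate from e by at most c₂/(4K).
  set c₁ : ℝ := min (c₂ ^ 2 / (32 * K ^ 3)) (c₂ / 4) with hc₁
  have hc₁0 : 0 < c₁ := by positivity
  have hc₁a : 2 * K ^ 3 * c₁ ≤ (c₂ / 4) ^ 2 := by
    have h1 := min_le_left (c₂ ^ 2 / (32 * K ^ 3)) (c₂ / 4)
    rw [← hc₁] at h1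
    calc 2 * K ^ 3 * c₁ ≤ 2 * K ^ 3 * (c₂ ^ 2 / (32 * K ^ 3)) := by gcongr
      _ = (c₂ / 4) ^ 2 := by field_simp; norm_num
  have hc₁b : c₁ ≤ c₂ / 4 := min_le_right _ _
  refine ⟨c₁, hc₁0, fun K₁ hK₁ => ?_⟩
  set K' : ℝ := 1 + K + 4 * K ^ 2 + K₁ + 512 * K₁ ^ 6 + 24 * K ^ 2 / c₂ with hK'
  have q1 : 0 < 4 * K ^ 2 := by positivity
  have q2 : 0 < 512 * K₁ ^ 6 := by positivity
  have q3 : 0 < 24 * K ^ 2 / c₂ := by positivity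
  have hK'0 : 0 < K' := by positivity
  have hKK' : K ≤ K' := by linarith
  have hKi : K'⁻¹ ≤ K⁻¹ := by gcongr
  have hK'c : 24 * K ^ 2 ≤ K' * c₂ := by
    have : 24 * K ^ 2 / c₂ ≤ K' := by linarith
    rwa [div_le_iff₀ hc₂] at this
  refine ⟨K', by linarith, ?_⟩
  intro D e H hD hconv hDb hDb₁ he hH h0 htouch hgraph y₁ y₂ hne hy₁ hy₂ hH₁ hH₂ hor
  have hcb : ∀ y ∈ closure D, ‖y‖ ≤ K := by
    intro y hy
    have := closure_mono hDb hy
    simpa using Metric.closure_ball_subset_closedBall this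
  have hKi0 : 0 < K⁻¹ := inv_pos.2 hK0
  have hdist : ∀ x ∈ closure D, ∀ y ∈ closure D, ‖x - y‖ ^ 2 ≤ 4 * K ^ 2 := by
    intro x hx y hy
    have h1 : ‖x - y‖ ≤ 2 * K := by linarith [norm_sub_le x y, hcb x hx, hcb y hy]
    calc ‖x - y‖ ^ 2 ≤ (2 * K) ^ 2 := by gcongr
      _ = 4 * K ^ 2 := by ring
  -- near the origin the normal is almost `e`
  have hnear : ∀ p, p ∉ D → ‖p‖ < c₁ → ∀ n : Plane, ‖n‖ = 1 →
      Metric.ball (p + K⁻¹ • n) K⁻¹ ⊆ D → ∀ x ∈ closure D, c₂ ≤ inner ℝ e x →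
      c₂ / 2 ≤ inner ℝ n (x - p) := by
    intro p hpD hpc n hn hb x hx hxc
    have hnn : inner ℝ n n = (1 : ℝ) := by rw [real_inner_self_eq_norm_sq, hn]; norm_num
    have hnp : |inner ℝ n p| ≤ c₁ := by
      have := abs_real_inner_le_norm n p
      rw [hn, one_mul] at this
      linarith
    -- This is the point of the closed ball touching at 0 that is extremal in the direction −n. The
    -- supporting inequality at p, tested on it, gives ⟨n, e⟩ ≥ 1 − Kc₁, so n is close to e.
    have h1 : K⁻¹ • e - K⁻¹ • n ∈ closure D := by
      refine closure_mono h0 ?_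
      rw [closure_ball _ hKi0.ne', mem_closedBall_iff_norm, sub_sub_cancel_left, norm_neg,
        norm_smul, hn, mul_one, Real.norm_eq_abs, abs_of_pos hKi0]
    have h2 := inner_nonneg_of_touching hD hconv hKi0 hn hb hpD h1
    rw [inner_sub_right, inner_sub_right, inner_smul_right, inner_smul_right, hnn, mul_one] at h2
    have h3 : 1 - K * c₁ ≤ inner ℝ n e := by
      have : K * (K⁻¹ * inner ℝ n e - K⁻¹ - inner ℝ n p) = inner ℝ n e - 1 - K * inner ℝ n p := by
        field_simp
      have h4 : 0 ≤ inner ℝ n e - 1 - K * inner ℝ n p := by rw [← this]; positivity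
      have h5 := (abs_le.1 hnp).1
      nlinarith
    have h4 : ‖n - e‖ ^ 2 ≤ 2 * K * c₁ := by
      rw [norm_sub_sq_real, hn, he]; linarith
    have h5 : ‖n - e‖ * K ≤ c₂ / 4 := by
      refine le_of_sq_le_sq ?_ (by positivity)
      rw [mul_pow]
      calc ‖n - e‖ ^ 2 * K ^ 2 ≤ 2 * K * c₁ * K ^ 2 := by gcongr
        _ = 2 * K ^ 3 * c₁ := by ring
        _ ≤ _ := hc₁a
    have h6 : |inner ℝ (n - e) x| ≤ c₂ / 4 := by
      refine (abs_real_inner_le_norm _ _).trans (le_trans ?_ h5)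
      have := hcb x hx
      gcongr
    rw [inner_sub_left] at h6
    rw [inner_sub_right]
    have := (abs_le.1 h6).1
    have := (abs_le.1 hnp).2
    linarith
  have hfar : ∀ p ∈ closure D, p ∉ D → inner ℝ e p ≤ 2 * H → c₁ ≤ ‖p‖ → ∀ n : Plane, ‖n‖ = 1 →
      Metric.ball (p + K⁻¹ • n) K⁻¹ ⊆ D → ∀ x ∈ closure D,
      ‖x - p‖ ^ 2 ≤ 128 * K₁ ^ 6 * inner ℝ n (x - p) := by
    intro p hp hpD hpH hpc n hn hb x hx
    obtain ⟨o, e₁, e₂, ρ, s₀, hG, hc, ho⟩ := hgraph p hp hpD hpH hpc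
    exact hG.norm_sq_le hK₁ hconv hDb₁ hc ho hn
      (fun x hx => inner_nonneg_of_touching hD hconv hKi0 hn hb hpD hx) hx
  have htouch' : ∀ y ∈ closure D, inner ℝ e y ≤ H → ∀ x ∈ closure D,
      (c₂ ≤ inner ℝ e y ∨ c₂ ≤ inner ℝ e x) →
      y ∈ D ∨ ∃ n : Plane, ‖n‖ = 1 ∧ Metric.ball (y + K'⁻¹ • n) K'⁻¹ ⊆ D ∧
        ‖x - y‖ ^ 2 ≤ K' * inner ℝ n (x - y) := by
    intro y hy hyH x hx hor
    by_cases hyD : y ∈ D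
    · exact Or.inl hyD
    obtain ⟨n, hn, hb⟩ := htouch y hy hyD (by linarith)
    refine Or.inr ⟨n, hn, (touching_ball_subset hKi hn).trans hb, ?_⟩
    have hnn := inner_nonneg_of_touching hD hconv hKi0 hn hb hyD hx
    rcases le_or_gt c₁ ‖y‖ with hyc | hyc
    · refine (hfar y hy hyD (by linarith) hyc n hn hb x hx).trans ?_
      gcongr
      linarith
    · have hey : inner ℝ e y < c₂ := by
        have := real_inner_le_norm e y
        rw [he, one_mul] at this
        linarith
      have hex : c₂ ≤ inner ℝ e x := hor.resolve_left (not_le.2 hey)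
      have h1 := hnear y hyD hyc n hn hb x hx hex
      calc ‖x - y‖ ^ 2 ≤ 4 * K ^ 2 := hdist x hx y hy
        _ ≤ K' * (c₂ / 2) := by linarith
        _ ≤ _ := by gcongr
  refine
    { ne := hne
      mem_fst := hy₁
      mem_snd := hy₂
      touch_fst := htouch' y₁ hy₁ hH₁ y₂ hy₂ hor
      touch_snd := htouch' y₂ hy₂ hH₂ y₁ hy₁ hor.symm
      ball_subset := ?_
      graph := ?_ }
  · intro u hu
    rw [mem_ball_iff_norm] at hu
    by_contra huD
    set m : Plane := y₁ + (1 / 2 : ℝ) • (y₂ - y₁) with hm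
    have hmcl : m ∈ closure D :=
      hconv.closure.add_smul_sub_mem hy₁ hy₂ ⟨by norm_num, by norm_num⟩
    -- A boundary point p within ε of the midpoint would have normal distances to y₁ and y₂ with sum
    -- at most 2ε. Far from 0 the paraboloid bound makes this sum at least a multiple of l²; near 0
    -- the point of height c₂ makes it at least c₂/2. Both contradict the choice of K'.
    obtain ⟨p, hp, hpD, hpm⟩ := exists_not_mem_closure_near hD hmcl huD
    set l := ‖y₂ - y₁‖ with hl
    have hl0 : 0 < l := norm_pos_iff.2 (sub_ne_zero.2 hne.symm)
    set ε := l ^ 2 / K' with hε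
    have hεK : ε * K' = l ^ 2 := by rw [hε]; field_simp
    have hpε : ‖p - m‖ < ε := hpm.trans_lt hu
    have hl4 : l ^ 2 ≤ 4 * K ^ 2 := hdist y₂ hy₂ y₁ hy₁
    have hε1 : ε ≤ 1 := by
      rw [hε, div_le_one hK'0]; linarith
    have hpH : inner ℝ e p ≤ 2 * H := by
      have h1 : inner ℝ e m ≤ H := by
        rw [hm, inner_add_right, inner_smul_right, inner_sub_right]; linarith
      have h2 := real_inner_le_norm e (p - m)
      rw [he, one_mul, inner_sub_right] at h2
      linarith
    obtain ⟨n, hn, hb⟩ := htouch p hp hpD hpH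
    have hn₁ := inner_nonneg_of_touching hD hconv hKi0 hn hb hpD hy₁
    have hn₂ := inner_nonneg_of_touching hD hconv hKi0 hn hb hpD hy₂
    have hsum : inner ℝ n (y₁ - p) + inner ℝ n (y₂ - p) ≤ 2 * ε := by
      have e1 : inner ℝ n (y₁ - p) + inner ℝ n (y₂ - p) = 2 * inner ℝ n (m - p) := by
        have e2 : y₁ - p + (y₂ - p) = (2 : ℝ) • (m - p) := by rw [hm]; module
        rw [← inner_add_right, e2, inner_smul_right]
      have h2 := real_inner_le_norm n (m - p)
      rw [hn, one_mul, norm_sub_rev] at h2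
      linarith
    rcases le_or_gt c₁ ‖p‖ with hpc | hpc
    · have f1 := hfar p hp hpD hpH hpc n hn hb y₁ hy₁
      have f2 := hfar p hp hpD hpH hpc n hn hb y₂ hy₂
      have h3 : l ^ 2 ≤ 2 * (‖y₁ - p‖ ^ 2 + ‖y₂ - p‖ ^ 2) := by
        have e1 : y₂ - y₁ = (y₂ - p) - (y₁ - p) := by abel
        have h4 := norm_sub_le (y₂ - p) (y₁ - p)
        rw [← e1, ← hl] at h4
        nlinarith [sq_nonneg (‖y₂ - p‖ - ‖y₁ - p‖), norm_nonneg (y₂ - p), norm_nonneg (y₁ - p)]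
      have h4 : l ^ 2 ≤ 256 * K₁ ^ 6 * (2 * ε) := by
        calc l ^ 2 ≤ 256 * K₁ ^ 6 * (inner ℝ n (y₁ - p) + inner ℝ n (y₂ - p)) := by linarith
          _ ≤ _ := by gcongr
      have hε0 : 0 < ε := by positivity
      have h5 : 512 * K₁ ^ 6 * ε < K' * ε := mul_lt_mul_of_pos_right (by linarith) hε0
      linarith
    · have h3 : c₂ / 2 ≤ 2 * ε := by
        rcases hor with h | h
        · linarith [hnear p hpD hpc n hn hb y₁ hy₁ h]
        · linarith [hnear p hpD hpc n hn hb y₂ hy₂ h]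
      have h4 := mul_le_mul_of_nonneg_left h3 hK'0.le
      have h5 : 0 < K ^ 2 := by positivity
      linarith
  · intro h1 h2 hl
    -- If y₁ were within c₁ of 0, then y₂ would be the one of height at least c₂, and the pair could
    -- not be short.
    have hy₁c : c₁ ≤ ‖y₁‖ := by
      by_contra hcon
      push Not at hcon
      have h3 := real_inner_le_norm e y₁
      rw [he, one_mul] at h3
      have h4 : c₂ ≤ inner ℝ e y₂ := hor.resolve_left (by linarith)
      have h5 := real_inner_le_norm e (y₂ - y₁)
      rw [he, one_mul, inner_sub_right] at h5
      have h6 : c₂ / 2 < K'⁻¹ := by linarith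
      have h7 : K' * (c₂ / 2) < 1 := by
        calc K' * (c₂ / 2) < K' * K'⁻¹ := by gcongr
          _ = 1 := mul_inv_cancel₀ hK'0.ne'
      have h8 : 1 ≤ K ^ 2 := one_le_pow₀ (by linarith)
      linarith
    obtain ⟨o, e₁, e₂, ρ, s₀, hG, hc, ho⟩ := hgraph y₁ hy₁ h1 (by linarith) hy₁c
    have hK₁K : K₁ ≤ K' := by linarith
    have hi : K'⁻¹ ≤ K₁⁻¹ := by gcongr
    exact ⟨o, e₁, e₂, ρ, s₀, hG.mono (by linarith) hK₁K, fun s hs =>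
      hi.trans (hc s (Ioo_subset_Ioo (by linarith) (by linarith) hs)), ho⟩

end AdmissiblePairs

/-! ### The boundary near the degenerate point -/

section OriginChart

/-- Lagrange's form of the remainder for a function whose derivatives of order less than n vanish at
0, by induction through Cauchy's mean value theorem against t^(n+1)/(n+1)!. Here `c i` plays the
role of the i-th derivative. -/
theorem exists_eq_of_chain (n : ℕ) : ∀ {c : ℕ → ℝ → ℝ} {r : ℝ},
    (∀ i < n, ∀ t ∈ Ioo (-r) r, HasDerivAt (c i) (c (i + 1) t) t) → (∀ i < n, c i 0 = 0) →
    ∀ t ∈ Ioo (-r) r, ∃ ξ, |ξ| ≤ |t| ∧ c 0 t = c n ξ * (t ^ n / n.factorial) := by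
  induction n with
  | zero => intro c r _ _ t _; exact ⟨t, le_rfl, by simp⟩
  | succ n ih =>
    intro c r hc h0 t ht
    have hd : ∀ s ∈ Ioo (-r) r, HasDerivAt (c 0) (c 1 s) s := fun s hs => hc 0 (by omega) s hs
    have hp : ∀ s : ℝ, HasDerivAt (fun s : ℝ => s ^ (n + 1) / ((n + 1).factorial : ℝ))
        (s ^ n / n.factorial) s := by
      intro s
      refine ((hasDerivAt_pow (n + 1) s).div_const _).congr_deriv ?_
      rw [Nat.factorial_succ]
      push_cast
      have : (n.factorial : ℝ) ≠ 0 := by positivity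
      have : (n : ℝ) + 1 ≠ 0 := by positivity
      field_simp
    have hih := ih (c := fun i => c (i + 1)) (r := r) (fun i hi => hc (i + 1) (by omega))
      (fun i hi => h0 (i + 1) (by omega))
    have key : ∀ s ∈ Ioo (-r) r, s ≠ 0 → |s| ≤ |t| →
        t ^ (n + 1) / ((n + 1).factorial : ℝ) * c 1 s = c 0 t * (s ^ n / n.factorial) →
        ∃ ξ, |ξ| ≤ |t| ∧ c 0 t = c (n + 1) ξ * (t ^ (n + 1) / (n + 1).factorial) := by
      intro s hs hs0 hst e
      obtain ⟨ξ, hξ, e1⟩ := hih s hs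
      refine ⟨ξ, hξ.trans hst, ?_⟩
      simp only [zero_add] at e1
      rw [e1] at e
      have : s ^ n / (n.factorial : ℝ) ≠ 0 := by positivity
      refine mul_right_cancel₀ this ?_
      linarith
    have h00 := h0 0 (by omega)
    have hz : (0 : ℝ) ^ (n + 1) / ((n + 1).factorial : ℝ) = 0 := by simp
    rcases lt_trichotomy t 0 with h | h | h
    · obtain ⟨s, hs, e⟩ := exists_ratio_hasDerivAt_eq_ratio_slope (c 0) (c 1) h
        (fun s hs => (hd s ⟨by linarith [hs.1, ht.1], by linarith [hs.2, ht.1]⟩).continuousAt.continuousWithinAt)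
        (fun s hs => hd s ⟨by linarith [hs.1, ht.1], by linarith [hs.2, ht.1]⟩) _ _
        (fun s _ => (hp s).continuousAt.continuousWithinAt) (fun s _ => hp s)
      rw [h00, hz] at e
      refine key s ⟨by linarith [hs.1, ht.1], by linarith [hs.2, ht.1]⟩ hs.2.ne ?_ (by linarith)
      rw [abs_of_neg hs.2, abs_of_neg h]; linarith [hs.1]
    · subst h
      exact ⟨0, le_rfl, by rw [h00]; simp⟩
    · obtain ⟨s, hs, e⟩ := exists_ratio_hasDerivAt_eq_ratio_slope (c 0) (c 1) h
        (fun s hs => (hd s ⟨by linarith [hs.1, ht.2], by linarith [hs.2, ht.2]⟩).continuousAt.continuousWithinAt)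
        (fun s hs => hd s ⟨by linarith [hs.1, ht.2], by linarith [hs.2, ht.2]⟩) _ _
        (fun s _ => (hp s).continuousAt.continuousWithinAt) (fun s _ => hp s)
      rw [h00, hz] at e
      refine key s ⟨by linarith [hs.1, ht.2], by linarith [hs.2, ht.2]⟩ hs.1.ne' ?_ (by linarith)
      rw [abs_of_pos hs.1, abs_of_pos h]; linarith [hs.2]

/-- Near `0`, the set `Ω` lies above the graph of `ρ`, which is comparable to `t ^ k` together with
its derivatives. -/
structure OriginChart (k : ℕ) (Ω : Set Plane) (ρ : ℝ → ℝ) (r c C : ℝ) : Prop where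
  pos : 0 < r
  low_pos : 0 < c
  contDiffOn : ContDiffOn ℝ 4 ρ (Ioo (-r) r)
  mem_iff : ∀ x : Plane, |x 0| < r → |x 1| < r → (x ∈ Ω ↔ ρ (x 0) < x 1)
  deriv_le : ∀ i ≤ 4, ∀ t ∈ Ioo (-r) r, |iteratedDeriv i ρ t| ≤ C * |t| ^ (k - i)
  le_second : ∀ t ∈ Ioo (-r) r, c * |t| ^ (k - 2) ≤ iteratedDeriv 2 ρ t
  le_value : ∀ t ∈ Ioo (-r) r, c * |t| ^ k ≤ ρ t

/-- On a short interval the k-th derivative stays within |a|/2 of its value a at 0. Taylor's formula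
of order k − i for the i-th derivative then gives the power bounds; the parity of k turns t^k and
t^(k−2) into powers of |t|. -/
theorem IsDegenerateAtOrigin.exists_originChart {k : ℕ} (hk4 : 4 ≤ k) (hk : Even k) {β : ℝ}
    {Ω : Set Plane} (hconv : Convex ℝ Ω) (hdeg : IsDegenerateAtOrigin k β Ω) :
    ∃ ρ r c C, OriginChart k Ω ρ r c C := by
  obtain ⟨ρ, r₀, hgraph, hmem, hd1, hdi, hdk, -⟩ := hdeg
  have hr₀ := hgraph.pos
  have hρ0 := hgraph.graph_zero
  have hiff : ∀ x : Plane, |x 0| < r₀ → |x 1| < r₀ → (x ∈ Ω ↔ ρ (x 0) < x 1) := fun x h1 h2 =>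
    hgraph.mem_iff x h1 h2
  have hCk : ContDiffOn ℝ k ρ (Ioo (-r₀) r₀) :=
    hmem.contDiffOn.of_le (by exact_mod_cast Nat.le_add_right _ _)
  set a := iteratedDeriv k ρ 0 with ha
  have h0 : (0 : ℝ) ∈ Ioo (-r₀) r₀ := ⟨by linarith, hr₀⟩
  have hcont : ContinuousAt (iteratedDeriv k ρ) 0 := by
    have h1 := (hCk.continuousOn_iteratedDerivWithin le_rfl isOpen_Ioo.uniqueDiffOn).continuousAt
      (isOpen_Ioo.mem_nhds h0)
    refine h1.congr ?_
    filter_upwards [isOpen_Ioo.mem_nhds h0] with t ht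
    exact iteratedDerivWithin_of_isOpen isOpen_Ioo ht
  obtain ⟨r₁, hr₁, hr₁'⟩ : ∃ r₁ > 0, ∀ t, |t| < r₁ → |iteratedDeriv k ρ t - a| < |a| / 2 := by
    have hpos : 0 < |a| / 2 := by positivity
    obtain ⟨r₁, h1, h2⟩ := Metric.continuousAt_iff.1 hcont _ hpos
    exact ⟨r₁, h1, fun t ht => by
      have := h2 (x := t) (by simpa using ht)
      rwa [Real.dist_eq] at this⟩
  set r := min r₀ r₁ with hr
  have hr0 : 0 < r := lt_min hr₀ hr₁
  have hrr₀ : r ≤ r₀ := min_le_left _ _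
  have hrr₁ : r ≤ r₁ := min_le_right _ _
  have hsub : Ioo (-r) r ⊆ Ioo (-r₀) r₀ := Ioo_subset_Ioo (by linarith) hrr₀
  have hzero : ∀ i < k, iteratedDeriv i ρ 0 = 0 := by
    intro i hi
    match i, hi with
    | 0, _ => simpa using hρ0
    | 1, _ => simpa using hd1
    | (j + 2), hj => exact hdi (j + 2) (by omega) (by omega)
  have htaylor : ∀ i ≤ 4, ∀ t ∈ Ioo (-r) r, ∃ ξ, |ξ| ≤ |t| ∧
      iteratedDeriv i ρ t = iteratedDeriv k ρ ξ * (t ^ (k - i) / (k - i).factorial) := by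
    intro i hi t ht
    have := exists_eq_of_chain (k - i) (c := fun j => iteratedDeriv (i + j) ρ) (r := r)
      (fun j hj s hs => hasDerivAt_iteratedDeriv (n := k) hCk (by omega) (hsub hs))
      (fun j hj => hzero _ (by omega)) t ht
    simpa [show i + (k - i) = k by omega] using this
  have hξ : ∀ t ∈ Ioo (-r) r, ∀ ξ : ℝ, |ξ| ≤ |t| → |iteratedDeriv k ρ ξ - a| < |a| / 2 := by
    intro t ht ξ h
    exact hr₁' ξ (h.trans_lt ((abs_lt.2 ht).trans_le hrr₁))
  -- Convexity decides the sign. If a < 0, the graph is negative on both sides of 0, so Ω contains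
  -- two points (±t, y) with y < 0, hence their midpoint (0, y), which lies below the graph.
  have hapos : 0 < a := by
    by_contra hcon
    have han : a < 0 := lt_of_le_of_ne (not_lt.1 hcon) hdk
    have hneg : ∀ t ∈ Ioo (-r) r, t ≠ 0 → ρ t < 0 := by
      intro t ht ht0
      obtain ⟨ξ, h1, h2⟩ := htaylor 0 (by norm_num) t ht
      have h3 := (abs_lt.1 (hξ t ht ξ h1)).2
      rw [abs_of_neg han] at h3
      rw [iteratedDeriv_zero, Nat.sub_zero] at h2
      rw [h2]
      have : 0 < t ^ k := hk.pow_pos ht0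
      exact mul_neg_of_neg_of_pos (by linarith) (by positivity)
    set t := r / 2 with ht
    have ht1 : t ∈ Ioo (-r) r := ⟨by linarith, by linarith⟩
    have ht2 : -t ∈ Ioo (-r) r := ⟨by linarith, by linarith⟩
    have n1 := hneg t ht1 (by positivity)
    have n2 := hneg (-t) ht2 (by rw [neg_ne_zero]; positivity)
    obtain ⟨y, hy1, hy2, hy3, hy4⟩ : ∃ y, ρ t < y ∧ ρ (-t) < y ∧ y < 0 ∧ -r₀ < y := by
      refine ⟨max (max (ρ t / 2) (ρ (-t) / 2)) (-r₀ / 2), ?_, ?_, ?_, ?_⟩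
      · exact (by linarith : ρ t < ρ t / 2).trans_le (by simp)
      · exact (by linarith : ρ (-t) < ρ (-t) / 2).trans_le (by simp)
      · simp only [max_lt_iff]; exact ⟨⟨by linarith, by linarith⟩, by linarith⟩
      · exact (by linarith : -r₀ < -r₀ / 2).trans_le (by simp)
    have hyr : |y| < r₀ := by rw [abs_lt]; constructor <;> linarith
    have m1 : (!₂[t, y] : Plane) ∈ Ω := (hiff _ (by simpa [abs_lt] using ⟨by linarith, by linarith⟩)
      (by simpa using hyr)).2 (by simpa using hy1)
    have m2 : (!₂[-t, y] : Plane) ∈ Ω := (hiff _ (by simpa [abs_lt] using ⟨by linarith, by linarith⟩)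
      (by simpa using hyr)).2 (by simpa using hy2)
    have m3 := hconv m1 m2 (a := 1 / 2) (b := 1 / 2) (by norm_num) (by norm_num) (by norm_num)
    have m4 := (hiff _ (by simpa using hr₀) (by simp; rw [← two_mul]; simpa using hyr)).1 m3
    simp [hρ0] at m4
    linarith
  refine ⟨ρ, r, a / 2 / k.factorial, 3 / 2 * a, hr0, by positivity,
    (hCk.mono hsub).of_le (by exact_mod_cast hk4),
    fun x h1 h2 => hiff x (h1.trans_le hrr₀) (h2.trans_le hrr₀), ?_, ?_, ?_⟩
  · intro i hi t ht
    obtain ⟨ξ, h1, h2⟩ := htaylor i hi t ht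
    have h3 := abs_lt.1 (hξ t ht ξ h1)
    rw [abs_of_pos hapos] at h3
    rw [h2, abs_mul, abs_div, abs_pow]
    have h4 : |iteratedDeriv k ρ ξ| ≤ 3 / 2 * a := by rw [abs_le]; constructor <;> linarith
    have h5 : |t| ^ (k - i) / |((k - i).factorial : ℝ)| ≤ |t| ^ (k - i) := by
      refine div_le_self (by positivity) ?_
      rw [abs_of_pos (by positivity)]
      exact_mod_cast Nat.one_le_iff_ne_zero.2 (Nat.factorial_ne_zero _)
    exact mul_le_mul h4 h5 (by positivity) (by positivity)
  · intro t ht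
    obtain ⟨ξ, h1, h2⟩ := htaylor 2 (by norm_num) t ht
    have h3 := abs_lt.1 (hξ t ht ξ h1)
    rw [abs_of_pos hapos] at h3
    have hev : Even (k - 2) := (Nat.even_sub (by omega)).2 (by simpa using hk)
    rw [h2, ← hev.pow_abs t]
    have h4 : ((k - 2).factorial : ℝ) ≤ k.factorial := by
      exact_mod_cast Nat.factorial_le (Nat.sub_le _ _)
    calc a / 2 / k.factorial * |t| ^ (k - 2) = a / 2 * (|t| ^ (k - 2) / k.factorial) := by ring
      _ ≤ iteratedDeriv k ρ ξ * (|t| ^ (k - 2) / (k - 2).factorial) := by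
        have : a / 2 ≤ iteratedDeriv k ρ ξ := by linarith
        gcongr
        linarith
  · intro t ht
    obtain ⟨ξ, h1, h2⟩ := htaylor 0 (by norm_num) t ht
    have h3 := abs_lt.1 (hξ t ht ξ h1)
    rw [abs_of_pos hapos] at h3
    rw [iteratedDeriv_zero, Nat.sub_zero] at h2
    rw [h2, ← hk.pow_abs t]
    calc a / 2 / k.factorial * |t| ^ k = a / 2 * (|t| ^ k / k.factorial) := by ring
      _ ≤ iteratedDeriv k ρ ξ * (|t| ^ k / k.factorial) := by
        have : a / 2 ≤ iteratedDeriv k ρ ξ := by linarith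
        gcongr

end OriginChart

/-! ### Anisotropic dilations and the rescaled domain -/

section Dilations

/-- The dilation `(x₁, x₂) ↦ (T x₁, T ^ k x₂)`. -/
noncomputable def dilation (k : ℕ) (T : ℝ) : Plane →L[ℝ] Plane :=
  LinearMap.toContinuousLinearMap
    { toFun := fun x => !₂[T * x 0, T ^ k * x 1]
      map_add' := fun x y => by ext i; fin_cases i <;> simp [mul_add]
      map_smul' := fun a x => by ext i; fin_cases i <;> simp <;> ring }

@[simp] theorem dilation_zero (k : ℕ) (T : ℝ) (x : Plane) : dilation k T x 0 = T * x 0 := rfl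

@[simp] theorem dilation_one (k : ℕ) (T : ℝ) (x : Plane) : dilation k T x 1 = T ^ k * x 1 := rfl

theorem dilation_inv_apply {k : ℕ} {T : ℝ} (hT : T ≠ 0) (x : Plane) :
    dilation k T⁻¹ (dilation k T x) = x := by
  ext i
  fin_cases i <;> simp [hT]

theorem dilation_apply_inv {k : ℕ} {T : ℝ} (hT : T ≠ 0) (x : Plane) :
    dilation k T (dilation k T⁻¹ x) = x := by
  ext i
  fin_cases i <;> simp [hT]

theorem plane_norm_sq (x : Plane) : ‖x‖ ^ 2 = x 0 ^ 2 + x 1 ^ 2 := by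
  rw [EuclideanSpace.norm_sq_eq, Fin.sum_univ_two]
  simp

theorem plane_abs_le (x : Plane) : |x 0| ≤ ‖x‖ ∧ |x 1| ≤ ‖x‖ := by
  have := plane_norm_sq x
  constructor <;> refine abs_le_of_sq_le_sq ?_ (norm_nonneg _) <;> nlinarith [sq_nonneg (x 0), sq_nonneg (x 1)]

theorem plane_norm_le (x : Plane) : ‖x‖ ≤ |x 0| + |x 1| := by
  refine le_of_sq_le_sq ?_ (by positivity)
  rw [plane_norm_sq, ← sq_abs (x 0), ← sq_abs (x 1)]
  nlinarith [abs_nonneg (x 0), abs_nonneg (x 1)]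

theorem norm_dilation_apply_le {k : ℕ} (hk : 1 ≤ k) {T : ℝ} (hT0 : 0 ≤ T) (hT : T ≤ 1) (x : Plane) :
    ‖dilation k T x‖ ≤ T * ‖x‖ := by
  refine le_of_sq_le_sq ?_ (by positivity)
  rw [mul_pow, plane_norm_sq, plane_norm_sq, dilation_zero, dilation_one, mul_pow, mul_pow, mul_add]
  have h1 : T ^ k ≤ T := by simpa using pow_le_pow_of_le_one hT0 hT hk
  have h2 : (T ^ k) ^ 2 ≤ T ^ 2 := by gcongr
  gcongr

/-- The worst stretching is the vertical one. This factor T^(−k), weighed against the normalisation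
T^(k+β) of the function, produces the exponent 1 + β/k. -/
theorem norm_dilation_inv_apply_le {k : ℕ} (hk : 1 ≤ k) {T : ℝ} (hT0 : 0 < T) (hT : T ≤ 1)
    (x : Plane) : ‖dilation k T⁻¹ x‖ ≤ (T ^ k)⁻¹ * ‖x‖ := by
  refine le_of_sq_le_sq ?_ (by positivity)
  rw [mul_pow, plane_norm_sq, plane_norm_sq, dilation_zero, dilation_one, mul_pow, mul_pow, mul_add,
    inv_pow T k]
  have h1 : T ^ k ≤ T := by simpa using pow_le_pow_of_le_one hT0.le hT hk
  have h2 : T⁻¹ ^ 2 ≤ (T ^ k)⁻¹ ^ 2 := by gcongr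
  exact add_le_add (mul_le_mul_of_nonneg_right h2 (sq_nonneg _)) le_rfl

/-- The unit coordinate vectors of the plane. -/
noncomputable abbrev axis (i : Fin 2) : Plane := EuclideanSpace.single i 1

theorem plane_eq (x : Plane) : x = (0 : Plane) + x 0 • axis 0 + x 1 • axis 1 := by
  ext i
  fin_cases i <;> simp [axis]

theorem inner_axis_one (x : Plane) : inner ℝ (axis 1) x = x 1 := by
  simp [axis, EuclideanSpace.inner_single_left]

theorem iteratedDeriv_rescale (f : ℝ → ℝ) (a b : ℝ) (i : ℕ) :
    iteratedDeriv i (fun s => b * f (a * s)) = fun s => b * a ^ i * iteratedDeriv i f (a * s) := by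
  induction i with
  | zero => simp
  | succ i ih =>
    rw [iteratedDeriv_succ, ih]
    funext s
    have h1 := deriv_comp_mul_left a (iteratedDeriv i f) s
    rw [deriv_const_mul_field, h1, iteratedDeriv_succ]
    simp only [smul_eq_mul]
    ring

variable {k : ℕ} {Ω : Set Plane} {ρ : ℝ → ℝ} {r c C : ℝ}

theorem OriginChart.le_of_mem_closure (h : OriginChart k Ω ρ r c C) {x : Plane}
    (hx : x ∈ closure Ω) (h0 : |x 0| < r) (h1 : |x 1| < r) : ρ (x 0) ≤ x 1 := by
  by_contra hcon
  push Not at hcon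
  have c0 : Continuous fun y : Plane => y 0 := by fun_prop
  have c1 : Continuous fun y : Plane => y 1 := by fun_prop
  have ev1 : ∀ᶠ y : Plane in 𝓝 x, |y 0| < r :=
    c0.abs.continuousAt.eventually_lt continuousAt_const h0
  have ev2 : ∀ᶠ y : Plane in 𝓝 x, |y 1| < r :=
    c1.abs.continuousAt.eventually_lt continuousAt_const h1
  have ev3 : ∀ᶠ y : Plane in 𝓝 x, y 1 < ρ (y 0) := by
    refine c1.continuousAt.eventually_lt ?_ hcon
    have : ContinuousAt ρ (x 0) :=
      (h.contDiffOn.continuousOn).continuousAt (isOpen_Ioo.mem_nhds (abs_lt.1 h0))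
    exact ContinuousAt.comp (f := fun y : Plane => y 0) (x := x) this c0.continuousAt
  obtain ⟨y, ⟨⟨e1, e2⟩, e3⟩, hy⟩ :=
    mem_closure_iff_nhds.1 hx _ (inter_mem (inter_mem ev1 ev2) ev3)
  exact absurd ((h.mem_iff y e1 e2).1 hy) (not_lt.2 (le_of_lt e3))

theorem OriginChart.rho_zero (h : OriginChart k Ω ρ r c C) (hk : 4 ≤ k) : ρ 0 = 0 := by
  have := h.deriv_le 0 (by norm_num) 0 ⟨by linarith [h.pos], h.pos⟩
  rw [abs_zero, zero_pow (by omega), mul_zero, iteratedDeriv_zero] at this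
  exact abs_eq_zero.1 (le_antisymm this (abs_nonneg _))

theorem OriginChart.up_nonneg (h : OriginChart k Ω ρ r c C) : 0 ≤ C := by
  have h1 : r / 2 ∈ Ioo (-r) r := ⟨by linarith [h.pos], by linarith [h.pos]⟩
  have h2 := (abs_nonneg _).trans (h.deriv_le 0 (by norm_num) _ h1)
  have h3 : 0 < |r / 2| ^ (k - 0) := by
    have : 0 < |r / 2| := abs_pos.2 (by linarith [h.pos])
    positivity
  exact nonneg_of_mul_nonneg_left h2 h3

theorem OriginChart.zero_mem_closure (h : OriginChart k Ω ρ r c C) (hk : 4 ≤ k) :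
    (0 : Plane) ∈ closure Ω := by
  have hr := h.pos
  have hcont : Tendsto (fun t : ℝ => t • axis 1) (𝓝[>] 0) (𝓝 ((0 : ℝ) • axis 1)) :=
    (Continuous.tendsto (by fun_prop) 0).mono_left nhdsWithin_le_nhds
  rw [zero_smul] at hcont
  refine mem_closure_of_tendsto hcont ?_
  filter_upwards [Ioo_mem_nhdsGT hr] with t ht
  refine (h.mem_iff _ (by simpa [axis] using hr) ?_).2 ?_
  · simpa [axis, abs_of_pos ht.1] using ht.2
  · simpa [axis, h.rho_zero hk] using ht.1

/-- The degenerate boundary point is a strictly exposed point of order `k`. -/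
theorem OriginChart.exists_pow_le (h : OriginChart k Ω ρ r c C) (hk : 4 ≤ k) (hconv : Convex ℝ Ω)
    (hb : Bornology.IsBounded Ω) : ∃ P ≥ 1, ∀ x ∈ closure Ω, ‖x‖ ^ k ≤ P * x 1 := by
  obtain ⟨B, hB1, hB⟩ : ∃ B ≥ 1, ∀ x ∈ closure Ω, ‖x‖ ≤ B := by
    obtain ⟨B, hB⟩ := hb.closure.exists_norm_le
    exact ⟨max B 1, le_max_right _ _, fun x hx => (hB x hx).trans (le_max_left _ _)⟩
  have hr := h.pos
  have hc := h.low_pos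
  set d : ℝ := min r 1 / 2 with hd
  have hd0 : 0 < d := by positivity
  have hdr : d < r := by have := min_le_left r 1; linarith
  have hd1 : d ≤ 1 := by have := min_le_right r 1; linarith
  have hloc : ∀ x ∈ closure Ω, ‖x‖ ≤ d → 0 ≤ x 1 ∧ ‖x‖ ^ k ≤ 2 ^ k * (1 / c + 1) * x 1 := by
    intro x hx hxd
    obtain ⟨h0, h1⟩ := plane_abs_le x
    have h0r : |x 0| < r := by linarith
    have h2 := (h.le_value _ (abs_lt.1 h0r)).trans (h.le_of_mem_closure hx h0r (by linarith))
    have h3 : 0 ≤ x 1 := le_trans (by positivity) h2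
    refine ⟨h3, ?_⟩
    have h4 : |x 0| ^ k ≤ 1 / c * x 1 := by
      rw [one_div, le_inv_mul_iff₀ hc]; exact h2
    have h5 : |x 1| ^ k ≤ x 1 := by
      have : |x 1| ^ k ≤ |x 1| ^ 1 := pow_le_pow_of_le_one (abs_nonneg _) (by linarith) (by omega)
      simpa [abs_of_nonneg h3] using this
    have h6 : ‖x‖ ≤ 2 * max |x 0| |x 1| := by
      have := plane_norm_le x
      have := le_max_left |x 0| |x 1|
      have := le_max_right |x 0| |x 1|
      linarith
    calc ‖x‖ ^ k ≤ (2 * max |x 0| |x 1|) ^ k := by gcongr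
      _ = 2 ^ k * max |x 0| |x 1| ^ k := mul_pow _ _ _
      _ ≤ 2 ^ k * (1 / c * x 1 + x 1) := by
        have h7 : 0 ≤ 1 / c * x 1 := by positivity
        rcases max_choice |x 0| |x 1| with h8 | h8 <;> rw [h8] <;> gcongr <;> linarith
      _ = _ := by ring
  -- The local estimate is propagated by convexity: contraction towards 0, a point of the closure,
  -- moves any point into the chart.
  set lam : ℝ := d / B with hlam
  have hB0 : 0 < B := by linarith
  have hlam0 : 0 < lam := by positivity
  have hlam1 : lam ≤ 1 := by rw [hlam, div_le_one hB0]; linarith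
  refine ⟨max 1 (2 ^ k * (1 / c + 1) * lam / lam ^ k), le_max_left _ _, fun x hx => ?_⟩
  have hmem : lam • x ∈ closure Ω :=
    hconv.closure.smul_mem_of_zero_mem (h.zero_mem_closure hk) hx ⟨hlam0.le, hlam1⟩
  obtain ⟨h1, h2⟩ := hloc _ hmem (by
    rw [norm_smul, Real.norm_eq_abs, abs_of_pos hlam0]
    calc lam * ‖x‖ ≤ lam * B := by gcongr; exact hB x hx
      _ = d := by rw [hlam]; field_simp)
  rw [norm_smul, Real.norm_eq_abs, abs_of_pos hlam0, mul_pow] at h2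
  simp only [PiLp.smul_apply, smul_eq_mul] at h1 h2
  have h3 : 0 ≤ x 1 := nonneg_of_mul_nonneg_right h1 hlam0
  calc ‖x‖ ^ k ≤ 2 ^ k * (1 / c + 1) * lam / lam ^ k * x 1 := by
        have e : 2 ^ k * (1 / c + 1) * lam / lam ^ k * x 1 =
            (2 ^ k * (1 / c + 1) * (lam * x 1)) / lam ^ k := by ring
        rw [e, le_div_iff₀ (by positivity)]
        linarith
    _ ≤ _ := by gcongr; exact le_max_right _ _

/-- The rescaled domain. -/
def rescaled (k : ℕ) (Ω : Set Plane) (T R : ℝ) : Set Plane :=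
  dilation k T ⁻¹' Ω ∩ Metric.ball 0 R

theorem rescaled_isOpen (hΩ : IsOpen Ω) (T R : ℝ) : IsOpen (rescaled k Ω T R) :=
  (hΩ.preimage (dilation k T).continuous).inter Metric.isOpen_ball

theorem rescaled_convex (hΩ : Convex ℝ Ω) (T R : ℝ) : Convex ℝ (rescaled k Ω T R) :=
  (hΩ.linear_preimage (dilation k T).toLinearMap).inter (convex_ball _ _)

theorem dilation_mem_closure {T R : ℝ} {x : Plane} (hx : x ∈ closure (rescaled k Ω T R)) :
    dilation k T x ∈ closure Ω :=
  map_mem_closure (dilation k T).continuous hx fun _ h => h.1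

theorem mem_closure_rescaled {T R : ℝ} (hT : T ≠ 0) {x : Plane} (hx : dilation k T x ∈ closure Ω)
    (hxR : x ∈ Metric.ball 0 R) : x ∈ closure (rescaled k Ω T R) := by
  have h1 : x ∈ closure (dilation k T ⁻¹' Ω) := by
    have := map_mem_closure (dilation k T⁻¹).continuous hx (t := dilation k T ⁻¹' Ω) fun y hy => by
      rw [mem_preimage, dilation_apply_inv hT]; exact hy
    rwa [dilation_inv_apply hT] at this
  rw [rescaled, inter_comm]
  exact Metric.isOpen_ball.inter_closure ⟨hxR, h1⟩

/-- The boundary of the rescaled domain is a graph near the rescaled point over `s₀`. -/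
theorem OriginChart.graphNear_rescaled (h : OriginChart k Ω ρ r c C) (hk : 4 ≤ k) {T R R₀ K s₀ : ℝ}
    (hT : 0 < T) (hK : 0 < K) (hs₀ : |s₀| + K⁻¹ ≤ R₀) (hTr : T * R₀ < r)
    (hTk : T ^ k * (C * R₀ ^ k + K⁻¹) < r) (hR : R₀ + (C * R₀ ^ k + K⁻¹) < R)
    (hCK : ∀ i ≤ 4, C * R₀ ^ (k - i) ≤ K) :
    GraphNear K (rescaled k Ω T R) 0 (axis 0) (axis 1) (fun s => (T ^ k)⁻¹ * ρ (T * s)) s₀ := by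
  have hC := h.up_nonneg
  have hKi : 0 < K⁻¹ := inv_pos.2 hK
  have hR₀ : 0 < R₀ := by linarith [abs_nonneg s₀]
  have hsmall : ∀ s ∈ Ioo (s₀ - K⁻¹) (s₀ + K⁻¹), |s| ≤ R₀ := by
    intro s hs
    have := abs_le.1 (le_refl |s₀|)
    rw [abs_le]; constructor <;> linarith [hs.1, hs.2]
  have hTs : ∀ s : ℝ, |s| ≤ R₀ → T * s ∈ Ioo (-r) r := by
    intro s hs
    refine abs_lt.1 (lt_of_le_of_lt ?_ hTr)
    rw [abs_mul, abs_of_pos hT]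
    gcongr
  -- Scale invariance: T^(−k) T^i |Ts|^(k−i) = |s|^(k−i), so the derivative bounds of the rescaled
  -- graph do not involve T.
  have hder : ∀ i ≤ 4, ∀ s, |s| ≤ R₀ → |(T ^ k)⁻¹ * T ^ i * iteratedDeriv i ρ (T * s)| ≤
      C * R₀ ^ (k - i) := by
    intro i hi s hs
    have h1 := h.deriv_le i hi _ (hTs s hs)
    rw [abs_mul, abs_of_pos (by positivity)]
    have e : T ^ k = T ^ i * T ^ (k - i) := by rw [← pow_add]; congr 1; omega
    calc (T ^ k)⁻¹ * T ^ i * |iteratedDeriv i ρ (T * s)|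
        ≤ (T ^ k)⁻¹ * T ^ i * (C * |T * s| ^ (k - i)) := by gcongr
      _ = C * |s| ^ (k - i) := by
        rw [abs_mul, abs_of_pos hT, mul_pow, e]; field_simp
      _ ≤ _ := by gcongr
  have hs₀R : |s₀| ≤ R₀ := by linarith
  have hval : |(T ^ k)⁻¹ * ρ (T * s₀)| ≤ C * R₀ ^ k := by
    simpa using hder 0 (by norm_num) s₀ hs₀R
  exact
    { norm_fst := by simp [axis]
      norm_snd := by simp [axis]
      inner_eq := by simp [axis, EuclideanSpace.inner_single_left]
      contDiffOn := by
        refine contDiffOn_const.mul (h.contDiffOn.comp (by fun_prop) fun s hs => hTs s (hsmall s hs))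
      deriv_le := fun i _ h4 s hs => by
        rw [iteratedDeriv_rescale]
        exact (hder i h4 s (hsmall s hs)).trans (hCK i h4)
      mem_iff := fun s hs η hη => by
        set x : Plane := 0 + s • axis 0 + η • axis 1 with hx
        have x0 : x 0 = s := by simp [hx, axis]
        have x1 : x 1 = η := by simp [hx, axis]
        have hηa : |η| < C * R₀ ^ k + K⁻¹ := by
          have : η = (η - (T ^ k)⁻¹ * ρ (T * s₀)) + (T ^ k)⁻¹ * ρ (T * s₀) := by ring
          rw [this]
          refine (abs_add_le _ _).trans_lt ?_
          linarith
        have hxR : x ∈ Metric.ball 0 R := by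
          rw [mem_ball_zero_iff]
          have := plane_norm_le x
          rw [x0, x1] at this
          linarith [hsmall s hs]
        have h1 : |dilation k T x 0| < r := by
          rw [dilation_zero, x0]; exact abs_lt.2 (hTs s (hsmall s hs))
        have h2 : |dilation k T x 1| < r := by
          rw [dilation_one, x1, abs_mul, abs_of_pos (by positivity)]
          refine lt_of_le_of_lt ?_ hTk
          gcongr
        have h3 := h.mem_iff _ h1 h2
        rw [dilation_zero, dilation_one, x0, x1] at h3
        have hTk0 : 0 < T ^ k := by positivity
        rw [inv_mul_lt_iff₀ hTk0, ← h3]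
        exact ⟨fun hh => hh.1, fun hh => ⟨hh, hxR⟩⟩ }

end Dilations

/-! ### Pairs near the degenerate point, after rescaling -/

section InnerPairs

variable {k : ℕ} {Ω : Set Plane} {ρ : ℝ → ℝ} {r c C : ℝ}

theorem OriginChart.le_second_rescaled (h : OriginChart k Ω ρ r c C) (hk : 4 ≤ k) {T s : ℝ}
    (hT : 0 < T) (hs : T * s ∈ Ioo (-r) r) :
    c * |s| ^ (k - 2) ≤ iteratedDeriv 2 (fun s => (T ^ k)⁻¹ * ρ (T * s)) s := by
  rw [iteratedDeriv_rescale]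
  have h1 := h.le_second _ hs
  have e : T ^ k = T ^ 2 * T ^ (k - 2) := by rw [← pow_add]; congr 1; omega
  calc c * |s| ^ (k - 2) = (T ^ k)⁻¹ * T ^ 2 * (c * |T * s| ^ (k - 2)) := by
        rw [abs_mul, abs_of_pos hT, mul_pow, e]; field_simp
    _ ≤ _ := mul_le_mul_of_nonneg_left h1 (by positivity)

theorem OriginChart.touching_ball_origin (h : OriginChart k Ω ρ r c C) (hk : 4 ≤ k) {D : Set Plane}
    {T K : ℝ} (hG : GraphNear K D 0 (axis 0) (axis 1) (fun s => (T ^ k)⁻¹ * ρ (T * s)) 0)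
    (hK : 1 ≤ K) : Metric.ball ((2 * K)⁻¹ • axis 1) (2 * K)⁻¹ ⊆ D := by
  have h1 : iteratedDeriv 1 (fun s => (T ^ k)⁻¹ * ρ (T * s)) 0 = 0 := by
    rw [iteratedDeriv_rescale]
    have := h.deriv_le 1 (by norm_num) 0 ⟨by linarith [h.pos], h.pos⟩
    rw [abs_zero, zero_pow (by omega), mul_zero] at this
    simp only [mul_zero, abs_eq_zero.1 (le_antisymm this (abs_nonneg _))]
  have := hG.touching_ball hK (β := 1) one_pos le_rfl (by rw [h1]; simp [axis])
  simpa [h1, h.rho_zero hk] using this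

/-- Pairs of points near the degenerate boundary point become admissible after rescaling. -/
theorem OriginChart.exists_rescaled_admissible (h : OriginChart k Ω ρ r c C) (hk : 4 ≤ k)
    (hopen : IsOpen Ω) (hconv : Convex ℝ Ω) (hb : Bornology.IsBounded Ω) :
    ∃ K' ≥ 2, ∃ T₁ > 0, T₁ ≤ 1 ∧ ∃ R ≥ 1, ∀ T, 0 < T → T ≤ T₁ →
      (∀ z, dilation k T z ∈ closure Ω → z 1 ≤ 2 → ‖z‖ < R) ∧
      ∀ y₁ y₂, y₁ ≠ y₂ → dilation k T y₁ ∈ closure Ω → dilation k T y₂ ∈ closure Ω →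
        y₁ 1 ≤ 1 → y₂ 1 ≤ 1 → (1 ≤ y₁ 1 ∨ 1 ≤ y₂ 1) →
        AdmissiblePair K' (rescaled k Ω T R) y₁ y₂ := by
  obtain ⟨P, hP1, hP⟩ := h.exists_pow_le hk hconv hb
  have hr := h.pos
  have hc := h.low_pos
  have hC := h.up_nonneg
  -- By ‖x‖^k ≤ P x₂, rescaled points of height at most 2 have first coordinate at most M₀ in
  -- absolute value. R exceeds the norm of all of them, so cutting with the ball creates no new
  -- boundary below height 2, and T₁ keeps the whole window inside the chart.
  set M₀ : ℝ := 2 * P with hM₀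
  set R₀ : ℝ := M₀ + 1 with hR₀
  have hR₀1 : 1 ≤ R₀ := by linarith
  have hR₀0 : 0 < R₀ := by linarith
  set Q : ℝ := C * R₀ ^ k with hQ
  have hQ0 : 0 ≤ Q := by positivity
  set R : ℝ := R₀ + (Q + 1) + 4 with hR
  set T₁ : ℝ := min 1 (r / (2 * (R₀ + Q + 3))) with hT₁
  have hT₁0 : 0 < T₁ := lt_min one_pos (by positivity)
  have hT₁r : T₁ * (R₀ + Q + 3) < r := by
    have h1 : T₁ ≤ r / (2 * (R₀ + Q + 3)) := min_le_right _ _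
    have h2 : r / (2 * (R₀ + Q + 3)) * (R₀ + Q + 3) = r / 2 := by field_simp
    have h3 : T₁ * (R₀ + Q + 3) ≤ r / (2 * (R₀ + Q + 3)) * (R₀ + Q + 3) := by gcongr
    linarith
  set Kg : ℝ := Q + 2 with hKg
  have hKg1 : 1 ≤ Kg := by linarith
  set K₀ : ℝ := 2 * Kg + R with hK₀
  have hK₀2 : 2 ≤ K₀ := by linarith
  have hK₀i : K₀⁻¹ ≤ (2 * Kg)⁻¹ := by
    have : 0 < 2 * Kg := by linarith
    gcongr; linarith
  obtain ⟨c₁, hc₁, hadm⟩ := exists_admissiblePair (K := K₀) (c₂ := 1) hK₀2 one_pos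
  -- On the boundary p₂ ≤ Q|p₁|, so ‖p‖ ≥ c₁ forces |p₁| ≥ 2δ. On the interval of half-length K₁⁻¹ ≤
  -- δ around p₁ the second derivative is then at least cδ^(k−2) ≥ K₁⁻¹.
  set δ : ℝ := c₁ / (2 * (1 + Q)) with hδ
  have hδ0 : 0 < δ := by positivity
  set K₁ : ℝ := Kg + R + δ⁻¹ + (c * δ ^ (k - 2))⁻¹ with hK₁
  have i1 : 0 < δ⁻¹ := by positivity
  have i2 : 0 < (c * δ ^ (k - 2))⁻¹ := by positivity
  have hK₁0 : 0 < K₁ := by linarith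
  have hK₁1 : 1 ≤ K₁ := by linarith
  obtain ⟨K', hK'2, hadm⟩ := hadm K₁ hK₁1
  refine ⟨K', hK'2, T₁, hT₁0, min_le_left _ _, R, by linarith, fun T hT hTT => ?_⟩
  have hT1 : T ≤ 1 := hTT.trans (min_le_left _ _)
  have hTk : T ^ k ≤ T := by simpa using pow_le_pow_of_le_one hT.le hT1 (by omega : 1 ≤ k)
  have hTk0 : 0 < T ^ k := by positivity
  have hTr : T * (R₀ + Q + 3) < r := lt_of_le_of_lt (by gcongr) hT₁r
  have hTM : T * R₀ < r := lt_of_le_of_lt (by gcongr; linarith) hTr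
  have hz : ∀ z, dilation k T z ∈ closure Ω → z 1 ≤ 2 → 0 ≤ z 1 ∧ |z 0| ≤ M₀ := by
    intro z hz hz2
    have h1 := hP _ hz
    rw [dilation_one] at h1
    have h0 : 0 ≤ z 1 := by
      have : 0 ≤ P * (T ^ k * z 1) := le_trans (by positivity) h1
      exact nonneg_of_mul_nonneg_right (nonneg_of_mul_nonneg_right this (by linarith)) hTk0
    refine ⟨h0, ?_⟩
    have h2 := (plane_abs_le (dilation k T z)).1
    rw [dilation_zero, abs_mul, abs_of_pos hT] at h2
    have h3 : T ^ k * |z 0| ^ k ≤ T ^ k * (P * z 1) := by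
      calc T ^ k * |z 0| ^ k = (T * |z 0|) ^ k := (mul_pow _ _ _).symm
        _ ≤ ‖dilation k T z‖ ^ k := by gcongr
        _ ≤ _ := by linarith
    have h4 : |z 0| ^ k ≤ P * z 1 := le_of_mul_le_mul_left h3 hTk0
    by_contra hcon
    push Not at hcon
    have h5 : |z 0| ≤ |z 0| ^ k := le_self_pow₀ (by linarith) (by omega)
    nlinarith
  have hnorm : ∀ z, dilation k T z ∈ closure Ω → z 1 ≤ 2 → ‖z‖ < R := by
    intro z hz1 hz2
    obtain ⟨h1, h2⟩ := hz z hz1 hz2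
    have := plane_norm_le z
    rw [abs_of_nonneg h1] at this
    linarith
  refine ⟨hnorm, ?_⟩
  set D := rescaled k Ω T R with hD
  set ρT : ℝ → ℝ := fun s => (T ^ k)⁻¹ * ρ (T * s) with hρT
  have hgraph : ∀ K : ℝ, Kg ≤ K → ∀ s₀, |s₀| ≤ M₀ → GraphNear K D 0 (axis 0) (axis 1) ρT s₀ := by
    intro K hK s₀ hs₀
    have hK0 : 0 < K := by linarith
    have hKi : K⁻¹ ≤ 1 := inv_le_one_of_one_le₀ (by linarith)
    refine h.graphNear_rescaled hk (R₀ := R₀) hT hK0 (by linarith) hTM ?_ (by linarith) ?_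
    · calc T ^ k * (C * R₀ ^ k + K⁻¹) ≤ T * (R₀ + Q + 3) :=
            mul_le_mul hTk (by linarith) (by positivity) hT.le
        _ < r := hTr
    · intro i _
      calc C * R₀ ^ (k - i) ≤ C * R₀ ^ k := by
            exact mul_le_mul_of_nonneg_left (pow_le_pow_right₀ hR₀1 (Nat.sub_le _ _)) hC
        _ ≤ K := by linarith
  have hfront : ∀ p ∈ closure D, p ∉ D → p 1 ≤ 2 → |p 0| ≤ M₀ ∧ p 1 = ρT (p 0) ∧ 0 ≤ p 1 := by
    intro p hp hpD hp2
    have hcl := dilation_mem_closure hp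
    obtain ⟨h1, h2⟩ := hz p hcl hp2
    have hpR : p ∈ Metric.ball (0 : Plane) R := by
      rw [mem_ball_zero_iff]; exact hnorm p hcl hp2
    have hpΩ : dilation k T p ∉ Ω := fun hh => hpD ⟨hh, hpR⟩
    have b0 : |dilation k T p 0| < r := by
      rw [dilation_zero, abs_mul, abs_of_pos hT]
      calc T * |p 0| ≤ T * R₀ := by gcongr; linarith
        _ < r := hTM
    have b1 : |dilation k T p 1| < r := by
      rw [dilation_one, abs_mul, abs_of_pos hTk0, abs_of_nonneg h1]
      calc T ^ k * p 1 ≤ T * (R₀ + Q + 3) := mul_le_mul hTk (by linarith) h1 hT.le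
        _ < r := hTr
    have h3 := h.le_of_mem_closure hcl b0 b1
    have h4 := (h.mem_iff _ b0 b1).not.1 hpΩ
    rw [dilation_zero, dilation_one] at h3 h4
    refine ⟨h2, ?_, h1⟩
    have h5 : T ^ k * p 1 = ρ (T * p 0) := le_antisymm (not_lt.1 h4) h3
    simp only [hρT]
    rw [← h5]; field_simp
  have hDR : D ⊆ Metric.ball 0 R := inter_subset_right
  have hprep : ∀ p ∈ closure D, p ∉ D → p 1 ≤ 2 →
      p = 0 + p 0 • axis 0 + ρT (p 0) • axis 1 := by
    intro p hp hpD hp2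
    rw [← (hfront p hp hpD hp2).2.1]
    exact plane_eq p
  intro y₁ y₂ hne hy₁ hy₂ h₁ h₂ hor
  have hmem : ∀ y, dilation k T y ∈ closure Ω → y 1 ≤ 1 → y ∈ closure D := fun y hy hy1 =>
    mem_closure_rescaled hT.ne' hy (by
      rw [mem_ball_zero_iff]; exact hnorm y hy (by linarith))
  refine hadm (e := axis 1) (H := 1) (rescaled_isOpen hopen T R) (rescaled_convex hconv T R)
    (hDR.trans (Metric.ball_subset_ball (by linarith)))
    (hDR.trans (Metric.ball_subset_ball (by linarith))) (by simp [axis]) le_rfl ?_ ?_ ?_ hne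
    (hmem _ hy₁ h₁) (hmem _ hy₂ h₂) ?_ ?_ ?_
  · refine Subset.trans ?_ (h.touching_ball_origin hk
      (hgraph Kg le_rfl 0 (by rw [abs_zero]; linarith)) hKg1)
    have := touching_ball_subset (p := (0 : Plane)) hK₀i (n := axis 1) (by simp [axis])
    simpa using this
  · intro p hp hpD hp2
    rw [inner_axis_one] at hp2
    have hp2' : p 1 ≤ 2 := by linarith
    obtain ⟨n, hn, hb⟩ := (hgraph Kg le_rfl (p 0) (hfront p hp hpD hp2').1).exists_touching_ball hKg1
    rw [← hprep p hp hpD hp2'] at hb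
    exact ⟨n, hn, (touching_ball_subset hK₀i hn).trans hb⟩
  · intro p hp hpD hp2 hpc
    rw [inner_axis_one] at hp2
    have hp2' : p 1 ≤ 2 := by linarith
    obtain ⟨f1, f2, f3⟩ := hfront p hp hpD hp2'
    refine ⟨0, axis 0, axis 1, ρT, p 0, hgraph K₁ (by linarith) _ f1, ?_, hprep p hp hpD hp2'⟩
    have hTp : ∀ s : ℝ, |s| ≤ R₀ → T * s ∈ Ioo (-r) r := by
      intro s hs
      refine abs_lt.1 (lt_of_le_of_lt ?_ hTM)
      rw [abs_mul, abs_of_pos hT]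
      gcongr
    have hp1 : p 1 ≤ Q * |p 0| := by
      have h1 := h.deriv_le 0 (by norm_num) _ (hTp (p 0) (by linarith))
      rw [iteratedDeriv_zero, Nat.sub_zero, abs_mul, abs_of_pos hT, mul_pow] at h1
      have h2 : p 1 ≤ C * |p 0| ^ k := by
        rw [f2]
        simp only [hρT]
        rw [inv_mul_le_iff₀ hTk0]
        linarith [le_abs_self (ρ (T * p 0))]
      have h3 : |p 0| ^ k ≤ R₀ ^ k * |p 0| := by
        have e : k = (k - 1) + 1 := by omega
        calc |p 0| ^ k = |p 0| ^ (k - 1) * |p 0| := by rw [← pow_succ]; congr 1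
          _ ≤ R₀ ^ (k - 1) * |p 0| := by gcongr; linarith
          _ ≤ R₀ ^ k * |p 0| := by
            exact mul_le_mul_of_nonneg_right (pow_le_pow_right₀ hR₀1 (Nat.sub_le _ _))
              (abs_nonneg _)
      calc p 1 ≤ C * |p 0| ^ k := h2
        _ ≤ C * (R₀ ^ k * |p 0|) := by gcongr
        _ = _ := by ring
    have hp0 : 2 * δ ≤ |p 0| := by
      have h1 := plane_norm_le p
      rw [abs_of_nonneg f3] at h1
      have h2 : c₁ ≤ (1 + Q) * |p 0| := by linarith
      have h3 : 2 * δ = c₁ / (1 + Q) := by rw [hδ]; field_simp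
      rw [h3, div_le_iff₀ (by positivity)]
      linarith
    intro s hs
    have hK₁i : K₁⁻¹ ≤ δ := by
      rw [inv_le_comm₀ hK₁0 hδ0]; linarith
    have hK₁j : K₁⁻¹ ≤ c * δ ^ (k - 2) := by
      rw [inv_le_comm₀ hK₁0 (by positivity)]; linarith
    have hK₁k : K₁⁻¹ ≤ 1 := inv_le_one_of_one_le₀ hK₁1
    have hsp : |s - p 0| ≤ K₁⁻¹ := by rw [abs_le]; constructor <;> linarith [hs.1, hs.2]
    have hsl : δ ≤ |s| := by
      have := abs_sub_abs_le_abs_sub (p 0) s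
      rw [abs_sub_comm] at this
      linarith
    have hsu : |s| ≤ R₀ := by
      have := abs_sub_abs_le_abs_sub s (p 0)
      linarith
    calc K₁⁻¹ ≤ c * δ ^ (k - 2) := hK₁j
      _ ≤ c * |s| ^ (k - 2) := by gcongr
      _ ≤ _ := h.le_second_rescaled hk hT (hTp s hsu)
  · rw [inner_axis_one]; exact h₁
  · rw [inner_axis_one]; exact h₂
  · rw [inner_axis_one, inner_axis_one]; exact hor

end InnerPairs

/-! ### Uniform convexity from positive curvature -/

section Curvature

theorem exists_taylor_second {f : ℝ → ℝ} {r : ℝ} (hf : ContDiffOn ℝ 2 f (Ioo (-r) r)) {t : ℝ}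
    (ht : t ∈ Ioo (-r) r) :
    ∃ ξ, |ξ| ≤ |t| ∧ f t = f 0 + iteratedDeriv 1 f 0 * t + iteratedDeriv 2 f ξ * (t ^ 2 / 2) := by
  set c : ℕ → ℝ → ℝ := fun i s =>
    if i = 0 then f s - f 0 - iteratedDeriv 1 f 0 * s
    else if i = 1 then iteratedDeriv 1 f s - iteratedDeriv 1 f 0 else iteratedDeriv i f s with hc
  obtain ⟨ξ, hξ, e⟩ := exists_eq_of_chain 2 (c := c) (r := r) (fun i hi s hs => by
    have hd := hasDerivAt_iteratedDeriv (n := 2) hf hi hs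
    match i, hi with
    | 0, _ =>
      have h0 : HasDerivAt f (iteratedDeriv 1 f s) s := by simpa using hd
      have h1 : HasDerivAt (fun s => f s - f 0 - iteratedDeriv 1 f 0 * s)
          (iteratedDeriv 1 f s - iteratedDeriv 1 f 0) s :=
        ((h0.sub_const (f 0)).sub ((hasDerivAt_id s).const_mul (iteratedDeriv 1 f 0))).congr_deriv
          (by ring)
      simpa [hc] using h1
    | 1, _ => simpa [hc] using hd.sub_const (iteratedDeriv 1 f 0))
    (fun i hi => by interval_cases i <;> simp [hc]) t ht
  refine ⟨ξ, hξ, ?_⟩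
  simp only [hc, if_true, OfNat.ofNat_ne_zero, OfNat.ofNat_ne_one, if_false] at e
  norm_num [Nat.factorial] at e
  rw [iteratedDeriv_one]
  linarith

theorem continuousAt_iteratedDeriv {f : ℝ → ℝ} {r : ℝ} {n : ℕ}
    (hf : ContDiffOn ℝ n f (Ioo (-r) r)) {i : ℕ} (hi : i ≤ n) {t : ℝ} (ht : t ∈ Ioo (-r) r) :
    ContinuousAt (iteratedDeriv i f) t := by
  have h1 := (hf.continuousOn_iteratedDerivWithin (m := i) (by exact_mod_cast hi)
    isOpen_Ioo.uniqueDiffOn).continuousAt (isOpen_Ioo.mem_nhds ht)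
  refine h1.congr ?_
  filter_upwards [isOpen_Ioo.mem_nhds ht] with s hs
  exact iteratedDerivWithin_of_isOpen isOpen_Ioo hs

/-- `Ω` lies above the graph of `ρ` in the orthonormal frame `e₁, e₂` at `z`. -/
structure FrameGraph (Ω : Set Plane) (z e₁ e₂ : Plane) (ρ : ℝ → ℝ) (r : ℝ) : Prop where
  pos : 0 < r
  norm_fst : ‖e₁‖ = 1
  norm_snd : ‖e₂‖ = 1
  inner_eq : inner ℝ e₁ e₂ = (0 : ℝ)
  graph_zero : ρ 0 = 0
  mem_iff : ∀ s η : ℝ, |s| < r → |η| < r → (z + s • e₁ + η • e₂ ∈ Ω ↔ ρ s < η)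

theorem IsGraphAt.exists_frameGraph {Ω : Set Plane} {z : Plane} {Φ : Plane ≃ᵃⁱ[ℝ] Plane}
    {ρ : ℝ → ℝ} {r : ℝ} (h : IsGraphAt Ω z Φ ρ r) : ∃ e₁ e₂, FrameGraph Ω z e₁ e₂ ρ r := by
  set L := Φ.symm.linearIsometryEquiv with hL
  refine ⟨L (axis 0), L (axis 1), h.pos, by simp [axis], by simp [axis], ?_, h.graph_zero, ?_⟩
  · rw [LinearIsometryEquiv.inner_map_map]
    simp [axis, EuclideanSpace.inner_single_left]
  · intro s η hs hη
    set x : Plane := s • axis 0 + η • axis 1 with hx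
    have x0 : x 0 = s := by simp [hx, axis]
    have x1 : x 1 = η := by simp [hx, axis]
    have h1 := h.mem_iff x (by rwa [x0]) (by rwa [x1])
    rw [x0, x1] at h1
    rw [← h1]
    have e : Φ.symm x = z + s • L (axis 0) + η • L (axis 1) := by
      have h2 := Φ.symm.map_vadd 0 x
      rw [vadd_eq_add, add_zero, vadd_eq_add, ← h.map_base, Φ.symm_apply_apply] at h2
      rw [h2, hx, map_add, map_smul, map_smul]
      simp only [hL]
      abel
    rw [e]

variable {Ω : Set Plane} {z e₁ e₂ : Plane} {ρ : ℝ → ℝ} {r : ℝ}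

/-- Positive curvature places the domain inside a paraboloid near the boundary point. -/
theorem FrameGraph.exists_paraboloid (h : FrameGraph Ω z e₁ e₂ ρ r)
    (hρ : ContDiffOn ℝ 2 ρ (Ioo (-r) r)) (h2 : 0 < iteratedDeriv 2 ρ 0) :
    ∃ (n : Plane) (c δ : ℝ), 0 < c ∧ 0 < δ ∧
      ∀ x ∈ Ω, ‖x - z‖ < δ → c * ‖x - z‖ ^ 2 ≤ inner ℝ n (x - z) := by
  have hr := h.pos
  set a := iteratedDeriv 2 ρ 0 with ha
  set m := iteratedDeriv 1 ρ 0 with hm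
  have h0 : (0 : ℝ) ∈ Ioo (-r) r := ⟨by linarith, hr⟩
  obtain ⟨d, hd, hd'⟩ : ∃ d > 0, ∀ t, |t| < d → a / 2 < iteratedDeriv 2 ρ t := by
    have hcont := continuousAt_iteratedDeriv (n := 2) hρ le_rfl h0
    obtain ⟨d, h1, h3⟩ := Metric.continuousAt_iff.1 hcont (a / 2) (by positivity)
    refine ⟨d, h1, fun t ht => ?_⟩
    have := h3 (x := t) (by simpa using ht)
    rw [Real.dist_eq] at this
    linarith [(abs_lt.1 this).1]
  -- With t = η − ms the height above the tangent, a point above the graph has as²/4 ≤ t. As t is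
  -- also at most 1 + |m|, both s² and η² are multiples of t; Q collects the factors.
  set Q : ℝ := (1 + 2 * m ^ 2) * (4 / a) + 2 * (1 + |m|) with hQ
  have hQ0 : 0 < Q := by positivity
  refine ⟨e₂ - m • e₁, Q⁻¹, min (min r d) 1, by positivity, by positivity, fun x hx hxz => ?_⟩
  have hxr : ‖x - z‖ < r := hxz.trans_le ((min_le_left _ _).trans (min_le_left _ _))
  have hxd : ‖x - z‖ < d := hxz.trans_le ((min_le_left _ _).trans (min_le_right _ _))
  have hx1 : ‖x - z‖ ≤ 1 := hxz.le.trans (min_le_right _ _)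
  set s : ℝ := inner ℝ e₁ (x - z) with hs
  set η : ℝ := inner ℝ e₂ (x - z) with hη
  have hrep : x - z = s • e₁ + η • e₂ := plane_decomposition h.norm_fst h.norm_snd h.inner_eq _
  have hco := abs_le_norm_coords h.norm_fst h.norm_snd h.inner_eq s η
  rw [← hrep] at hco
  have hn : ‖x - z‖ ^ 2 = s ^ 2 + η ^ 2 := by
    conv_lhs => rw [hrep]
    exact norm_sq_coords h.norm_fst h.norm_snd h.inner_eq s η
  have hin : inner ℝ (e₂ - m • e₁) (x - z) = η - m * s := by
    have e : e₂ - m • e₁ = (-m) • e₁ + (1 : ℝ) • e₂ := by module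
    rw [e, hrep, inner_coords h.norm_fst h.norm_snd h.inner_eq]; ring
  set t := η - m * s with ht
  have hlt : ρ s < η := by
    refine (h.mem_iff s η (hco.1.trans_lt hxr) (hco.2.trans_lt hxr)).1 ?_
    rw [add_assoc, ← hrep, add_sub_cancel]; exact hx
  obtain ⟨ξ, hξ, e⟩ := exists_taylor_second hρ (abs_lt.1 (hco.1.trans_lt hxr))
  rw [h.graph_zero, zero_add, ← hm] at e
  have h3 := hd' ξ (hξ.trans_lt (hco.1.trans_lt hxd))
  have h4 : a / 4 * s ^ 2 ≤ t := by
    have : a / 2 * (s ^ 2 / 2) ≤ iteratedDeriv 2 ρ ξ * (s ^ 2 / 2) := by gcongr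
    linarith
  have h5 : s ^ 2 ≤ 4 / a * t := by
    have : s ^ 2 = 4 / a * (a / 4 * s ^ 2) := by field_simp
    rw [this]; gcongr
  have ht0 : 0 ≤ t := le_trans (by positivity) h4
  have ht1 : t ≤ 1 + |m| := by
    have h6 : |m * s| ≤ |m| * 1 := by
      rw [abs_mul]; gcongr; exact hco.1.trans hx1
    have := (abs_le.1 h6).1
    have := (abs_le.1 (hco.2.trans hx1)).2
    linarith
  have h6 : ‖x - z‖ ^ 2 ≤ Q * t := by
    have h7 : η ^ 2 ≤ 2 * t ^ 2 + 2 * m ^ 2 * s ^ 2 := by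
      have : η = t + m * s := by rw [ht]; ring
      rw [this]; nlinarith [sq_nonneg (t - m * s)]
    have h8 := mul_le_mul_of_nonneg_left h5 (by positivity : 0 ≤ 1 + 2 * m ^ 2)
    have h9 := mul_le_mul_of_nonneg_left ht1 ht0
    rw [hn, hQ]
    nlinarith
  rw [hin, inv_mul_le_iff₀ hQ0]
  exact h6

/-- Positivity of the second derivative of the defining function does not depend on the chart. -/
theorem FrameGraph.second_deriv_pos (h : FrameGraph Ω z e₁ e₂ ρ r)
    (hρ : ContDiffOn ℝ 2 ρ (Ioo (-r) r)) {n : Plane} {c δ : ℝ} (hc : 0 < c) (hδ : 0 < δ)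
    (hpar : ∀ x ∈ Ω, ‖x - z‖ < δ → c * ‖x - z‖ ^ 2 ≤ inner ℝ n (x - z)) :
    0 < iteratedDeriv 2 ρ 0 := by
  have hr := h.pos
  have h0 : (0 : ℝ) ∈ Ioo (-r) r := ⟨by linarith, hr⟩
  set α : ℝ := inner ℝ e₁ n with hα
  set β : ℝ := inner ℝ e₂ n with hβ
  have hnr : n = α • e₁ + β • e₂ := plane_decomposition h.norm_fst h.norm_snd h.inner_eq n
  have hcoord : ∀ s η : ℝ, |s| < r → |η| < r → ‖s • e₁ + η • e₂‖ < δ → ρ s < η →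
      c * (s ^ 2 + η ^ 2) ≤ α * s + β * η := by
    intro s η hs hη hd hlt
    have e : z + s • e₁ + η • e₂ - z = s • e₁ + η • e₂ := by abel
    have := hpar _ ((h.mem_iff s η hs hη).2 hlt) (by rwa [e])
    rwa [e, norm_sq_coords h.norm_fst h.norm_snd h.inner_eq, hnr,
      inner_coords h.norm_fst h.norm_snd h.inner_eq] at this
  -- The paraboloid inequality is passed to points of the graph as limits from above.
  have hev : ∀ᶠ s in 𝓝 (0 : ℝ), c * s ^ 2 ≤ α * s + β * ρ s := by
    have hρc : ContinuousAt ρ 0 := hρ.continuousOn.continuousAt (isOpen_Ioo.mem_nhds h0)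
    have c1 : ∀ᶠ s in 𝓝 (0 : ℝ), |s| < r :=
      continuous_abs.continuousAt.eventually_lt continuousAt_const (by simpa using hr)
    have c2 : ∀ᶠ s in 𝓝 (0 : ℝ), |ρ s| < r :=
      hρc.abs.eventually_lt continuousAt_const (by simpa [h.graph_zero] using hr)
    have c3 : ∀ᶠ s in 𝓝 (0 : ℝ), ‖s • e₁ + ρ s • e₂‖ < δ := by
      refine ContinuousAt.eventually_lt ?_ continuousAt_const (by simpa [h.graph_zero] using hδ)
      fun_prop
    filter_upwards [c1, c2, c3] with s s1 s2 s3
    have hlim : Tendsto (fun η : ℝ => α * s + β * η - c * (s ^ 2 + η ^ 2)) (𝓝[>] (ρ s))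
        (𝓝 (α * s + β * ρ s - c * (s ^ 2 + ρ s ^ 2))) :=
      (Continuous.tendsto (by fun_prop) _).mono_left nhdsWithin_le_nhds
    have hge : ∀ᶠ η in 𝓝[>] (ρ s), 0 ≤ α * s + β * η - c * (s ^ 2 + η ^ 2) := by
      have k1 : ∀ᶠ η in 𝓝 (ρ s), |η| < r :=
        continuous_abs.continuousAt.eventually_lt continuousAt_const s2
      have k2 : ∀ᶠ η in 𝓝 (ρ s), ‖s • e₁ + η • e₂‖ < δ :=
        ContinuousAt.eventually_lt (by fun_prop) continuousAt_const s3
      filter_upwards [nhdsWithin_le_nhds k1, nhdsWithin_le_nhds k2, self_mem_nhdsWithin]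
        with η e1 e2 e3
      exact sub_nonneg.2 (hcoord s η s1 e1 e2 e3)
    have := ge_of_tendsto hlim hge
    nlinarith [sq_nonneg (ρ s)]
  have hβ0 : 0 ≤ β := by
    set η : ℝ := min r δ / 2 with hη
    have hη0 : 0 < η := by positivity
    have hηr : η < r := by have := min_le_left r δ; linarith
    have hηδ : η < δ := by have := min_le_right r δ; linarith
    have := hcoord 0 η (by simpa using hr) (by rwa [abs_of_pos hη0])
      (by rw [zero_smul, zero_add, norm_smul, h.norm_snd, mul_one, Real.norm_eq_abs,
        abs_of_pos hη0]; exact hηδ) (by rw [h.graph_zero]; exact hη0)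
    have h1 : 0 ≤ β * η := by nlinarith [sq_nonneg η]
    exact nonneg_of_mul_nonneg_left h1 hη0
  have hρd : HasDerivAt ρ (iteratedDeriv 1 ρ 0) 0 := by
    simpa using hasDerivAt_iteratedDeriv (n := 2) hρ (i := 0) (by norm_num) h0
  -- The function αs + βρ(s) is at least cs² near 0 and vanishes at 0, so its derivative there is
  -- zero. If ρ″(0) ≤ 0, its second derivative βρ″ would be below 2c near 0, contradicting the lower
  -- bound cs².
  have hcrit : α + β * iteratedDeriv 1 ρ 0 = 0 := by
    have hmin : IsLocalMin (fun s => α * s + β * ρ s) 0 := by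
      filter_upwards [hev] with s hs
      simp only [mul_zero, h.graph_zero, add_zero]
      exact le_trans (by positivity) hs
    have := hmin.hasDerivAt_eq_zero (((hasDerivAt_id (0 : ℝ)).const_mul α).add (hρd.const_mul β))
    linarith
  by_contra hcon
  push Not at hcon
  have hcont : ContinuousAt (fun s => β * iteratedDeriv 2 ρ s) 0 :=
    continuousAt_const.mul (continuousAt_iteratedDeriv (n := 2) hρ le_rfl h0)
  have hlt : ∀ᶠ s in 𝓝 (0 : ℝ), β * iteratedDeriv 2 ρ s < 2 * c := by
    refine hcont.eventually_lt continuousAt_const ?_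
    have : β * iteratedDeriv 2 ρ 0 ≤ 0 := mul_nonpos_of_nonneg_of_nonpos hβ0 hcon
    linarith
  obtain ⟨d, hd, hd'⟩ := Metric.eventually_nhds_iff.1 (hlt.and hev)
  set s : ℝ := min r d / 2 with hs
  have hs0 : 0 < s := by positivity
  have hsr : s < r := by have := min_le_left r d; linarith
  have hsd : s < d := by have := min_le_right r d; linarith
  obtain ⟨ξ, hξ, e⟩ := exists_taylor_second hρ (t := s) ⟨by linarith, hsr⟩
  rw [h.graph_zero, zero_add] at e
  have h1 := (hd' (y := s) (by simpa [abs_of_pos hs0] using hsd)).2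
  have h2 := (hd' (y := ξ) (by
    rw [Real.dist_eq, sub_zero]; rw [abs_of_pos hs0] at hξ; linarith)).1
  have h3 : α * s + β * ρ s = β * iteratedDeriv 2 ρ ξ * (s ^ 2 / 2) := by
    rw [e]; linear_combination s * hcrit
  rw [h3] at h1
  have h4 : β * iteratedDeriv 2 ρ ξ * (s ^ 2 / 2) < 2 * c * (s ^ 2 / 2) :=
    mul_lt_mul_of_pos_right h2 (by positivity)
  linarith

/-- The boundary is a uniformly convex graph near `p`. -/
def ConvexGraphAt (K : ℝ) (D : Set Plane) (p : Plane) : Prop :=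
  ∃ (o e₁ e₂ : Plane) (ρ : ℝ → ℝ) (s₀ : ℝ), GraphNear K D o e₁ e₂ ρ s₀ ∧
    (∀ s ∈ Ioo (s₀ - K⁻¹) (s₀ + K⁻¹), K⁻¹ ≤ iteratedDeriv 2 ρ s) ∧ p = o + s₀ • e₁ + ρ s₀ • e₂

theorem ConvexGraphAt.mono {K K' : ℝ} {D : Set Plane} {p : Plane} (h : ConvexGraphAt K D p)
    (hK : 0 < K) (hKK : K ≤ K') : ConvexGraphAt K' D p := by
  have hi : K'⁻¹ ≤ K⁻¹ := by gcongr
  obtain ⟨o, e₁, e₂, ρ, s₀, hG, hc, ho⟩ := h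
  exact ⟨o, e₁, e₂, ρ, s₀, hG.mono hK hKK, fun s hs =>
    hi.trans (hc s (Ioo_subset_Ioo (by linarith) (by linarith) hs)), ho⟩

/-- A boundary point with positive second derivative has a neighbourhood of uniformly convex boundary
points. -/
theorem FrameGraph.exists_convexGraphAt (h : FrameGraph Ω z e₁ e₂ ρ r) (hΩ : IsOpen Ω)
    (hρ : ContDiffOn ℝ 4 ρ (Ioo (-r) r)) (h2 : 0 < iteratedDeriv 2 ρ 0) :
    ∃ K ≥ 1, ∀ᶠ p in 𝓝 z, p ∈ frontier Ω → ConvexGraphAt K Ω p := by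
  have hr := h.pos
  set a := iteratedDeriv 2 ρ 0 with ha
  have h0 : (0 : ℝ) ∈ Ioo (-r) r := ⟨by linarith, hr⟩
  have hρc : ContinuousAt ρ 0 := hρ.continuousOn.continuousAt (isOpen_Ioo.mem_nhds h0)
  have ev1 : ∀ᶠ s in 𝓝 (0 : ℝ), |ρ s| < r / 2 :=
    hρc.abs.eventually_lt continuousAt_const (by rw [h.graph_zero, abs_zero]; positivity)
  have ev2 : ∀ᶠ s in 𝓝 (0 : ℝ), a / 2 < iteratedDeriv 2 ρ s :=
    continuousAt_const.eventually_lt (continuousAt_iteratedDeriv (n := 4) hρ (by norm_num) h0)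
      (by linarith)
  have ev3 : ∀ i ≤ 4, ∀ᶠ s in 𝓝 (0 : ℝ), |iteratedDeriv i ρ s| < |iteratedDeriv i ρ 0| + 1 :=
    fun i hi => (continuousAt_iteratedDeriv (n := 4) hρ hi h0).abs.eventually_lt continuousAt_const
      (by linarith)
  have ev4 : ∀ᶠ s in 𝓝 (0 : ℝ), ∀ i ∈ Finset.range 5,
      |iteratedDeriv i ρ s| < |iteratedDeriv i ρ 0| + 1 := by
    rw [Finset.eventually_all]
    exact fun i hi => ev3 i (by have := Finset.mem_range.1 hi; omega)
  obtain ⟨d, hd, hd'⟩ := Metric.eventually_nhds_iff.1 ((ev1.and ev2).and ev4)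
  set B : ℝ := ∑ i ∈ Finset.range 5, (|iteratedDeriv i ρ 0| + 1) with hB
  have hB0 : 0 ≤ B := Finset.sum_nonneg fun i _ => by positivity
  set K : ℝ := 1 + B + 2 / a + 4 / d + 4 / r with hK
  have p1 : 0 < 2 / a := by positivity
  have p2 : 0 < 4 / d := by positivity
  have p3 : 0 < 4 / r := by positivity
  have hK1 : 1 ≤ K := by linarith
  have hK0 : 0 < K := by linarith
  have hKi : 0 < K⁻¹ := inv_pos.2 hK0
  have hinv : ∀ b : ℝ, 0 < b → b ≤ K → K⁻¹ ≤ b⁻¹ := fun b hb hbK => by gcongr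
  have hKd : K⁻¹ ≤ d / 4 := by simpa [inv_div] using hinv (4 / d) p2 (by linarith)
  have hKr : K⁻¹ ≤ r / 4 := by simpa [inv_div] using hinv (4 / r) p3 (by linarith)
  have hKa : K⁻¹ ≤ a / 2 := by simpa [inv_div] using hinv (2 / a) p1 (by linarith)
  have hG : ∀ s₀ : ℝ, |s₀| ≤ K⁻¹ → GraphNear K Ω z e₁ e₂ ρ s₀ ∧
      ∀ s ∈ Ioo (s₀ - K⁻¹) (s₀ + K⁻¹), K⁻¹ ≤ iteratedDeriv 2 ρ s := by
    intro s₀ hs₀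
    have hsd : ∀ s ∈ Ioo (s₀ - K⁻¹) (s₀ + K⁻¹), |s| < d ∧ |s| < r := by
      intro s hs
      have h1 := abs_le.1 hs₀
      have h3 : |s| < 2 * K⁻¹ := by rw [abs_lt]; constructor <;> linarith [hs.1, hs.2]
      exact ⟨by linarith, by linarith⟩
    have hs₀d := hd' (y := s₀) (by rw [Real.dist_eq, sub_zero]; linarith)
    refine ⟨⟨h.norm_fst, h.norm_snd, h.inner_eq, hρ.mono fun s hs => abs_lt.1 (hsd s hs).2, ?_, ?_⟩,
      ?_⟩
    · intro i _ hi s hs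
      have h1 := (hd' (y := s) (by simpa using (hsd s hs).1)).2 i (Finset.mem_range.2 (by omega))
      have h3 : |iteratedDeriv i ρ 0| + 1 ≤ B :=
        Finset.single_le_sum (f := fun i => |iteratedDeriv i ρ 0| + 1) (fun i _ => by positivity)
          (Finset.mem_range.2 (by omega : i < 5))
      linarith
    · intro s hs η hη
      refine h.mem_iff s η (hsd s hs).2 ?_
      have h1 := hs₀d.1.1
      have e : η = (η - ρ s₀) + ρ s₀ := by ring
      rw [e]
      refine (abs_add_le _ _).trans_lt ?_
      linarith
    · intro s hs
      have h1 := (hd' (y := s) (by simpa using (hsd s hs).1)).1.2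
      linarith
  refine ⟨K, hK1, ?_⟩
  filter_upwards [Metric.ball_mem_nhds z hKi] with p hp hpf
  rw [mem_ball_iff_norm] at hp
  obtain ⟨hG0, -⟩ := hG 0 (by rw [abs_zero]; exact hKi.le)
  obtain ⟨s, η, hrep⟩ := hG0.exists_coords p
  have hco := hG0.abs_le_dist s η 0 0
  simp only [zero_smul, add_zero, sub_zero] at hco
  rw [← hrep] at hco
  have hs : s ∈ Ioo (0 - K⁻¹) (0 + K⁻¹) := by
    have := abs_lt.1 (hco.1.trans_lt hp)
    exact ⟨by linarith, by linarith⟩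
  have hη : |η - ρ 0| < K⁻¹ := by rw [h.graph_zero, sub_zero]; exact hco.2.trans_lt hp
  rw [hΩ.frontier_eq] at hpf
  have e1 : ρ s ≤ η := hG0.le_of_mem_closure hs hη (hrep ▸ hpf.1)
  have e2 : ¬ ρ s < η := fun hh => hpf.2 (hrep ▸ (hG0.mem_iff s hs η hη).2 hh)
  have e3 : η = ρ s := le_antisymm (not_lt.1 e2) e1
  obtain ⟨hGs, hcs⟩ := hG s (hco.1.trans hp.le)
  exact ⟨z, e₁, e₂, ρ, s, hGs, hcs, by rw [hrep, e3]⟩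

/-- Away from the degenerate point, the boundary is uniformly convex. -/
theorem exists_uniform_convexGraphAt {m : ℕ} {θ : ℝ} (hm : 4 ≤ m) (hΩ : IsOpen Ω)
    (hb : Bornology.IsBounded Ω) (hreg : HasCHolderBoundary m θ Ω)
    (hcurv : ∀ z ∈ frontier Ω, z ≠ 0 → ∃ κ : ℝ, 0 < κ ∧ HasBoundaryCurvatureAt Ω z κ) {ε : ℝ}
    (hε : 0 < ε) : ∃ K ≥ 1, ∀ p ∈ frontier Ω, ε ≤ ‖p‖ → ConvexGraphAt K Ω p := by
  have hlocal : ∀ z ∈ frontier Ω, z ≠ 0 →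
      ∃ K ≥ 1, ∀ᶠ p in 𝓝 z, p ∈ frontier Ω → ConvexGraphAt K Ω p := by
    intro z hz hz0
    obtain ⟨κ, hκ, Φ, ρ, r, hgr, hC2, hκe⟩ := hcurv z hz hz0
    -- The curvature hypothesis supplies one chart and the regularity of the boundary another.
    -- Positivity of the second derivative is carried from the first to the second through the
    -- enclosing paraboloid, which refers to no chart.
    obtain ⟨Ψ, σ, r', hgr', hmem⟩ := hreg z hz
    obtain ⟨e₁, e₂, hfr⟩ := hgr.exists_frameGraph
    obtain ⟨f₁, f₂, hfr'⟩ := hgr'.exists_frameGraph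
    have h2 : 0 < iteratedDeriv 2 ρ 0 := by
      rw [hκe] at hκ
      have : (0 : ℝ) < (1 + deriv ρ 0 ^ 2) ^ (3 / 2 : ℝ) := Real.rpow_pos_of_pos (by positivity) _
      exact (div_pos_iff_of_pos_right this).1 hκ
    obtain ⟨n, c, δ, hc, hδ, hpar⟩ := hfr.exists_paraboloid hC2 h2
    have h4 : ContDiffOn ℝ 4 σ (Ioo (-r') r') := hmem.contDiffOn.of_le (by exact_mod_cast hm)
    exact hfr'.exists_convexGraphAt hΩ h4
      (hfr'.second_deriv_pos (h4.of_le (by norm_num)) hc hδ hpar)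
  have hcomp : IsCompact (frontier Ω ∩ {p | ε ≤ ‖p‖}) :=
    (Metric.isCompact_of_isClosed_isBounded isClosed_frontier
      (hb.closure.subset frontier_subset_closure)).inter_right
      (isClosed_le continuous_const continuous_norm)
  have := hcomp.induction_on (p := fun S => ∃ K ≥ 1, ∀ p ∈ S, p ∈ frontier Ω → ConvexGraphAt K Ω p)
    ⟨1, le_rfl, fun p hp => absurd hp (notMem_empty p)⟩
    (fun S S' hS ⟨K, hK, h⟩ => ⟨K, hK, fun p hp => h p (hS hp)⟩)
    (fun S S' ⟨K, hK, h⟩ ⟨K', hK', h'⟩ => ⟨max K K', le_max_of_le_left hK, fun p hp hpf =>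
      hp.elim (fun hh => (h p hh hpf).mono (by linarith) (le_max_left _ _))
        fun hh => (h' p hh hpf).mono (by linarith) (le_max_right _ _)⟩)
    (fun z hz => by
      obtain ⟨K, hK, hev⟩ := hlocal z hz.1 (by
        rintro rfl
        have : ε ≤ ‖(0 : Plane)‖ := hz.2
        rw [norm_zero] at this; linarith)
      exact ⟨_, nhdsWithin_le_nhds hev, K, hK, fun p hp => hp⟩)
  obtain ⟨K, hK, h⟩ := this
  exact ⟨K, hK, fun p hp hpε => h p ⟨hp, hpε⟩ hp⟩

end Curvature

/-! ### Pairs away from the degenerate point -/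

section OuterPairs

variable {k : ℕ} {Ω : Set Plane} {ρ : ℝ → ℝ} {r c C : ℝ}

theorem rescaled_one {R : ℝ} (hR : Ω ⊆ Metric.ball 0 R) : rescaled k Ω 1 R = Ω := by
  have h1 : dilation k 1 ⁻¹' Ω = Ω := by
    ext x
    have : dilation k 1 x = x := by ext i; fin_cases i <;> simp
    rw [mem_preimage, this]
  rw [rescaled, h1]
  exact inter_eq_left.2 hR

/-- Pairs of points that are not both close to the degenerate boundary point are admissible. -/
theorem OriginChart.exists_admissible_of_height (h : OriginChart k Ω ρ r c C) (hk : 4 ≤ k)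
    (hopen : IsOpen Ω) (hconv : Convex ℝ Ω) (hb : Bornology.IsBounded Ω)
    (hgr : ∀ ε > 0, ∃ K ≥ 1, ∀ p ∈ frontier Ω, ε ≤ ‖p‖ → ConvexGraphAt K Ω p)
    {c₂ : ℝ} (hc₂ : 0 < c₂) :
    ∃ K' ≥ 2, Ω ⊆ Metric.ball 0 K' ∧ ∀ y₁ y₂, y₁ ≠ y₂ → y₁ ∈ closure Ω → y₂ ∈ closure Ω →
      (c₂ ≤ y₁ 1 ∨ c₂ ≤ y₂ 1) → AdmissiblePair K' Ω y₁ y₂ := by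
  have hr := h.pos
  have hC := h.up_nonneg
  obtain ⟨B, hB0, hB⟩ : ∃ B > 0, ∀ x ∈ closure Ω, ‖x‖ ≤ B := hb.closure.exists_pos_norm_le
  set R₀ : ℝ := min 1 (r / (2 * (C + 1))) with hR₀
  have hR₀0 : 0 < R₀ := lt_min one_pos (by positivity)
  have hR₀1 : R₀ ≤ 1 := min_le_left _ _
  have hR₀C : (C + 1) * R₀ ≤ r / 2 := by
    have h1 : R₀ ≤ r / (2 * (C + 1)) := min_le_right _ _
    calc (C + 1) * R₀ ≤ (C + 1) * (r / (2 * (C + 1))) := by gcongr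
      _ = r / 2 := by field_simp
  have hCR₀ : 0 ≤ C * R₀ := by positivity
  set Kg : ℝ := 1 + C + 2 / R₀ + 4 / r with hKg
  have q1 : 0 < 2 / R₀ := by positivity
  have q2 : 0 < 4 / r := by positivity
  have hKg0 : 0 < Kg := by linarith
  have hKg1 : 1 ≤ Kg := by linarith
  have hinv : ∀ b : ℝ, 0 < b → b ≤ Kg → Kg⁻¹ ≤ b⁻¹ := fun b hb hbK => by gcongr
  have hKR₀ : Kg⁻¹ ≤ R₀ / 2 := by simpa [inv_div] using hinv (2 / R₀) q1 (by linarith)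
  have hKr : Kg⁻¹ ≤ r / 4 := by simpa [inv_div] using hinv (4 / r) q2 (by linarith)
  have hKi1 : Kg⁻¹ ≤ 1 := inv_le_one_of_one_le₀ hKg1
  have hpow : C * R₀ ^ k ≤ C * R₀ := by
    have : R₀ ^ k ≤ R₀ ^ 1 := pow_le_pow_of_le_one hR₀0.le hR₀1 (by omega)
    rw [pow_one] at this
    gcongr
  set R : ℝ := B + R₀ + C * R₀ + 2 with hR
  have hΩR : Ω ⊆ Metric.ball 0 R := fun x hx => by
    rw [mem_ball_zero_iff]; linarith [hB x (subset_closure hx)]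
  set ρ₁ : ℝ → ℝ := fun s => ((1 : ℝ) ^ k)⁻¹ * ρ (1 * s) with hρ₁
  -- The rescaled chart with T = 1 is the chart itself.
  have hgraph : ∀ s₀, |s₀| ≤ R₀ / 2 → GraphNear Kg Ω 0 (axis 0) (axis 1) ρ₁ s₀ := by
    intro s₀ hs₀
    have := h.graphNear_rescaled hk (T := 1) (R₀ := R₀) (K := Kg) (R := R) (s₀ := s₀) one_pos hKg0
      (by linarith) (by linarith) (by rw [one_pow, one_mul]; linarith) (by linarith) (fun i _ => by
        have : R₀ ^ (k - i) ≤ 1 := pow_le_one₀ hR₀0.le hR₀1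
        calc C * R₀ ^ (k - i) ≤ C * 1 := by gcongr
          _ ≤ Kg := by linarith)
    rwa [rescaled_one hΩR] at this
  obtain ⟨Kf, hKf, hfar⟩ := hgr (R₀ / 2) (by positivity)
  set K : ℝ := 2 * (Kg + Kf) + R with hK
  have hK2 : 2 ≤ K := by linarith
  have hKi : ∀ b : ℝ, 0 < b → b ≤ Kg + Kf → K⁻¹ ≤ (2 * b)⁻¹ := by
    intro b hb hbK
    have : 0 < 2 * b := by linarith
    gcongr
    linarith
  -- Touching balls exist at every boundary point, also where the curvature degenerates: only an
  -- upper bound for the second derivative of the graph is needed. The origin chart serves near 0,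
  -- the convex charts elsewhere.
  have htouch : ∀ p ∈ closure Ω, p ∉ Ω → ∃ n : Plane, ‖n‖ = 1 ∧
      Metric.ball (p + K⁻¹ • n) K⁻¹ ⊆ Ω := by
    intro p hp hpΩ
    rcases le_or_gt (R₀ / 2) ‖p‖ with hpR | hpR
    · obtain ⟨o, e₁, e₂, σ, s₀, hG, -, ho⟩ := hfar p (by
        rw [hopen.frontier_eq]; exact ⟨hp, hpΩ⟩) hpR
      obtain ⟨n, hn, hbl⟩ := hG.exists_touching_ball hKf
      rw [← ho] at hbl
      exact ⟨n, hn, (touching_ball_subset (hKi Kf (by linarith) (by linarith)) hn).trans hbl⟩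
    · obtain ⟨a0, a1⟩ := plane_abs_le p
      have b0 : |p 0| < r := by linarith
      have b1 : |p 1| < r := by linarith
      have e1 := h.le_of_mem_closure hp b0 b1
      have e2 := (h.mem_iff p b0 b1).not.1 hpΩ
      have e3 : p 1 = ρ₁ (p 0) := by
        simp only [hρ₁, one_pow, inv_one, one_mul]
        exact le_antisymm (not_lt.1 e2) e1
      obtain ⟨n, hn, hbl⟩ := (hgraph (p 0) (by linarith)).exists_touching_ball hKg1
      rw [← e3, ← plane_eq p] at hbl
      exact ⟨n, hn, (touching_ball_subset (hKi Kg hKg0 (by linarith)) hn).trans hbl⟩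
  obtain ⟨c₁, hc₁, hadm⟩ := exists_admissiblePair (K := K) hK2 hc₂
  obtain ⟨K₁, hK₁, hfar₁⟩ := hgr c₁ hc₁
  obtain ⟨K', hK'2, hadm⟩ := hadm (K₁ + R) (by linarith)
  refine ⟨K' + R, by linarith, hΩR.trans (Metric.ball_subset_ball (by linarith)),
    fun y₁ y₂ hne hy₁ hy₂ hor => ?_⟩
  -- With H = B + 1 the height restriction of the criterion is void.
  have hH : ∀ y ∈ closure Ω, inner ℝ (axis 1) y ≤ B + 1 := by
    intro y hy
    rw [inner_axis_one]
    linarith [le_abs_self (y 1), (plane_abs_le y).2, hB y hy]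
  refine (hadm (e := axis 1) (H := B + 1) hopen hconv
    (hΩR.trans (Metric.ball_subset_ball (by linarith)))
    (hΩR.trans (Metric.ball_subset_ball (by linarith))) (by simp [axis]) (by linarith) ?_
    (fun p hp hpΩ _ => htouch p hp hpΩ) (fun p hp hpΩ _ hpc => ?_) hne hy₁ hy₂ (hH _ hy₁) (hH _ hy₂)
    (by rw [inner_axis_one, inner_axis_one]; exact hor)).mono (by linarith) (by linarith)
  · refine Subset.trans ?_ (h.touching_ball_origin hk (T := 1)
      (hgraph 0 (by rw [abs_zero]; positivity)) hKg1)
    have := touching_ball_subset (p := (0 : Plane)) (hKi Kg hKg0 (by linarith)) (n := axis 1)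
      (by simp [axis])
    simpa using this
  · exact (hfar₁ p (by rw [hopen.frontier_eq]; exact ⟨hp, hpΩ⟩) hpc).mono (by linarith)
      (by linarith)

end OuterPairs

/-! ### Functions flat at the degenerate point -/

section FlatFunctions

set_option maxSynthPendingDepth 3

theorem norm_iteratedFDeriv_le_of_cHolderNorm_le {V : Type*} [NormedAddCommGroup V]
    [NormedSpace ℝ V] {m : ℕ} {θ : ℝ} {U : Set V} {f : V → ℝ} {M : ℝ≥0}
    (h : cHolderNorm m θ U f ≤ M) {i : ℕ} (hi : i ≤ m) {x : V} (hx : x ∈ U) :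
    ‖iteratedFDeriv ℝ i f x‖ ≤ M := by
  have h1 : ‖iteratedFDeriv ℝ i f x‖ₑ ≤ M := by
    calc ‖iteratedFDeriv ℝ i f x‖ₑ ≤ ⨆ x ∈ U, ‖iteratedFDeriv ℝ i f x‖ₑ :=
          le_iSup₂ (f := fun x (_ : x ∈ U) => ‖iteratedFDeriv ℝ i f x‖ₑ) x hx
      _ ≤ ∑ i ∈ Finset.range (m + 1), ⨆ x ∈ U, ‖iteratedFDeriv ℝ i f x‖ₑ :=
          Finset.single_le_sum (f := fun i => ⨆ x ∈ U, ‖iteratedFDeriv ℝ i f x‖ₑ)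
            (fun _ _ => zero_le) (Finset.mem_range.2 (by omega))
      _ ≤ cHolderNorm m θ U f := le_self_add
      _ ≤ M := h
  rw [enorm_eq_nnnorm] at h1
  exact_mod_cast h1

theorem norm_iteratedFDeriv_sub_le_of_cHolderNorm_le {V : Type*} [NormedAddCommGroup V]
    [NormedSpace ℝ V] {m : ℕ} {θ : ℝ} (hθ : 0 ≤ θ) {U : Set V} {f : V → ℝ} {M : ℝ≥0}
    (h : cHolderNorm m θ U f ≤ M) {x y : V} (hx : x ∈ U) (hy : y ∈ U) :
    ‖iteratedFDeriv ℝ m f x - iteratedFDeriv ℝ m f y‖ ≤ M * ‖x - y‖ ^ θ := by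
  have h1 : eHolderNorm θ.toNNReal (U.domRestrict (iteratedFDeriv ℝ m f)) ≤ M :=
    le_trans le_add_self h
  have h2 : MemHolder θ.toNNReal (U.domRestrict (iteratedFDeriv ℝ m f)) :=
    eHolderNorm_lt_top.1 (h1.trans_lt ENNReal.coe_lt_top)
  have h3 : nnHolderNorm θ.toNNReal (U.domRestrict (iteratedFDeriv ℝ m f)) ≤ M := by
    rw [← ENNReal.coe_le_coe, h2.coe_nnHolderNorm_eq_eHolderNorm]; exact h1
  have h4 := h2.holderWith.dist_le ⟨x, hx⟩ ⟨y, hy⟩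
  rw [Real.coe_toNNReal _ hθ, Subtype.dist_eq, dist_eq_norm, dist_eq_norm] at h4
  refine h4.trans ?_
  gcongr

/-- Integration of a decay estimate from a boundary point of a convex set. -/
theorem norm_le_of_norm_fderiv_le {E F : Type*} [NormedAddCommGroup E] [InnerProductSpace ℝ E]
    [NormedAddCommGroup F] [NormedSpace ℝ F] {Ω : Set E} (hopen : IsOpen Ω) (hconv : Convex ℝ Ω)
    (h0 : (0 : E) ∈ closure Ω) {f : E → F} (hf : ∀ x ∈ Ω, DifferentiableAt ℝ f x) {C e : ℝ}
    (hC : 0 ≤ C) (he : 0 ≤ e) (hd : ∀ x ∈ Ω, ‖fderiv ℝ f x‖ ≤ C * ‖x‖ ^ e)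
    (hlim : Tendsto f (𝓝[Ω] 0) (𝓝 0)) {x : E} (hx : x ∈ Ω) : ‖f x‖ ≤ C * ‖x‖ ^ (e + 1) := by
  have hmem : ∀ t ∈ Ioc (0 : ℝ) 1, t • x ∈ Ω := by
    intro t ht
    have := combo_mem_of_closure hopen hconv hx h0 ht.1 (sub_nonneg.2 ht.2) (by ring)
    simpa using this
  -- On this convex set the derivative is at most C‖x‖^e. The mean value inequality between t • x
  -- and x, with t → 0⁺, reaches the boundary point 0.
  have hS : Convex ℝ (Ω ∩ Metric.closedBall 0 ‖x‖) := hconv.inter (convex_closedBall _ _)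
  have hxS : x ∈ Ω ∩ Metric.closedBall 0 ‖x‖ := ⟨hx, by simp⟩
  have key : ∀ t ∈ Ioc (0 : ℝ) 1, ‖f x - f (t • x)‖ ≤ C * ‖x‖ ^ e * ‖x - t • x‖ := by
    intro t ht
    refine hS.norm_image_sub_le_of_norm_hasFDerivWithin_le
      (fun y hy => (hf y hy.1).hasFDerivAt.hasFDerivWithinAt) (fun y hy => ?_)
      ⟨hmem t ht, ?_⟩ hxS
    · refine (hd y hy.1).trans ?_
      have : ‖y‖ ≤ ‖x‖ := by simpa using hy.2
      gcongr
    · rw [mem_closedBall_zero_iff, norm_smul, Real.norm_eq_abs, abs_of_pos ht.1]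
      nlinarith [norm_nonneg x, ht.2]
  have hcont : Tendsto (fun t : ℝ => t • x) (𝓝[>] 0) (𝓝 0) := by
    have : Tendsto (fun t : ℝ => t • x) (𝓝[>] 0) (𝓝 ((0 : ℝ) • x)) :=
      (Continuous.tendsto (by fun_prop) 0).mono_left nhdsWithin_le_nhds
    rwa [zero_smul] at this
  have hev : ∀ᶠ t in 𝓝[>] (0 : ℝ), t ∈ Ioc (0 : ℝ) 1 := Ioc_mem_nhdsGT one_pos
  have h1 : Tendsto (fun t : ℝ => f (t • x)) (𝓝[>] 0) (𝓝 0) :=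
    hlim.comp (tendsto_nhdsWithin_iff.2 ⟨hcont, hev.mono fun t ht => hmem t ht⟩)
  have h2 : Tendsto (fun t : ℝ => ‖f x - f (t • x)‖) (𝓝[>] 0) (𝓝 ‖f x - 0‖) :=
    (tendsto_const_nhds.sub h1).norm
  have h3 : Tendsto (fun t : ℝ => C * ‖x‖ ^ e * ‖x - t • x‖) (𝓝[>] 0)
      (𝓝 (C * ‖x‖ ^ e * ‖x - 0‖)) := (tendsto_const_nhds.sub hcont).norm.const_mul _
  have h4 := le_of_tendsto_of_tendsto h2 h3 (hev.mono fun t ht => key t ht)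
  rw [sub_zero, sub_zero] at h4
  refine h4.trans (le_of_eq ?_)
  rw [Real.rpow_add_one' (norm_nonneg _) (by positivity)]
  ring

variable {Ω : Set Plane} {N : ℕ} {α : ℝ} {M : ℝ≥0} {w : Plane → ℝ}

theorem contDiffAt_of_memCHolder (hopen : IsOpen Ω) (hw : MemCHolder N α Ω w) {x : Plane}
    (hx : x ∈ Ω) : ContDiffAt ℝ N w x :=
  (hw.contDiffOn x hx).contDiffAt (hopen.mem_nhds hx)

/-- The Hölder condition on the top derivative, compared with its limit 0 at the origin, gives the
decay ‖x‖^α. Each integration from the origin lowers the order by one and raises the exponent by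
one, down to order two. -/
theorem norm_iteratedFDeriv_le_rpow (hopen : IsOpen Ω) (hconv : Convex ℝ Ω)
    (h0 : (0 : Plane) ∈ closure Ω) (hα : 0 < α) (hN : 2 ≤ N) (hw : MemCHolder N α Ω w)
    (hM : cHolderNorm N α Ω w ≤ M) (hflat : DerivsVanishAtOrigin N Ω w) :
    ∀ j, j + 2 ≤ N → ∀ x ∈ Ω, ‖iteratedFDeriv ℝ (N - j) w x‖ ≤ M * ‖x‖ ^ (j + α) := by
  have hne : (𝓝[Ω] (0 : Plane)).NeBot := mem_closure_iff_nhdsWithin_neBot.1 h0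
  intro j
  induction j with
  | zero =>
    intro _ x hx
    rw [Nat.sub_zero, Nat.cast_zero, zero_add]
    have h1 := (hflat N hN le_rfl)
    have h2 : Tendsto (fun y : Plane => ‖iteratedFDeriv ℝ N w x - iteratedFDeriv ℝ N w y‖)
        (𝓝[Ω] 0) (𝓝 ‖iteratedFDeriv ℝ N w x - 0‖) := (tendsto_const_nhds.sub h1).norm
    have h3 : Tendsto (fun y : Plane => (M : ℝ) * ‖x - y‖ ^ α) (𝓝[Ω] 0) (𝓝 (M * ‖x - 0‖ ^ α)) := by
      have hc : Continuous fun y : Plane => (M : ℝ) * ‖x - y‖ ^ α := by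
        have : Continuous fun y : Plane => ‖x - y‖ := by fun_prop
        exact continuous_const.mul (this.rpow_const fun _ => Or.inr hα.le)
      exact (hc.tendsto 0).mono_left nhdsWithin_le_nhds
    have h4 := le_of_tendsto_of_tendsto h2 h3 (by
      filter_upwards [self_mem_nhdsWithin] with y hy
      exact norm_iteratedFDeriv_sub_le_of_cHolderNorm_le hα.le hM hx hy)
    simpa using h4
  | succ j ih =>
    intro hj x hx
    have := norm_le_of_norm_fderiv_le hopen hconv h0 (f := iteratedFDeriv ℝ (N - (j + 1)) w)
      (C := M) (e := j + α) (fun y hy => (contDiffAt_of_memCHolder hopen hw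
        hy).differentiableAt_iteratedFDeriv (by exact_mod_cast (by omega : N - (j + 1) < N)))
      M.2 (by positivity) (fun y hy => by
        rw [norm_fderiv_iteratedFDeriv, show N - (j + 1) + 1 = N - j by omega]
        exact ih (by omega) y hy) (hflat _ (by omega) (by omega)) hx
    push_cast
    rwa [show (j : ℝ) + 1 + α = j + α + 1 by ring]

/-- A function whose derivatives of order at least two vanish at the boundary point `0` agrees with
an affine function to high order. -/
theorem exists_affine_approximation (hopen : IsOpen Ω) (hconv : Convex ℝ Ω)
    (h0 : (0 : Plane) ∈ closure Ω) (hα : 0 < α) (hN : 4 ≤ N) (hw : MemCHolder N α Ω w)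
    (hM : cHolderNorm N α Ω w ≤ M) (hflat : DerivsVanishAtOrigin N Ω w) :
    ∃ (g : Plane → Plane →L[ℝ] ℝ) (L : Plane →L[ℝ] ℝ) (b : ℝ), ContinuousOn g (closure Ω) ∧
      (∀ x ∈ Ω, g x = fderiv ℝ w x) ∧ ∀ i ≤ 4, ∀ x ∈ Ω,
        ‖iteratedFDeriv ℝ i (fun y => w y - (L y + b)) x‖ ≤ M * ‖x‖ ^ (((N - i : ℕ) : ℝ) + α) := by
  obtain ⟨G, hGc, hGe⟩ := hw.extends_closure 1 (by omega)
  set g : Plane → Plane →L[ℝ] ℝ := fun x => continuousMultilinearCurryFin1 ℝ Plane ℝ (G x) with hg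
  have hgc : ContinuousOn g (closure Ω) :=
    (continuousMultilinearCurryFin1 ℝ Plane ℝ).continuous.comp_continuousOn hGc
  have hge : ∀ x ∈ Ω, g x = fderiv ℝ w x := by
    intro x hx
    ext v
    simp only [hg]
    rw [hGe hx, continuousMultilinearCurryFin1_apply, iteratedFDeriv_one_apply]
    rfl
  set L := g 0 with hL
  set b := w 0 with hb
  have hdw : ∀ x ∈ Ω, DifferentiableAt ℝ w x := fun x hx =>
    (contDiffAt_of_memCHolder hopen hw hx).differentiableAt (by
      have : N ≠ 0 := by omega
      exact_mod_cast this)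
  have hdw' : ∀ x ∈ Ω, DifferentiableAt ℝ (fderiv ℝ w) x := fun x hx =>
    ((contDiffAt_of_memCHolder hopen hw hx).fderiv_right (m := 1) (by
      have : 2 ≤ N := by omega
      exact_mod_cast this)).differentiableAt (by norm_num)
  have hhigh := norm_iteratedFDeriv_le_rpow hopen hconv h0 hα (by omega) hw hM hflat
  have hv : ∀ x ∈ Ω, fderiv ℝ (fun y => w y - (L y + b)) x = fderiv ℝ w x - L := by
    intro x hx
    rw [fderiv_fun_sub (hdw x hx) (by fun_prop), fderiv_add_const]
    simp
  have hvd : ∀ x ∈ Ω, DifferentiableAt ℝ (fun y => w y - (L y + b)) x := fun x hx =>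
    (hdw x hx).sub (by fun_prop)
  have hcast : ∀ i, i ≤ 4 → ((N - i : ℕ) : ℝ) = N - i := fun i hi => by
    rw [Nat.cast_sub (by omega)]
  -- The boundary values of w and of its gradient at 0 need not vanish; subtracting them allows two
  -- further integrations, to orders one and zero.
  have h1 : ∀ x ∈ Ω, ‖fderiv ℝ w x - L‖ ≤ M * ‖x‖ ^ (((N - 1 : ℕ) : ℝ) + α) := by
    intro x hx
    have hlim : Tendsto (fun x => fderiv ℝ w x - L) (𝓝[Ω] 0) (𝓝 0) := by
      have t1 : Tendsto g (𝓝[Ω] 0) (𝓝 L) := (hgc 0 h0).tendsto.mono_left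
        (nhdsWithin_mono _ subset_closure)
      have t2 : Tendsto (fderiv ℝ w) (𝓝[Ω] 0) (𝓝 L) := t1.congr' (by
        filter_upwards [self_mem_nhdsWithin] with y hy using hge y hy)
      simpa using t2.sub_const L
    have := norm_le_of_norm_fderiv_le hopen hconv h0 (f := fun x => fderiv ℝ w x - L) (C := M)
      (e := ((N - 2 : ℕ) : ℝ) + α) (fun y hy => (hdw' y hy).sub_const L) M.2 (by positivity)
      (fun y hy => by
        rw [fderiv_sub_const]
        have h2 := hhigh (N - 2) (by omega) y hy
        rw [show N - (N - 2) = 2 by omega] at h2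
        rwa [← norm_iteratedFDeriv_fderiv, ← norm_iteratedFDeriv_fderiv,
          norm_iteratedFDeriv_zero] at h2) hlim hx
    rw [hcast 1 (by norm_num)]
    rw [hcast 2 (by norm_num)] at this
    convert this using 3
    push_cast; ring
  refine ⟨g, L, b, hgc, hge, fun i hi x hx => ?_⟩
  match i, hi with
  | 0, _ =>
    rw [norm_iteratedFDeriv_zero]
    have hlim : Tendsto (fun y => w y - (L y + b)) (𝓝[Ω] 0) (𝓝 0) := by
      have t1 : Tendsto w (𝓝[Ω] 0) (𝓝 b) := (hw.continuousOn 0 h0).tendsto.mono_left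
        (nhdsWithin_mono _ subset_closure)
      have t2 : Tendsto (fun y => L y + b) (𝓝[Ω] 0) (𝓝 (L 0 + b)) :=
        (Continuous.tendsto (by fun_prop) 0).mono_left nhdsWithin_le_nhds
      simpa using t1.sub t2
    have := norm_le_of_norm_fderiv_le hopen hconv h0 (f := fun y => w y - (L y + b)) (C := M)
      (e := ((N - 1 : ℕ) : ℝ) + α) hvd M.2 (by positivity)
      (fun y hy => by rw [hv y hy]; exact h1 y hy) hlim hx
    rw [hcast 0 (by norm_num)]
    rw [hcast 1 (by norm_num)] at this
    convert this using 3
    push_cast; ring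
  | 1, _ =>
    rw [← norm_iteratedFDeriv_fderiv, norm_iteratedFDeriv_zero, hv x hx]
    exact h1 x hx
  | (j + 2), hj =>
    have h2 := hhigh (N - (j + 2)) (by omega) x hx
    rw [show N - (N - (j + 2)) = j + 2 by omega] at h2
    rw [← norm_iteratedFDeriv_fderiv, ← norm_iteratedFDeriv_fderiv] at h2 ⊢
    have h3 : fderiv ℝ (fderiv ℝ (fun y => w y - (L y + b))) =ᶠ[𝓝 x] fderiv ℝ (fderiv ℝ w) := by
      filter_upwards [hopen.mem_nhds hx] with y hy
      have : fderiv ℝ (fun y => w y - (L y + b)) =ᶠ[𝓝 y] fun y => fderiv ℝ w y - L := by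
        filter_upwards [hopen.mem_nhds hy] with u hu using hv u hu
      rw [this.fderiv_eq, fderiv_sub_const]
    rwa [(h3.iteratedFDeriv ℝ j).eq_of_nhds]

end FlatFunctions

/-! ### Uniform regularity after rescaling -/

section RescaledFunctions

set_option maxSynthPendingDepth 3

variable {k : ℕ} {Ω : Set Plane} {v : Plane → ℝ} {g : Plane → Plane →L[ℝ] ℝ}

theorem norm_dilation_le (hk : 1 ≤ k) {T : ℝ} (hT0 : 0 ≤ T) (hT : T ≤ 1) : ‖dilation k T‖ ≤ T :=
  ContinuousLinearMap.opNorm_le_bound _ hT0 fun x => norm_dilation_apply_le hk hT0 hT x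

/-- A function flat of order `e` at `0` is uniformly regular after rescaling. -/
theorem regularOn_rescaled (hk : 4 ≤ k) {e M : ℝ} (he : (4 : ℝ) ≤ e) (hM : 0 ≤ M) (hopen : IsOpen Ω)
    (hconv : Convex ℝ Ω) (hv : ContDiffOn ℝ 4 v Ω) (hvc : ContinuousOn v (closure Ω))
    (hgc : ContinuousOn g (closure Ω)) (hge : ∀ x ∈ Ω, g x = fderiv ℝ v x)
    (hb : ∀ i : ℕ, i ≤ 4 → ∀ x ∈ Ω, ‖iteratedFDeriv ℝ i v x‖ ≤ M * ‖x‖ ^ (e - i)) {T R : ℝ}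
    (hT : 0 < T) (hT1 : T ≤ 1) (hR : 1 ≤ R) :
    RegularOn (R + M * R ^ e) (rescaled k Ω T R) (fun x => (T ^ e)⁻¹ * v (dilation k T x))
      (fun x => (T ^ e)⁻¹ • (g (dilation k T x)).comp (dilation k T)) := by
  have hk1 : 1 ≤ k := by omega
  have hR0 : 0 < R := by linarith
  have hS : 0 < T ^ e := Real.rpow_pos_of_pos hT e
  have hRe : 0 < R ^ e := Real.rpow_pos_of_pos hR0 e
  have hcl : MapsTo (dilation k T) (closure (rescaled k Ω T R)) (closure Ω) := fun x hx =>
    dilation_mem_closure hx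
  have hcomp : ContDiffOn ℝ 4 (fun x => v (dilation k T x)) (dilation k T ⁻¹' Ω) :=
    hv.comp (dilation k T).contDiff.contDiffOn fun x hx => hx
  have hpre : IsOpen (dilation k T ⁻¹' Ω) := hopen.preimage (dilation k T).continuous
  have hat : ∀ x ∈ dilation k T ⁻¹' Ω, ContDiffAt ℝ 4 (fun x => v (dilation k T x)) x :=
    fun x hx => (hcomp x hx).contDiffAt (hpre.mem_nhds hx)
  exact
    { isOpen := rescaled_isOpen hopen T R
      convex := rescaled_convex hconv T R
      subset_ball := inter_subset_right.trans (Metric.ball_subset_ball (by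
        have : 0 ≤ M * R ^ e := by positivity
        linarith))
      contDiffOn := contDiffOn_const.mul (hcomp.mono inter_subset_left)
      continuousOn := continuousOn_const.mul
        (hvc.comp (dilation k T).continuous.continuousOn hcl)
      continuousOn_grad := by
        have h1 : ContinuousOn (fun x => g (dilation k T x)) (closure (rescaled k Ω T R)) :=
          hgc.comp (dilation k T).continuous.continuousOn hcl
        have h2 : ContinuousOn (fun x => (g (dilation k T x)).comp (dilation k T))
            (closure (rescaled k Ω T R)) :=
          h1.clm_comp (continuousOn_const (c := dilation k T))
        exact h2.const_smul (T ^ e)⁻¹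
      grad_eq := fun x hx => by
        have h1 : DifferentiableAt ℝ v (dilation k T x) :=
          (hv.differentiableOn (by norm_num) _ hx.1).differentiableAt (hopen.mem_nhds hx.1)
        have h2 : HasFDerivAt (fun x => v (dilation k T x))
            ((fderiv ℝ v (dilation k T x)).comp (dilation k T)) x :=
          h1.hasFDerivAt.comp x (dilation k T).hasFDerivAt
        rw [hge _ hx.1, (h2.const_mul (T ^ e)⁻¹).fderiv]
      bound := fun i hi x hx => by
        have hi' : ((i : ℕ) : WithTop ℕ∞) ≤ 4 := by exact_mod_cast hi
        have hier : (i : ℝ) ≤ e := le_trans (by exact_mod_cast hi) he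
        have e1 : iteratedFDeriv ℝ i (fun x => (T ^ e)⁻¹ * v (dilation k T x)) x =
            (T ^ e)⁻¹ • iteratedFDeriv ℝ i (fun x => v (dilation k T x)) x :=
          iteratedFDeriv_const_smul_apply' (a := (T ^ e)⁻¹) ((hat x hx.1).of_le hi')
        have e2 : iteratedFDeriv ℝ i (fun x => v (dilation k T x)) x =
            (iteratedFDeriv ℝ i v (dilation k T x)).compContinuousLinearMap
              fun _ => dilation k T := by
          have := (dilation k T).iteratedFDerivWithin_comp_right hv hopen.uniqueDiffOn
            hpre.uniqueDiffOn hx.1 hi'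
          rwa [iteratedFDerivWithin_of_isOpen i hpre hx.1,
            iteratedFDerivWithin_of_isOpen i hopen hx.1] at this
        have hx2 : ‖x‖ ≤ R := by
          have := hx.2
          rw [mem_ball_zero_iff] at this
          exact this.le
        rw [e1, norm_smul, Real.norm_eq_abs, abs_of_pos (inv_pos.2 hS), e2]
        -- The i-th derivative gains T^i from the chain rule and (TR)^(e−i) from flatness; their
        -- product is T^e R^(e−i), and the normalisation removes T^e.
        have h3 : ‖(iteratedFDeriv ℝ i v (dilation k T x)).compContinuousLinearMap
            fun _ => dilation k T‖ ≤ M * (T * R) ^ (e - i) * T ^ i := by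
          refine (ContinuousMultilinearMap.norm_compContinuousLinearMap_le _ _).trans ?_
          rw [Finset.prod_const, Finset.card_univ, Fintype.card_fin]
          have h4 : ‖dilation k T x‖ ≤ T * R :=
            (norm_dilation_apply_le hk1 hT.le hT1 x).trans (by gcongr)
          have h5 := hb i hi _ hx.1
          have h6 := norm_dilation_le hk1 hT.le hT1
          have h7 : ‖dilation k T x‖ ^ (e - i) ≤ (T * R) ^ (e - i) :=
            Real.rpow_le_rpow (norm_nonneg _) h4 (by linarith)
          calc _ ≤ M * ‖dilation k T x‖ ^ (e - i) * ‖dilation k T‖ ^ i := by gcongr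
            _ ≤ _ := by gcongr
        have h8 : (T ^ e)⁻¹ * (M * (T * R) ^ (e - i) * T ^ i) = M * R ^ (e - i) := by
          rw [Real.mul_rpow hT.le hR0.le, ← Real.rpow_natCast T i]
          have : T ^ e = T ^ (e - i) * T ^ (i : ℝ) := by rw [← Real.rpow_add hT]; congr 1; ring
          rw [this]
          have a1 : T ^ (e - i) ≠ 0 := (Real.rpow_pos_of_pos hT _).ne'
          have a2 : T ^ (i : ℝ) ≠ 0 := (Real.rpow_pos_of_pos hT _).ne'
          field_simp
        calc _ ≤ (T ^ e)⁻¹ * (M * (T * R) ^ (e - i) * T ^ i) := by gcongr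
          _ = M * R ^ (e - i) := h8
          _ ≤ M * R ^ e := by
            refine mul_le_mul_of_nonneg_left (Real.rpow_le_rpow_of_exponent_le hR ?_) hM
            have : (0 : ℝ) ≤ i := Nat.cast_nonneg i
            linarith
          _ ≤ _ := by linarith }

/-- On bounded distances a quadratic estimate is stronger than one with exponent 1 + γ. -/
theorem sq_le_mul_rpow {t B γ : ℝ} (ht : 0 ≤ t) (htB : t ≤ B) (hB : 1 ≤ B) (hγ0 : 0 < γ)
    (hγ1 : γ ≤ 1) : t ^ 2 ≤ B * t ^ (1 + γ) := by
  rcases eq_or_lt_of_le ht with rfl | ht0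
  · simp only [ne_eq, OfNat.ofNat_ne_zero, not_false_eq_true, zero_pow]
    positivity
  have e : t ^ 2 = t ^ (1 - γ) * t ^ (1 + γ) := by
    rw [← Real.rpow_add ht0, ← Real.rpow_natCast]; congr 1; push_cast; ring
  rw [e]
  refine mul_le_mul_of_nonneg_right ?_ (by positivity)
  calc t ^ (1 - γ) ≤ B ^ (1 - γ) := Real.rpow_le_rpow ht htB (by linarith)
    _ ≤ B ^ (1 : ℝ) := Real.rpow_le_rpow_of_exponent_le hB (by linarith)
    _ = B := Real.rpow_one B

end RescaledFunctions

/-! ### The estimate for one pair of contact points -/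

section PairEstimate

set_option maxSynthPendingDepth 3

variable {k : ℕ} {Ω : Set Plane} {w : Plane → ℝ} {g : Plane → Plane →L[ℝ] ℝ}

/-- The chord bound for a single interior contact point. -/
theorem RegularOn.chordBound_of_mem {K : ℝ} (h : RegularOn K Ω w g) (hK : 1 ≤ K) {γ : ℝ}
    (hγ0 : 0 < γ) (hγ1 : γ ≤ 1) {L : Plane →L[ℝ] ℝ} {b : ℝ} (hle : ∀ x ∈ closure Ω, L x + b ≤ w x)
    {y z : Plane} (hy : y ∈ Ω) (hyc : L y + b = w y) (hz : z ∈ Ω) :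
    ChordBound Ω (fun x => w x - (L x + b)) z (2 * K ^ 2 * ‖z - y‖ ^ (1 + γ)) := by
  have hK0 : 0 < K := by linarith
  have hV := h.sub_affine hK0.le L b
  have h0 := hV.grad_eq_zero (fun x hx => sub_nonneg.2 (hle x hx)) hy (by rw [hyc, sub_self])
  rw [← hV.grad_eq y hy, sub_eq_zero] at h0
  have h1 := h.le_taylor (subset_closure hy) (subset_closure hz) ⟨y, hy⟩
  have h2 : L (z - y) = L z - L y := map_sub L z y
  rw [h0, h2] at h1
  refine chordBound_of_le (subset_closure hz) ?_
  have h3 := sq_le_mul_rpow (norm_nonneg (z - y))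
    (h.norm_sub_le (subset_closure hz) (subset_closure hy)) (by linarith) hγ0 hγ1
  calc w z - (L z + b) ≤ K * ‖z - y‖ ^ 2 := by linarith
    _ ≤ K * (2 * K * ‖z - y‖ ^ (1 + γ)) := by gcongr
    _ = _ := by ring

/-- The chord bound at a pair of contact points both close to the degenerate point. -/
theorem chordBound_of_rescaled (hk : 4 ≤ k) {β γ : ℝ} (hβ : 0 < β) (hβk : β ≤ k) (hγ : γ = β / k)
    {P R K C M T : ℝ} (hP1 : 1 ≤ P) (hP : ∀ x ∈ closure Ω, ‖x‖ ^ k ≤ P * x 1) (hT : 0 < T)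
    (hT1 : T ≤ 1) (hC : 0 ≤ C) (hM : 0 ≤ M) {L₀ : Plane →L[ℝ] ℝ} {b₀ : ℝ}
    (hdecay : ∀ x ∈ Ω, |w x - (L₀ x + b₀)| ≤ M * ‖x‖ ^ (k + β))
    (hreg : RegularOn K (rescaled k Ω T R)
      (fun x => (T ^ (k + β))⁻¹ * (w (dilation k T x) - (L₀ (dilation k T x) + b₀))) g)
    (hball : ∀ z, dilation k T z ∈ closure Ω → z 1 ≤ 2 → ‖z‖ < R)
    {y₁ y₂ : Plane} (h₁ : y₁ 1 ≤ T ^ k) (h₂ : y₂ 1 ≤ T ^ k)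
    (hadm : AdmissiblePair K (rescaled k Ω T R) (dilation k T⁻¹ y₁) (dilation k T⁻¹ y₂))
    (hmain : ∀ {D : Set Plane} {W : Plane → ℝ} {g : Plane → Plane →L[ℝ] ℝ},
      RegularOn K D W g → ∀ {L : Plane →L[ℝ] ℝ} {b : ℝ},
      (∀ x ∈ closure D, L x + b ≤ W x) → ∀ {y₁ y₂ : Plane},
      AdmissiblePair K D y₁ y₂ → L y₁ + b = W y₁ → L y₂ + b = W y₂ →
      ‖L‖ ≤ C ∧ |b| ≤ C ∧ ∀ τ ∈ Icc (0 : ℝ) 1, ∀ z ∈ D,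
      ChordBound D (fun x => W x - (L x + b)) z (C * ‖z - (y₁ + τ • (y₂ - y₁))‖ ^ 2))
    {L : Plane →L[ℝ] ℝ} {b : ℝ} (hle : ∀ x ∈ closure Ω, L x + b ≤ w x)
    (hc₁ : L y₁ + b = w y₁) (hc₂ : L y₂ + b = w y₂) {τ : ℝ} (hτ : τ ∈ Icc (0 : ℝ) 1) {z : Plane}
    (hz : z ∈ Ω) : ChordBound Ω (fun x => w x - (L x + b)) z
      ((C + M * (2 * P) ^ (1 + γ) + C * (2 * P + 5)) *
        ‖z - (y₁ + τ • (y₂ - y₁))‖ ^ (1 + γ)) := by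
  have hk0 : (0 : ℝ) < k := by positivity
  have hk1 : 1 ≤ k := by omega
  have hγ0 : 0 < γ := by rw [hγ]; positivity
  have hγ1 : γ ≤ 1 := by rw [hγ, div_le_one hk0]; exact hβk
  have hexp : ∀ t : ℝ, 0 ≤ t → (t ^ k) ^ (1 + γ) = t ^ (k + β) := by
    intro t ht
    rw [← Real.rpow_natCast, ← Real.rpow_mul ht]
    congr 1
    rw [hγ]; field_simp
  set S : ℝ := T ^ ((k : ℝ) + β) with hS
  have hS0 : 0 < S := Real.rpow_pos_of_pos hT _
  have hTk0 : 0 < T ^ k := by positivity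
  set A := dilation k T with hA
  set A' := dilation k T⁻¹ with hA'
  have hAA' : ∀ x, A (A' x) = x := dilation_apply_inv hT.ne'
  set LT : Plane →L[ℝ] ℝ := S⁻¹ • (L - L₀).comp A with hLT
  set bT : ℝ := S⁻¹ * (b - b₀) with hbT
  have hdiff : ∀ x, S⁻¹ * (w (A x) - (L₀ (A x) + b₀)) - (LT x + bT) =
      S⁻¹ * (w (A x) - (L (A x) + b)) := by
    intro x
    simp only [hLT, hbT, smul_apply, ContinuousLinearMap.comp_apply, sub_apply, smul_eq_mul]
    ring
  have hcontact : ∀ y, L y + b = w y → LT (A' y) + bT =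
      S⁻¹ * (w (A (A' y)) - (L₀ (A (A' y)) + b₀)) := by
    intro y hy
    have := hdiff (A' y)
    rw [hAA', hy, sub_self, mul_zero, sub_eq_zero] at this
    rw [hAA']
    exact this.symm
  obtain ⟨hLC, hbC, hch⟩ := hmain hreg (L := LT) (b := bT) (fun x hx => by
    have h1 := hle _ (dilation_mem_closure hx)
    have h2 := hdiff x
    have h3 : 0 ≤ S⁻¹ * (w (A x) - (L (A x) + b)) :=
      mul_nonneg (inv_pos.2 hS0).le (sub_nonneg.2 h1)
    linarith) hadm (hcontact y₁ hc₁) (hcontact y₂ hc₂)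
  set y : Plane := y₁ + τ • (y₂ - y₁) with hy
  have hA'y : A' y = A' y₁ + τ • (A' y₂ - A' y₁) := by rw [hy, map_add, map_smul, map_sub]
  set h : ℝ := ‖A' z - A' y‖ with hh
  -- The key scaling identity: S h^(1+γ) = (T^k h)^(1+γ), because (T^k)^(1+β/k) = T^(k+β), and T^k h
  -- ≤ ‖z − y‖.
  have hle_h : S * h ^ (1 + γ) ≤ ‖z - y‖ ^ (1 + γ) := by
    have h1 : h ≤ (T ^ k)⁻¹ * ‖z - y‖ := by
      rw [hh, ← map_sub]
      exact norm_dilation_inv_apply_le hk1 hT hT1 _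
    have h2 : T ^ k * h ≤ ‖z - y‖ := by
      rwa [le_inv_mul_iff₀ hTk0] at h1
    have h3 : S * h ^ (1 + γ) = (T ^ k * h) ^ (1 + γ) := by
      rw [Real.mul_rpow hTk0.le (norm_nonneg _), hexp T hT.le]
    rw [h3]
    exact Real.rpow_le_rpow (by positivity) h2 (by linarith)
  have hy1 : (A' y) 1 ≤ 1 := by
    have e : (A' y) 1 = (T ^ k)⁻¹ * y 1 := by rw [hA', dilation_one, inv_pow]
    have h3 : y 1 ≤ T ^ k := by
      have e2 : y 1 = (1 - τ) * y₁ 1 + τ * y₂ 1 := by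
        simp only [hy, PiLp.add_apply, PiLp.smul_apply, PiLp.sub_apply, smul_eq_mul]; ring
      rw [e2]
      nlinarith [hτ.1, hτ.2]
    rw [e, inv_mul_le_iff₀ hTk0, mul_one]; exact h3
  have hz1 : (A' z) 1 ≤ 1 + h := by
    have := (plane_abs_le (A' z - A' y)).2
    rw [PiLp.sub_apply] at this
    linarith [le_abs_self ((A' z) 1 - (A' y) 1)]
  have pC : 0 ≤ M * (2 * P) ^ (1 + γ) := by positivity
  have pC' : 0 ≤ C * (2 * P + 5) := by positivity
  have hpow0 : 0 ≤ ‖z - y‖ ^ (1 + γ) := by positivity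
  -- At rescaled distance h < 1 the point has height at most 2, so it belongs to the truncated
  -- domain and the quadratic bound applies, with h² ≤ h^(1+γ).
  rcases lt_or_ge h 1 with hlt | hge
  · have hzD : A' z ∈ rescaled k Ω T R := by
      refine ⟨?_, ?_⟩
      · change A (A' z) ∈ Ω
        rw [hAA']; exact hz
      · rw [mem_ball_zero_iff]
        refine hball _ ?_ (by linarith)
        rw [hAA']; exact subset_closure hz
    have h1 := hch τ hτ (A' z) hzD
    rw [← hA'y, ← hh] at h1
    obtain ⟨z₁, m₁, z₂, m₂, p, q, hp, hq, hpq, hcomb, hV⟩ := h1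
    refine ⟨A z₁, dilation_mem_closure m₁, A z₂, dilation_mem_closure m₂, p, q, hp, hq, hpq, ?_, ?_⟩
    · rw [← map_smul, ← map_smul, ← map_add, hcomb, hAA']
    · beta_reduce at hV
      rw [hdiff, hdiff] at hV
      have h2 : h ^ 2 ≤ h ^ (1 + γ) := by
        simpa using sq_le_mul_rpow (norm_nonneg _) hlt.le le_rfl hγ0 hγ1
      calc p * (w (A z₁) - (L (A z₁) + b)) + q * (w (A z₂) - (L (A z₂) + b))
          = S * (p * (S⁻¹ * (w (A z₁) - (L (A z₁) + b))) +
            q * (S⁻¹ * (w (A z₂) - (L (A z₂) + b)))) := by field_simp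
        _ ≤ S * (C * h ^ 2) := by gcongr
        _ ≤ S * (C * h ^ (1 + γ)) := by gcongr
        _ = C * (S * h ^ (1 + γ)) := by ring
        _ ≤ C * ‖z - y‖ ^ (1 + γ) := by gcongr
        _ ≤ _ := by
          refine mul_le_mul_of_nonneg_right ?_ hpow0
          linarith
  -- For h ≥ 1 the value at z itself suffices. The rescaled height of z is at most 2h, so ‖z‖^k is
  -- at most T^k · 2Ph and flatness gives the exponent 1 + γ; the rescaled support grows at most
  -- linearly, and h ≤ h^(1+γ).
  · refine chordBound_of_le (subset_closure hz) ?_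
    have hzP := hP z (subset_closure hz)
    set η : ℝ := (A' z) 1 with hη
    have hzη : z 1 = T ^ k * η := by
      rw [hη, hA', dilation_one, inv_pow]; field_simp
    have hη0 : 0 ≤ η := by
      rw [hzη] at hzP
      have : 0 ≤ P * (T ^ k * η) := le_trans (by positivity) hzP
      exact nonneg_of_mul_nonneg_right (nonneg_of_mul_nonneg_right this (by linarith)) hTk0
    have hη2 : η ≤ 2 * h := by linarith
    have hdec : S⁻¹ * |w z - (L₀ z + b₀)| ≤ M * (2 * P) ^ (1 + γ) * h ^ (1 + γ) := by
      rw [inv_mul_le_iff₀ hS0]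
      calc |w z - (L₀ z + b₀)| ≤ M * ‖z‖ ^ ((k : ℝ) + β) := hdecay z hz
        _ = M * (‖z‖ ^ k) ^ (1 + γ) := by rw [hexp _ (norm_nonneg _)]
        _ ≤ M * (T ^ k * (2 * P * h)) ^ (1 + γ) := by
          refine mul_le_mul_of_nonneg_left (Real.rpow_le_rpow (by positivity) ?_ (by linarith)) hM
          calc ‖z‖ ^ k ≤ P * z 1 := hzP
            _ = T ^ k * (P * η) := by rw [hzη]; ring
            _ ≤ T ^ k * (P * (2 * h)) := by gcongr
            _ = _ := by ring
        _ = S * (M * (2 * P) ^ (1 + γ) * h ^ (1 + γ)) := by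
          rw [Real.mul_rpow hTk0.le (by positivity), Real.mul_rpow (by positivity) (norm_nonneg _),
            hexp T hT.le]
          ring
    have hhp : h ≤ h ^ (1 + γ) := by
      calc h = h ^ (1 : ℝ) := (Real.rpow_one h).symm
        _ ≤ h ^ (1 + γ) := Real.rpow_le_rpow_of_exponent_le hge (by linarith)
    have hz0 : |(A' z) 0| ≤ P * η + 1 := by
      have e0 : T * |(A' z) 0| ≤ ‖z‖ := by
        have := (plane_abs_le z).1
        have e1 : z 0 = T * (A' z) 0 := by rw [hA', dilation_zero]; field_simp
        rwa [e1, abs_mul, abs_of_pos hT] at this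
      have h1 : T ^ k * |(A' z) 0| ^ k ≤ T ^ k * (P * η) := by
        calc T ^ k * |(A' z) 0| ^ k = (T * |(A' z) 0|) ^ k := (mul_pow _ _ _).symm
          _ ≤ ‖z‖ ^ k := by gcongr
          _ ≤ P * z 1 := hzP
          _ = _ := by rw [hzη]; ring
      have h2 := le_of_mul_le_mul_left h1 hTk0
      by_contra hcon
      push Not at hcon
      have hPη : 0 ≤ P * η := by positivity
      have h3 : |(A' z) 0| ≤ |(A' z) 0| ^ k := le_self_pow₀ (by linarith) (by omega)
      linarith
    have hlin : -(LT (A' z) + bT) ≤ C * (2 * P + 5) * h ^ (1 + γ) := by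
      have h1 : |LT (A' z)| ≤ C * ‖A' z‖ := by
        rw [← Real.norm_eq_abs]
        exact (LT.le_opNorm _).trans (by gcongr)
      have h2 := plane_norm_le (A' z)
      rw [← hη, abs_of_nonneg hη0] at h2
      have h3 : ‖A' z‖ + 1 ≤ (2 * P + 5) * h := by nlinarith
      calc -(LT (A' z) + bT) ≤ C * ‖A' z‖ + C := by
            linarith [(abs_le.1 h1).1, (abs_le.1 hbC).1]
        _ = C * (‖A' z‖ + 1) := by ring
        _ ≤ C * ((2 * P + 5) * h) := by gcongr
        _ ≤ C * ((2 * P + 5) * h ^ (1 + γ)) := by gcongr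
        _ = _ := by ring
    have hVz := hdiff (A' z)
    rw [hAA'] at hVz
    have h5 : S⁻¹ * (w z - (L z + b)) ≤
        (M * (2 * P) ^ (1 + γ) + C * (2 * P + 5)) * h ^ (1 + γ) := by
      rw [← hVz]
      have h6 : S⁻¹ * (w z - (L₀ z + b₀)) ≤ S⁻¹ * |w z - (L₀ z + b₀)| := by
        gcongr; exact le_abs_self _
      linarith
    rw [inv_mul_le_iff₀ hS0] at h5
    calc w z - (L z + b) ≤ _ := h5
      _ = (M * (2 * P) ^ (1 + γ) + C * (2 * P + 5)) * (S * h ^ (1 + γ)) := by ring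
      _ ≤ (M * (2 * P) ^ (1 + γ) + C * (2 * P + 5)) * ‖z - y‖ ^ (1 + γ) := by gcongr
      _ ≤ _ := by
        refine mul_le_mul_of_nonneg_right ?_ hpow0
        linarith

end PairEstimate

/-! ### The estimate for all pairs, uniformly in the obstacle -/

section UniformPairEstimate

set_option maxSynthPendingDepth 3

/-- This makes the Hölder exponent β − [β] positive. The truncated subtraction is harmless because
the ceiling of a positive number is at least one. -/
theorem strictFloor_lt {β : ℝ} (hβ : 0 < β) : (strictFloor β : ℝ) < β := by
  have h1 : ⌈β⌉₊ ≠ 0 := (Nat.ceil_pos.2 hβ).ne'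
  have h2 : (⌈β⌉₊ : ℝ) < β + 1 := Nat.ceil_lt_add_one hβ.le
  rw [strictFloor, Nat.cast_sub (by omega)]
  push_cast
  linarith

/-- The convex envelope estimate at a pair of contact points, uniform in the obstacle. -/
theorem exists_chordBound_rpow {k : ℕ} (hk4 : 4 ≤ k) (hkeven : Even k) {β : ℝ} (hβ : 0 < β)
    (hβk : β ≤ k) {Ω : Set Plane} (hopen : IsOpen Ω) (hconv : Convex ℝ Ω)
    (hb : Bornology.IsBounded Ω)
    (hreg : HasCHolderBoundary (k + strictFloor β) (β - strictFloor β) Ω)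
    (hdeg : IsDegenerateAtOrigin k β Ω)
    (hcurv : ∀ z ∈ frontier Ω, z ≠ 0 → ∃ κ : ℝ, 0 < κ ∧ HasBoundaryCurvatureAt Ω z κ) (M : ℝ≥0) :
    ∃ C : ℝ, 0 ≤ C ∧ ∀ w : Plane → ℝ, MemCHolder (k + strictFloor β) (β - strictFloor β) Ω w →
      cHolderNorm (k + strictFloor β) (β - strictFloor β) Ω w ≤ M →
      DerivsVanishAtOrigin (k + strictFloor β) Ω w →
      ∀ (L : Plane →L[ℝ] ℝ) (b : ℝ), (∀ x ∈ closure Ω, L x + b ≤ w x) →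
      ∀ y₁ ∈ closure Ω, ∀ y₂ ∈ closure Ω, L y₁ + b = w y₁ → L y₂ + b = w y₂ →
      ∀ τ ∈ Icc (0 : ℝ) 1, y₁ + τ • (y₂ - y₁) ∈ Ω → ∀ z ∈ Ω,
      ChordBound Ω (fun x => w x - (L x + b)) z
        (C * ‖z - (y₁ + τ • (y₂ - y₁))‖ ^ (1 + β / k)) := by
  obtain ⟨ρ, r, c, C₀, hchart⟩ := hdeg.exists_originChart hk4 hkeven hconv
  obtain ⟨P, hP1, hP⟩ := hchart.exists_pow_le hk4 hconv hb
  obtain ⟨K₁, hK₁, T₁, hT₁, hT₁1, R, hR, hinner⟩ :=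
    hchart.exists_rescaled_admissible hk4 hopen hconv hb
  obtain ⟨K₂, hK₂, hΩK₂, houter⟩ := hchart.exists_admissible_of_height hk4 hopen hconv hb
    (fun ε hε => exists_uniform_convexGraphAt (by omega) hopen hb hreg hcurv hε)
    (c₂ := T₁ ^ k) (by positivity)
  have h0 := hchart.zero_mem_closure hk4
  have hk0 : (0 : ℝ) < k := by positivity
  have hk4' : (4 : ℝ) ≤ k := by exact_mod_cast hk4
  set γ : ℝ := β / k with hγ
  have hγ0 : 0 < γ := by positivity
  have hγ1 : γ ≤ 1 := by rw [hγ, div_le_one hk0]; exact hβk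
  have hα := sub_pos.2 (strictFloor_lt hβ)
  set N : ℕ := k + strictFloor β with hN
  set e : ℝ := k + β with he
  have hM0 : (0 : ℝ) ≤ M := M.2
  have hRe : 0 ≤ M * R ^ e := by positivity
  set Kin : ℝ := max K₁ (R + M * R ^ e) with hKin
  set Kout : ℝ := max K₂ M with hKout
  obtain ⟨Cin, hCin, hmain⟩ := exists_chordBound_sub_affine (hK₁.trans (le_max_left _ _) : 2 ≤ Kin)
  obtain ⟨Cout, hCout, hmain'⟩ :=
    exists_chordBound_sub_affine (hK₂.trans (le_max_left _ _) : 2 ≤ Kout)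
  have hKout2 : 2 ≤ Kout := hK₂.trans (le_max_left _ _)
  set C₁ : ℝ := 2 * Kout ^ 2 with hC₁
  set C₂ : ℝ := Cout * (2 * Kout) with hC₂
  set C₃ : ℝ := Cin + M * (2 * P) ^ (1 + γ) + Cin * (2 * P + 5) with hC₃
  have hC₁0 : 0 ≤ C₁ := by positivity
  have hC₂0 : 0 ≤ C₂ := by positivity
  have hC₃0 : 0 ≤ C₃ := by positivity
  refine ⟨C₁ + C₂ + C₃, by positivity, ?_⟩
  intro w hw hwM hflat L b hle y₁ hy₁ y₂ hy₂ hc₁ hc₂ τ hτ hyΩ z hz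
  obtain ⟨g, L₀, b₀, hgc, hge, hflat'⟩ :=
    exists_affine_approximation hopen hconv h0 hα (by omega) hw hwM hflat
  have hw4 : ContDiffOn ℝ 4 w Ω := hw.contDiffOn.of_le (by exact_mod_cast (by omega : 4 ≤ N))
  have hregw : RegularOn Kout Ω w g :=
    { isOpen := hopen
      convex := hconv
      subset_ball := hΩK₂.trans (Metric.ball_subset_ball (le_max_left _ _))
      contDiffOn := hw4
      continuousOn := hw.continuousOn
      continuousOn_grad := hgc
      grad_eq := hge
      bound := fun i hi x hx =>
        (norm_iteratedFDeriv_le_of_cHolderNorm_le hwM (by omega) hx).trans (le_max_right _ _) }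
  have hpow0 : 0 ≤ ‖z - (y₁ + τ • (y₂ - y₁))‖ ^ (1 + γ) := by positivity
  rcases eq_or_ne y₁ y₂ with rfl | hne
  · rw [sub_self, smul_zero, add_zero] at hyΩ hpow0 ⊢
    refine (hregw.chordBound_of_mem (by linarith) hγ0 hγ1 hle hyΩ hc₁ hz).mono ?_
    exact mul_le_mul_of_nonneg_right (by linarith) hpow0
  -- The threshold T₁^k is where the two regimes meet: below it the scale T with T^k equal to the
  -- larger height satisfies T ≤ T₁.
  by_cases hheight : T₁ ^ k ≤ y₁ 1 ∨ T₁ ^ k ≤ y₂ 1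
  · have hadm := (houter y₁ y₂ hne hy₁ hy₂ hheight).mono (by linarith) (le_max_left K₂ (M : ℝ))
    refine ((hmain' hregw hle hadm hc₁ hc₂).2.2 τ hτ z hz).mono ?_
    have h1 := sq_le_mul_rpow (norm_nonneg (z - (y₁ + τ • (y₂ - y₁))))
      (hregw.norm_sub_le (subset_closure hz) (subset_closure hyΩ)) (by linarith) hγ0 hγ1
    calc _ ≤ Cout * (2 * Kout * ‖z - (y₁ + τ • (y₂ - y₁))‖ ^ (1 + γ)) := by gcongr
      _ = C₂ * ‖z - (y₁ + τ • (y₂ - y₁))‖ ^ (1 + γ) := by rw [hC₂]; ring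
      _ ≤ _ := mul_le_mul_of_nonneg_right (by linarith) hpow0
  push Not at hheight
  have hh0 : ∀ y ∈ closure Ω, 0 ≤ y 1 ∧ (y 1 ≤ 0 → y = 0) := by
    intro y hy
    have h1 := hP y hy
    have h2 : 0 ≤ P * y 1 := le_trans (by positivity) h1
    refine ⟨nonneg_of_mul_nonneg_right h2 (by linarith), fun h3 => ?_⟩
    have h4 : ‖y‖ ^ k ≤ 0 := h1.trans (mul_nonpos_of_nonneg_of_nonpos (by linarith) h3)
    have h5 : ‖y‖ ^ k = 0 := le_antisymm h4 (by positivity)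
    exact norm_eq_zero.1 (pow_eq_zero_iff (by omega) |>.1 h5)
  set H : ℝ := max (y₁ 1) (y₂ 1) with hH
  -- The only point of the closure at height zero is 0, so two distinct points cannot both have it.
  have hH0 : 0 < H := by
    by_contra hcon
    push Not at hcon
    have h1 := (hh0 y₁ hy₁).2 ((le_max_left _ _).trans hcon)
    have h2 := (hh0 y₂ hy₂).2 ((le_max_right _ _).trans hcon)
    exact hne (h1.trans h2.symm)
  set T : ℝ := H ^ ((k : ℝ)⁻¹) with hT
  have hT0 : 0 < T := Real.rpow_pos_of_pos hH0 _
  have hTk : T ^ k = H := Real.rpow_inv_natCast_pow hH0.le (by omega)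
  have hTT : T ≤ T₁ := by
    have : T ^ k ≤ T₁ ^ k := by rw [hTk]; exact (max_lt hheight.1 hheight.2).le
    exact (pow_le_pow_iff_left₀ hT0.le hT₁.le (by omega)).1 this
  have hT1 : T ≤ 1 := hTT.trans hT₁1
  obtain ⟨hball, hpair⟩ := hinner T hT0 hTT
  have hAA' : ∀ x, dilation k T (dilation k T⁻¹ x) = x := dilation_apply_inv hT0.ne'
  have hcoord : ∀ y : Plane, (dilation k T⁻¹ y) 1 = y 1 / H := by
    intro y; rw [dilation_one, inv_pow, hTk]; ring
  have hadm : AdmissiblePair K₁ (rescaled k Ω T R) (dilation k T⁻¹ y₁) (dilation k T⁻¹ y₂) := by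
    refine hpair _ _ ?_ ?_ ?_ ?_ ?_ ?_
    · intro heq
      apply hne
      rw [← hAA' y₁, heq, hAA']
    · rwa [hAA']
    · rwa [hAA']
    · rw [hcoord, div_le_one hH0]; exact le_max_left _ _
    · rw [hcoord, div_le_one hH0]; exact le_max_right _ _
    · rw [hcoord, hcoord, one_le_div hH0, one_le_div hH0]
      exact le_max_iff.1 le_rfl
  have haff : ContDiff ℝ 4 fun x => L₀ x + b₀ := L₀.contDiff.add contDiff_const
  have hexp : ∀ i : ℕ, i ≤ 4 → (((N - i : ℕ) : ℝ) + (β - strictFloor β)) = e - i := by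
    intro i hi
    rw [Nat.cast_sub (by omega), hN, he]
    push_cast
    ring
  have hflat'' : ∀ i : ℕ, i ≤ 4 → ∀ x ∈ Ω,
      ‖iteratedFDeriv ℝ i (fun y => w y - (L₀ y + b₀)) x‖ ≤ M * ‖x‖ ^ (e - i) := by
    intro i hi x hx
    have := hflat' i hi x hx
    rwa [hexp i hi] at this
  have hregT := (regularOn_rescaled (v := fun x => w x - (L₀ x + b₀)) (g := fun x => g x - L₀)
    hk4 (e := e) (by linarith) hM0 hopen hconv (hw4.sub haff.contDiffOn)
    (hw.continuousOn.sub haff.continuous.continuousOn) (hgc.sub continuousOn_const)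
    (fun x hx => by
      have h1 : DifferentiableAt ℝ w x :=
        (hw4.differentiableOn (by norm_num) x hx).differentiableAt (hopen.mem_nhds hx)
      have h2 : HasFDerivAt (fun x => w x - (L₀ x + b₀)) (fderiv ℝ w x - L₀) x :=
        h1.hasFDerivAt.sub (L₀.hasFDerivAt.add_const b₀)
      rw [hge x hx, h2.fderiv]) hflat'' hT0 hT1 hR).mono (le_max_right K₁ _)
  have hdecay : ∀ x ∈ Ω, |w x - (L₀ x + b₀)| ≤ M * ‖x‖ ^ e := by
    intro x hx
    have := hflat'' 0 (by norm_num) x hx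
    rwa [norm_iteratedFDeriv_zero, Real.norm_eq_abs, Nat.cast_zero, sub_zero] at this
  refine (chordBound_of_rescaled hk4 hβ hβk hγ hP1 hP hT0 hT1 hCin hM0 hdecay hregT hball
    (by rw [hTk]; exact le_max_left _ _) (by rw [hTk]; exact le_max_right _ _)
    (hadm.mono (by linarith) (le_max_left _ _)) hmain hle hc₁ hc₂ hτ hz).mono ?_
  exact mul_le_mul_of_nonneg_right (by linarith) hpow0

end UniformPairEstimate

/-! ### Convex hulls in the plane -/

section PlanarHull

/-- By Carathéodory three points suffice in the plane, so the hull is a continuous image of the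
product of a simplex with Z³. Shorter combinations are padded with weight zero at a fixed point of
Z. -/
theorem Plane.isCompact_convexHull {Z : Set Plane} (hZ : IsCompact Z) :
    IsCompact (convexHull ℝ Z) := by
  rcases Z.eq_empty_or_nonempty with rfl | ⟨z₀, hz₀⟩
  · simp
  have himage : convexHull ℝ Z = (fun q : (Fin 3 → ℝ) × (Fin 3 → Plane) => ∑ i, q.1 i • q.2 i) ''
      (stdSimplex ℝ (Fin 3) ×ˢ univ.pi fun _ => Z) := by
    apply Subset.antisymm
    · intro x hx
      obtain ⟨ι, _, z, w, hz, hind, hw, hw1, hwx⟩ := eq_pos_convex_span_of_mem_convexHull hx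
      have hcard : Fintype.card ι ≤ Fintype.card (Fin 3) := by
        have h1 := hind.card_le_finrank_succ
        have h2 := Submodule.finrank_le (vectorSpan ℝ (range z))
        rw [finrank_euclideanSpace_fin] at h2
        rw [Fintype.card_fin]
        omega
      obtain ⟨f⟩ := Function.Embedding.nonempty_of_card_le hcard
      have hoff : ∀ j ∉ range f, Function.extend f w 0 j = 0 := fun j hj =>
        Function.extend_apply' _ _ _ fun ⟨i, hi⟩ => hj ⟨i, hi⟩
      refine ⟨(Function.extend f w 0, Function.extend f z fun _ => z₀), ⟨⟨fun j => ?_, ?_⟩, ?_⟩, ?_⟩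
      · change 0 ≤ Function.extend f w 0 j
        by_cases hj : j ∈ range f
        · obtain ⟨i, rfl⟩ := hj
          rw [f.injective.extend_apply]; exact (hw i).le
        · rw [hoff j hj]
      · rw [← hw1]
        exact (Fintype.sum_of_injective f f.injective _ _ hoff
          fun i => (f.injective.extend_apply _ _ i).symm).symm
      · intro j _
        by_cases hj : j ∈ range f
        · obtain ⟨i, rfl⟩ := hj
          simp only [f.injective.extend_apply]; exact hz ⟨i, rfl⟩
        · simp only
          rw [Function.extend_apply' _ _ _ fun ⟨i, hi⟩ => hj ⟨i, hi⟩]; exact hz₀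
      · rw [← hwx]
        refine (Fintype.sum_of_injective f f.injective _ _ (fun j hj => ?_) fun i => ?_).symm
        · simp only [hoff j hj, zero_smul]
        · simp only [f.injective.extend_apply]
    · rintro _ ⟨⟨w, z⟩, ⟨hw, hz⟩, rfl⟩
      exact (convex_convexHull ℝ Z).sum_mem (fun i _ => hw.1 i) hw.2
        fun i _ => subset_convexHull ℝ Z (hz i (mem_univ i))
  rw [himage]
  refine ((isCompact_stdSimplex ℝ (Fin 3)).prod (isCompact_univ_pi fun _ => hZ)).image ?_
  fun_prop

/-- A point of a planar convex hull outside its interior lies on a segment between two points. -/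
theorem Plane.exists_segment_of_notMem_interior {Z : Set Plane} {x : Plane}
    (hx : x ∈ convexHull ℝ Z) (hxi : x ∉ interior (convexHull ℝ Z)) :
    ∃ p ∈ Z, ∃ q ∈ Z, ∃ τ ∈ Icc (0 : ℝ) 1, x = p + τ • (q - p) := by
  obtain ⟨ι, _, z, w, hz, hind, hw, hw1, hwx⟩ := eq_pos_convex_span_of_mem_convexHull hx
  have hcard : Fintype.card ι ≤ 3 := by
    have h1 := hind.card_le_finrank_succ
    have h2 := Submodule.finrank_le (vectorSpan ℝ (range z))
    rw [finrank_euclideanSpace_fin] at h2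
    omega
  -- In a minimal representation all weights are positive; with three affinely independent points
  -- these are positive barycentric coordinates, so x would be interior to a triangle in the hull.
  have hne3 : Fintype.card ι ≠ 3 := by
    intro h3
    have htop : affineSpan ℝ (range z) = ⊤ := by
      rw [hind.affineSpan_eq_top_iff_card_eq_finrank_add_one, finrank_euclideanSpace_fin, h3]
    let b : AffineBasis ι ℝ Plane := ⟨z, hind, htop⟩
    apply hxi
    refine interior_mono (convexHull_mono (s := range b) hz) ?_
    rw [b.interior_convexHull]
    intro i
    have h4 := b.coord_apply_combination_of_mem (Finset.mem_univ i) hw1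
    rw [Finset.affineCombination_eq_linear_combination _ _ _ hw1] at h4
    have h5 : ∑ i, w i • b i = x := hwx
    rw [h5] at h4
    rw [h4]; exact hw i
  have hne0 : Fintype.card ι ≠ 0 := by
    intro h
    have := Fintype.card_eq_zero_iff.1 h
    simp at hw1
  obtain h1 | h2 : Fintype.card ι = 1 ∨ Fintype.card ι = 2 := by omega
  · let e := Fintype.equivFinOfCardEq h1
    rw [← e.symm.sum_comp] at hw1 hwx
    simp only [Fin.sum_univ_one] at hw1 hwx
    rw [hw1, one_smul] at hwx
    exact ⟨_, hz ⟨e.symm 0, rfl⟩, _, hz ⟨e.symm 0, rfl⟩, 0, by simp, by simp [hwx]⟩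
  · let e := Fintype.equivFinOfCardEq h2
    rw [← e.symm.sum_comp] at hw1 hwx
    simp only [Fin.sum_univ_two] at hw1 hwx
    refine ⟨_, hz ⟨e.symm 0, rfl⟩, _, hz ⟨e.symm 1, rfl⟩, w (e.symm 1), ⟨(hw _).le, ?_⟩, ?_⟩
    · linarith [hw (e.symm 0)]
    · rw [← hwx, eq_sub_of_add_eq hw1]; module

/-- Moving a point of a planar convex hull towards `x`, one reaches `x` or a segment between two
points. -/
theorem Plane.mem_convexHull_or_exists_segment {Z : Set Plane} (hZ : IsCompact Z) {y : Plane}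
    (hy : y ∈ convexHull ℝ Z) (x : Plane) :
    x ∈ convexHull ℝ Z ∨ ∃ t ∈ Icc (0 : ℝ) 1, ∃ p ∈ Z, ∃ q ∈ Z, ∃ τ ∈ Icc (0 : ℝ) 1,
      y + t • (x - y) = p + τ • (q - p) := by
  have hcont : Continuous fun t : ℝ => y + t • (x - y) := by fun_prop
  set S : Set ℝ := Icc 0 1 ∩ (fun t : ℝ => y + t • (x - y)) ⁻¹' convexHull ℝ Z with hS
  have hScomp : IsCompact S :=
    isCompact_Icc.inter_right ((Plane.isCompact_convexHull hZ).isClosed.preimage hcont)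
  -- The last parameter at which the path is in the hull: unless it is the end, its point cannot be
  -- interior, and so lies on a segment between points of Z.
  obtain ⟨t, ⟨ht, htm⟩, hmax⟩ := hScomp.exists_isMaxOn ⟨0, by simp [hS, hy]⟩ continuousOn_id
  rcases eq_or_lt_of_le ht.2 with h1 | h1
  · left
    have : y + t • (x - y) = x := by rw [h1]; module
    rw [mem_preimage, this] at htm
    exact htm
  right
  refine ⟨t, ht, Plane.exists_segment_of_notMem_interior htm fun hint => ?_⟩
  have h2 : ∀ᶠ s in 𝓝[>] t, s < 1 ∧ y + s • (x - y) ∈ convexHull ℝ Z := by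
    have h3 : ∀ᶠ s in 𝓝 t, y + s • (x - y) ∈ interior (convexHull ℝ Z) :=
      hcont.continuousAt.eventually (isOpen_interior.mem_nhds hint)
    filter_upwards [nhdsWithin_le_nhds h3, Ioo_mem_nhdsGT h1] with s hs hs'
    exact ⟨hs'.2, interior_subset hs⟩
  obtain ⟨s, ⟨hs1, hsm⟩, hst⟩ := (h2.and self_mem_nhdsWithin).exists
  have hst' : t < s := hst
  have := hmax (show s ∈ S from ⟨⟨by linarith [ht.1], hs1.le⟩, hsm⟩)
  exact absurd hst' (not_lt.2 this)

end PlanarHull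

/-! ### Supports and contact sets of the envelope -/

section ConvexEnvelope

variable {Ω : Set Plane} {w : Plane → ℝ} {B : ℝ}

/-- At points of the closure the competitors are bounded above by w, so the real supremum does not
take its default value. -/
theorem le_convexEnvelope {L : Plane →L[ℝ] ℝ} {b : ℝ} (hL : ∀ y ∈ closure Ω, L y + b ≤ w y)
    {x : Plane} (hx : x ∈ closure Ω) : L x + b ≤ convexEnvelope Ω w x := by
  refine le_csSup ⟨w x, ?_⟩ ⟨L.toLinearMap.toAffineMap + AffineMap.const ℝ Plane b, ?_, ?_⟩
  · rintro _ ⟨l, hl, rfl⟩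
    exact hl x hx
  · intro y hy
    simpa using hL y hy
  · simp

theorem convexEnvelope_le (hB : ∀ y ∈ closure Ω, -B ≤ w y) {x : Plane} {t : ℝ}
    (h : ∀ (L : Plane →L[ℝ] ℝ) (b : ℝ), (∀ y ∈ closure Ω, L y + b ≤ w y) → L x + b ≤ t) :
    convexEnvelope Ω w x ≤ t := by
  refine csSup_le ⟨-B, AffineMap.const ℝ Plane (-B), by simpa using hB, by simp⟩ ?_
  rintro _ ⟨l, hl, rfl⟩
  have e : ∀ y, l y = LinearMap.toContinuousLinearMap l.linear y + l 0 := fun y =>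
    congrFun (AffineMap.decomp l) y
  rw [e]
  exact h _ _ fun y hy => by rw [← e]; exact hl y hy

theorem convexEnvelope_le_self (hB : ∀ y ∈ closure Ω, -B ≤ w y) {x : Plane} (hx : x ∈ closure Ω) :
    convexEnvelope Ω w x ≤ w x :=
  convexEnvelope_le hB fun _ _ h => h x hx

theorem neg_le_convexEnvelope (hB : ∀ y ∈ closure Ω, -B ≤ w y) {x : Plane} (hx : x ∈ closure Ω) :
    -B ≤ convexEnvelope Ω w x := by
  simpa using le_convexEnvelope (L := 0) (b := -B) (by simpa using hB) hx

/-- Every affine minorant is at most the interpolation of w along the chord, and interpolation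
reproduces affine functions exactly. -/
theorem ChordBound.convexEnvelope_le (hB : ∀ y ∈ closure Ω, -B ≤ w y) {L : Plane →L[ℝ] ℝ} {b : ℝ}
    {z : Plane} {t : ℝ} (h : ChordBound Ω (fun x => w x - (L x + b)) z t) :
    convexEnvelope Ω w z ≤ L z + b + t := by
  obtain ⟨z₁, m₁, z₂, m₂, p, q, hp, hq, hpq, rfl, hV⟩ := h
  refine _root_.convexEnvelope_le hB fun L' b' h' => ?_
  have h1 := mul_le_mul_of_nonneg_left (h' z₁ m₁) hp
  have h2 := mul_le_mul_of_nonneg_left (h' z₂ m₂) hq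
  simp only [map_add, map_smul, smul_eq_mul]
  have h3 : b' = p * b' + q * b' := by rw [← add_mul, hpq, one_mul]
  have h4 : b = p * b + q * b := by rw [← add_mul, hpq, one_mul]
  nlinarith

/-- The supremum is attained: affine minorants that are at least −B at y have slopes bounded through
a ball around y in Ω, so they form a compact set. The constant −B shows that it is nonempty. -/
theorem exists_support_convexEnvelope (hopen : IsOpen Ω)
    (hB : ∀ y ∈ closure Ω, |w y| ≤ B) {y : Plane} (hy : y ∈ Ω) :
    ∃ (L : Plane →L[ℝ] ℝ) (b : ℝ), (∀ x ∈ closure Ω, L x + b ≤ w x) ∧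
      L y + b = convexEnvelope Ω w y := by
  have hB' : ∀ x ∈ closure Ω, -B ≤ w x := fun x hx => (abs_le.1 (hB x hx)).1
  have hB0 : 0 ≤ B := (abs_nonneg _).trans (hB y (subset_closure hy))
  obtain ⟨δ, hδ, hball⟩ := Metric.isOpen_iff.1 hopen y hy
  set S : Set ((Plane →L[ℝ] ℝ) × ℝ) :=
    {q | (∀ x ∈ closure Ω, q.1 x + q.2 ≤ w x) ∧ -B ≤ q.1 y + q.2} with hS
  have hev : ∀ x : Plane, Continuous fun q : (Plane →L[ℝ] ℝ) × ℝ => q.1 x + q.2 := fun x => by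
    fun_prop
  have hclosed : IsClosed S := by
    have : S = (⋂ x ∈ closure Ω, {q | q.1 x + q.2 ≤ w x}) ∩ {q | -B ≤ q.1 y + q.2} := by
      ext q; simp [hS]
    rw [this]
    exact (isClosed_biInter fun x _ => isClosed_le (hev x) continuous_const).inter
      (isClosed_le continuous_const (hev y))
  have hbdd : Bornology.IsBounded S := by
    refine isBounded_iff_forall_norm_le.2 ⟨4 * B / δ + (B + 4 * B / δ * ‖y‖), ?_⟩
    rintro ⟨L, b⟩ ⟨h1, h2⟩
    have hLd : ∀ v : Plane, ‖v‖ < δ → |L v| ≤ 2 * B := by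
      have key : ∀ v : Plane, ‖v‖ < δ → L v ≤ 2 * B := by
        intro v hv
        have hm : y + v ∈ closure Ω := subset_closure (hball (by simpa using hv))
        have h3 := h1 _ hm
        have h4 := (abs_le.1 (hB _ hm)).2
        simp only [map_add] at h3 h2
        linarith
      intro v hv
      have := key (-v) (by rwa [norm_neg])
      rw [map_neg] at this
      exact abs_le.2 ⟨by linarith, key v hv⟩
    have hL : ‖L‖ ≤ 4 * B / δ := by
      refine L.opNorm_le_bound (by positivity) fun v => ?_
      rcases eq_or_ne v 0 with rfl | hv
      · simp
      have hv0 : 0 < ‖v‖ := norm_pos_iff.2 hv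
      have h3 := hLd ((δ / (2 * ‖v‖)) • v) (by
        rw [norm_smul, Real.norm_eq_abs, abs_of_pos (by positivity)]
        have : δ / (2 * ‖v‖) * ‖v‖ = δ / 2 := by field_simp
        linarith)
      rw [map_smul, smul_eq_mul, abs_mul, abs_of_pos (by positivity)] at h3
      rw [Real.norm_eq_abs]
      calc |L v| = δ / (2 * ‖v‖) * |L v| * (2 * ‖v‖ / δ) := by field_simp
        _ ≤ 2 * B * (2 * ‖v‖ / δ) := by gcongr
        _ = _ := by ring
    have hLy : |L y| ≤ 4 * B / δ * ‖y‖ := by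
      rw [← Real.norm_eq_abs]
      exact (L.le_opNorm y).trans (by gcongr)
    have hb : |b| ≤ B + 4 * B / δ * ‖y‖ := by
      have h3 := h1 y (subset_closure hy)
      have h4 := (abs_le.1 (hB y (subset_closure hy))).2
      have h5 := abs_le.1 hLy
      simp only at h2 h3
      exact abs_le.2 ⟨by linarith, by linarith⟩
    rw [Prod.norm_def]
    refine max_le ?_ ?_
    · refine hL.trans ?_
      have : 0 ≤ B + 4 * B / δ * ‖y‖ := by positivity
      linarith
    · rw [Real.norm_eq_abs]
      refine hb.trans ?_
      have : 0 ≤ 4 * B / δ := by positivity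
      linarith
  have hcomp : IsCompact S := Metric.isCompact_of_isClosed_isBounded hclosed hbdd
  have hzero : ((0 : Plane →L[ℝ] ℝ), -B) ∈ S := by simpa [hS] using hB'
  obtain ⟨⟨L, b⟩, hm, hmax⟩ := hcomp.exists_isMaxOn ⟨_, hzero⟩ (hev y).continuousOn
  refine ⟨L, b, hm.1, le_antisymm (le_convexEnvelope hm.1 (subset_closure hy)) ?_⟩
  refine convexEnvelope_le hB' fun L' b' h' => ?_
  by_cases hlow : -B ≤ L' y + b'
  · exact hmax (show ((L', b') : (Plane →L[ℝ] ℝ) × ℝ) ∈ S from ⟨h', hlow⟩)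
  · exact (not_le.1 hlow).le.trans hm.2

/-- The contact set of a supporting affine function has the base point in its convex hull. -/
theorem mem_convexHull_contact (hbdd : Bornology.IsBounded Ω) (hw : ContinuousOn w (closure Ω))
    {L : Plane →L[ℝ] ℝ} {b : ℝ} (hL : ∀ x ∈ closure Ω, L x + b ≤ w x) {y : Plane}
    (hy : y ∈ Ω) (hyc : L y + b = convexEnvelope Ω w y) :
    IsCompact {x | x ∈ closure Ω ∧ L x + b = w x} ∧
      y ∈ convexHull ℝ {x | x ∈ closure Ω ∧ L x + b = w x} := by
  have hcl : IsCompact (closure Ω) := hbdd.isCompact_closure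
  have hv : ContinuousOn (fun x => w x - (L x + b)) (closure Ω) :=
    hw.sub (L.continuous.add continuous_const).continuousOn
  set Z : Set Plane := {x | x ∈ closure Ω ∧ L x + b = w x} with hZ
  have hZcomp : IsCompact Z := by
    have : Z = closure Ω ∩ (fun x => w x - (L x + b)) ⁻¹' {0} := by
      ext x
      simp only [hZ, mem_inter_iff, mem_preimage, mem_singleton_iff, sub_eq_zero]
      exact and_congr_right fun _ => eq_comm
    rw [this]
    exact hcl.of_isClosed_subset (hv.preimage_isClosed_of_isClosed isClosed_closure
      isClosed_singleton) inter_subset_left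
  refine ⟨hZcomp, ?_⟩
  by_contra hcon
  -- Otherwise a linear functional separates y strictly from the hull. On the far side w exceeds the
  -- support by a positive minimum m, so the support can be tilted upwards there, by at most m, and
  -- remain a minorant; at y this beats the envelope.
  obtain ⟨f, s, hf, hfy⟩ := geometric_hahn_banach_closed_point (convex_convexHull ℝ Z)
    (Plane.isCompact_convexHull hZcomp).isClosed hcon
  set A : Set Plane := closure Ω ∩ {x | s ≤ f x} with hA
  have hAcomp : IsCompact A := hcl.inter_right (isClosed_le continuous_const f.continuous)
  have hApos : ∀ x ∈ A, 0 < w x - (L x + b) := by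
    intro x hx
    refine lt_of_le_of_ne (sub_nonneg.2 (hL x hx.1)) fun h0 => ?_
    have hxZ : x ∈ Z := ⟨hx.1, (sub_eq_zero.1 h0.symm).symm⟩
    exact absurd (hf x (subset_convexHull ℝ Z hxZ)) (not_lt.2 hx.2)
  have hyA : y ∈ A := ⟨subset_closure hy, hfy.le⟩
  obtain ⟨x₀, hx₀, hmin⟩ := hAcomp.exists_isMinOn ⟨y, hyA⟩ (hv.mono inter_subset_left)
  obtain ⟨x₁, hx₁, hmax⟩ := hAcomp.exists_isMaxOn ⟨y, hyA⟩ (f.continuous.sub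
    (continuous_const (y := s))).continuousOn
  set m : ℝ := w x₀ - (L x₀ + b) with hm
  have hm0 : 0 < m := hApos x₀ hx₀
  set F : ℝ := f x₁ - s with hF
  have hF0 : 0 < F := lt_of_lt_of_le (sub_pos.2 hfy) (hmax hyA)
  have hnew : ∀ x ∈ closure Ω, (L + (m / F) • f) x + (b - m / F * s) ≤ w x := by
    intro x hx
    have e : (L + (m / F) • f) x + (b - m / F * s) = L x + b + m / F * (f x - s) := by
      simp only [add_apply, smul_apply, smul_eq_mul]; ring
    rw [e]
    rcases le_or_gt s (f x) with h | h
    · have hxA : x ∈ A := ⟨hx, h⟩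
      have h1 : m ≤ w x - (L x + b) := hmin hxA
      have h2 : f x - s ≤ F := hmax hxA
      have h3 : m / F * (f x - s) ≤ m / F * F := by gcongr
      have h4 : m / F * F = m := by field_simp
      linarith
    · have h1 : m / F * (f x - s) ≤ 0 :=
        mul_nonpos_of_nonneg_of_nonpos (by positivity) (by linarith)
      linarith [hL x hx]
  have h1 := le_convexEnvelope hnew (subset_closure hy)
  rw [← hyc] at h1
  have e : (L + (m / F) • f) y + (b - m / F * s) = L y + b + m / F * (f y - s) := by
    simp only [add_apply, smul_apply, smul_eq_mul]; ring
  rw [e] at h1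
  have h2 : 0 < m / F * (f y - s) := mul_pos (by positivity) (by linarith)
  linarith

/-- One-sided Taylor bounds of the envelope from chord bounds at pairs of contact points. -/
theorem exists_taylor_convexEnvelope (hopen : IsOpen Ω) (hconv : Convex ℝ Ω)
    (hbdd : Bornology.IsBounded Ω) (hw : ContinuousOn w (closure Ω))
    (hB : ∀ y ∈ closure Ω, |w y| ≤ B) {C e : ℝ} (hC : 0 ≤ C) (he : 0 ≤ e)
    (hpair : ∀ (L : Plane →L[ℝ] ℝ) (b : ℝ), (∀ x ∈ closure Ω, L x + b ≤ w x) →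
      ∀ y₁ ∈ closure Ω, ∀ y₂ ∈ closure Ω, L y₁ + b = w y₁ → L y₂ + b = w y₂ →
      ∀ τ ∈ Icc (0 : ℝ) 1, y₁ + τ • (y₂ - y₁) ∈ Ω → ∀ z ∈ Ω,
      ChordBound Ω (fun x => w x - (L x + b)) z (C * ‖z - (y₁ + τ • (y₂ - y₁))‖ ^ e))
    {y : Plane} (hy : y ∈ Ω) :
    ∃ L : Plane →L[ℝ] ℝ,
      (∀ z ∈ closure Ω, convexEnvelope Ω w y + L (z - y) ≤ convexEnvelope Ω w z) ∧
      ∀ z ∈ Ω, convexEnvelope Ω w z ≤ convexEnvelope Ω w y + L (z - y) + C * ‖z - y‖ ^ e := by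
  have hB' : ∀ x ∈ closure Ω, -B ≤ w x := fun x hx => (abs_le.1 (hB x hx)).1
  obtain ⟨L, b, hL, hyc⟩ := exists_support_convexEnvelope hopen hB hy
  have haff : ∀ z, convexEnvelope Ω w y + L (z - y) = L z + b := by
    intro z; rw [← hyc, map_sub]; ring
  refine ⟨L, fun z hz => by rw [haff]; exact le_convexEnvelope hL hz, fun z hz => ?_⟩
  rw [haff]
  obtain ⟨hZ, hyZ⟩ := mem_convexHull_contact hbdd hw hL hy hyc
  -- If z is in the hull, every minorant is at most the support there, being so at the contact
  -- points. Otherwise the pair estimate is used at the point of the segment found, which lies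
  -- between y and z, so its distance to z is at most ‖z − y‖.
  rcases Plane.mem_convexHull_or_exists_segment hZ hyZ z with hz' | ⟨t, ht, p, hp, q, hq, τ, hτ, heq⟩
  · have h1 : convexEnvelope Ω w z ≤ L z + b := by
      refine convexEnvelope_le hB' fun L' b' h' => ?_
      have hsub : convexHull ℝ {x | x ∈ closure Ω ∧ L x + b = w x} ⊆
          {x | (L' - L) x ≤ b - b'} := by
        refine convexHull_min (fun x hx => ?_) (convex_halfSpace_le (L' - L).isLinear _)
        have := h' x hx.1
        rw [← hx.2] at this
        simp only [mem_ofPred_eq, sub_apply]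
        linarith
      have := hsub hz'
      simp only [mem_ofPred_eq, sub_apply] at this
      linarith
    have : 0 ≤ C * ‖z - y‖ ^ e := by positivity
    linarith
  · have hmem : p + τ • (q - p) ∈ Ω := by
      rw [← heq]
      exact hconv.add_smul_sub_mem hy hz ht
    have h1 := (hpair L b hL p hp.1 q hq.1 hp.2 hq.2 τ hτ hmem z hz).convexEnvelope_le hB'
    have h2 : ‖z - (p + τ • (q - p))‖ ≤ ‖z - y‖ := by
      rw [← heq]
      have : z - (y + t • (z - y)) = (1 - t) • (z - y) := by module
      rw [this, norm_smul, Real.norm_eq_abs, abs_of_nonneg (by linarith [ht.2])]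
      exact mul_le_of_le_one_left (norm_nonneg _) (by linarith [ht.1])
    have h3 : C * ‖z - (p + τ • (q - p))‖ ^ e ≤ C * ‖z - y‖ ^ e := by gcongr
    linarith

end ConvexEnvelope

/-! ### From Taylor bounds to a Hölder gradient -/

section HolderGradient

set_option maxSynthPendingDepth 3

variable {E : Type*} [NormedAddCommGroup E] [NormedSpace ℝ E] {D : Set E} {u : E → ℝ}
  {G : E → E →L[ℝ] ℝ} {C γ : ℝ}

theorem hasFDerivAt_of_taylor (hopen : IsOpen D) (hγ : 0 < γ)
    (hlow : ∀ y ∈ D, ∀ z ∈ D, u y + G y (z - y) ≤ u z)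
    (hup : ∀ y ∈ D, ∀ z ∈ D, u z ≤ u y + G y (z - y) + C * ‖z - y‖ ^ (1 + γ)) {y : E}
    (hy : y ∈ D) : HasFDerivAt u (G y) y := by
  refine HasFDerivAt.of_isLittleO (Asymptotics.isLittleO_iff.2 fun c hc => ?_)
  have hlim : Tendsto (fun z => C * ‖z - y‖ ^ γ) (𝓝 y) (𝓝 0) := by
    have hcont : Continuous fun z : E => C * ‖z - y‖ ^ γ :=
      continuous_const.mul ((continuous_norm.comp (continuous_id.sub continuous_const)).rpow_const
        fun _ => Or.inr hγ.le)
    have := hcont.tendsto y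
    simpa [Real.zero_rpow hγ.ne'] using this
  filter_upwards [hopen.mem_nhds hy, hlim.eventually (gt_mem_nhds hc)] with z hz hzc
  have h1 := hlow y hy z hz
  have h2 := hup y hy z hz
  have e : C * ‖z - y‖ ^ (1 + γ) = C * ‖z - y‖ ^ γ * ‖z - y‖ := by
    rw [add_comm, Real.rpow_add_one' (norm_nonneg _) (by linarith)]; ring
  have h3 : C * ‖z - y‖ ^ γ * ‖z - y‖ ≤ c * ‖z - y‖ := by gcongr
  rw [Real.norm_eq_abs, abs_le]
  have h4 : 0 ≤ c * ‖z - y‖ := by positivity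
  exact ⟨by linarith, by linarith⟩

/-- Near the boundary not all directions are available for testing. The Taylor bounds are therefore
compared at x + t(z − x) with t = ‖x − y‖/R, for arbitrary z ∈ D, which bounds (G y − G x)(z − x).
Taking z in a fixed interior ball, exchanging x and y with z its centre, and using monotonicity of
the gradient yields a bound in every direction. -/
theorem norm_grad_sub_le (hconv : Convex ℝ D) (hC : 0 ≤ C) (hγ : 0 < γ)
    (hlow : ∀ y ∈ D, ∀ z ∈ D, u y + G y (z - y) ≤ u z)
    (hup : ∀ y ∈ D, ∀ z ∈ D, u z ≤ u y + G y (z - y) + C * ‖z - y‖ ^ (1 + γ)) {R δ : ℝ}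
    (hR : ∀ x ∈ D, ∀ y ∈ D, ‖x - y‖ ≤ R) (hδ : 0 < δ) {c : E} (hc : Metric.closedBall c δ ⊆ D)
    {x y : E} (hx : x ∈ D) (hy : y ∈ D) :
    ‖G x - G y‖ ≤ 4 * C * R / δ * ‖x - y‖ ^ γ := by
  rcases eq_or_ne x y with rfl | hne
  · rw [sub_self, norm_zero, sub_self, norm_zero, Real.zero_rpow hγ.ne', mul_zero]
  set h : ℝ := ‖x - y‖ with hh
  have hh0 : 0 < h := norm_pos_iff.2 (sub_ne_zero.2 hne)
  have hhR : h ≤ R := hR x hx y hy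
  have hR0 : 0 < R := hh0.trans_le hhR
  have hpow : 0 ≤ h ^ γ := by positivity
  have base : ∀ x ∈ D, ∀ y ∈ D, ‖x - y‖ = h → ∀ z ∈ D,
      (G y - G x) (z - x) ≤ 2 * C * R * h ^ γ := by
    intro x hx y hy hxy z hz
    set t : ℝ := h / R with ht
    have ht0 : 0 < t := by positivity
    have ht1 : t ≤ 1 := (div_le_one hR0).2 hhR
    have hp : x + t • (z - x) ∈ D := hconv.add_smul_sub_mem hx hz ⟨ht0.le, ht1⟩
    have h1 := hlow y hy _ hp
    have h2 := hup x hx _ hp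
    have h3 := hup y hy x hx
    have e1 : x + t • (z - x) - x = t • (z - x) := by module
    have e2 : x + t • (z - x) - y = (x - y) + t • (z - x) := by module
    rw [e1, map_smul, smul_eq_mul] at h2
    rw [e2, map_add, map_smul, smul_eq_mul] at h1
    rw [hxy] at h3
    have h4 : ‖t • (z - x)‖ ^ (1 + γ) ≤ h ^ (1 + γ) := by
      refine Real.rpow_le_rpow (norm_nonneg _) ?_ (by linarith)
      rw [norm_smul, Real.norm_eq_abs, abs_of_pos ht0]
      calc t * ‖z - x‖ ≤ t * R := by gcongr; exact hR z hz x hx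
        _ = h := by rw [ht]; field_simp
    have h5 : C * ‖t • (z - x)‖ ^ (1 + γ) ≤ C * h ^ (1 + γ) := by gcongr
    have h6 : t * (G y - G x) (z - x) ≤ 2 * C * h ^ (1 + γ) := by
      rw [sub_apply]; linarith
    have e3 : 2 * C * h ^ (1 + γ) = t * (2 * C * R * h ^ γ) := by
      rw [add_comm, Real.rpow_add_one hh0.ne', ht]; field_simp
    rw [e3] at h6
    exact le_of_mul_le_mul_left h6 ht0
  have hcD : c ∈ D := hc (Metric.mem_closedBall_self hδ.le)
  have hmono : (G y - G x) (x - y) ≤ 0 := by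
    have h1 := hlow x hx y hy
    have h2 := hlow y hy x hx
    have e : y - x = -(x - y) := by abel
    rw [e, map_neg] at h1
    rw [sub_apply]; linarith
  have hball : ∀ v : E, ‖v‖ ≤ δ → (G y - G x) v ≤ 4 * C * R * h ^ γ := by
    intro v hv
    have hm : c + v ∈ D := hc (by simpa [mem_closedBall_iff_norm] using hv)
    -- The two instances add up to a bound for v − (x − y), and the term with x − y has a favourable
    -- sign by monotonicity.
    have h1 := base x hx y hy rfl (c + v) hm
    have h2 := base y hy x hx (norm_sub_rev y x) c hcD
    have e1 : c + v - x = v + (c - y) - (x - y) := by abel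
    have e2 : (G x - G y) (c - y) = -(G y - G x) (c - y) := by
      simp only [sub_apply]; ring
    rw [e1, map_sub, map_add] at h1
    rw [e2] at h2
    linarith
  rw [norm_sub_rev]
  refine ContinuousLinearMap.opNorm_le_bound _ (by positivity) fun v => ?_
  rcases eq_or_ne v 0 with rfl | hv
  · simp
  have hv0 : 0 < ‖v‖ := norm_pos_iff.2 hv
  have hscale : ∀ s : ℝ, |s| = δ / ‖v‖ → s * (G y - G x) v ≤ 4 * C * R * h ^ γ := by
    intro s hs
    have := hball (s • v) (by
      rw [norm_smul, Real.norm_eq_abs, hs]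
      exact le_of_eq (by field_simp))
    rwa [map_smul, smul_eq_mul] at this
  have hr0 : 0 < δ / ‖v‖ := by positivity
  have h1 := hscale (δ / ‖v‖) (abs_of_pos hr0)
  have h2 := hscale (-(δ / ‖v‖)) (by rw [abs_neg, abs_of_pos hr0])
  have h3 : δ / ‖v‖ * |(G y - G x) v| ≤ 4 * C * R * h ^ γ := by
    rcases abs_cases ((G y - G x) v) with ⟨h, -⟩ | ⟨h, -⟩ <;> rw [h] <;> linarith
  rw [Real.norm_eq_abs]
  calc |(G y - G x) v| = δ / ‖v‖ * |(G y - G x) v| * (‖v‖ / δ) := by field_simp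
    _ ≤ 4 * C * R * h ^ γ * (‖v‖ / δ) := by gcongr
    _ = _ := by ring

theorem norm_grad_le_of_ball {B : ℝ} (hB : ∀ x ∈ D, |u x| ≤ B)
    (hlow : ∀ y ∈ D, ∀ z ∈ D, u y + G y (z - y) ≤ u z) {δ : ℝ} (hδ : 0 < δ) {c : E}
    (hc : Metric.closedBall c δ ⊆ D) : ‖G c‖ ≤ 2 * B / δ := by
  have hcD : c ∈ D := hc (Metric.mem_closedBall_self hδ.le)
  have hB0 : 0 ≤ B := (abs_nonneg _).trans (hB c hcD)
  have hball : ∀ v : E, ‖v‖ ≤ δ → G c v ≤ 2 * B := by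
    intro v hv
    have hm : c + v ∈ D := hc (by simpa [mem_closedBall_iff_norm] using hv)
    have h1 := hlow c hcD _ hm
    rw [add_sub_cancel_left] at h1
    linarith [(abs_le.1 (hB _ hm)).2, (abs_le.1 (hB c hcD)).1]
  refine ContinuousLinearMap.opNorm_le_bound _ (by positivity) fun v => ?_
  rcases eq_or_ne v 0 with rfl | hv
  · simp
  have hv0 : 0 < ‖v‖ := norm_pos_iff.2 hv
  have hscale : ∀ s : ℝ, |s| = δ / ‖v‖ → s * G c v ≤ 2 * B := by
    intro s hs
    have := hball (s • v) (by
      rw [norm_smul, Real.norm_eq_abs, hs]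
      exact le_of_eq (by field_simp))
    rwa [map_smul, smul_eq_mul] at this
  have hr0 : 0 < δ / ‖v‖ := by positivity
  have h1 := hscale (δ / ‖v‖) (abs_of_pos hr0)
  have h2 := hscale (-(δ / ‖v‖)) (by rw [abs_neg, abs_of_pos hr0])
  have h3 : δ / ‖v‖ * |G c v| ≤ 2 * B := by
    rcases abs_cases (G c v) with ⟨h, -⟩ | ⟨h, -⟩ <;> rw [h] <;> linarith
  rw [Real.norm_eq_abs]
  calc |G c v| = δ / ‖v‖ * |G c v| * (‖v‖ / δ) := by field_simp
    _ ≤ 2 * B * (‖v‖ / δ) := by gcongr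
    _ = _ := by ring

/-- A Hölder continuous map with values in a complete space extends continuously to the closure. -/
theorem exists_continuousOn_closure_of_holder {X F : Type*} [NormedAddCommGroup X]
    [NormedAddCommGroup F] [CompleteSpace F] {D : Set X} {C γ : ℝ} {f : X → F} (hγ : 0 < γ) (hf : ∀ x ∈ D, ∀ y ∈ D, ‖f x - f y‖ ≤ C * ‖x - y‖ ^ γ) :
    ∃ g : X → F, ContinuousOn g (closure D) ∧ EqOn g f D := by
  have hlim : ∀ x₀ : X, Tendsto (fun p : X × X => C * ‖p.1 - p.2‖ ^ γ) (𝓝 (x₀, x₀)) (𝓝 0) := by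
    intro x₀
    have hcont : Continuous fun p : X × X => C * ‖p.1 - p.2‖ ^ γ :=
      continuous_const.mul ((continuous_norm.comp (continuous_fst.sub continuous_snd)).rpow_const
        fun _ => Or.inr hγ.le)
    simpa [Real.zero_rpow hγ.ne'] using hcont.tendsto (x₀, x₀)
  have htend : ∀ x ∈ closure D, ∃ l, Tendsto f (𝓝[D] x) (𝓝 l) := by
    intro x hx
    have hne : (𝓝[D] x).NeBot := mem_closure_iff_nhdsWithin_neBot.1 hx
    refine cauchy_map_iff_exists_tendsto.1 (cauchy_map_iff.2 ⟨hne, ?_⟩)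
    rw [Metric.uniformity_basis_dist.tendsto_right_iff]
    intro ε hε
    have h1 : Tendsto (fun p : X × X => C * ‖p.1 - p.2‖ ^ γ) (𝓝[D] x ×ˢ 𝓝[D] x) (𝓝 0) :=
      (hlim x).mono_left (by
        rw [nhds_prod_eq]; exact Filter.prod_mono nhdsWithin_le_nhds nhdsWithin_le_nhds)
    filter_upwards [h1.eventually (gt_mem_nhds hε),
      prod_mem_prod self_mem_nhdsWithin self_mem_nhdsWithin] with p hp hpD
    rw [dist_eq_norm]
    exact (hf _ hpD.1 _ hpD.2).trans_lt hp
  refine ⟨extendFrom D f, continuousOn_extendFrom subset_rfl htend, fun x hx => ?_⟩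
  refine extendFrom_eq (subset_closure hx) ?_
  have hcont : Continuous fun y : X => C * ‖y - x‖ ^ γ :=
    continuous_const.mul ((continuous_norm.comp (continuous_id.sub continuous_const)).rpow_const
      fun _ => Or.inr hγ.le)
  have h2 : Tendsto (fun y : X => C * ‖y - x‖ ^ γ) (𝓝[D] x) (𝓝 0) := by
    have := (hcont.tendsto x).mono_left (nhdsWithin_le_nhds (s := D))
    simpa [Real.zero_rpow hγ.ne'] using this
  rw [tendsto_iff_norm_sub_tendsto_zero]
  refine squeeze_zero' (Eventually.of_forall fun _ => norm_nonneg _) ?_ h2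
  filter_upwards [self_mem_nhdsWithin] with y hy using hf y hy x hx

end HolderGradient

/-! ### Regularity of the envelope up to the boundary -/

section EnvelopeRegularity

set_option maxSynthPendingDepth 3

variable {Ω : Set Plane} {w : Plane → ℝ} {B C γ : ℝ} {G : Plane → Plane →L[ℝ] ℝ}

/-- The interior gradient bound gives a Lipschitz estimate up to the boundary. Both points are
pulled towards an interior point c; an affine minorant at x is the limit of its values at the pulled
points, where it is below the envelope, and convexity bounds the envelope at the pulled y by its
values at c and y. -/
theorem continuousOn_convexEnvelope (hopen : IsOpen Ω) (hconv : Convex ℝ Ω)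
    (hB : ∀ y ∈ closure Ω, -B ≤ w y) {A : ℝ} (hA : ∀ x ∈ Ω, ‖G x‖ ≤ A)
    (hlow : ∀ y ∈ Ω, ∀ z ∈ Ω,
      convexEnvelope Ω w y + G y (z - y) ≤ convexEnvelope Ω w z) (hne : Ω.Nonempty) :
    ContinuousOn (convexEnvelope Ω w) (closure Ω) := by
  obtain ⟨c, hc⟩ := hne
  have hA0 : 0 ≤ A := (norm_nonneg _).trans (hA c hc)
  have hconvex : ∀ x ∈ closure Ω, ∀ t ∈ Ioc (0 : ℝ) 1,
      convexEnvelope Ω w (t • c + (1 - t) • x) ≤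
        t * convexEnvelope Ω w c + (1 - t) * convexEnvelope Ω w x := by
    intro x hx t ht
    refine convexEnvelope_le hB fun L b h => ?_
    have h1 := le_convexEnvelope h (subset_closure hc)
    have h2 := le_convexEnvelope h hx
    simp only [map_add, map_smul, smul_eq_mul]
    have h3 := mul_le_mul_of_nonneg_left h1 ht.1.le
    have h4 := mul_le_mul_of_nonneg_left h2 (sub_nonneg.2 ht.2)
    linarith
  have hlip : ∀ x ∈ closure Ω, ∀ y ∈ closure Ω,
      convexEnvelope Ω w x ≤ convexEnvelope Ω w y + A * ‖x - y‖ := by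
    intro x hx y hy
    refine convexEnvelope_le hB fun L b h => ?_
    have hev : ∀ t ∈ Ioc (0 : ℝ) 1, L (t • c + (1 - t) • x) + b ≤
        t * convexEnvelope Ω w c + (1 - t) * convexEnvelope Ω w y + A * ((1 - t) * ‖x - y‖) := by
      intro t ht
      have hxt := combo_mem_of_closure hopen hconv hc hx ht.1 (sub_nonneg.2 ht.2) (by ring)
      have hyt := combo_mem_of_closure hopen hconv hc hy ht.1 (sub_nonneg.2 ht.2) (by ring)
      have h1 := le_convexEnvelope h (subset_closure hxt)
      have h2 := hlow _ hxt _ hyt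
      have e : t • c + (1 - t) • y - (t • c + (1 - t) • x) = -((1 - t) • (x - y)) := by module
      rw [e, map_neg] at h2
      have h3 : G (t • c + (1 - t) • x) ((1 - t) • (x - y)) ≤ A * ((1 - t) * ‖x - y‖) := by
        have h4 := (G (t • c + (1 - t) • x)).le_opNorm ((1 - t) • (x - y))
        rw [norm_smul, Real.norm_eq_abs, Real.norm_eq_abs, abs_of_nonneg (sub_nonneg.2 ht.2)] at h4
        refine (le_abs_self _).trans (h4.trans ?_)
        exact mul_le_mul_of_nonneg_right (hA _ hxt)
          (mul_nonneg (sub_nonneg.2 ht.2) (norm_nonneg _))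
      linarith [hconvex y hy t ht]
    have hl : Tendsto (fun t : ℝ => L (t • c + (1 - t) • x) + b) (𝓝[>] 0) (𝓝 (L x + b)) := by
      have : Continuous fun t : ℝ => L (t • c + (1 - t) • x) + b := by fun_prop
      exact (this.tendsto' 0 _ (by simp)).mono_left nhdsWithin_le_nhds
    have hr : Tendsto (fun t : ℝ => t * convexEnvelope Ω w c + (1 - t) * convexEnvelope Ω w y +
        A * ((1 - t) * ‖x - y‖)) (𝓝[>] 0) (𝓝 (convexEnvelope Ω w y + A * ‖x - y‖)) := by
      have : Continuous fun t : ℝ => t * convexEnvelope Ω w c + (1 - t) * convexEnvelope Ω w y +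
        A * ((1 - t) * ‖x - y‖) := by fun_prop
      exact (this.tendsto' 0 _ (by simp)).mono_left nhdsWithin_le_nhds
    refine le_of_tendsto_of_tendsto hl hr ?_
    filter_upwards [Ioc_mem_nhdsGT (zero_lt_one' ℝ)] with t ht using hev t ht
  have hL : LipschitzOnWith A.toNNReal (convexEnvelope Ω w) (closure Ω) := by
    refine LipschitzOnWith.of_dist_le_mul fun x hx y hy => ?_
    rw [Real.dist_eq, dist_eq_norm, Real.coe_toNNReal _ hA0, abs_le]
    have h1 := hlip x hx y hy
    have h2 := hlip y hy x hx
    rw [norm_sub_rev y x] at h2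
    exact ⟨by linarith, by linarith⟩
  exact hL.continuousOn

theorem norm_iteratedFDeriv_one_sub_eq {E : Type*} [NormedAddCommGroup E] [NormedSpace ℝ E]
    (u : E → ℝ) (x y : E) :
    ‖iteratedFDeriv ℝ 1 u x - iteratedFDeriv ℝ 1 u y‖ = ‖fderiv ℝ u x - fderiv ℝ u y‖ := by
  have h : ∀ x, continuousMultilinearCurryFin1 ℝ E ℝ (iteratedFDeriv ℝ 1 u x) = fderiv ℝ u x := by
    intro x
    ext v
    rw [continuousMultilinearCurryFin1_apply, iteratedFDeriv_one_apply]
    rfl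
  rw [← h, ← h, ← map_sub, LinearIsometryEquiv.norm_map]

/-- `C^{1,γ}` regularity from bounds on the function and its gradient. -/
theorem memCHolder_one {E : Type*} [NormedAddCommGroup E] [NormedSpace ℝ E] {D : Set E} {u : E → ℝ}
    {G : E → E →L[ℝ] ℝ} {B A H γ : ℝ} (hopen : IsOpen D) (hγ : 0 < γ) (hH0 : 0 ≤ H) (hu : ContinuousOn u (closure D)) (hB : ∀ x ∈ D, |u x| ≤ B)
    (hG : ∀ x ∈ D, HasFDerivAt u (G x) x) (hA : ∀ x ∈ D, ‖G x‖ ≤ A)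
    (hH : ∀ x ∈ D, ∀ y ∈ D, ‖G x - G y‖ ≤ H * ‖x - y‖ ^ γ) :
    MemCHolder 1 γ D u ∧
      cHolderNorm 1 γ D u ≤ (B.toNNReal + A.toNNReal + H.toNNReal : ℝ≥0) := by
  have hfd : ∀ x ∈ D, ∀ y ∈ D,
      ‖iteratedFDeriv ℝ 1 u x - iteratedFDeriv ℝ 1 u y‖ ≤ H * ‖x - y‖ ^ γ := by
    intro x hx y hy
    rw [norm_iteratedFDeriv_one_sub_eq, (hG x hx).fderiv, (hG y hy).fderiv]
    exact hH x hx y hy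
  have hnorm : cHolderNorm 1 γ D u ≤ (B.toNNReal + A.toNNReal + H.toNNReal : ℝ≥0) := by
    rw [cHolderNorm, Finset.sum_range_succ, Finset.sum_range_one]
    push_cast
    refine add_le_add (add_le_add ?_ ?_) ?_
    · refine iSup₂_le fun x hx => ?_
      rw [← ofReal_norm, norm_iteratedFDeriv_zero, Real.norm_eq_abs]
      exact ENNReal.ofReal_le_ofReal (hB x hx)
    · refine iSup₂_le fun x hx => ?_
      rw [← ofReal_norm, norm_iteratedFDeriv_one, (hG x hx).fderiv]
      exact ENNReal.ofReal_le_ofReal (hA x hx)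
    · refine HolderWith.eHolderNorm_le (HolderWith.restrict_iff.2 fun x hx y hy => ?_)
      rw [edist_dist, edist_dist, dist_eq_norm, dist_eq_norm, Real.coe_toNNReal _ hγ.le,
        ENNReal.ofReal_rpow_of_nonneg (norm_nonneg _) hγ.le]
      change _ ≤ ENNReal.ofReal H * _
      rw [← ENNReal.ofReal_mul hH0]
      exact ENNReal.ofReal_le_ofReal (hfd x hx y hy)
  refine ⟨⟨?_, hu, ?_, hnorm.trans_lt ENNReal.coe_lt_top⟩, hnorm⟩
  · have hGc : ContinuousOn G D := by
      obtain ⟨g, hg, hgG⟩ := exists_continuousOn_closure_of_holder hγ hH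
      exact (hg.mono subset_closure).congr fun x hx => (hgG hx).symm
    rw [Nat.cast_one, show (1 : WithTop ℕ∞) = 0 + 1 from rfl,
      contDiffOn_succ_iff_fderiv_of_isOpen hopen]
    refine ⟨fun x hx => (hG x hx).differentiableAt.differentiableWithinAt, by simp, ?_⟩
    rw [contDiffOn_zero]
    exact hGc.congr fun x hx => (hG x hx).fderiv
  · intro i hi
    interval_cases i
    · refine ⟨iteratedFDeriv ℝ 0 u, ?_, fun _ _ => rfl⟩
      rw [iteratedFDeriv_zero_eq_comp]
      exact (LinearIsometryEquiv.continuous _).comp_continuousOn hu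
    · exact exists_continuousOn_closure_of_holder hγ hfd

theorem theorem1p3 (k : ℕ) (hk4 : 4 ≤ k) (hkeven : Even k)
    (β : ℝ) (hβpos : 0 < β) (hβk : β ≤ k)
    (Ω : Set Plane) (hopen : IsOpen Ω) (hconv : Convex ℝ Ω) (hbdd : Bornology.IsBounded Ω)
    (hreg : HasCHolderBoundary (k + strictFloor β) (β - strictFloor β) Ω)
    (hdeg : IsDegenerateAtOrigin k β Ω)
    (hcurv : ∀ z ∈ frontier Ω, z ≠ 0 → ∃ κ : ℝ, 0 < κ ∧ HasBoundaryCurvatureAt Ω z κ) :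
    ∀ M : ℝ≥0, ∃ C : ℝ≥0, ∀ w : Plane → ℝ,
      MemCHolder (k + strictFloor β) (β - strictFloor β) Ω w →
      cHolderNorm (k + strictFloor β) (β - strictFloor β) Ω w ≤ M →
      DerivsVanishAtOrigin (k + strictFloor β) Ω w →
      MemCHolder 1 (β / k) Ω (convexEnvelope Ω w) ∧
        cHolderNorm 1 (β / k) Ω (convexEnvelope Ω w) ≤ C := by
  intro M
  obtain ⟨C, hC, hpair⟩ :=
    exists_chordBound_rpow hk4 hkeven hβpos hβk hopen hconv hbdd hreg hdeg hcurv M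
  obtain ⟨ρ, r, c₁, C₁, hchart⟩ := hdeg.exists_originChart hk4 hkeven hconv
  obtain ⟨c, hc⟩ := closure_nonempty_iff.1 ⟨0, hchart.zero_mem_closure hk4⟩
  obtain ⟨δ, hδ, hball⟩ := Metric.nhds_basis_closedBall.mem_iff.1 (hopen.mem_nhds hc)
  obtain ⟨R, hR0, hR⟩ : ∃ R, 0 ≤ R ∧ ∀ x ∈ Ω, ∀ y ∈ Ω, ‖x - y‖ ≤ R := by
    refine ⟨Metric.diam Ω, Metric.diam_nonneg, fun x hx y hy => ?_⟩
    rw [← dist_eq_norm]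
    exact Metric.dist_le_diam_of_mem hbdd hx hy
  have hγ : 0 < β / k := by positivity
  have hM0 : (0 : ℝ) ≤ M := M.2
  set H : ℝ := 4 * C * R / δ with hH
  have hH0 : 0 ≤ H := by positivity
  -- The gradient is bounded at the centre of an interior ball, and elsewhere by adding its Hölder
  -- oscillation across the domain.
  set A : ℝ := 2 * M / δ + H * R ^ (β / k) with hA
  have hA0 : 0 ≤ A := by positivity
  refine ⟨(M : ℝ).toNNReal + A.toNNReal + H.toNNReal, fun w hw hwM hflat => ?_⟩
  have hB : ∀ y ∈ closure Ω, |w y| ≤ M := by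
    intro y hy
    refine closure_ineq (f := fun y => |w y|) (g := fun _ => (M : ℝ)) hy
      hw.continuousOn.abs continuousOn_const fun x hx => ?_
    have := norm_iteratedFDeriv_le_of_cHolderNorm_le hwM (Nat.zero_le _) hx
    rwa [norm_iteratedFDeriv_zero, Real.norm_eq_abs] at this
  have hB' : ∀ y ∈ closure Ω, -(M : ℝ) ≤ w y := fun y hy => (abs_le.1 (hB y hy)).1
  choose! G hlow hup using fun y (hy : y ∈ Ω) =>
    exists_taylor_convexEnvelope hopen hconv hbdd hw.continuousOn hB hC (by positivity)
      (hpair w hw hwM hflat) hy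
  have hlow' : ∀ y ∈ Ω, ∀ z ∈ Ω,
      convexEnvelope Ω w y + G y (z - y) ≤ convexEnvelope Ω w z :=
    fun y hy z hz => hlow y hy z (subset_closure hz)
  have huB : ∀ x ∈ Ω, |convexEnvelope Ω w x| ≤ M := fun x hx =>
    abs_le.2 ⟨neg_le_convexEnvelope hB' (subset_closure hx),
      (convexEnvelope_le_self hB' (subset_closure hx)).trans
        (abs_le.1 (hB x (subset_closure hx))).2⟩
  have hGH : ∀ x ∈ Ω, ∀ y ∈ Ω, ‖G x - G y‖ ≤ H * ‖x - y‖ ^ (β / k) := fun x hx y hy =>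
    norm_grad_sub_le hconv hC hγ hlow' hup hR hδ hball hx hy
  have hGA : ∀ x ∈ Ω, ‖G x‖ ≤ A := by
    intro x hx
    have h1 := norm_grad_le_of_ball huB hlow' hδ hball
    have h2 := hGH x hx c hc
    have h3 : H * ‖x - c‖ ^ (β / k) ≤ H * R ^ (β / k) := by
      gcongr; exact hR x hx c hc
    have h4 := norm_le_norm_add_norm_sub (G c) (G x)
    rw [norm_sub_rev] at h4
    linarith
  exact memCHolder_one hopen hγ hH0
    (continuousOn_convexEnvelope hopen hconv hB' hGA hlow' ⟨c, hc⟩) huB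
    (fun x hx => hasFDerivAt_of_taylor hopen hγ hlow' hup hx) hGA hGH

end EnvelopeRegularity
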